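/- **Theorem.** Let $d,d_1\ge 1$, $\gamma\in\mathbb R$, $\mu>0$, and let $H^s_2=H^s_2(\mathbb R^d;\mathbb R^{d_1})$ be the space of $\mathbb R^{d_1}$-valued distributions $u$ with $\|u\|_{H^s_2}^2=\sum_{k=1}^{d_1}\|(1-\Delta)^{s/2}u^k\|_{L_2(\mathbb R^d)}^2<\infty$. For $T\in(0,\infty)$ let $\mathbb H^s_2(T)=L_2((0,T],H^s_2)$ with norm $\|u\|_{\mathbb H^s_2(T)}^2=\int_0^T\|u(t)\|_{H^s_2}^2dt$, and put $U^{\gamma+2}_2=H^{\gamma+1}_2$. Write $u\in\mathcal H^{\gamma+2}_2(T)$ if $u\in\mathbb H^{\gamma+2}_2(T)$, $u(0)\in U^{\gamma+2}_2$ and there is $g\in\mathbb H^\gamma_2(T)$ such that for every test function $\phi\in C_0^\infty$ the equality $(u(t),\phi)=(u(0),\phi)+\int_0^t(g(s),\phi)\,ds$ holds for all $t\in[0,T]$; then we write $u_t=g$. Let $|\gamma|_+=|\gamma|$ if $|\gamma|$ is an integer and $|\gamma|_+=|\gamma|+\mu$ otherwise. Let $|\cdot|_{0}$ be the supremum norm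 on the space $B^0$ of bounded functions on $\mathbb R^d$, and for $s>0$ let $|\cdot|_s$ be the norm of the Hölder space $B^s=C^{m,\alpha}(\mathbb R^d)$, where $s=m+\alpha$, $m\in\{0,1,2,\dots\}$, $\alpha\in(0,1]$ (so $B^s=C^{s-1,1}$ for integers $s\ge1$). Consider the system (summation over repeated $i,j\in\{1,\dots,d\}$, $r\in\{1,\dots,d_1\}$) $$u^k_t=a^{ij}_{kr}u^r_{x^ix^j}+b^i_{kr}u^r_{x^i}+c_{kr}u^r+f^k,\qquad u^k(0)=u^k_0,\qquad k=1,\dots,d_1, \tag{1}$$ on $[0,T]\times\mathbb R^d$ with real measurable coefficients depending on $(t,x)$, and let $A^{ij}=(a^{ij}_{kr})_{k,r}$. Let $\delta,L,K^1,\dots,K^d>0$ be constants and $\omega:(0,\infty)\to(0,\infty)$ a function, and assume that for all $t>0$, $x,y\in\mathbb R^d$ and all $i,j,k,r$: 1. $\delta|\xi|^2\le \xi_i^*A^{ij}(t,x)\xi_j$ for every real $d_1\times d$ matrix $\xi$ with columns $\xi_1,\dots,\xi_d$, and $|A^{1j}(t,x)|\le K^j$, where $|C|^2=\sum_{k,r}c_{kr}^2$;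 2. for every $\varepsilon>0$, $|a^{ij}_{kr}(t,x)-a^{ij}_{kr}(t,y)|<\varepsilon$ whenever $|x-y|<\omega(\varepsilon)$; 3. $|a^{ij}_{kr}(t,\cdot)|_{|\gamma|_+}+|b^i_{kr}(t,\cdot)|_{|\gamma|_+}+|c_{kr}(t,\cdot)|_{|\gamma|_+}<L$. Then for any $T\in(0,\infty)$, $f\in\mathbb H^\gamma_2(T)$ and $u_0\in U^{\gamma+2}_2$, system (1) has a unique solution $u\in\mathcal H^{\gamma+2}_2(T)$, and for this solution $$\|u\|_{\mathbb H^{\gamma+2}_2(T)}\le N e^{NT}\bigl(\|f\|_{\mathbb H^\gamma_2(T)}+\|u_0\|_{U^{\gamma+2}_2}\bigr),$$ where $N$ depends only on $d,d_1,\gamma,\mu,\delta,K^1,\dots,K^d,L$ and the modulus of continuity $\omega$ (and not on $T$). -/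

import Mathlib

noncomputable section

namespace ParabolicSystem

open MeasureTheory Set
open scoped SchwartzMap ENNReal LineDeriv

/-- The space `ℝ^d` with its Euclidean norm. -/
abbrev Space (d : ℕ) := EuclideanSpace ℝ (Fin d)

/-- Scalar tempered distributions on `ℝ^d`. Real-valued distributions are singled out below by
`IsReal`. -/
abbrev Dist (d : ℕ) := 𝓢'(Space d, ℂ)

/-- A distribution is real-valued if it is real on real test functions. -/
def IsReal {d : ℕ} (u : Dist d) : Prop :=
  ∀ φ : 𝓢(Space d, ℂ), (∀ x, (φ x).im = 0) → (u φ).im = 0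

/-- The symbol `(1 + |2πξ|²)^{s/2}` of `(1 - Δ)^{s/2}`, for the Fourier transform with kernel
`e^{-2πi x·ξ}`. -/
def besselSymbol (d : ℕ) (s : ℝ) (ξ : Space d) : ℝ :=
  (1 + ‖(2 * Real.pi) • ξ‖ ^ 2) ^ (s / 2)

/-- The symbol is smooth with derivatives of polynomial growth, so that multiplication by it acts
on tempered distributions. -/
theorem besselSymbol_hasTemperateGrowth (d : ℕ) (s : ℝ) :
    (fun ξ : Space d => (besselSymbol d s ξ : ℂ)).HasTemperateGrowth := by
  have h := Function.hasTemperateGrowth_one_add_norm_sq_rpow (Space d) (s / 2)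
  have h2 : (fun ξ : Space d => (2 * Real.pi) • ξ).HasTemperateGrowth := by fun_prop
  have h3 : (fun ξ : Space d => besselSymbol d s ξ).HasTemperateGrowth := by
    unfold besselSymbol
    exact h.comp h2
  fun_prop

/-- The operator `(1 - Δ)^{s/2}` on tempered distributions. -/
def besselOp {d : ℕ} (s : ℝ) (u : Dist d) : Dist d :=
  TemperedDistribution.fourierMultiplierCLM ℂ (fun ξ : Space d => (besselSymbol d s ξ : ℂ)) u

/-- `(1 - Δ)^{s/2} u` is given by a function in `L_2`. -/
def BesselInL2 {d : ℕ} (s : ℝ) (u : Dist d) : Prop :=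
  ∃ g : Lp ℂ 2 (volume : Measure (Space d)), besselOp s u = (g : Dist d)

open Classical in
/-- The (unique) function in `L_2` that represents `(1 - Δ)^{s/2} u`; zero if there is none. -/
def besselRep {d : ℕ} (s : ℝ) (u : Dist d) : Lp ℂ 2 (volume : Measure (Space d)) :=
  if h : BesselInL2 s u then h.choose else 0

theorem besselRep_eq_iff {d : ℕ} {s : ℝ} {u : Dist d} (h : BesselInL2 s u)
    (g : Lp ℂ 2 (volume : Measure (Space d))) :
    besselRep s u = g ↔ besselOp s u = (g : Dist d) := by
  have key : besselOp s u = (besselRep s u : Dist d) := by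
    rw [besselRep, dif_pos h]; exact h.choose_spec
  constructor
  · rintro rfl; exact key
  · intro hg
    have hk := Lp.ker_toTemperedDistributionCLM_eq_bot (F := ℂ)
      (μ := (volume : Measure (Space d))) (p := 2)
    exact (LinearMap.ker_eq_bot.mp hk) (key.symm.trans hg)

/-- `u = (u^1, …, u^{d₁})` belongs to the Bessel potential space `H^s_2(ℝ^d; ℝ^{d₁})`. -/
def MemH {d d₁ : ℕ} (s : ℝ) (u : Fin d₁ → Dist d) : Prop :=
  ∀ k, IsReal (u k) ∧ BesselInL2 s (u k)

/-- The norm of `H^s_2(ℝ^d; ℝ^{d₁})`. -/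
def hNorm {d d₁ : ℕ} (s : ℝ) (u : Fin d₁ → Dist d) : ℝ :=
  Real.sqrt (∑ k, ‖besselRep s (u k)‖ ^ 2)

/-- `u ∈ ℍ^s_2(T) = L_2((0,T], H^s_2)`. -/
def MemBH {d d₁ : ℕ} (s T : ℝ) (u : ℝ → Fin d₁ → Dist d) : Prop :=
  (∀ᵐ t ∂(volume.restrict (Ioc 0 T)), MemH s (u t)) ∧
    ∀ k, MemLp (fun t => besselRep s (u t k)) 2 (volume.restrict (Ioc 0 T))

/-- The norm of `ℍ^s_2(T)`. -/
def bhNorm {d d₁ : ℕ} (s T : ℝ) (u : ℝ → Fin d₁ → Dist d) : ℝ :=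
  Real.sqrt (∫ t in Ioc 0 T, hNorm s (u t) ^ 2)

/-- `u_t = g` on `[0,T]` in the sense of distributions: for all test functions `φ` with compact
support, `(u(t), φ) = (u(0), φ) + ∫_0^t (g(s), φ) ds` for all `t ∈ [0,T]`. (Complex test functions
are allowed: by linearity they give the same condition as real ones.) -/
def HasTimeDeriv {d d₁ : ℕ} (T : ℝ) (u g : ℝ → Fin d₁ → Dist d) : Prop :=
  ∀ k, ∀ φ : 𝓢(Space d, ℂ), HasCompactSupport φ → ∀ t ∈ Icc 0 T,
    u t k φ = u 0 k φ + ∫ s in (0 : ℝ)..t, g s k φ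

/-- `u ∈ 𝓗^{γ+2}_2(T)`, with `u_t = g`. The space of initial data is
`U^{γ+2}_2 = H^{γ+2-2/2}_2 = H^{γ+1}_2`. -/
structure MemCH {d d₁ : ℕ} (γ T : ℝ) (u g : ℝ → Fin d₁ → Dist d) : Prop where
  mem : MemBH (γ + 2) T u
  mem_zero : MemH (γ + 1) (u 0)
  mem_deriv : MemBH γ T g
  deriv : HasTimeDeriv T u g

open Classical in
/-- A function in `L_2`, as a distribution (zero if it is not in `L_2`). -/
def ofFun {d : ℕ} (g : Space d → ℂ) : Dist d :=
  if h : MemLp g 2 (volume : Measure (Space d)) then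
    ((h.toLp g : Lp ℂ 2 (volume : Measure (Space d))) : Dist d) else 0

/-- The value `(a v, φ) = (v, a φ)` at a test function `φ` of the product of a function `a` and a
distribution `v ∈ H^s_2`. Here `a φ ∈ H^{-s}_2`, and `( , )` is the pairing between `H^s_2` and
`H^{-s}_2`, `(v, w) = ∫ (1 - Δ)^{s/2} v · (1 - Δ)^{-s/2} w dx`. For `s ≥ 0` this is the integral of
`a v φ`. -/
def mulPair {d : ℕ} (s : ℝ) (a : Space d → ℝ) (v : Dist d) (φ : 𝓢(Space d, ℂ)) : ℂ :=
  ∫ x, besselRep s v x * besselRep (-s) (ofFun fun y => (a y : ℂ) * φ y) x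

/-- The `i`-th partial derivative of a distribution. -/
def pderiv {d : ℕ} (i : Fin d) (u : Dist d) : Dist d :=
  ∂_{(EuclideanSpace.single i 1 : Space d)} u

/-- `u ∈ 𝓗^{γ+2}_2(T)` is a solution on `[0,T]` of
`u^k_t = a^{ij}_{kr} u^r_{x^i x^j} + b^i_{kr} u^r_{x^i} + c_{kr} u^r + f^k`, `u^k(0) = u^k_0`.
The equation is an equality of distributions for almost every `t`. -/
def IsSolution {d d₁ : ℕ} (γ T : ℝ)
    (a : Fin d → Fin d → Fin d₁ → Fin d₁ → ℝ → Space d → ℝ)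
    (b : Fin d → Fin d₁ → Fin d₁ → ℝ → Space d → ℝ)
    (c : Fin d₁ → Fin d₁ → ℝ → Space d → ℝ)
    (f : ℝ → Fin d₁ → Dist d) (u₀ : Fin d₁ → Dist d) (u : ℝ → Fin d₁ → Dist d) : Prop :=
  u 0 = u₀ ∧ ∃ g : ℝ → Fin d₁ → Dist d, MemCH γ T u g ∧
    ∀ᵐ t ∂(volume.restrict (Ioc 0 T)), ∀ k, ∀ φ : 𝓢(Space d, ℂ), HasCompactSupport φ →
      g t k φ =
        (∑ i, ∑ j, ∑ r, mulPair γ (a i j k r t) (pderiv i (pderiv j (u t r))) φ)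
        + (∑ i, ∑ r, mulPair γ (b i k r t) (pderiv i (u t r)) φ)
        + (∑ r, mulPair γ (c k r t) (u t r) φ)
        + f t k φ

open Classical in
/-- `|γ|_+`: it is `|γ|` if `|γ|` is an integer, and `|γ| + μ` otherwise. -/
def absPlus (μ γ : ℝ) : ℝ := if ∃ n : ℕ, |γ| = n then |γ| else |γ| + μ

open Classical in
/-- The norm of `B^s`, infinite for functions outside this space: for `s = 0` the space of bounded
functions, and for `s > 0` the Hölder space `C^{m,α}`, where `s = m + α`, `m ∈ {0,1,2,…}` and
`α ∈ (0,1]`. -/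
def holderNorm {d : ℕ} (s : ℝ) (h : Space d → ℝ) : ℝ≥0∞ :=
  if s = 0 then ⨆ x, ‖h x‖ₑ
  else if ContDiff ℝ ((⌈s⌉₊ - 1 : ℕ) : ℕ∞) h then
    (∑ j ∈ Finset.range (⌈s⌉₊ - 1 + 1), ⨆ x, ‖iteratedFDeriv ℝ j h x‖ₑ)
      + ⨆ x, ⨆ y, ⨆ _ : x ≠ y,
          ‖iteratedFDeriv ℝ (⌈s⌉₊ - 1) h x - iteratedFDeriv ℝ (⌈s⌉₊ - 1) h y‖ₑ
            / edist x y ^ (s - ((⌈s⌉₊ - 1 : ℕ) : ℝ))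
  else ⊤

end ParabolicSystem

end

/-! Put `j = (1 - Δ)^{-1/2}`, `W = (1 - Δ)^{(γ+2)/2} u` and `w = (1 - Δ)^{(γ+1)/2} u₀`. After
applying `(1 - Δ)^{γ/2}`, the system becomes `(j² W)' = F - A(t) W`, `j² W (0) = j w`, for functions
with values in `L2`. Here `A(t)` is bounded: it is built from the Riesz-type operators `R_i = ∂_i (1
- Δ)^{-1/2}` and from multiplications by the coefficients conjugated by `(1 - Δ)^{γ/2}`. Everything
rests on a Gårding inequality `κ ‖W‖² ≤ Re (ρ A W, W) + λ ‖j W‖²`, where `ρ` is a Fourier multiplier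
with symbol between two positive constants.

Abstract Cauchy problem (`VolterraTriple`, `wellPosed_of_garding`). The factor `e^{-lt}` replaces
`A` by `A + l j²`, and a suitable `l` absorbs `λ`. Pairing the equation with `ρ W` produces half the
time derivative of `(ρ j W, j W)`, hence an a priori bound. The bound makes the set of solvable data
closed. A right-hand side orthogonal to all those solvable with zero initial value solves the
adjoint homogeneous problem and vanishes by the adjoint energy inequality. Initial values are then
reached from a dense set. Undoing the shift is the only source of the factor `e^{NT}`.

Gårding inequality (`coercive_L2`, `norm_Q_sub_mainForm_le`, `garding`). Up to lower order terms,
`-W` is the sum of the `R_l R_l W`, so the leading part of `(ρ A W, W)` is the pairing of `a^{ij}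
u_{ij}` with `u_{ll}` in `H^γ`. In `L2` two integrations by parts turn it into the pairing of
`a^{ij} u_{jl}` with `u_{il}`, to which the Legendre condition applies for each `l`, pointwise in
`x`. The integration by parts needs a derivative of the coefficient, so `a` is first replaced by a
mollification `α` within a small distance `η`. The radius comes from the modulus `ω`, and the error
`η ‖u_{xx}‖²` is absorbed.

For `|γ| = n + σ` with `0 ≤ σ < 1`, the inner product of `H^{|γ|}` is replaced by an equivalent one
built from `n` derivatives and from weighted differences with steps `2^{-k}` along the axes. This is
the role of `ρ`. If no derivative or difference falls on the coefficient, the form is a sum of `L2`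
forms with translated coefficients, and the `L2` inequality applies to each. The remainder is a
commutator of lower order: for fractional `σ` because the Hölder exponent of the coefficient exceeds
`σ`, and for integer orders because `C^{n-1,1}` functions have mollifications with bounded
derivatives up to order `n`. The forms are used with finitely many steps and smooth coefficients,
with uniform constants. The limit in the number of steps and then in the coefficients gives the
statement for the operators.

For negative `γ`, multiplication in `H^γ` is the adjoint of multiplication in `H^{|γ|}`. With the
inner product given by `ρ⁻¹`, the required estimate is the one for the transposed form of order
`|γ|`, which holds because the main form is Hermitian.

Solutions are real because conjugation preserves the Cauchy problem and solutions are unique.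
Solutions in the sense of distributions correspond to functions `W` because a tempered distribution
is determined by compactly supported test functions. -/

noncomputable section
namespace ParabolicSystem
open MeasureTheory Set
open scoped SchwartzMap ENNReal LineDeriv

/-! ### Multiplication operators and Fourier multipliers on `L2`. -/

/-- Complex-valued square integrable functions. -/
abbrev L2 (d : ℕ) := Lp ℂ 2 (volume : Measure (Space d))

variable {d : ℕ}

open Classical in
/-- Multiplication by a bounded measurable function, as an operator on `L2` (zero for other
functions). -/
def mulOp (g : Space d → ℂ) : L2 d →L[ℂ] L2 d :=
  if h : MemLp g ⊤ (volume : Measure (Space d)) then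
    (ContinuousLinearMap.mul ℂ ℂ).holderL (volume : Measure (Space d)) ⊤ 2 2 (h.toLp g) else 0

theorem coeFn_mulOp {g : Space d → ℂ} (hg : MemLp g ⊤ (volume : Measure (Space d))) (v : L2 d) :
    mulOp g v =ᵐ[volume] fun x => g x * v x := by
  rw [mulOp, dif_pos hg]
  filter_upwards [(ContinuousLinearMap.mul ℂ ℂ).coeFn_holder (r := 2) (hg.toLp g) v,
    hg.coeFn_toLp] with x h1 h2
  rw [← h2]
  exact h1

theorem memLp_top_of_bound' {g : Space d → ℂ} (hg : AEStronglyMeasurable g volume) (C : ℝ)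
    (hC : ∀ x, ‖g x‖ ≤ C) : MemLp g ⊤ (volume : Measure (Space d)) :=
  memLp_top_of_bound hg C (Filter.Eventually.of_forall hC)

theorem norm_mulOp_le {g : Space d → ℂ} {C : ℝ} (hC0 : 0 ≤ C) (hC : ∀ x, ‖g x‖ ≤ C) (v : L2 d) :
    ‖mulOp g v‖ ≤ C * ‖v‖ := by
  by_cases hg : MemLp g ⊤ (volume : Measure (Space d))
  · refine Lp.norm_le_mul_norm_of_ae_le_mul ?_
    filter_upwards [coeFn_mulOp hg v] with x hx
    rw [hx, norm_mul]
    gcongr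
    exact hC x
  · rw [mulOp, dif_neg hg]
    simpa using mul_nonneg hC0 (norm_nonneg v)

theorem mulOp_mul {g h : Space d → ℂ} (hg : MemLp g ⊤ (volume : Measure (Space d)))
    (hh : MemLp h ⊤ (volume : Measure (Space d))) (v : L2 d) :
    mulOp g (mulOp h v) = mulOp (fun x => g x * h x) v := by
  have hgh : MemLp (fun x => g x * h x) ⊤ (volume : Measure (Space d)) := hh.mul hg
  refine Lp.ext ?_
  filter_upwards [coeFn_mulOp hg (mulOp h v), coeFn_mulOp hh v, coeFn_mulOp hgh v] with x h1 h2 h3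
  rw [h1, h2, h3, mul_assoc]

theorem mulOp_add {g h : Space d → ℂ} (hg : MemLp g ⊤ (volume : Measure (Space d)))
    (hh : MemLp h ⊤ (volume : Measure (Space d))) (v : L2 d) :
    mulOp (fun x => g x + h x) v = mulOp g v + mulOp h v := by
  have hgh : MemLp (fun x => g x + h x) ⊤ (volume : Measure (Space d)) := hg.add hh
  refine Lp.ext ?_
  filter_upwards [coeFn_mulOp hg v, coeFn_mulOp hh v, coeFn_mulOp hgh v,
    Lp.coeFn_add (mulOp g v) (mulOp h v)] with x h1 h2 h3 h4
  rw [h3, h4, Pi.add_apply, h1, h2, add_mul]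

theorem mulOp_sub {g h : Space d → ℂ} (hg : MemLp g ⊤ (volume : Measure (Space d)))
    (hh : MemLp h ⊤ (volume : Measure (Space d))) (v : L2 d) :
    mulOp (fun x => g x - h x) v = mulOp g v - mulOp h v := by
  have hgh : MemLp (fun x => g x - h x) ⊤ (volume : Measure (Space d)) := hg.sub hh
  refine Lp.ext ?_
  filter_upwards [coeFn_mulOp hg v, coeFn_mulOp hh v, coeFn_mulOp hgh v,
    Lp.coeFn_sub (mulOp g v) (mulOp h v)] with x h1 h2 h3 h4
  rw [h3, h4, Pi.sub_apply, h1, h2, sub_mul]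

theorem mulOp_const (c : ℂ) (v : L2 d) : mulOp (fun _ => c) v = c • v := by
  refine Lp.ext ?_
  filter_upwards [coeFn_mulOp (memLp_top_const c) v, Lp.coeFn_smul c v] with x h1 h2
  rw [h1, h2, Pi.smul_apply, smul_eq_mul]

theorem inner_mulOp {g : Space d → ℂ} (hg : MemLp g ⊤ (volume : Measure (Space d))) (v w : L2 d) :
    inner ℂ v (mulOp g w) = ∫ x, g x * (starRingEnd ℂ (v x) * w x) := by
  rw [L2.inner_def]
  refine integral_congr_ae ?_
  filter_upwards [coeFn_mulOp hg w] with x hx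
  rw [hx, RCLike.inner_apply]
  ring

theorem memLp_top_conj {g : Space d → ℂ} (hg : MemLp g ⊤ (volume : Measure (Space d))) :
    MemLp (fun x => starRingEnd ℂ (g x)) ⊤ (volume : Measure (Space d)) := hg.star

theorem inner_mulOp_left {g : Space d → ℂ} (hg : MemLp g ⊤ (volume : Measure (Space d)))
    (v w : L2 d) :
    inner ℂ (mulOp g v) w = inner ℂ v (mulOp (fun x => starRingEnd ℂ (g x)) w) := by
  rw [inner_mulOp (memLp_top_conj hg), L2.inner_def]
  refine integral_congr_ae ?_
  filter_upwards [coeFn_mulOp hg v] with x hx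
  rw [hx, RCLike.inner_apply, map_mul]
  ring

theorem integrable_conj_mul (v w : L2 d) :
    Integrable (fun x => starRingEnd ℂ (v x) * w x) := by
  have := L2.integrable_inner (𝕜 := ℂ) v w
  refine this.congr (Filter.Eventually.of_forall fun x => ?_)
  simp only [RCLike.inner_apply]
  ring

theorem re_inner_mulOp_mono {g h : Space d → ℝ}
    (hg : MemLp (fun x => (g x : ℂ)) ⊤ (volume : Measure (Space d)))
    (hh : MemLp (fun x => (h x : ℂ)) ⊤ (volume : Measure (Space d)))
    (hgh : ∀ x, g x ≤ h x) (v : L2 d) :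
    (inner ℂ v (mulOp (fun x => (g x : ℂ)) v)).re ≤ (inner ℂ v (mulOp (fun x => (h x : ℂ)) v)).re := by
  have key : ∀ {k : Space d → ℝ}, MemLp (fun x => (k x : ℂ)) ⊤ (volume : Measure (Space d)) →
      Integrable (fun x => (k x : ℂ) * (starRingEnd ℂ (v x) * v x)) := by
    intro k hk
    have h1 := L2.integrable_inner (𝕜 := ℂ) v (mulOp (fun x => (k x : ℂ)) v)
    refine h1.congr ?_
    filter_upwards [coeFn_mulOp hk v] with x hx
    rw [hx, RCLike.inner_apply]
    ring
  rw [inner_mulOp hg, inner_mulOp hh]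
  have e : ∀ z : ℂ, z.re = RCLike.re z := fun _ => rfl
  rw [e, e, ← integral_re (key hg), ← integral_re (key hh)]
  refine integral_mono (key hg).re (key hh).re fun x => ?_
  have h2 : starRingEnd ℂ (v x) * v x = ((‖v x‖ ^ 2 : ℝ) : ℂ) := by
    rw [mul_comm, Complex.mul_conj, Complex.normSq_eq_norm_sq]
  simp only [h2, ← Complex.ofReal_mul, RCLike.re_to_complex, Complex.ofReal_re]
  exact mul_le_mul_of_nonneg_right (hgh x) (sq_nonneg _)

open FourierTransform

/-- The Fourier multiplier operator on `L2` with a bounded measurable symbol. -/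
def fm (g : Space d → ℂ) : L2 d →L[ℂ] L2 d :=
  (Lp.fourierTransformₗᵢ (Space d) ℂ).symm.toContinuousLinearEquiv.toContinuousLinearMap ∘L mulOp g ∘L
    (Lp.fourierTransformₗᵢ (Space d) ℂ).toContinuousLinearEquiv.toContinuousLinearMap

theorem fm_apply (g : Space d → ℂ) (v : L2 d) : fm g v = 𝓕⁻ (mulOp g (𝓕 v)) := rfl

theorem fourier_fm (g : Space d → ℂ) (v : L2 d) : 𝓕 (fm g v) = mulOp g (𝓕 v) := by
  rw [fm_apply, fourier_fourierInv_eq]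

theorem norm_fm_le {g : Space d → ℂ} {C : ℝ} (hC0 : 0 ≤ C) (hC : ∀ x, ‖g x‖ ≤ C) (v : L2 d) :
    ‖fm g v‖ ≤ C * ‖v‖ := by
  rw [← Lp.norm_fourier_eq, fourier_fm, ← Lp.norm_fourier_eq v]
  exact norm_mulOp_le hC0 hC _

theorem fm_mul {g h : Space d → ℂ} (hg : MemLp g ⊤ (volume : Measure (Space d)))
    (hh : MemLp h ⊤ (volume : Measure (Space d))) (v : L2 d) :
    fm g (fm h v) = fm (fun x => g x * h x) v := by
  rw [fm_apply g, fourier_fm, mulOp_mul hg hh, ← fm_apply]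

theorem fm_comm {g h : Space d → ℂ} (hg : MemLp g ⊤ (volume : Measure (Space d)))
    (hh : MemLp h ⊤ (volume : Measure (Space d))) (v : L2 d) :
    fm g (fm h v) = fm h (fm g v) := by
  rw [fm_mul hg hh, fm_mul hh hg]
  simp only [mul_comm]

theorem fm_add {g h : Space d → ℂ} (hg : MemLp g ⊤ (volume : Measure (Space d)))
    (hh : MemLp h ⊤ (volume : Measure (Space d))) (v : L2 d) :
    fm (fun x => g x + h x) v = fm g v + fm h v := by
  simp only [fm_apply, mulOp_add hg hh, FourierTransform.fourierInv_add]

theorem fm_sub {g h : Space d → ℂ} (hg : MemLp g ⊤ (volume : Measure (Space d)))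
    (hh : MemLp h ⊤ (volume : Measure (Space d))) (v : L2 d) :
    fm (fun x => g x - h x) v = fm g v - fm h v := by
  simp only [fm_apply, mulOp_sub hg hh]
  exact map_sub (Lp.fourierTransformₗᵢ (Space d) ℂ).symm _ _

theorem fm_const (c : ℂ) (v : L2 d) : fm (fun _ => c) v = c • v := by
  rw [fm_apply, mulOp_const, FourierTransform.fourierInv_smul, fourierInv_fourier_eq]

theorem fm_sum {ι : Type*} (s : Finset ι) (g : ι → Space d → ℂ)
    (hg : ∀ i ∈ s, MemLp (g i) ⊤ (volume : Measure (Space d))) (v : L2 d) :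
    fm (fun x => ∑ i ∈ s, g i x) v = ∑ i ∈ s, fm (g i) v := by
  classical
  induction s using Finset.induction_on with
  | empty => simp [fm_const]
  | insert a s ha ih =>
    simp only [Finset.sum_insert ha]
    rw [fm_add (hg a (Finset.mem_insert_self _ _))
      (memLp_finsetSum s fun i hi => hg i (Finset.mem_insert_of_mem hi)),
      ih fun i hi => hg i (Finset.mem_insert_of_mem hi)]

theorem fm_const_mul {g : Space d → ℂ} (hg : MemLp g ⊤ (volume : Measure (Space d))) (c : ℂ)
    (v : L2 d) : fm (fun x => c * g x) v = c • fm g v := by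
  rw [← fm_mul (memLp_top_const c) hg, fm_const]

theorem inner_fm_left {g : Space d → ℂ} (hg : MemLp g ⊤ (volume : Measure (Space d)))
    (v w : L2 d) :
    inner ℂ (fm g v) w = inner ℂ v (fm (fun x => starRingEnd ℂ (g x)) w) := by
  rw [← Lp.inner_fourier_eq, fourier_fm, inner_mulOp_left hg, ← fourier_fm, Lp.inner_fourier_eq]

theorem inner_fm_real_left {g : Space d → ℝ}
    (hg : MemLp (fun x => (g x : ℂ)) ⊤ (volume : Measure (Space d))) (v w : L2 d) :
    inner ℂ (fm (fun x => (g x : ℂ)) v) w = inner ℂ v (fm (fun x => (g x : ℂ)) w) := by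
  rw [inner_fm_left hg]
  simp only [Complex.conj_ofReal]

/-- By Plancherel, pointwise inequalities between symbols become inequalities between quadratic
forms. This is the source of the coercivity of `ρ`. -/
theorem re_inner_fm_mono {g h : Space d → ℝ}
    (hg : MemLp (fun x => (g x : ℂ)) ⊤ (volume : Measure (Space d)))
    (hh : MemLp (fun x => (h x : ℂ)) ⊤ (volume : Measure (Space d)))
    (hgh : ∀ x, g x ≤ h x) (v : L2 d) :
    (inner ℂ v (fm (fun x => (g x : ℂ)) v)).re ≤ (inner ℂ v (fm (fun x => (h x : ℂ)) v)).re := by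
  rw [← Lp.inner_fourier_eq, fourier_fm, ← Lp.inner_fourier_eq v, fourier_fm]
  exact re_inner_mulOp_mono hg hh hgh _

theorem toLp_fourierMultiplier {g : Space d → ℂ} (hg : g.HasTemperateGrowth)
    (hb : MemLp g ⊤ (volume : Measure (Space d))) (f : 𝓢(Space d, ℂ)) :
    (SchwartzMap.fourierMultiplierCLM ℂ g f).toLp 2 = fm g (f.toLp 2) := by
  rw [SchwartzMap.fourierMultiplierCLM_apply, ← SchwartzMap.toLp_fourierInv_eq, fm_apply,
    SchwartzMap.toLp_fourier_eq]
  congr 1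
  refine Lp.ext ?_
  filter_upwards [coeFn_mulOp hb ((𝓕 f).toLp 2), (𝓕 f).coeFn_toLp 2 volume,
    (SchwartzMap.smulLeftCLM ℂ g (𝓕 f)).coeFn_toLp 2 volume] with x h1 h2 h3
  rw [h1, h2, h3, SchwartzMap.smulLeftCLM_apply_apply hg, smul_eq_mul]

/-- The link between the distributional operators `(1 - Δ)^{-r/2}`, `r ≥ 0`, and bounded operators
on `L2`. A smooth symbol is needed on the left, boundedness on the right. -/
theorem fourierMultiplier_coe {g : Space d → ℂ} (hg : g.HasTemperateGrowth)
    (hb : MemLp g ⊤ (volume : Measure (Space d))) (v : L2 d) :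
    TemperedDistribution.fourierMultiplierCLM ℂ g (v : Dist d) = (fm g v : Dist d) := by
  rw [TemperedDistribution.fourierMultiplierCLM_apply, fm_apply,
    ← Lp.fourierInv_toTemperedDistribution_eq, Lp.fourier_toTemperedDistribution_eq]
  congr 1
  ext u
  rw [TemperedDistribution.smulLeftCLM_apply_apply, Lp.toTemperedDistribution_apply,
    Lp.toTemperedDistribution_apply]
  refine integral_congr_ae ?_
  filter_upwards [coeFn_mulOp hb (𝓕 v)] with x hx
  rw [hx, SchwartzMap.smulLeftCLM_apply_apply hg]
  simp only [smul_eq_mul]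
  ring

theorem dense_toLp : DenseRange (fun f : 𝓢(Space d, ℂ) => (f.toLp 2 : L2 d)) :=
  SchwartzMap.denseRange_toLpCLM (by simp)

end ParabolicSystem
end

/-! ### The abstract parabolic Cauchy problem. -/

noncomputable section
namespace ParabolicSystem
open MeasureTheory Set Filter Topology

/-- An abstract form of the operators that enter a parabolic Cauchy problem: the time integration
`V`, the smoothing operator `j = (1 - Δ)^{-1/2}`, an equivalent inner product given by `ρ` and its
inverse `ρ'`, the embedding `ι` of initial data as functions constant in time, and approximate
inverses `Q n` of `j`. -/
structure VolterraTriple (E X : Type*) [NormedAddCommGroup E] [InnerProductSpace ℂ E]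
    [NormedAddCommGroup X] [InnerProductSpace ℂ X] where
  V : E →L[ℂ] E
  j : E →L[ℂ] E
  ρ : E →L[ℂ] E
  ρ' : E →L[ℂ] E
  ι : X →L[ℂ] E
  jX : X →L[ℂ] X
  Q : ℕ → E →L[ℂ] E
  QX : ℕ → X →L[ℂ] X
  bound : ℝ
  j_symm : ∀ x y, inner ℂ (j x) y = inner ℂ x (j y)
  Q_symm : ∀ n x y, inner ℂ (Q n x) y = inner ℂ x (Q n y)
  ρ_symm : ∀ x y, inner ℂ (ρ x) y = inner ℂ x (ρ y)
  V_j : ∀ x, V (j x) = j (V x)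
  V_Q : ∀ n x, V (Q n x) = Q n (V x)
  Q_j : ∀ n x, Q n (j x) = j (Q n x)
  ρ_j : ∀ x, ρ (j x) = j (ρ x)
  ρ_Q : ∀ n x, ρ (Q n x) = Q n (ρ x)
  ι_j : ∀ x, j (ι x) = ι (jX x)
  ι_Q : ∀ n x, Q n (ι x) = ι (QX n x)
  ρ_ρ' : ∀ x, ρ (ρ' x) = x
  tendsto_Q : ∀ x, Tendsto (fun n => Q n (j x)) atTop (𝓝 x)
  norm_QX : ∀ n x, ‖QX n (jX x)‖ ≤ ‖x‖
  dense_jX : DenseRange jX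
  accretive : ∀ x g, -(bound / 2) * ‖x‖ ^ 2 ≤ (inner ℂ (ρ (ι x + V g)) g).re
  bound_nonneg : 0 ≤ bound
  norm_ρ : ∀ x, ‖ρ x‖ ≤ bound * ‖x‖

namespace VolterraTriple

variable {E X : Type*} [NormedAddCommGroup E] [InnerProductSpace ℂ E] [CompleteSpace E]
  [NormedAddCommGroup X] [InnerProductSpace ℂ X] [CompleteSpace X] (D : VolterraTriple E X)

-- Formally `g` is the time derivative of `j² W`, so the right-hand side is the integral of half the
-- derivative of `(ρ j W, j W)`. The hypothesis carries one factor `j` too many for `accretive`. It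
-- is removed by `Q n`, which gives `j (Q n (j W)) = ι (QX n (jX w)) + V (Q n g)`. One `j` then
-- moves to the other argument, and `Q n ∘ j` tends to the identity.
omit [CompleteSpace E] [CompleteSpace X] in
theorem energy {W g : E} {w : X} (h : D.j (D.j W) = D.j (D.ι w) + D.V g) :
    -(D.bound / 2) * ‖w‖ ^ 2 ≤ (inner ℂ (D.ρ W) g).re := by
  have hn : ∀ n, -(D.bound / 2) * ‖w‖ ^ 2
      ≤ (inner ℂ (D.ρ (D.Q n (D.j W))) (D.Q n (D.j g))).re := by
    intro n
    have h1 := D.accretive (D.QX n (D.jX w)) (D.Q n g)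
    have h2 : D.ι (D.QX n (D.jX w)) + D.V (D.Q n g) = D.j (D.Q n (D.j W)) := by
      rw [← D.ι_Q, ← D.ι_j, D.V_Q, ← map_add, ← h, D.Q_j]
    rw [h2, D.ρ_j, D.j_symm, ← D.Q_j] at h1
    refine le_trans ?_ h1
    have h3 := D.norm_QX n w
    have h4 : ‖D.QX n (D.jX w)‖ ^ 2 ≤ ‖w‖ ^ 2 := by gcongr
    have := D.bound_nonneg
    nlinarith
  have hlim : Tendsto (fun n => (inner ℂ (D.ρ (D.Q n (D.j W))) (D.Q n (D.j g))).re) atTop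
      (𝓝 (inner ℂ (D.ρ W) g).re) :=
    (Complex.continuous_re.tendsto _).comp
      ((((D.ρ.continuous.tendsto _).comp (D.tendsto_Q W))).inner (D.tendsto_Q g))
  exact ge_of_tendsto' hlim hn

variable {T : E →L[ℂ] E} {c : ℝ}

-- The energy inequality with `g = F - T W` and coercivity of `T` give `c ‖W‖² ≤ b ‖W‖ ‖F‖ + (b / 2)
-- ‖w‖²`, where `b` is `bound`.
omit [CompleteSpace E] [CompleteSpace X] in
theorem apriori (hc : 0 < c) (hT : ∀ x, c * ‖x‖ ^ 2 ≤ (inner ℂ (D.ρ (T x)) x).re) {W F : E} {w : X}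
    (h : D.j (D.j W) = D.j (D.ι w) + D.V (F - T W)) :
    ‖W‖ ≤ (D.bound / c + 1) * (‖F‖ + ‖w‖) := by
  have h1 := D.energy h
  have h2 := hT W
  rw [map_sub] at *
  have h3 : (inner ℂ (D.ρ W) (F - T W)).re
      = (inner ℂ (D.ρ W) F).re - (inner ℂ (D.ρ (T W)) W).re := by
    rw [inner_sub_right, Complex.sub_re, D.ρ_symm W (T W), ← inner_conj_symm W, Complex.conj_re]
  have h4 : (inner ℂ (D.ρ W) F).re ≤ D.bound * ‖W‖ * ‖F‖ :=
    (Complex.re_le_norm _).trans ((norm_inner_le_norm _ _).trans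
      (mul_le_mul_of_nonneg_right (D.norm_ρ W) (norm_nonneg _)))
  have h5 : c * ‖W‖ ^ 2 ≤ D.bound * ‖W‖ * ‖F‖ + D.bound / 2 * ‖w‖ ^ 2 := by linarith
  have hb := D.bound_nonneg
  set b := D.bound
  have hW := norm_nonneg W
  have hF := norm_nonneg F
  have hw := norm_nonneg w
  -- If the bound fails, then `‖w‖ ≤ ‖W‖`, so `‖w‖²` is at most `‖W‖ ‖w‖`, and the quadratic
  -- inequality contradicts `hcon` multiplied by `‖W‖`.
  by_contra hcon
  push Not at hcon
  set q := b / c with hq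
  have hbq : b = q * c := by rw [hq]; field_simp
  have hq0 : 0 ≤ q := by positivity
  rw [hbq] at h5
  have h6 : ‖W‖ ^ 2 ≤ q * ‖W‖ * ‖F‖ + q / 2 * ‖w‖ ^ 2 := by
    have : c * ‖W‖ ^ 2 ≤ c * (q * ‖W‖ * ‖F‖ + q / 2 * ‖w‖ ^ 2) := by nlinarith
    exact le_of_mul_le_mul_left this hc
  have h7 : ‖w‖ ≤ ‖W‖ := by nlinarith [mul_nonneg hq0 hF, mul_nonneg hq0 hw]
  have h8 : ‖W‖ * ((q + 1) * (‖F‖ + ‖w‖)) ≤ ‖W‖ ^ 2 := by nlinarith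
  have h8' : ‖w‖ ^ 2 ≤ ‖W‖ * ‖w‖ := by nlinarith
  have hW0 : 0 < ‖W‖ := lt_of_le_of_lt (by positivity) hcon
  have h9 : ‖W‖ * ((q + 1) * (‖F‖ + ‖w‖)) < ‖W‖ * ‖W‖ := mul_lt_mul_of_pos_left hcon hW0
  nlinarith [mul_nonneg hq0 (mul_nonneg hW hw), mul_nonneg hW hF, mul_nonneg hW hw, mul_nonneg hq0 (sub_nonneg.2 h8'), mul_nonneg hq0 (mul_nonneg hW hF)]

-- The energy inequality for the problem run backwards in time. Accretivity with zero initial value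
-- is applied to `ρ' (Q n g)`. There `ρ` cancels `ρ'`, the adjoint of `V` appears on the other side,
-- and the limit in `n` removes the regularization as before.
omit [CompleteSpace X] in
theorem adjoint_energy {Y g : E} (h : D.j (D.j (D.ρ Y)) = ContinuousLinearMap.adjoint D.V g) :
    0 ≤ (inner ℂ g Y).re := by
  have hV' : ∀ n x, ContinuousLinearMap.adjoint D.V (D.Q n x)
      = D.Q n (ContinuousLinearMap.adjoint D.V x) := by
    intro n x
    refine ext_inner_left ℂ fun y => ?_
    rw [ContinuousLinearMap.adjoint_inner_right, ← D.Q_symm, ← D.Q_symm,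
      ContinuousLinearMap.adjoint_inner_right, D.V_Q]
  have hn : ∀ n, 0 ≤ (inner ℂ (D.Q n (D.j g)) (D.Q n (D.j Y))).re := by
    intro n
    have h1 := D.accretive 0 (D.ρ' (D.Q n g))
    have h2 : D.ρ (D.Q n (D.j (D.j Y))) = ContinuousLinearMap.adjoint D.V (D.Q n g) := by
      rw [hV', ← h, ← D.ρ_j, ← D.ρ_j, D.ρ_Q]
    rw [map_zero, zero_add, norm_zero, D.ρ_symm, D.ρ_ρ', ← ContinuousLinearMap.adjoint_inner_right,
      ← h2, ← D.ρ_symm, D.ρ_ρ', D.Q_j, ← D.j_symm, ← D.Q_j] at h1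
    simpa using h1
  have hlim : Tendsto (fun n => (inner ℂ (D.Q n (D.j g)) (D.Q n (D.j Y))).re) atTop
      (𝓝 (inner ℂ g Y).re) :=
    (Complex.continuous_re.tendsto _).comp ((D.tendsto_Q g).inner (D.tendsto_Q Y))
  exact ge_of_tendsto' hlim hn

/-- The continuous linear map whose kernel consists of the triples `(W, F, w)` such that `W`
solves the equation with right-hand side `F` and initial value `w`. -/
def residual (T : E →L[ℂ] E) : E × E × X →L[ℂ] E :=
  (D.j ∘L D.j + D.V ∘L T) ∘L ContinuousLinearMap.fst ℂ E (E × X)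
    - (D.V ∘L ContinuousLinearMap.fst ℂ E X + D.j ∘L D.ι ∘L ContinuousLinearMap.snd ℂ E X) ∘L
      ContinuousLinearMap.snd ℂ E (E × X)

omit [CompleteSpace E] [CompleteSpace X] in
theorem residual_eq_zero_iff (W F : E) (w : X) :
    D.residual T (W, F, w) = 0 ↔ D.j (D.j W) = D.j (D.ι w) + D.V (F - T W) := by
  simp only [residual, sub_apply, ContinuousLinearMap.comp_apply,
    add_apply, ContinuousLinearMap.coe_fst', ContinuousLinearMap.coe_snd', map_sub]
  rw [← sub_eq_zero (a := D.j (D.j W))]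
  constructor <;> intro h <;> rw [← h] <;> abel

/-- The triples `(W, F, w)` form a closed subspace. By the a priori bound its projection to `(F, w)`
is bounded below, and so has closed range. -/
theorem isClosed_solvable (hc : 0 < c) (hT : ∀ x, c * ‖x‖ ^ 2 ≤ (inner ℂ (D.ρ (T x)) x).re) :
    IsClosed {p : E × X | ∃ W, D.residual T (W, p.1, p.2) = 0} := by
  set Γ := LinearMap.ker (D.residual T).toLinearMap with hΓ
  have hcl : IsClosed (Γ : Set (E × E × X)) := (D.residual T).isClosed_ker
  have : CompleteSpace Γ := hcl.completeSpace_coe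
  let p : Γ →L[ℂ] E × X := ContinuousLinearMap.snd ℂ E (E × X) ∘L Γ.subtypeL
  have hb := D.bound_nonneg
  have hq : 0 ≤ D.bound / c := by positivity
  have hp : AntilipschitzWith (Real.toNNReal (2 * (D.bound / c + 1))) p := by
    refine AddMonoidHomClass.antilipschitz_of_bound p fun x => ?_
    obtain ⟨⟨W, F, w⟩, hx⟩ := x
    have h1 := D.apriori hc hT ((D.residual_eq_zero_iff W F w).1 hx)
    have h2 : ‖F‖ ≤ ‖(F, w)‖ := norm_fst_le (F, w)
    have h3 : ‖w‖ ≤ ‖(F, w)‖ := norm_snd_le (F, w)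
    rw [Real.coe_toNNReal _ (by positivity)]
    change ‖(W, F, w)‖ ≤ 2 * (D.bound / c + 1) * ‖(F, w)‖
    have h4 : ‖(F, w)‖ ≤ 2 * (D.bound / c + 1) * ‖(F, w)‖ :=
      le_mul_of_one_le_left (norm_nonneg _) (by linarith)
    refine (max_le (h1.trans ?_) h4 : max ‖W‖ ‖(F, w)‖ ≤ _)
    nlinarith
  have hrange := hp.isClosed_range p.uniformContinuous
  have heq : {p : E × X | ∃ W, D.residual T (W, p.1, p.2) = 0} = range p := by
    refine Set.ext fun q => ?_
    obtain ⟨F, w⟩ := q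
    constructor
    · rintro ⟨W, h⟩
      exact ⟨⟨(W, F, w), h⟩, rfl⟩
    · rintro ⟨⟨⟨W, F', w'⟩, h⟩, hx⟩
      obtain ⟨rfl, rfl⟩ := Prod.mk.inj hx
      exact ⟨W, h⟩
  rw [heq]
  exact hrange

/-- Existence for the abstract Cauchy problem with a coercive operator `T`. -/
theorem exists_solution (hc : 0 < c) (hT : ∀ x, c * ‖x‖ ^ 2 ≤ (inner ℂ (D.ρ (T x)) x).re)
    (F : E) (w : X) : ∃ W, D.j (D.j W) = D.j (D.ι w) + D.V (F - T W) := by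
  let R : Submodule ℂ (E × X) :=
    (LinearMap.ker (D.residual T).toLinearMap).map (LinearMap.snd ℂ E (E × X))
  have hR : ∀ F w, (F, w) ∈ R ↔ ∃ W, D.j (D.j W) = D.j (D.ι w) + D.V (F - T W) := by
    intro F w
    simp only [← D.residual_eq_zero_iff (T := T)]
    constructor
    · rintro ⟨⟨W, F', w'⟩, h, hx⟩
      obtain ⟨rfl, rfl⟩ := Prod.mk.inj hx
      exact ⟨W, h⟩
    · rintro ⟨W, h⟩
      exact ⟨(W, F, w), h, rfl⟩
  have hcl : IsClosed (R : Set (E × X)) := by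
    convert D.isClosed_solvable hc hT using 1
    ext ⟨F, w⟩
    simp only [D.residual_eq_zero_iff]
    exact hR F w
  let R₀ : Submodule ℂ E := R.comap (LinearMap.inl ℂ E X)
  have hR₀ : ∀ F, F ∈ R₀ ↔ (F, (0 : X)) ∈ R := fun F => Iff.rfl
  have hcl₀ : IsClosed (R₀ : Set E) :=
    hcl.preimage (by fun_prop : Continuous fun F : E => (F, (0 : X)))
  have : CompleteSpace R₀ := hcl₀.completeSpace_coe
  have htop : R₀ = ⊤ := by
    rw [← Submodule.orthogonal_eq_bot_iff, Submodule.eq_bot_iff]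
    intro Z hZ
    -- The right-hand side `j² h + T (V h)` is solvable with zero initial value, the solution being
    -- `V h`, because `V` commutes with `j`.
    have h1 : ∀ h, inner ℂ (D.j (D.j h) + T (D.V h)) Z = 0 := by
      intro h
      refine (Submodule.mem_orthogonal _ _).1 hZ _ ((hR₀ _).2 ((hR _ _).2 ⟨D.V h, ?_⟩))
      simp [D.V_j]
    set A := ContinuousLinearMap.adjoint T
    set B := ContinuousLinearMap.adjoint D.V
    -- Thus `Z` solves the adjoint homogeneous equation. The adjoint energy inequality for `ρ' Z`,
    -- against coercivity of `T` at `ρ' Z`, forces `ρ' Z = 0`.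
    have h2 : D.j (D.j Z) = B (-(A Z)) := by
      rw [map_neg, ← sub_eq_zero, sub_neg_eq_add]
      refine ext_inner_left ℂ fun h => ?_
      rw [inner_zero_right, ← h1 h, inner_add_right, inner_add_left, D.j_symm, D.j_symm,
        ContinuousLinearMap.adjoint_inner_right, ContinuousLinearMap.adjoint_inner_right]
    have h3 : D.j (D.j (D.ρ (D.ρ' Z))) = B (-(A Z)) := by rw [D.ρ_ρ', h2]
    have h4 := D.adjoint_energy h3
    have h5 : (inner ℂ (A Z) (D.ρ' Z)).re = (inner ℂ (D.ρ (T (D.ρ' Z))) (D.ρ' Z)).re := by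
      rw [ContinuousLinearMap.adjoint_inner_left, D.ρ_symm, ← inner_conj_symm, Complex.conj_re,
        D.ρ_ρ']
    rw [inner_neg_left, Complex.neg_re, h5] at h4
    have h6 := hT (D.ρ' Z)
    have h7 : D.ρ' Z = 0 := by
      have : ‖D.ρ' Z‖ ^ 2 ≤ 0 := by nlinarith
      simpa using this
    rw [← D.ρ_ρ' Z, h7, map_zero]
  have hmem₀ : ∀ F, (F, (0 : X)) ∈ R := fun F => (hR₀ F).1 (htop ▸ Submodule.mem_top)
  -- For `w = jX z` the function `ι z`, constant in time, is a solution with right-hand side `T (ι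
  -- z)`, which is then subtracted. Density of the range of `jX` and closedness of `R` give all
  -- other `w`.
  have hmem₁ : ∀ w, ((0 : E), w) ∈ R := by
    have hclX : IsClosed {w : X | ((0 : E), w) ∈ R} := hcl.preimage (by fun_prop)
    refine fun w => D.dense_jX.induction_on (p := fun w => ((0 : E), w) ∈ R) w hclX fun z => ?_
    have h1 : (T (D.ι z), D.jX z) ∈ R := (hR _ _).2 ⟨D.ι z, by simp [D.ι_j]⟩
    have := R.sub_mem h1 (hmem₀ (T (D.ι z)))
    simpa using this
  have := R.add_mem (hmem₀ F) (hmem₁ w)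
  rw [Prod.mk_add_mk, add_zero, zero_add] at this
  exact (hR F w).1 this

end VolterraTriple
end ParabolicSystem
end

/-! ### Vector-valued functions of time: measurability, primitives and the energy identity. -/

noncomputable section
namespace ParabolicSystem
set_option linter.unusedSectionVars false
open MeasureTheory Set Filter Topology
open scoped ENNReal

section WeakMeasurability

variable {X : Type*} [NormedAddCommGroup X] [InnerProductSpace ℂ X]

theorem Orthonormal.countable [SecondCountableTopology X] {w : Set X}
    (hw : Orthonormal ℂ ((↑) : w → X)) : w.Countable := by
  refine Set.PairwiseDisjoint.countable_of_isOpen (s := fun x => Metric.ball x (1 / 2)) ?_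
    (fun _ _ => Metric.isOpen_ball) fun x _ => ⟨x, Metric.mem_ball_self (by norm_num)⟩
  intro x hx y hy hxy
  refine Metric.ball_disjoint_ball ?_
  have h1 : ‖x - y‖ ^ 2 = 2 := by
    rw [@norm_sub_sq ℂ, hw.1 ⟨x, hx⟩, hw.1 ⟨y, hy⟩,
      hw.2 (i := ⟨x, hx⟩) (j := ⟨y, hy⟩) (by simpa using hxy)]
    norm_num
  rw [dist_eq_norm]
  nlinarith [norm_nonneg (x - y)]

/-- A form of Pettis' theorem: `f` is the limit of its partial expansions in a Hilbert basis.
Separability makes the basis countable, hence the filter of its finite subsets countably generated.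
-/
theorem aestronglyMeasurable_of_inner [CompleteSpace X] [SecondCountableTopology X]
    {α : Type*} [MeasurableSpace α] {μ : Measure α} {f : α → X}
    (h : ∀ y : X, AEStronglyMeasurable (fun t => inner ℂ y (f t)) μ) :
    AEStronglyMeasurable f μ := by
  obtain ⟨w, b, hb⟩ := exists_hilbertBasis ℂ X
  have hw : w.Countable := Orthonormal.countable (by rw [← hb]; exact b.orthonormal)
  have := hw.to_subtype
  refine aestronglyMeasurable_of_tendsto_ae (u := (atTop : Filter (Finset w)))
    (f := fun s t => ∑ i ∈ s, b.repr (f t) i • b i) (fun s => ?_)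
    (Eventually.of_forall fun t => b.hasSum_repr (f t))
  refine Finset.aestronglyMeasurable_fun_sum s fun i _ => ?_
  simp only [b.repr_apply_apply]
  exact (h _).smul_const _

end WeakMeasurability

section OperatorFamily

variable {X : Type*} [NormedAddCommGroup X] [NormedSpace ℂ X]
  {α : Type*} [MeasurableSpace α] {μ : Measure α}

/-- Only strong measurability of `A` is available, so `f` is approximated by simple functions;
continuity of each `A t` passes to the limit. -/
theorem aestronglyMeasurable_family_apply {A : α → X →L[ℂ] X}
    (hA : ∀ x, AEStronglyMeasurable (fun t => A t x) μ) {f : α → X}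
    (hf : AEStronglyMeasurable f μ) : AEStronglyMeasurable (fun t => A t (f t)) μ := by
  have hs : ∀ s : SimpleFunc α X, AEStronglyMeasurable (fun t => A t (s t)) μ := by
    intro s
    induction s using SimpleFunc.induction with
    | @const c s hs =>
      refine ((hA c).indicator hs).congr (Eventually.of_forall fun t => ?_)
      by_cases ht : t ∈ s <;> simp [Set.indicator, Set.piecewise, ht]
    | add _ hf hg => 
      refine (hf.add hg).congr (Eventually.of_forall fun t => ?_)
      simp
  obtain ⟨g, hg, hfg⟩ := hf
  have h1 : AEStronglyMeasurable (fun t => A t (g t)) μ :=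
    aestronglyMeasurable_of_tendsto_ae (u := atTop) (f := fun n t => A t (hg.approx n t))
      (fun n => hs _) (Eventually.of_forall fun t =>
        ((A t).continuous.tendsto _).comp (hg.tendsto_approx t))
  refine h1.congr ?_
  filter_upwards [hfg] with t ht
  rw [ht]

variable {A : α → X →L[ℂ] X} {M : ℝ}

theorem memLp_family_apply (hA : ∀ x, AEStronglyMeasurable (fun t => A t x) μ)
    (hM : ∀ t x, ‖A t x‖ ≤ M * ‖x‖) (f : Lp X 2 μ) : MemLp (fun t => A t (f t)) 2 μ :=
  MemLp.of_le_mul (Lp.memLp f) (aestronglyMeasurable_family_apply hA (Lp.aestronglyMeasurable f))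
    (Eventually.of_forall fun t => hM t (f t))

/-- A bounded strongly measurable family of operators, acting pointwise on square integrable
functions. -/
def familyOp (A : α → X →L[ℂ] X) (hA : ∀ x, AEStronglyMeasurable (fun t => A t x) μ)
    (hM : ∀ t x, ‖A t x‖ ≤ M * ‖x‖) : Lp X 2 μ →L[ℂ] Lp X 2 μ :=
  LinearMap.mkContinuous
    { toFun := fun f => (memLp_family_apply hA hM f).toLp _
      map_add' := fun f g => by
        rw [← MemLp.toLp_add]
        refine MemLp.toLp_congr _ _ ?_
        filter_upwards [Lp.coeFn_add f g] with t ht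
        rw [ht, Pi.add_apply, map_add, Pi.add_apply]
      map_smul' := fun c f => by
        rw [RingHom.id_apply, ← MemLp.toLp_const_smul]
        refine MemLp.toLp_congr _ _ ?_
        filter_upwards [Lp.coeFn_smul c f] with t ht
        simp [ht] }
    M fun f => by
      refine Lp.norm_le_mul_norm_of_ae_le_mul ?_
      filter_upwards [(memLp_family_apply hA hM f).coeFn_toLp] with t ht
      simp only [LinearMap.coe_mk, AddHom.coe_mk]
      rw [ht]
      exact hM t _

theorem coeFn_familyOp (hA : ∀ x, AEStronglyMeasurable (fun t => A t x) μ)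
    (hM : ∀ t x, ‖A t x‖ ≤ M * ‖x‖) (f : Lp X 2 μ) :
    familyOp A hA hM f =ᵐ[μ] fun t => A t (f t) :=
  (memLp_family_apply hA hM f).coeFn_toLp

end OperatorFamily

section Primitive

variable {X : Type*} [NormedAddCommGroup X] [NormedSpace ℝ X] {T : ℝ}

/-- The restriction of Lebesgue measure to the time interval `(0, T]`. -/
abbrev timeMeasure (T : ℝ) : Measure ℝ := volume.restrict (Ioc 0 T)

/-- The integral of `g` over `(0, t]`, for `t ≤ T`. -/
def primitive (T : ℝ) (g : ℝ → X) (t : ℝ) : X := ∫ s in Iic t, g s ∂(timeMeasure T)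

theorem primitive_eq_intervalIntegral {g : ℝ → X} {t : ℝ} (ht : t ∈ Icc 0 T) :
    primitive T g t = ∫ s in (0 : ℝ)..t, g s := by
  rw [primitive, intervalIntegral.integral_of_le ht.1, Measure.restrict_restrict measurableSet_Iic]
  congr 2
  ext s
  simp only [mem_inter_iff, mem_Iic, mem_Ioc]
  exact ⟨fun h => ⟨h.2.1, h.1⟩, fun h => ⟨h.2, h.1, h.2.trans ht.2⟩⟩

theorem primitive_congr {f g : ℝ → X} (h : f =ᵐ[timeMeasure T] g) (t : ℝ) :
    primitive T f t = primitive T g t :=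
  integral_congr_ae (ae_restrict_of_ae h)

theorem norm_primitive_le (g : ℝ → X) (hg : Integrable g (timeMeasure T)) (t : ℝ) :
    ‖primitive T g t‖ ≤ ∫ s, ‖g s‖ ∂(timeMeasure T) :=
  (norm_integral_le_integral_norm _).trans
    (setIntegral_le_integral hg.norm (Eventually.of_forall fun _ => norm_nonneg _))

theorem continuous_primitive' {g : ℝ → X} (hg : Integrable g (timeMeasure T)) :
    Continuous (primitive T g) := by
  have h2 : primitive T g = fun t => primitive T g 0 + ∫ s in (0 : ℝ)..t, g s ∂(timeMeasure T) := by
    funext t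
    rw [← intervalIntegral.integral_Iic_sub_Iic hg.integrableOn hg.integrableOn, primitive, primitive]
    abel
  rw [h2]
  exact continuous_const.add
    (intervalIntegral.continuous_primitive (fun a b => hg.intervalIntegrable) 0)

theorem map_primitive {Y : Type*} [NormedAddCommGroup Y] [NormedSpace ℝ Y] [CompleteSpace X]
    [CompleteSpace Y] {g : ℝ → X} (hg : Integrable g (timeMeasure T)) (A : X →L[ℝ] Y) (t : ℝ) :
    A (primitive T g t) = primitive T (fun s => A (g s)) t :=
  (A.integral_comp_comm hg.integrableOn).symm

/-- Interchange of the order of integration over the triangle `s ≤ t`. -/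
theorem integral_triangle_swap {Y : Type*} [NormedAddCommGroup Y] [NormedSpace ℝ Y] {μ : Measure ℝ}
    [SFinite μ] {b : ℝ → ℝ → Y} (hb : Integrable (Function.uncurry b) (μ.prod μ)) :
    ∫ t, ∫ s in Iic t, b t s ∂μ ∂μ = ∫ s, ∫ t in Ici s, b t s ∂μ ∂μ := by
  have hmeas : MeasurableSet {p : ℝ × ℝ | p.2 ≤ p.1} := measurableSet_le measurable_snd measurable_fst
  have h1 : ∀ t, ∫ s in Iic t, b t s ∂μ
      = ∫ s, ({p : ℝ × ℝ | p.2 ≤ p.1}.indicator (Function.uncurry b)) (t, s) ∂μ := by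
    intro t
    rw [← integral_indicator measurableSet_Iic]
    rfl
  have h2 : ∀ s, ∫ t in Ici s, b t s ∂μ
      = ∫ t, ({p : ℝ × ℝ | p.2 ≤ p.1}.indicator (Function.uncurry b)) (t, s) ∂μ := by
    intro s
    rw [← integral_indicator measurableSet_Ici]
    rfl
  simp only [h1, h2]
  exact integral_integral_swap (f := fun t s =>
    ({p : ℝ × ℝ | p.2 ≤ p.1}.indicator (Function.uncurry b)) (t, s)) (hb.indicator hmeas)

/-- An exponential factor shifts the equation `φ' = p`. -/
theorem exp_smul_primitive [CompleteSpace X] {p : ℝ → X} (hp : Integrable p (timeMeasure T)) (x : X)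
    (l : ℝ) {t : ℝ} (ht : t ∈ Icc 0 T) :
    Real.exp (l * t) • (x + primitive T p t)
      = x + primitive T (fun s => Real.exp (l * s) • (p s + l • (x + primitive T p s))) t := by
  have hpt : ∀ {r : ℝ}, r ≤ t → Integrable p (volume.restrict (Ioc 0 r)) := fun hr =>
    hp.mono_measure (Measure.restrict_mono (Ioc_subset_Ioc_right (hr.trans ht.2)) le_rfl)
  have hcont := continuous_primitive' hp
  have hderiv : ∀ s, HasDerivAt (fun s => Real.exp (l * s)) (l * Real.exp (l * s)) s := by
    intro s
    have := ((hasDerivAt_id s).const_mul l).exp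
    simpa [mul_comm] using this
  have hexpint : ∀ a b : ℝ, ∫ s in a..b, l * Real.exp (l * s) = Real.exp (l * b) - Real.exp (l * a) :=
    fun a b => intervalIntegral.integral_eq_sub_of_hasDerivAt (fun s _ => hderiv s)
      (Continuous.intervalIntegrable (by fun_prop) _ _)
  have hi1 : IntervalIntegrable (fun s => Real.exp (l * s) • p s) volume 0 t := by
    rw [intervalIntegrable_iff_integrableOn_Ioc_of_le ht.1]
    refine IntegrableOn.continuousOn_smul_of_subset (K := Icc 0 t) (by fun_prop) (hpt le_rfl) isCompact_Icc
      measurableSet_Ioc Ioc_subset_Icc_self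
  have hi2 : IntervalIntegrable (fun s => (l * Real.exp (l * s)) • x) volume 0 t :=
    Continuous.intervalIntegrable (by fun_prop) _ _
  have hi3 : IntervalIntegrable (fun s => (l * Real.exp (l * s)) • primitive T p s) volume 0 t :=
    Continuous.intervalIntegrable (by fun_prop) _ _
  have hsplit : ∀ s, Real.exp (l * s) • (p s + l • (x + primitive T p s))
      = Real.exp (l * s) • p s + (l * Real.exp (l * s)) • x
        + (l * Real.exp (l * s)) • primitive T p s := by
    intro s
    module
  -- Interchanging the integrals over the triangle replaces an integration by parts, so that the
  -- primitive of a merely integrable function need not be differentiated.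
  have htri : ∫ s in (0 : ℝ)..t, (l * Real.exp (l * s)) • primitive T p s
      = ∫ s in (0 : ℝ)..t, (Real.exp (l * t) - Real.exp (l * s)) • p s := by
    set ν : Measure ℝ := volume.restrict (Ioc 0 t) with hν
    have hb : Integrable (Function.uncurry fun s r => (l * Real.exp (l * s)) • p r) (ν.prod ν) := by
      have h1 : Integrable (fun s : ℝ => l * Real.exp (l * s)) ν :=
        (Continuous.integrableOn_Ioc (by fun_prop))
      exact h1.smul_prod (hpt le_rfl)
    have h2 := integral_triangle_swap hb
    rw [intervalIntegral.integral_of_le ht.1, intervalIntegral.integral_of_le ht.1]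
    have h3 : ∫ s in Ioc 0 t, (l * Real.exp (l * s)) • primitive T p s
        = ∫ s, ∫ r in Iic s, (l * Real.exp (l * s)) • p r ∂ν ∂ν := by
      refine setIntegral_congr_fun measurableSet_Ioc fun s hs => ?_
      rw [integral_smul, primitive_eq_intervalIntegral ⟨hs.1.le, hs.2.trans ht.2⟩,
        ← primitive_eq_intervalIntegral (T := t) ⟨hs.1.le, hs.2⟩, primitive]
    rw [h3, h2]
    refine setIntegral_congr_fun measurableSet_Ioc fun r hr => ?_
    rw [integral_smul_const, ← hexpint r t, intervalIntegral.integral_of_le hr.2, hν,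
      Measure.restrict_restrict measurableSet_Ici]
    congr 1
    have : Ici r ∩ Ioc 0 t = Icc r t := by
      ext s
      simp only [mem_inter_iff, mem_Ici, mem_Ioc, mem_Icc]
      exact ⟨fun h => ⟨h.1, h.2.2⟩, fun h => ⟨h.1, hr.1.trans_le h.1, h.2⟩⟩
    rw [this, integral_Icc_eq_integral_Ioc]
  simp only [hsplit]
  rw [primitive_eq_intervalIntegral (g := fun s => Real.exp (l * s) • p s
    + (l * Real.exp (l * s)) • x + (l * Real.exp (l * s)) • primitive T p s) ht]
  rw [intervalIntegral.integral_add (hi1.add hi2) hi3, intervalIntegral.integral_add hi1 hi2, htri,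
    intervalIntegral.integral_smul_const, hexpint]
  have h4 : ∫ s in (0 : ℝ)..t, (Real.exp (l * t) - Real.exp (l * s)) • p s
      = Real.exp (l * t) • primitive T p t - ∫ s in (0 : ℝ)..t, Real.exp (l * s) • p s := by
    rw [primitive_eq_intervalIntegral ht, ← intervalIntegral.integral_smul,
      ← intervalIntegral.integral_sub _ hi1]
    · simp only [sub_smul]
    · exact ((intervalIntegrable_iff_integrableOn_Ioc_of_le ht.1).2 (hpt le_rfl)).smul _
  rw [h4, smul_add, mul_zero, Real.exp_zero]
  module

end Primitive

section Accretive

variable {X : Type*} [NormedAddCommGroup X] [InnerProductSpace ℂ X] [CompleteSpace X] {T : ℝ}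

/-- The energy identity `2 Re ∫ (ρ (x + ∫₀ᵗ g), g) dt ≥ - (ρ x, x)` for a nonnegative operator. -/
theorem accretive_primitive {ρ : X →L[ℂ] X} (hsymm : ∀ x y, inner ℂ (ρ x) y = inner ℂ x (ρ y))
    (hpos : ∀ x, 0 ≤ (inner ℂ (ρ x) x).re) {g : ℝ → X} (hg : Integrable g (timeMeasure T)) (x : X) :
    -(1 / 2) * (inner ℂ (ρ x) x).re
      ≤ ∫ t, (inner ℂ (ρ (x + primitive T g t)) (g t)).re ∂(timeMeasure T) := by
  set μ := timeMeasure T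
  set b : ℝ → ℝ → ℝ := fun t s => (inner ℂ (ρ (g s)) (g t)).re with hb
  have hbs : ∀ t s, b t s = b s t := by
    intro t s
    simp only [hb]
    rw [hsymm, ← inner_conj_symm, Complex.conj_re]
  have hbm : Integrable (Function.uncurry b) (μ.prod μ) := by
    have h1 : Integrable (fun p : ℝ × ℝ => ‖ρ‖ * (‖g p.1‖ * ‖g p.2‖)) (μ.prod μ) :=
      (hg.norm.mul_prod hg.norm).const_mul _
    refine h1.mono ?_ (Eventually.of_forall fun p => ?_)
    · refine Complex.continuous_re.comp_aestronglyMeasurable ?_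
      exact (ρ.continuous.comp_aestronglyMeasurable hg.1.comp_snd).inner hg.1.comp_fst
    · simp only [Function.uncurry, hb]
      refine (Complex.abs_re_le_norm _).trans ((norm_inner_le_norm _ _).trans ?_)
      rw [Real.norm_of_nonneg (by positivity)]
      calc ‖ρ (g p.2)‖ * ‖g p.1‖ ≤ (‖ρ‖ * ‖g p.2‖) * ‖g p.1‖ := by
            gcongr; exact ρ.le_opNorm _
        _ = _ := by ring
  have hre : ∀ (L : Set ℝ) (y : X), ∫ s in L, (inner ℂ (ρ (g s)) y).re ∂μ
      = (inner ℂ (ρ (∫ s in L, g s ∂μ)) y).re := by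
    intro L y
    have h1 : ∀ z, (inner ℂ (ρ z) y).re = (Complex.reCLM ∘L ((innerSL ℂ (ρ y)).restrictScalars ℝ)) z := by
      intro z
      change _ = (inner ℂ (ρ y) z).re
      rw [hsymm y z, ← inner_conj_symm, Complex.conj_re]
    simp only [h1]
    exact ContinuousLinearMap.integral_comp_comm _ hg.integrableOn
  have htri := integral_triangle_swap hbm
  have hJ2 : ∫ s, ∫ t in Ici s, b t s ∂μ ∂μ = ∫ t, ∫ s in Ioi t, b t s ∂μ ∂μ := by
    refine integral_congr_ae (Eventually.of_forall fun s => ?_)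
    simp only
    rw [integral_Ici_eq_integral_Ioi]
    simp only [hbs s]
  -- The kernel is symmetric and the diagonal is a null set, so the two triangles contribute
  -- equally.
  have htot : ∫ t, ∫ s, b t s ∂μ ∂μ = 2 * ∫ t, ∫ s in Iic t, b t s ∂μ ∂μ := by
    have hsec : ∀ᵐ t ∂μ, Integrable (b t) μ := hbm.prod_right_ae
    have h1 : ∀ᵐ t ∂μ, ∫ s, b t s ∂μ = (∫ s in Iic t, b t s ∂μ) + ∫ s in Ioi t, b t s ∂μ := by
      filter_upwards [hsec] with t ht
      rw [← compl_Iic, integral_add_compl measurableSet_Iic ht]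
    have hA : Integrable (fun t => ∫ s in Iic t, b t s ∂μ) μ := by
      have hmeas : MeasurableSet {p : ℝ × ℝ | p.2 ≤ p.1} :=
        measurableSet_le measurable_snd measurable_fst
      refine (hbm.indicator hmeas).integral_prod_left.congr (Eventually.of_forall fun t => ?_)
      beta_reduce
      rw [← integral_indicator measurableSet_Iic]
      rfl
    have hB : Integrable (fun t => ∫ s in Ioi t, b t s ∂μ) μ := by
      refine (hbm.integral_prod_left.sub hA).congr ?_
      filter_upwards [h1] with t ht
      simp only [Pi.sub_apply, Function.uncurry]
      rw [ht]
      ring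
    rw [integral_congr_ae h1, integral_add hA hB, ← hJ2, ← htri]
    ring
  set I := ∫ s, g s ∂μ with hI
  have hfull : ∫ t, ∫ s, b t s ∂μ ∂μ = (inner ℂ (ρ I) I).re := by
    have h1 : ∀ t, ∫ s, b t s ∂μ = (inner ℂ (ρ (g t)) I).re := by
      intro t
      have := hre univ (g t)
      rw [setIntegral_univ, setIntegral_univ] at this
      rw [show (∫ s, b t s ∂μ) = _ from this, hsymm, ← inner_conj_symm, Complex.conj_re]
    simp only [h1]
    have := hre univ I
    rwa [setIntegral_univ, setIntegral_univ] at this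
  have hprim : ∀ t, ∫ s in Iic t, b t s ∂μ = (inner ℂ (ρ (primitive T g t)) (g t)).re :=
    fun t => hre (Iic t) (g t)
  have hx : ∫ t, (inner ℂ (ρ x) (g t)).re ∂μ = (inner ℂ (ρ x) I).re :=
    ContinuousLinearMap.integral_comp_comm
      (Complex.reCLM ∘L ((innerSL ℂ (ρ x)).restrictScalars ℝ)) hg
  have hi1 : Integrable (fun t => (inner ℂ (ρ x) (g t)).re) μ :=
    ContinuousLinearMap.integrable_comp
      (Complex.reCLM ∘L ((innerSL ℂ (ρ x)).restrictScalars ℝ)) hg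
  have hi2 : Integrable (fun t => (inner ℂ (ρ (primitive T g t)) (g t)).re) μ := by
    refine Integrable.mono' (hg.norm.const_mul (‖ρ‖ * ∫ s, ‖g s‖ ∂μ)) ?_
      (Eventually.of_forall fun t => ?_)
    · exact Complex.continuous_re.comp_aestronglyMeasurable
        ((ρ.continuous.comp (continuous_primitive' hg)).aestronglyMeasurable.inner hg.1)
    · refine (Complex.abs_re_le_norm _).trans ((norm_inner_le_norm _ _).trans ?_)
      gcongr
      exact (ρ.le_opNorm _).trans (by gcongr; exact norm_primitive_le g hg t)
  have hmain : ∫ t, (inner ℂ (ρ (x + primitive T g t)) (g t)).re ∂μ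
      = (inner ℂ (ρ x) I).re + (1 / 2) * (inner ℂ (ρ I) I).re := by
    simp only [map_add, inner_add_left, Complex.add_re]
    rw [integral_add hi1 hi2, hx, ← hfull, htot]
    simp only [hprim]
    ring
  -- Completing the square: `Re (ρ x, I) + ½ Re (ρ I, I)` is half the energy of `x + I` minus half
  -- the energy of `x`.
  have hp := hpos (x + I)
  simp only [map_add, inner_add_left, inner_add_right, Complex.add_re] at hp
  have hsw : (inner ℂ (ρ I) x).re = (inner ℂ (ρ x) I).re := by
    rw [hsymm, ← inner_conj_symm, Complex.conj_re]
  rw [hmain]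
  rw [hsw] at hp
  linarith

end Accretive

section Volterra

variable {X : Type*} [NormedAddCommGroup X] [InnerProductSpace ℂ X] [CompleteSpace X] {T : ℝ}

theorem Lp.integrable_time (g : Lp X 2 (timeMeasure T)) : Integrable g (timeMeasure T) :=
  (Lp.memLp g).integrable one_le_two

theorem integral_norm_le_time (g : Lp X 2 (timeMeasure T)) :
    ∫ s, ‖g s‖ ∂(timeMeasure T) ≤ ‖g‖ * ((timeMeasure T) univ ^ (1 / 2 : ℝ)).toReal := by
  have h1 := eLpNorm_le_eLpNorm_mul_rpow_measure_univ (μ := timeMeasure T) (p := 1) (q := 2)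
    one_le_two (Lp.aestronglyMeasurable g)
  rw [integral_norm_eq_lintegral_enorm (Lp.aestronglyMeasurable g), ← eLpNorm_one_eq_lintegral_enorm,
    Lp.norm_def, ← ENNReal.toReal_mul]
  refine ENNReal.toReal_mono (ENNReal.mul_ne_top (Lp.eLpNorm_ne_top g) ?_) (h1.trans_eq ?_)
  · exact ENNReal.rpow_ne_top_of_nonneg (by norm_num) (measure_ne_top _ _)
  · norm_num

theorem memLp_primitive (g : Lp X 2 (timeMeasure T)) :
    MemLp (primitive T g) 2 (timeMeasure T) :=
  MemLp.of_bound (continuous_primitive' (Lp.integrable_time g)).aestronglyMeasurable _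
    (Eventually.of_forall fun t => norm_primitive_le g (Lp.integrable_time g) t)

/-- Integration in time as an operator on `L_2((0,T], X)`. -/
def volterra (T : ℝ) : Lp X 2 (timeMeasure T) →L[ℂ] Lp X 2 (timeMeasure T) :=
  LinearMap.mkContinuous
    { toFun := fun g => (memLp_primitive g).toLp _
      map_add' := fun f g => by
        rw [← MemLp.toLp_add]
        refine MemLp.toLp_congr _ _ (Eventually.of_forall fun t => ?_)
        rw [primitive_congr (Lp.coeFn_add f g), Pi.add_apply, primitive, primitive, primitive,
          ← integral_add (Lp.integrable_time f).integrableOn (Lp.integrable_time g).integrableOn]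
        rfl
      map_smul' := fun c f => by
        rw [RingHom.id_apply, ← MemLp.toLp_const_smul]
        refine MemLp.toLp_congr _ _ (Eventually.of_forall fun t => ?_)
        rw [primitive_congr (Lp.coeFn_smul c f), Pi.smul_apply, primitive, primitive,
          ← integral_smul]
        rfl }
    (measureUnivNNReal (timeMeasure T) ^ (2 : ℝ≥0∞).toReal⁻¹
      * ((timeMeasure T) univ ^ (1 / 2 : ℝ)).toReal) fun f => by
      have h1 := Lp.norm_le_of_ae_bound (p := 2) (f := (memLp_primitive f).toLp _)
        (C := ∫ s, ‖f s‖ ∂(timeMeasure T)) (by positivity) (by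
          filter_upwards [(memLp_primitive f).coeFn_toLp] with t ht
          rw [ht]
          exact norm_primitive_le f (Lp.integrable_time f) t)
      refine h1.trans ?_
      rw [mul_assoc, mul_comm (ENNReal.toReal _)]
      gcongr
      exact integral_norm_le_time f

theorem coeFn_volterra (g : Lp X 2 (timeMeasure T)) :
    volterra T g =ᵐ[timeMeasure T] primitive T g :=
  (memLp_primitive g).coeFn_toLp

theorem volterra_compLpL (A : X →L[ℂ] X) (g : Lp X 2 (timeMeasure T)) :
    volterra T (A.compLpL 2 (timeMeasure T) g) = A.compLpL 2 (timeMeasure T) (volterra T g) := by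
  refine Lp.ext ?_
  filter_upwards [coeFn_volterra (A.compLpL 2 (timeMeasure T) g),
    A.coeFn_compLpL (μ := timeMeasure T) (volterra T g), coeFn_volterra g] with t h1 h2 h3
  rw [h1, h2, h3, primitive_congr (A.coeFn_compLpL g)]
  exact (map_primitive (Lp.integrable_time g) (A.restrictScalars ℝ) t).symm

theorem compLpL_comm {A B : X →L[ℂ] X} (h : ∀ x, A (B x) = B (A x)) {μ : Measure ℝ} (g : Lp X 2 μ) :
    A.compLpL 2 μ (B.compLpL 2 μ g) = B.compLpL 2 μ (A.compLpL 2 μ g) := by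
  refine Lp.ext ?_
  filter_upwards [A.coeFn_compLpL (μ := μ) (B.compLpL 2 μ g), B.coeFn_compLpL (μ := μ) g,
    B.coeFn_compLpL (μ := μ) (A.compLpL 2 μ g), A.coeFn_compLpL (μ := μ) g] with t h1 h2 h3 h4
  rw [h1, h2, h3, h4, h]

theorem compLpL_symm {A : X →L[ℂ] X} (h : ∀ x y, inner ℂ (A x) y = inner ℂ x (A y)) {μ : Measure ℝ}
    (f g : Lp X 2 μ) : inner ℂ (A.compLpL 2 μ f) g = inner ℂ f (A.compLpL 2 μ g) := by
  rw [L2.inner_def, L2.inner_def]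
  refine integral_congr_ae ?_
  filter_upwards [A.coeFn_compLpL (μ := μ) f, A.coeFn_compLpL (μ := μ) g] with t h1 h2
  rw [h1, h2, h]

theorem compLpL_const (A : X →L[ℂ] X) {μ : Measure ℝ} [IsFiniteMeasure μ] (x : X) :
    A.compLpL 2 μ (Lp.constL 2 μ ℂ x) = Lp.constL 2 μ ℂ (A x) := by
  refine Lp.ext ?_
  filter_upwards [A.coeFn_compLpL (μ := μ) (Lp.constL 2 μ ℂ x), Lp.coeFn_const (p := 2) (μ := μ) x,
    Lp.coeFn_const (p := 2) (μ := μ) (A x)] with t h1 h2 h3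
  rw [h1]
  erw [h2, h3]
  rfl

end Volterra
end ParabolicSystem
end

/-! ### From operators in space to well-posedness under a Gårding inequality. -/

noncomputable section
namespace ParabolicSystem
set_option linter.unusedSectionVars false
open MeasureTheory Set Filter Topology
open scoped ENNReal

/-- The operators in the space variable that enter the abstract Cauchy problem. -/
structure SpatialOps (X : Type*) [NormedAddCommGroup X] [InnerProductSpace ℂ X] where
  j : X →L[ℂ] X
  ρ : X →L[ℂ] X
  ρ' : X →L[ℂ] X
  Q : ℕ → X →L[ℂ] X
  bound : ℝ
  lower : ℝ
  lower_pos : 0 < lower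
  j_symm : ∀ x y, inner ℂ (j x) y = inner ℂ x (j y)
  ρ_symm : ∀ x y, inner ℂ (ρ x) y = inner ℂ x (ρ y)
  Q_symm : ∀ n x y, inner ℂ (Q n x) y = inner ℂ x (Q n y)
  Q_j : ∀ n x, Q n (j x) = j (Q n x)
  ρ_j : ∀ x, ρ (j x) = j (ρ x)
  ρ_Q : ∀ n x, ρ (Q n x) = Q n (ρ x)
  ρ_ρ' : ∀ x, ρ (ρ' x) = x
  tendsto_Q : ∀ x, Tendsto (fun n => Q n (j x)) atTop (𝓝 x)
  norm_Q : ∀ n x, ‖Q n (j x)‖ ≤ ‖x‖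
  dense_j : DenseRange j
  coercive_ρ : ∀ x, lower * ‖x‖ ^ 2 ≤ (inner ℂ (ρ x) x).re
  bound_nonneg : 0 ≤ bound
  norm_ρ : ∀ x, ‖ρ x‖ ≤ bound * ‖x‖

section

variable {X : Type*} [NormedAddCommGroup X] [InnerProductSpace ℂ X]

theorem Lp.norm_sq_eq_integral {α : Type*} [MeasurableSpace α] {μ : Measure α} (f : Lp X 2 μ) :
    ‖f‖ ^ 2 = ∫ t, ‖f t‖ ^ 2 ∂μ := by
  have h := L2.inner_def (𝕜 := ℂ) f f
  simp only [inner_self_eq_norm_sq_to_K] at h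
  have h2 : ∀ t, ((‖f t‖ : ℂ) ^ 2) = ((‖f t‖ ^ 2 : ℝ) : ℂ) := fun t => by push_cast; rfl
  simp only [RCLike.ofReal_eq_complex_ofReal] at h 
  simp only [h2, integral_complex_ofReal] at h
  exact_mod_cast h

theorem Lp.tendsto_of_dominated {α : Type*} [MeasurableSpace α] {μ : Measure α} {f : ℕ → Lp X 2 μ}
    {g : Lp X 2 μ} (hb : ∀ n, ∀ᵐ t ∂μ, ‖f n t‖ ≤ ‖g t‖)
    (hlim : ∀ᵐ t ∂μ, Tendsto (fun n => f n t) atTop (𝓝 (g t))) : Tendsto f atTop (𝓝 g) := by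
  rw [tendsto_iff_norm_sub_tendsto_zero]
  have h1 : Tendsto (fun n => ‖f n - g‖ ^ 2) atTop (𝓝 0) := by
    have h2 : ∀ n, ‖f n - g‖ ^ 2 = ∫ t, ‖f n t - g t‖ ^ 2 ∂μ := by
      intro n
      rw [Lp.norm_sq_eq_integral]
      refine integral_congr_ae ?_
      filter_upwards [Lp.coeFn_sub (f n) g] with t ht
      rw [ht, Pi.sub_apply]
    simp only [h2]
    have h3 : (0 : ℝ) = ∫ _t, (0 : ℝ) ∂μ := by simp
    rw [h3]
    refine tendsto_integral_of_dominated_convergence (fun t => 4 * ‖g t‖ ^ 2) (fun n => ?_) ?_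
      (fun n => ?_) ?_
    · exact ((Lp.aestronglyMeasurable (f n)).sub (Lp.aestronglyMeasurable g)).norm.pow 2
    · exact ((Lp.memLp g).integrable_norm_pow (by norm_num)).const_mul 4
    · filter_upwards [hb n] with t ht
      rw [Real.norm_of_nonneg (by positivity)]
      have := norm_sub_le (f n t) (g t)
      nlinarith [norm_nonneg (f n t - g t), norm_nonneg (g t)]
    · filter_upwards [hlim] with t ht
      have := (tendsto_iff_norm_sub_tendsto_zero.1 ht).pow 2
      simpa using this
  have h4 := h1.sqrt
  simpa [Real.sqrt_sq] using h4

end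

variable {X : Type*} [NormedAddCommGroup X] [InnerProductSpace ℂ X] [CompleteSpace X]

namespace SpatialOps

variable (S : SpatialOps X) {T : ℝ}

/-- The time-dependent operators obtained from operators in the space variable. -/
def toVolterra (T : ℝ) : VolterraTriple (Lp X 2 (timeMeasure T)) X where
  V := volterra T
  j := S.j.compLpL 2 _
  ρ := S.ρ.compLpL 2 _
  ρ' := S.ρ'.compLpL 2 _
  ι := Lp.constL 2 _ ℂ
  jX := S.j
  Q n := (S.Q n).compLpL 2 _
  QX := S.Q
  bound := S.bound
  j_symm := compLpL_symm S.j_symm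
  ρ_symm := compLpL_symm S.ρ_symm
  Q_symm n := compLpL_symm (S.Q_symm n)
  V_j := volterra_compLpL _
  V_Q n := volterra_compLpL _
  Q_j n := compLpL_comm (S.Q_j n)
  ρ_j := compLpL_comm S.ρ_j
  ρ_Q n := compLpL_comm (S.ρ_Q n)
  ι_j := compLpL_const _
  ι_Q n := compLpL_const _
  ρ_ρ' f := by
    refine Lp.ext ?_
    filter_upwards [S.ρ.coeFn_compLpL (μ := timeMeasure T) (S.ρ'.compLpL 2 _ f),
      S.ρ'.coeFn_compLpL (μ := timeMeasure T) f] with t h1 h2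
    rw [h1, h2, S.ρ_ρ']
  tendsto_Q f := by
    have h : ∀ n, ((S.Q n).compLpL 2 (timeMeasure T) (S.j.compLpL 2 _ f))
        =ᵐ[timeMeasure T] fun t => S.Q n (S.j (f t)) := by
      intro n
      filter_upwards [(S.Q n).coeFn_compLpL (μ := timeMeasure T) (S.j.compLpL 2 _ f),
        S.j.coeFn_compLpL (μ := timeMeasure T) f] with t h1 h2
      rw [h1, h2]
    refine Lp.tendsto_of_dominated (fun n => ?_) ?_
    · filter_upwards [h n] with t ht
      rw [ht]
      exact S.norm_Q n _
    · filter_upwards [ae_all_iff.2 h] with t ht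
      simp only [ht]
      exact S.tendsto_Q _
  norm_QX := S.norm_Q
  dense_jX := S.dense_j
  accretive x g := by
    have h1 := accretive_primitive S.ρ_symm
      (fun x => (mul_nonneg S.lower_pos.le (sq_nonneg _)).trans (S.coercive_ρ x))
      (Lp.integrable_time g) x
    have h2 : (inner ℂ (S.ρ x) x).re ≤ S.bound * ‖x‖ ^ 2 := by
      refine (Complex.re_le_norm _).trans ((norm_inner_le_norm _ _).trans ?_)
      have := mul_le_mul_of_nonneg_right (S.norm_ρ x) (norm_nonneg x)
      linarith
    have h3 : (inner ℂ (S.ρ.compLpL 2 (timeMeasure T) (Lp.constL 2 _ ℂ x + volterra T g)) g).re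
        = ∫ t, (inner ℂ (S.ρ (x + primitive T g t)) (g t)).re ∂(timeMeasure T) := by
      rw [L2.inner_def]
      have h4 := L2.integrable_inner (𝕜 := ℂ)
        (S.ρ.compLpL 2 (timeMeasure T) (Lp.constL 2 _ ℂ x + volterra T g)) g
      refine (integral_re h4).symm.trans ?_
      refine integral_congr_ae ?_
      filter_upwards [S.ρ.coeFn_compLpL (μ := timeMeasure T) (Lp.constL 2 _ ℂ x + volterra T g),
        Lp.coeFn_add (Lp.constL 2 (timeMeasure T) ℂ x) (volterra T g), coeFn_volterra g,
        Lp.coeFn_const (p := 2) (μ := timeMeasure T) x] with t h5 h6 h7 h8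
      have h9 : (Lp.constL 2 (timeMeasure T) ℂ x : Lp X 2 (timeMeasure T)) t = x := h8
      rw [h5, h6, Pi.add_apply, h7, h9]
      rfl
    rw [h3]
    refine le_trans ?_ h1
    linarith
  bound_nonneg := S.bound_nonneg
  norm_ρ f := by
    refine Lp.norm_le_mul_norm_of_ae_le_mul ?_
    filter_upwards [S.ρ.coeFn_compLpL (μ := timeMeasure T) f] with t ht
    rw [ht]
    exact S.norm_ρ _

end SpatialOps

section ExpMul

variable {T : ℝ}

theorem memLp_exp_smul (l : ℝ) (f : Lp X 2 (timeMeasure T)) :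
    MemLp (fun t => Real.exp (l * t) • f t) 2 (timeMeasure T) := by
  refine MemLp.of_le_mul (c := Real.exp (|l| * T)) (Lp.memLp f) ?_ ?_
  · have h1 : Continuous fun t : ℝ => Real.exp (l * t) := by fun_prop
    exact h1.aestronglyMeasurable.smul (Lp.aestronglyMeasurable f)
  · filter_upwards [ae_restrict_mem measurableSet_Ioc] with t ht
    rw [norm_smul, Real.norm_of_nonneg (Real.exp_pos _).le]
    refine mul_le_mul_of_nonneg_right (Real.exp_le_exp.2 ?_) (norm_nonneg _)
    calc l * t ≤ |l| * t := mul_le_mul_of_nonneg_right (le_abs_self l) ht.1.le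
      _ ≤ |l| * T := mul_le_mul_of_nonneg_left ht.2 (abs_nonneg l)

/-- Multiplication by `e^{lt}`. -/
def expMul (l : ℝ) (f : Lp X 2 (timeMeasure T)) : Lp X 2 (timeMeasure T) :=
  (memLp_exp_smul l f).toLp _

theorem coeFn_expMul (l : ℝ) (f : Lp X 2 (timeMeasure T)) :
    expMul l f =ᵐ[timeMeasure T] fun t => Real.exp (l * t) • f t :=
  (memLp_exp_smul l f).coeFn_toLp

theorem norm_expMul_le {l C : ℝ} (h : ∀ t ∈ Ioc 0 T, Real.exp (l * t) ≤ C)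
    (f : Lp X 2 (timeMeasure T)) : ‖expMul l f‖ ≤ C * ‖f‖ := by
  refine Lp.norm_le_mul_norm_of_ae_le_mul ?_
  filter_upwards [coeFn_expMul l f, ae_restrict_mem measurableSet_Ioc] with t ht h2
  rw [ht, norm_smul, Real.norm_of_nonneg (Real.exp_pos _).le]
  gcongr
  exact h t h2

theorem expMul_neg_expMul (l : ℝ) (f : Lp X 2 (timeMeasure T)) :
    expMul l (expMul (-l) f) = f := by
  refine Lp.ext ?_
  filter_upwards [coeFn_expMul l (expMul (-l) f), coeFn_expMul (-l) f] with t h1 h2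
  rw [h1, h2, smul_smul, ← Real.exp_add]
  simp

end ExpMul

/-- `W` solves `(j² W)' = F - A W` with initial value `j w`. -/
def SolvesCauchy (j : X →L[ℂ] X) (T : ℝ) (A : ℝ → X →L[ℂ] X) (F W : ℝ → X) (w : X) : Prop :=
  ∀ᵐ t ∂(timeMeasure T), j (j (W t)) = j w + primitive T (fun s => F s - A s (W s)) t

section Shift

variable {T M : ℝ} {A : ℝ → X →L[ℂ] X}

/-- The product rule for `e^{lt} j² W` adds the term `l j²` to the equation. Negative `l` improves
coercivity; positive `l` undoes the shift. -/
theorem SolvesCauchy.exp_shift (hA : ∀ x, AEStronglyMeasurable (fun t => A t x) (timeMeasure T))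
    (hM : ∀ t x, ‖A t x‖ ≤ M * ‖x‖) {j : X →L[ℂ] X} {F W : Lp X 2 (timeMeasure T)} {w : X}
    (h : SolvesCauchy j T A F W w) (l : ℝ) :
    SolvesCauchy j T (fun t => A t - (l : ℂ) • (j ∘L j)) (expMul l F) (expMul l W) w := by
  have hint : Integrable (fun s => F s - A s (W s)) (timeMeasure T) :=
    (Lp.integrable_time F).sub
      ((memLp_family_apply hA hM W).integrable one_le_two)
  have hcongr : ∀ t, primitive T
      (fun s => expMul l F s - (A s - (l : ℂ) • (j ∘L j)) (expMul l W s)) t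
      = primitive T (fun s => Real.exp (l * s) • ((F s - A s (W s))
          + l • (j w + primitive T (fun s => F s - A s (W s)) s))) t := by
    refine fun t => primitive_congr ?_ t
    filter_upwards [h, coeFn_expMul l F, coeFn_expMul l W] with s h1 h2 h3
    rw [← h1, h2, h3]
    have e : ∀ (c : ℝ) (x : X) (B : X →L[ℂ] X), B (c • x) = c • B x := fun c x B =>
      B.map_smul_of_tower c x
    simp only [sub_apply, smul_apply, ContinuousLinearMap.comp_apply, e, Complex.coe_smul, smul_sub, smul_add]
    abel
  filter_upwards [h, coeFn_expMul l W, ae_restrict_mem measurableSet_Ioc] with t h1 h2 h3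
  rw [hcongr, ← exp_smul_primitive hint (j w) l ⟨h3.1.le, h3.2⟩, h2, ← h1]
  simp only [ContinuousLinearMap.map_smul_of_tower]

theorem solvesCauchy_iff (S : SpatialOps X)
    (hA : ∀ x, AEStronglyMeasurable (fun t => A t x) (timeMeasure T))
    (hM : ∀ t x, ‖A t x‖ ≤ M * ‖x‖) (F W : Lp X 2 (timeMeasure T)) (w : X) :
    SolvesCauchy S.j T A F W w ↔
      (S.toVolterra T).j ((S.toVolterra T).j W) = (S.toVolterra T).j ((S.toVolterra T).ι w)
        + (S.toVolterra T).V (F - familyOp A hA hM W) := by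
  have h0 : (S.toVolterra T).j ((S.toVolterra T).ι w) = Lp.constL 2 (timeMeasure T) ℂ (S.j w) :=
    compLpL_const _ _
  rw [h0]
  have h1 : (S.toVolterra T).j ((S.toVolterra T).j W) =ᵐ[timeMeasure T] fun t => S.j (S.j (W t)) := by
    filter_upwards [S.j.coeFn_compLpL (μ := timeMeasure T) (S.j.compLpL 2 _ W),
      S.j.coeFn_compLpL (μ := timeMeasure T) W] with t h1 h2
    rw [← h2]
    exact h1
  have h2 : (Lp.constL 2 (timeMeasure T) ℂ (S.j w) + (S.toVolterra T).V (F - familyOp A hA hM W) :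
      Lp X 2 (timeMeasure T))
      =ᵐ[timeMeasure T] fun t => S.j w + primitive T (fun s => F s - A s (W s)) t := by
    have h3 : (F - familyOp A hA hM W : Lp X 2 (timeMeasure T)) =ᵐ[timeMeasure T]
        fun s => F s - A s (W s) := by
      filter_upwards [Lp.coeFn_sub F (familyOp A hA hM W), coeFn_familyOp hA hM W] with s h4 h5
      rw [h4, Pi.sub_apply, h5]
    filter_upwards [Lp.coeFn_add (Lp.constL 2 (timeMeasure T) ℂ (S.j w))
        ((S.toVolterra T).V (F - familyOp A hA hM W)),
      coeFn_volterra (F - familyOp A hA hM W),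
      Lp.coeFn_const (p := 2) (μ := timeMeasure T) (S.j w)] with t h4 h5 h6
    rw [h4, Pi.add_apply, show (S.toVolterra T).V (F - familyOp A hA hM W) t = _ from h5,
      primitive_congr h3]
    congr 1
  constructor
  · intro h
    refine Lp.ext ?_
    filter_upwards [h, h1, h2] with t h3 h4 h5
    rw [h4, h5, h3]
  · intro h
    filter_upwards [h1, h2] with t h4 h5
    rw [← h4, ← h5, h]

theorem SolvesCauchy.sub (hA : ∀ x, AEStronglyMeasurable (fun t => A t x) (timeMeasure T))
    (hM : ∀ t x, ‖A t x‖ ≤ M * ‖x‖) {j : X →L[ℂ] X} {F W W' : Lp X 2 (timeMeasure T)} {w : X}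
    (h : SolvesCauchy j T A F W w) (h' : SolvesCauchy j T A F W' w) :
    SolvesCauchy j T A (0 : Lp X 2 (timeMeasure T)) (W - W' : Lp X 2 (timeMeasure T)) 0 := by
  have hint : ∀ W : Lp X 2 (timeMeasure T), Integrable (fun s => F s - A s (W s)) (timeMeasure T) :=
    fun W => (Lp.integrable_time F).sub ((memLp_family_apply hA hM W).integrable one_le_two)
  have hcongr : ∀ t, primitive T (fun s => (0 : Lp X 2 (timeMeasure T)) s
      - A s ((W - W' : Lp X 2 (timeMeasure T)) s)) t
      = primitive T (fun s => F s - A s (W s)) t - primitive T (fun s => F s - A s (W' s)) t := by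
    intro t
    rw [primitive, primitive, primitive, ← integral_sub (hint W).integrableOn (hint W').integrableOn]
    refine primitive_congr ?_ t
    filter_upwards [Lp.coeFn_sub W W', Lp.coeFn_zero X 2 (timeMeasure T)] with s h1 h2
    rw [h1, h2, Pi.sub_apply, Pi.zero_apply, map_sub]
    abel
  filter_upwards [h, h', Lp.coeFn_sub W W'] with t h1 h2 h3
  rw [hcongr, h3, Pi.sub_apply, map_sub, map_sub, h1, h2, map_zero]
  abel

variable (S : SpatialOps X) {c lam : ℝ}

theorem coercive_familyOp (hA : ∀ x, AEStronglyMeasurable (fun t => A t x) (timeMeasure T))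
    (hM : ∀ t x, ‖A t x‖ ≤ M * ‖x‖)
    (hcoer : ∀ᵐ t ∂(timeMeasure T), ∀ x, c * ‖x‖ ^ 2 ≤ (inner ℂ (S.ρ (A t x)) x).re)
    (f : Lp X 2 (timeMeasure T)) :
    c * ‖f‖ ^ 2 ≤ (inner ℂ ((S.toVolterra T).ρ (familyOp A hA hM f)) f).re := by
  have h4 := L2.integrable_inner (𝕜 := ℂ) ((S.toVolterra T).ρ (familyOp A hA hM f)) f
  rw [Lp.norm_sq_eq_integral, ← integral_const_mul, L2.inner_def]
  refine le_trans ?_ (integral_re h4).le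
  refine integral_mono_ae (((Lp.memLp f).integrable_norm_pow (by norm_num)).const_mul c) h4.re ?_
  filter_upwards [hcoer, S.ρ.coeFn_compLpL (μ := timeMeasure T) (familyOp A hA hM f),
    coeFn_familyOp hA hM f] with t h1 h2 h3
  have h5 : ((S.toVolterra T).ρ (familyOp A hA hM f)) t = S.ρ (A t (f t)) := by
    rw [← h3]
    exact h2
  rw [h5]
  exact h1 (f t)

theorem norm_le_of_solvesCauchy (hc : 0 < c)
    (hA : ∀ x, AEStronglyMeasurable (fun t => A t x) (timeMeasure T))
    (hM : ∀ t x, ‖A t x‖ ≤ M * ‖x‖)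
    (hcoer : ∀ᵐ t ∂(timeMeasure T), ∀ x, c * ‖x‖ ^ 2 ≤ (inner ℂ (S.ρ (A t x)) x).re)
    {F W : Lp X 2 (timeMeasure T)} {w : X} (h : SolvesCauchy S.j T A F W w) :
    ‖W‖ ≤ (S.bound / c + 1) * (‖F‖ + ‖w‖) :=
  (S.toVolterra T).apriori hc (coercive_familyOp S hA hM hcoer)
    ((solvesCauchy_iff S hA hM F W w).1 h)

theorem exists_of_coercive (hc : 0 < c)
    (hA : ∀ x, AEStronglyMeasurable (fun t => A t x) (timeMeasure T))
    (hM : ∀ t x, ‖A t x‖ ≤ M * ‖x‖)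
    (hcoer : ∀ᵐ t ∂(timeMeasure T), ∀ x, c * ‖x‖ ^ 2 ≤ (inner ℂ (S.ρ (A t x)) x).re)
    (F : Lp X 2 (timeMeasure T)) (w : X) :
    ∃ W : Lp X 2 (timeMeasure T), SolvesCauchy S.j T A F W w := by
  obtain ⟨W, hW⟩ := (S.toVolterra T).exists_solution hc (coercive_familyOp S hA hM hcoer) F w
  exact ⟨W, (solvesCauchy_iff S hA hM F W w).2 hW⟩

/-- Well-posedness of the abstract Cauchy problem under a Gårding inequality. -/
theorem wellPosed_of_garding (hc : 0 < c) (hlam : 0 ≤ lam)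
    (hA : ∀ x, AEStronglyMeasurable (fun t => A t x) (timeMeasure T))
    (hM : ∀ t x, ‖A t x‖ ≤ M * ‖x‖)
    (hcoer : ∀ᵐ t ∂(timeMeasure T), ∀ x,
      c * ‖x‖ ^ 2 ≤ (inner ℂ (S.ρ (A t x)) x).re + lam * ‖S.j x‖ ^ 2)
    (F : Lp X 2 (timeMeasure T)) (w : X) :
    ∃ W : Lp X 2 (timeMeasure T), SolvesCauchy S.j T A F W w ∧
      (∀ W' : Lp X 2 (timeMeasure T), SolvesCauchy S.j T A F W' w → W' = W) ∧
      ‖W‖ ≤ (S.bound / c + 1) * Real.exp (lam / S.lower * T) * (‖F‖ + ‖w‖) := by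
  -- Since `(ρ j x, j x) ≥ lower * ‖j x‖²`, this `l` makes `A + l j²` coercive with the same
  -- constant `c`.
  set l := lam / S.lower with hl
  have hl0 : 0 ≤ l := div_nonneg hlam S.lower_pos.le
  set B : ℝ → X →L[ℂ] X := fun t => A t - ((-l : ℝ) : ℂ) • (S.j ∘L S.j) with hB
  have hBA : ∀ x, AEStronglyMeasurable (fun t => B t x) (timeMeasure T) := fun x =>
    (hA x).sub aestronglyMeasurable_const
  have hBM : ∀ t x, ‖B t x‖ ≤ (M + ‖((-l : ℝ) : ℂ) • (S.j ∘L S.j)‖) * ‖x‖ := by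
    intro t x
    refine (norm_sub_le _ _).trans ?_
    rw [add_mul]
    exact add_le_add (hM t x) (ContinuousLinearMap.le_opNorm _ _)
  have hBc : ∀ᵐ t ∂(timeMeasure T), ∀ x, c * ‖x‖ ^ 2 ≤ (inner ℂ (S.ρ (B t x)) x).re := by
    filter_upwards [hcoer] with t ht x
    refine (ht x).trans ?_
    have h1 : B t x = A t x + (l : ℂ) • S.j (S.j x) := by
      simp [hB]
    rw [h1, map_add, inner_add_left, Complex.add_re, map_smul, inner_smul_left, S.ρ_j, S.j_symm,
      Complex.conj_ofReal, Complex.re_ofReal_mul]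
    have h2 := S.coercive_ρ (S.j x)
    have h3 : lam = l * S.lower := by rw [hl]; field_simp [S.lower_pos.ne']
    rw [h3]
    nlinarith
  have hAB : ∀ {W : Lp X 2 (timeMeasure T)}, SolvesCauchy S.j T A F W w →
      SolvesCauchy S.j T B (expMul (-l) F) (expMul (-l) W) w := fun h => h.exp_shift hA hM (-l)
  have hBA' : ∀ {Y : Lp X 2 (timeMeasure T)}, SolvesCauchy S.j T B (expMul (-l) F) Y w →
      SolvesCauchy S.j T A F (expMul l Y) w := by
    intro Y h
    have h1 := h.exp_shift hBA hBM l
    rw [expMul_neg_expMul] at h1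
    convert h1 using 1
    funext t
    simp [hB]
  obtain ⟨Y, hY⟩ := exists_of_coercive S hc hBA hBM hBc (expMul (-l) F) w
  have huniq : ∀ Y' : Lp X 2 (timeMeasure T), SolvesCauchy S.j T B (expMul (-l) F) Y' w → Y' = Y := by
    intro Y' hY'
    have h1 := norm_le_of_solvesCauchy S hc hBA hBM hBc (hY'.sub hBA hBM hY)
    rw [norm_zero, norm_zero, add_zero, mul_zero] at h1
    exact sub_eq_zero.1 (norm_le_zero_iff.1 h1)
  refine ⟨expMul l Y, hBA' hY, fun W' hW' => ?_, ?_⟩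
  · rw [← huniq _ (hAB hW'), expMul_neg_expMul]
  -- The factor `e^{-lt}` does not increase the data and `e^{lt}` is at most `e^{lT}`, so time
  -- enters the constant only through one exponential.
  · have h1 := norm_le_of_solvesCauchy S hc hBA hBM hBc hY
    have h2 : ‖expMul l Y‖ ≤ Real.exp (l * T) * ‖Y‖ := norm_expMul_le (fun t ht =>
      Real.exp_le_exp.2 (mul_le_mul_of_nonneg_left ht.2 hl0)) Y
    have h3 : ‖expMul (-l) F‖ ≤ 1 * ‖F‖ := norm_expMul_le (fun t ht => by
      rw [Real.exp_le_one_iff]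
      nlinarith [ht.1]) F
    have hb : 0 ≤ S.bound / c := div_nonneg S.bound_nonneg hc.le
    calc ‖expMul l Y‖ ≤ Real.exp (l * T) * ‖Y‖ := h2
      _ ≤ Real.exp (l * T) * ((S.bound / c + 1) * (‖F‖ + ‖w‖)) := by
          gcongr
          refine h1.trans ?_
          gcongr
          linarith
      _ = _ := by ring

end Shift

end ParabolicSystem
end

/-! ### Derivatives, differences and products of Schwartz functions. -/

noncomputable section
namespace ParabolicSystem
set_option linter.unusedSectionVars false
open MeasureTheory Set Filter Topology
open scoped SchwartzMap ENNReal LineDeriv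

variable {d : ℕ}

/-- The embedding of Schwartz functions into `L2`. -/
def J : 𝓢(Space d, ℂ) →L[ℂ] L2 d := SchwartzMap.toLpCLM ℂ ℂ 2 volume

theorem J_apply (f : 𝓢(Space d, ℂ)) : J f = f.toLp 2 := rfl

theorem coeFn_J (f : 𝓢(Space d, ℂ)) : J f =ᵐ[volume] f := f.coeFn_toLp 2 volume

theorem denseRange_J : DenseRange (J : 𝓢(Space d, ℂ) → L2 d) := dense_toLp

theorem inner_J (f g : 𝓢(Space d, ℂ)) :
    inner ℂ (J f) (J g) = ∫ x, starRingEnd ℂ (f x) * g x := by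
  refine (SchwartzMap.inner_toL2_toL2_eq f g volume).trans ?_
  simp only [RCLike.inner_apply, mul_comm]

theorem integrable_conj_mul_schwartz (f g : 𝓢(Space d, ℂ)) :
    Integrable (fun x => starRingEnd ℂ (f x) * g x) := by
  refine (integrable_conj_mul (J f) (J g)).congr ?_
  filter_upwards [coeFn_J f, coeFn_J g] with x h1 h2
  rw [h1, h2]

/-- The partial derivative `∂_i`. -/
def pd (i : Fin d) : 𝓢(Space d, ℂ) →L[ℂ] 𝓢(Space d, ℂ) :=
  LineDeriv.lineDerivOpCLM ℂ 𝓢(Space d, ℂ) (EuclideanSpace.single i (1 : ℝ))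

theorem pd_apply (i : Fin d) (f : 𝓢(Space d, ℂ)) :
    pd i f = ∂_{(EuclideanSpace.single i (1 : ℝ) : Space d)} f := rfl

theorem pd_apply_apply (i : Fin d) (f : 𝓢(Space d, ℂ)) (x : Space d) :
    pd i f x = fderiv ℝ f x (EuclideanSpace.single i (1 : ℝ)) := by
  rw [pd_apply, SchwartzMap.lineDerivOp_apply_eq_fderiv]

theorem pd_eq_fourierMultiplier (i : Fin d) (f : 𝓢(Space d, ℂ)) :
    pd i f = (2 * Real.pi * Complex.I) • SchwartzMap.fourierMultiplierCLM ℂ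
      (fun x : Space d => ((x i : ℝ) : ℂ)) f := by
  have h := SchwartzMap.lineDeriv_eq_fourierMultiplierCLM (EuclideanSpace.single i (1 : ℝ)) f
  rw [← SchwartzMap.fourierMultiplierCLM_ofReal ℂ (by fun_prop)] at h
  rw [pd_apply, h]
  have e : (fun x : Space d => ((inner ℝ x (EuclideanSpace.single i (1 : ℝ)) : ℝ) : ℂ))
      = fun x => ((x i : ℝ) : ℂ) := by
    funext x
    simp [EuclideanSpace.inner_single_right]
  exact congrArg (fun g => (2 * Real.pi * Complex.I) • SchwartzMap.fourierMultiplierCLM ℂ g f) e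

theorem hasTemperateGrowth_coord (i : Fin d) :
    (fun x : Space d => ((x i : ℝ) : ℂ)).HasTemperateGrowth := by
  have h : (fun x : Space d => x i).HasTemperateGrowth :=
    (EuclideanSpace.proj i : Space d →L[ℝ] ℝ).hasTemperateGrowth
  fun_prop

theorem pd_comm (i j : Fin d) (f : 𝓢(Space d, ℂ)) : pd i (pd j f) = pd j (pd i f) := by
  simp only [pd_eq_fourierMultiplier, map_smul]
  rw [SchwartzMap.fourierMultiplierCLM_fourierMultiplierCLM_apply (hasTemperateGrowth_coord _)
    (hasTemperateGrowth_coord _), SchwartzMap.fourierMultiplierCLM_fourierMultiplierCLM_apply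
    (hasTemperateGrowth_coord _) (hasTemperateGrowth_coord _), mul_comm (fun x : Space d => ((x i : ℝ) : ℂ))]

/-- The difference operator `f(· + h) - f`. -/
def diff (h : Space d) : 𝓢(Space d, ℂ) →L[ℂ] 𝓢(Space d, ℂ) :=
  SchwartzMap.compSubConstCLM ℂ (-h) - ContinuousLinearMap.id ℂ _

theorem diff_apply (h : Space d) (f : 𝓢(Space d, ℂ)) (x : Space d) :
    diff h f x = f (x + h) - f x := by
  simp [diff]

theorem pd_diff (i : Fin d) (h : Space d) (f : 𝓢(Space d, ℂ)) :
    pd i (diff h f) = diff h (pd i f) := by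
  ext x
  rw [diff_apply, pd_apply_apply, pd_apply_apply, pd_apply_apply]
  have h1 : (diff h f : Space d → ℂ) = fun x => f (x + h) - f x := funext (diff_apply h f)
  have h2 : DifferentiableAt ℝ (fun x => f (x + h)) x :=
    f.differentiableAt.comp x (differentiableAt_id.add_const h)
  rw [h1, fderiv_fun_sub h2 f.differentiableAt, fderiv_comp_add_right]
  rfl

/-- Multiplication by a real function of temperate growth. -/
def mulS (a : Space d → ℝ) : 𝓢(Space d, ℂ) →L[ℂ] 𝓢(Space d, ℂ) :=
  SchwartzMap.smulLeftCLM ℂ (fun x => (a x : ℂ))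

theorem mulS_apply {a : Space d → ℝ} (ha : a.HasTemperateGrowth) (f : 𝓢(Space d, ℂ)) (x : Space d) :
    mulS a f x = a x * f x := by
  rw [mulS, SchwartzMap.smulLeftCLM_apply_apply (by fun_prop), smul_eq_mul]

theorem norm_J_mulS_le {a : Space d → ℝ} (ha : a.HasTemperateGrowth) {C : ℝ} 
    (hC : ∀ x, |a x| ≤ C) (f : 𝓢(Space d, ℂ)) : ‖J (mulS a f)‖ ≤ C * ‖J f‖ := by
  refine Lp.norm_le_mul_norm_of_ae_le_mul ?_
  filter_upwards [coeFn_J (mulS a f), coeFn_J f] with x h1 h2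
  rw [h1, h2, mulS_apply ha, norm_mul, Complex.norm_real]
  exact mul_le_mul_of_nonneg_right (hC x) (norm_nonneg _)

theorem inner_mulS {a : Space d → ℝ} (ha : a.HasTemperateGrowth) (f g : 𝓢(Space d, ℂ)) :
    inner ℂ (J f) (J (mulS a g)) = ∫ x, (a x : ℂ) * (starRingEnd ℂ (f x) * g x) := by
  rw [inner_J]
  congr 1
  funext x
  rw [mulS_apply ha]
  ring

theorem inner_mulS_comm {a : Space d → ℝ} (ha : a.HasTemperateGrowth) (f g : 𝓢(Space d, ℂ)) :
    inner ℂ (J (mulS a f)) (J g) = inner ℂ (J f) (J (mulS a g)) := by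
  rw [inner_mulS ha, inner_J]
  congr 1
  funext x
  rw [mulS_apply ha, map_mul, Complex.conj_ofReal]
  ring

/-- The partial derivative of a function. -/
def pdf (i : Fin d) (a : Space d → ℝ) (x : Space d) : ℝ :=
  fderiv ℝ a x (EuclideanSpace.single i (1 : ℝ))

theorem hasTemperateGrowth_pdf {a : Space d → ℝ} (ha : a.HasTemperateGrowth) (i : Fin d) :
    (pdf i a).HasTemperateGrowth := by
  have h1 : (fderiv ℝ a).HasTemperateGrowth := by
    refine ⟨(contDiff_infty_iff_fderiv.1 ha.1).2, fun n => ?_⟩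
    obtain ⟨k, C, h⟩ := ha.2 (n + 1)
    refine ⟨k, C, fun x => ?_⟩
    rw [norm_iteratedFDeriv_fderiv]
    exact h x
  exact (ContinuousLinearMap.apply ℝ ℝ (EuclideanSpace.single i (1 : ℝ))).hasTemperateGrowth.comp h1

theorem pd_mulS {a : Space d → ℝ} (ha : a.HasTemperateGrowth) (i : Fin d) (f : 𝓢(Space d, ℂ)) :
    pd i (mulS a f) = mulS a (pd i f) + mulS (pdf i a) f := by
  ext x
  rw [add_apply, mulS_apply ha, mulS_apply (hasTemperateGrowth_pdf ha i),
    pd_apply_apply, pd_apply_apply]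
  have h1 : (mulS a f : Space d → ℂ) = fun x => a x • f x := by
    funext x
    rw [mulS_apply ha, Complex.real_smul]
  have ha' : DifferentiableAt ℝ a x := (ha.1.differentiable (by simp)).differentiableAt
  rw [h1, fderiv_fun_smul ha' f.differentiableAt]
  simp [pdf]

theorem hasTemperateGrowth_comp_add {a : Space d → ℝ} (ha : a.HasTemperateGrowth) (h : Space d) :
    (fun x => a (x + h)).HasTemperateGrowth := by
  have : (fun x : Space d => x + h).HasTemperateGrowth := by fun_prop
  exact ha.comp this

/-- The discrete Leibniz rule. It is arranged so that the difference of `f` meets a translate of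
`a`, which satisfies the same ellipticity condition, and the difference of `a` meets `f` itself. -/
theorem diff_mulS {a : Space d → ℝ} (ha : a.HasTemperateGrowth) (h : Space d) (f : 𝓢(Space d, ℂ)) :
    diff h (mulS a f) = mulS (fun x => a (x + h)) (diff h f) + mulS (fun x => a (x + h) - a x) f := by
  ext x
  have h1 := hasTemperateGrowth_comp_add ha h
  rw [add_apply, mulS_apply h1, mulS_apply (a := fun x => a (x + h) - a x) (h1.sub ha), diff_apply, diff_apply,
    mulS_apply ha, mulS_apply ha]
  push_cast
  ring

theorem inner_pd_left (i : Fin d) (f g : 𝓢(Space d, ℂ)) :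
    inner ℂ (J (pd i f)) (J g) = -inner ℂ (J f) (J (pd i g)) := by
  rw [inner_J, inner_J]
  have h := SchwartzMap.integral_bilinear_lineDerivOp_right_eq_neg_left (μ := volume) f g
    ((ContinuousLinearMap.mul ℝ ℂ).comp Complex.conjCLE.toContinuousLinearMap)
    (EuclideanSpace.single i (1 : ℝ))
  exact (neg_eq_iff_eq_neg.2 h).symm

theorem pdf_comp_add (i : Fin d) (a : Space d → ℝ) (h : Space d) :
    pdf i (fun x => a (x + h)) = fun x => pdf i a (x + h) := by
  funext x
  simp only [pdf, fderiv_comp_add_right]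

end ParabolicSystem
end

/-! ### Fractional Sobolev forms by dyadic differences, and commutators. -/

noncomputable section
namespace ParabolicSystem
set_option linter.unusedSectionVars false
open MeasureTheory Set Filter Topology
open scoped SchwartzMap ENNReal LineDeriv

variable {d : ℕ}

/-- The step `2^{-k}` in the direction of the `l`-th coordinate axis. -/
def dyadicStep (l : Fin d) (k : ℕ) : Space d := ((2 : ℝ) ^ k)⁻¹ • EuclideanSpace.single l (1 : ℝ)

/-- Weights of dyadic differences, and bounds for the differences of a coefficient. -/
structure Weights where
  wt : ℕ → ℝ
  hb : ℕ → ℝ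
  K : ℕ
  wt_nonneg : ∀ k, 0 ≤ wt k
  hb_nonneg : ∀ k, 0 ≤ hb k

namespace Weights

/-- The sum that controls commutators with a coefficient. -/
def S (w : Weights) : ℝ := ∑ k ∈ Finset.range w.K, w.wt k * w.hb k ^ 2

theorem S_nonneg (w : Weights) : 0 ≤ w.S :=
  Finset.sum_nonneg fun k _ => mul_nonneg (w.wt_nonneg k) (sq_nonneg _)

end Weights

variable (w : Weights)

/-- A sesquilinear form equivalent to the inner product of a Sobolev space of fractional order. -/
def Q : ℕ → 𝓢(Space d, ℂ) → 𝓢(Space d, ℂ) → ℂ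
  | 0, f, g => inner ℂ (J f) (J g) + ∑ l, ∑ k ∈ Finset.range w.K,
      (w.wt k : ℂ) * inner ℂ (J (diff (dyadicStep l k) f)) (J (diff (dyadicStep l k) g))
  | n + 1, f, g => Q n f g + ∑ l, Q n (pd l f) (pd l g)

/-- The part of `Q n f (a g)` in which no derivative or difference falls on `a`. -/
def mainForm : ℕ → (Space d → ℝ) → 𝓢(Space d, ℂ) → 𝓢(Space d, ℂ) → ℂ
  | 0, a, f, g => inner ℂ (J f) (J (mulS a g)) + ∑ l, ∑ k ∈ Finset.range w.K,
      (w.wt k : ℂ) * inner ℂ (J (diff (dyadicStep l k) f))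
        (J (mulS (fun x => a (x + dyadicStep l k)) (diff (dyadicStep l k) g)))
  | n + 1, a, f, g => mainForm n a f g + ∑ l, mainForm n a (pd l f) (pd l g)

/-- The quadratic form of `Q`. -/
def qn (n : ℕ) (f : 𝓢(Space d, ℂ)) : ℝ := (Q w n f f).re

/-- The lower order quadratic form that controls commutators. -/
def lo : ℕ → 𝓢(Space d, ℂ) → ℝ
  | 0, g => w.S * ‖J g‖ ^ 2
  | n + 1, g => lo n g + ∑ l, lo n (pd l g) + qn w n g

/-- Quantitative regularity of a smooth coefficient. -/
def Reg (L : ℝ) : ℕ → (Space d → ℝ) → Prop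
  | 0, a => a.HasTemperateGrowth ∧ (∀ x, |a x| ≤ L) ∧
      ∀ l k x, |a (x + dyadicStep l k) - a x| ≤ L * w.hb k
  | n + 1, a => a.HasTemperateGrowth ∧ (∀ x, |a x| ≤ L) ∧ Reg L 0 a ∧ Reg L n a ∧ ∀ l, Reg L n (pdf l a)

theorem qn_zero (f : 𝓢(Space d, ℂ)) : qn w 0 f = ‖J f‖ ^ 2 + ∑ l, ∑ k ∈ Finset.range w.K,
    w.wt k * ‖J (diff (dyadicStep l k) f)‖ ^ 2 := by
  simp only [qn, Q, Complex.add_re, Complex.re_sum, Complex.re_ofReal_mul]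
  have h : ∀ v : L2 d, (inner ℂ v v).re = ‖v‖ ^ 2 := fun v => by
    rw [inner_self_eq_norm_sq_to_K]
    norm_cast
  simp only [h]

theorem qn_succ (n : ℕ) (f : 𝓢(Space d, ℂ)) : qn w (n + 1) f = qn w n f + ∑ l, qn w n (pd l f) := by
  simp only [qn, Q, Complex.add_re, Complex.re_sum]

theorem qn_nonneg (n : ℕ) (f : 𝓢(Space d, ℂ)) : 0 ≤ qn w n f := by
  induction n generalizing f with
  | zero =>
    rw [qn_zero]
    exact add_nonneg (sq_nonneg _) (Finset.sum_nonneg fun l _ => Finset.sum_nonneg fun k _ =>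
      mul_nonneg (w.wt_nonneg k) (sq_nonneg _))
  | succ n ih =>
    rw [qn_succ]
    exact add_nonneg (ih f) (Finset.sum_nonneg fun l _ => ih _)

theorem Q_add_right (n : ℕ) (f g h : 𝓢(Space d, ℂ)) : Q w n f (g + h) = Q w n f g + Q w n f h := by
  induction n generalizing f g h with
  | zero =>
    simp only [Q, map_add, inner_add_right, mul_add, Finset.sum_add_distrib]
    ring
  | succ n ih =>
    simp only [Q, map_add, ih, Finset.sum_add_distrib]
    ring

theorem mainForm_conj (n : ℕ) {a : Space d → ℝ} (ha : a.HasTemperateGrowth)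
    (f g : 𝓢(Space d, ℂ)) : starRingEnd ℂ (mainForm w n a f g) = mainForm w n a g f := by
  induction n generalizing f g with
  | zero =>
    simp only [mainForm, map_add, map_sum, map_mul, inner_conj_symm, Complex.conj_ofReal,
      inner_mulS_comm ha, inner_mulS_comm (hasTemperateGrowth_comp_add ha _)]
  | succ n ih => simp only [mainForm, map_add, map_sum, ih]

/-- Cauchy–Schwarz for the sum, and again for the resulting pair. It matches the recursion of `Q`,
in which one distinguished term is added to a sum. -/
theorem sqrt_mul_add_sum_le {ι : Type*} (s : Finset ι) {a b : ℝ} {f g : ι → ℝ} (ha : 0 ≤ a)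
    (hb : 0 ≤ b) (hf : ∀ i, 0 ≤ f i) (hg : ∀ i, 0 ≤ g i) :
    √a * √b + ∑ i ∈ s, √(f i) * √(g i) ≤ √(a + ∑ i ∈ s, f i) * √(b + ∑ i ∈ s, g i) := by
  have h1 : ∑ i ∈ s, √(f i) * √(g i) ≤ √(∑ i ∈ s, f i) * √(∑ i ∈ s, g i) :=
    Real.sum_sqrt_mul_sqrt_le s hf hg
  have hF : 0 ≤ ∑ i ∈ s, f i := Finset.sum_nonneg fun i _ => hf i
  have hG : 0 ≤ ∑ i ∈ s, g i := Finset.sum_nonneg fun i _ => hg i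
  refine (add_le_add_right h1 _).trans ?_
  have h2 := Real.sum_sqrt_mul_sqrt_le (Finset.univ : Finset (Fin 2)) (f := ![a, ∑ i ∈ s, f i])
    (g := ![b, ∑ i ∈ s, g i]) (by intro i; fin_cases i <;> simpa) (by intro i; fin_cases i <;> simpa)
  simpa using h2

theorem norm_Q_le (n : ℕ) (f g : 𝓢(Space d, ℂ)) :
    ‖Q w n f g‖ ≤ √(qn w n f) * √(qn w n g) := by
  induction n generalizing f g with
  | zero =>
    rw [qn_zero, qn_zero]
    have e : ∀ f : 𝓢(Space d, ℂ), ∑ l, ∑ k ∈ Finset.range w.K,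
        w.wt k * ‖J (diff (dyadicStep l k) f)‖ ^ 2
        = ∑ p ∈ (Finset.univ : Finset (Fin d)) ×ˢ Finset.range w.K,
          w.wt p.2 * ‖J (diff (dyadicStep p.1 p.2) f)‖ ^ 2 := fun f => by
      rw [Finset.sum_product]
    rw [e, e]
    refine le_trans ?_ (sqrt_mul_add_sum_le _ (by positivity) (by positivity)
      (fun i => mul_nonneg (w.wt_nonneg _) (sq_nonneg _))
      (fun i => mul_nonneg (w.wt_nonneg _) (sq_nonneg _)))
    rw [Q, Finset.sum_product]
    refine (norm_add_le _ _).trans (add_le_add ?_ ((norm_sum_le _ _).trans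
      (Finset.sum_le_sum fun l _ => (norm_sum_le _ _).trans (Finset.sum_le_sum fun k _ => ?_))))
    · rw [Real.sqrt_sq (norm_nonneg _), Real.sqrt_sq (norm_nonneg _)]
      exact norm_inner_le_norm _ _
    · rw [norm_mul, Complex.norm_real, Real.norm_of_nonneg (w.wt_nonneg k),
        Real.sqrt_mul (w.wt_nonneg k), Real.sqrt_mul (w.wt_nonneg k),
        Real.sqrt_sq (norm_nonneg _), Real.sqrt_sq (norm_nonneg _)]
      calc w.wt k * ‖inner ℂ (J (diff (dyadicStep l k) f)) (J (diff (dyadicStep l k) g))‖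
          ≤ (√(w.wt k) * √(w.wt k)) * (‖J (diff (dyadicStep l k) f)‖
            * ‖J (diff (dyadicStep l k) g)‖) := by
            rw [Real.mul_self_sqrt (w.wt_nonneg k)]
            exact mul_le_mul_of_nonneg_left (norm_inner_le_norm _ _) (w.wt_nonneg k)
        _ = _ := by ring
  | succ n ih =>
    rw [qn_succ, qn_succ, Q]
    refine le_trans ?_ (sqrt_mul_add_sum_le _ (qn_nonneg w n f) (qn_nonneg w n g)
      (fun l => qn_nonneg w n (pd l f)) (fun l => qn_nonneg w n (pd l g)))
    exact (norm_add_le _ _).trans (add_le_add (ih f g) ((norm_sum_le _ _).trans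
      (Finset.sum_le_sum fun l _ => ih _ _)))

theorem norm_add_sq_le {E : Type*} [SeminormedAddCommGroup E] (x y : E) :
    ‖x + y‖ ^ 2 ≤ 2 * ‖x‖ ^ 2 + 2 * ‖y‖ ^ 2 := by
  have := norm_add_le x y
  nlinarith [norm_nonneg (x + y), sq_nonneg (‖x‖ - ‖y‖)]

theorem qn_add_le (n : ℕ) (f g : 𝓢(Space d, ℂ)) : qn w n (f + g) ≤ 2 * qn w n f + 2 * qn w n g := by
  induction n generalizing f g with
  | zero =>
    simp only [qn_zero, map_add]
    have h1 := norm_add_sq_le (J f) (J g)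
    have h2 : ∑ l, ∑ k ∈ Finset.range w.K, w.wt k * ‖J (diff (dyadicStep l k) f) + J (diff (dyadicStep l k) g)‖ ^ 2
        ≤ ∑ l, ∑ k ∈ Finset.range w.K, (2 * (w.wt k * ‖J (diff (dyadicStep l k) f)‖ ^ 2)
          + 2 * (w.wt k * ‖J (diff (dyadicStep l k) g)‖ ^ 2)) :=
      Finset.sum_le_sum fun l _ => Finset.sum_le_sum fun k _ => by
        have := mul_le_mul_of_nonneg_left
          (norm_add_sq_le (J (diff (dyadicStep l k) f)) (J (diff (dyadicStep l k) g))) (w.wt_nonneg k)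
        linarith
    simp only [Finset.sum_add_distrib, ← Finset.mul_sum] at h2
    linarith
  | succ n ih =>
    simp only [qn_succ, map_add]
    have h2 : ∑ l, qn w n (pd l f + pd l g) ≤ ∑ l, (2 * qn w n (pd l f) + 2 * qn w n (pd l g)) :=
      Finset.sum_le_sum fun l _ => ih _ _
    simp only [Finset.sum_add_distrib, ← Finset.mul_sum] at h2
    linarith [ih f g]

variable {w} {L : ℝ}

theorem Reg.temperate {n : ℕ} {a : Space d → ℝ} (h : Reg w L n a) : a.HasTemperateGrowth := by
  cases n <;> (rw [Reg] at h; exact h.1)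

theorem Reg.bound {n : ℕ} {a : Space d → ℝ} (h : Reg w L n a) (x : Space d) : |a x| ≤ L := by
  cases n <;> (rw [Reg] at h; exact h.2.1 x)

theorem qn_pd_le (n : ℕ) (l : Fin d) (f : 𝓢(Space d, ℂ)) : qn w n (pd l f) ≤ qn w (n + 1) f := by
  rw [qn_succ]
  have := Finset.single_le_sum (f := fun l => qn w n (pd l f)) (fun l _ => qn_nonneg w n (pd l f))
    (Finset.mem_univ l)
  linarith [qn_nonneg w n f]

theorem qn_le_succ (n : ℕ) (f : 𝓢(Space d, ℂ)) : qn w n f ≤ qn w (n + 1) f := by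
  rw [qn_succ]
  linarith [Finset.sum_nonneg fun l (_ : l ∈ Finset.univ) => qn_nonneg w n (pd l f)]

/-- The constant in the estimate of products. -/
def mulConst (d : ℕ) (s L : ℝ) (n : ℕ) : ℝ := 2 * L ^ 2 * (1 + d * s) * (2 + 2 * d) ^ n

theorem mulConst_nonneg {s : ℝ} (hs : 0 ≤ s) (n : ℕ) : 0 ≤ mulConst d s L n := by
  unfold mulConst; positivity

/-- Multiplication by a regular coefficient is bounded. -/
theorem qn_mulS_le {n : ℕ} {a : Space d → ℝ} (ha : Reg w L n a) (f : 𝓢(Space d, ℂ)) :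
    qn w n (mulS a f) ≤ mulConst d w.S L n * qn w n f := by
  induction n generalizing a f with
  | zero =>
    rw [Reg] at ha
    obtain ⟨ht, hL, hd⟩ := ha
    have hL0 : 0 ≤ L := (abs_nonneg _).trans (hL 0)
    have h1 : ‖J (mulS a f)‖ ^ 2 ≤ L ^ 2 * ‖J f‖ ^ 2 := by
      rw [← mul_pow]
      gcongr
      exact norm_J_mulS_le ht hL f
    -- In the discrete Leibniz rule the translated coefficient is bounded by `L` and its difference
    -- by `L * hb k`. Summed with the weights, the latter produce `w.S`.
    have h2 : ∀ l k, ‖J (diff (dyadicStep l k) (mulS a f))‖ ^ 2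
        ≤ 2 * L ^ 2 * ‖J (diff (dyadicStep l k) f)‖ ^ 2 + 2 * L ^ 2 * w.hb k ^ 2 * ‖J f‖ ^ 2 := by
      intro l k
      rw [diff_mulS ht, map_add]
      refine (norm_add_sq_le _ _).trans ?_
      have h3 := norm_J_mulS_le (hasTemperateGrowth_comp_add ht (dyadicStep l k))
        (fun x => hL (x + dyadicStep l k)) (diff (dyadicStep l k) f)
      have h4 := norm_J_mulS_le (a := fun x => a (x + dyadicStep l k) - a x)
        ((hasTemperateGrowth_comp_add ht (dyadicStep l k)).sub ht) (hd l k) f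
      have h5 := pow_le_pow_left₀ (norm_nonneg _) h3 2
      have h6 := pow_le_pow_left₀ (norm_nonneg _) h4 2
      simp only [mul_pow] at h5 h6
      linarith
    have h3 : ∑ l : Fin d, ∑ k ∈ Finset.range w.K, w.wt k * ‖J (diff (dyadicStep l k) (mulS a f))‖ ^ 2
        ≤ ∑ l : Fin d, ∑ k ∈ Finset.range w.K, (2 * L ^ 2 * (w.wt k * ‖J (diff (dyadicStep l k) f)‖ ^ 2)
          + 2 * L ^ 2 * ‖J f‖ ^ 2 * (w.wt k * w.hb k ^ 2)) :=
      Finset.sum_le_sum fun l _ => Finset.sum_le_sum fun k _ => by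
        have := mul_le_mul_of_nonneg_left (h2 l k) (w.wt_nonneg k)
        linarith
    simp only [Finset.sum_add_distrib, ← Finset.mul_sum, Finset.sum_const, Finset.card_univ,
      Fintype.card_fin, nsmul_eq_mul] at h3
    rw [qn_zero, qn_zero, mulConst, pow_zero, mul_one]
    change _ ≤ _ + 2 * L ^ 2 * ‖J f‖ ^ 2 * (d * w.S) at h3
    set A := ∑ l, ∑ k ∈ Finset.range w.K, w.wt k * ‖J (diff (dyadicStep l k) f)‖ ^ 2 with hA
    have hA0 : 0 ≤ A := Finset.sum_nonneg fun l _ => Finset.sum_nonneg fun k _ =>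
      mul_nonneg (w.wt_nonneg k) (sq_nonneg _)
    have hS := w.S_nonneg
    have e1 : 0 ≤ 2 * L ^ 2 * (d * w.S) * A := by positivity
    have e2 : 0 ≤ L ^ 2 * ‖J f‖ ^ 2 := by positivity
    nlinarith
  | succ n ih =>
    rw [Reg] at ha
    obtain ⟨ht, hL, h0, hn, hd⟩ := ha
    have hC := mulConst_nonneg (d := d) (L := L) w.S_nonneg n
    set C := mulConst d w.S L n with hCdef
    have h1 := ih hn f
    have h2 : ∀ l, qn w n (pd l (mulS a f)) ≤ 2 * C * qn w n (pd l f) + 2 * C * qn w n f := by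
      intro l
      rw [pd_mulS ht]
      refine (qn_add_le w n _ _).trans ?_
      have h3 := ih hn (pd l f)
      have h4 := ih (hd l) f
      linarith
    have h3 : ∑ l : Fin d, qn w n (pd l (mulS a f))
        ≤ ∑ l : Fin d, (2 * C * qn w n (pd l f) + 2 * C * qn w n f) :=
      Finset.sum_le_sum fun l _ => h2 l
    simp only [Finset.sum_add_distrib, ← Finset.mul_sum, Finset.sum_const, Finset.card_univ,
      Fintype.card_fin, nsmul_eq_mul] at h3
    rw [qn_succ, qn_succ]
    have e : mulConst d w.S L (n + 1) = C * (2 + 2 * d) := by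
      rw [hCdef, mulConst, mulConst, pow_succ]; ring
    rw [e]
    set A := ∑ l, qn w n (pd l f)
    have hA : 0 ≤ A := Finset.sum_nonneg fun l _ => qn_nonneg w n _
    have hf := qn_nonneg w n f
    have e1 : 0 ≤ C * qn w n f := mul_nonneg hC hf
    have e2 : 0 ≤ C * d * A := by positivity
    nlinarith

theorem lo_nonneg (n : ℕ) (g : 𝓢(Space d, ℂ)) : 0 ≤ lo w n g := by
  induction n generalizing g with
  | zero => exact mul_nonneg w.S_nonneg (sq_nonneg _)
  | succ n ih =>
    exact add_nonneg (add_nonneg (ih g) (Finset.sum_nonneg fun l _ => ih _)) (qn_nonneg w n g)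

/-- The constant in the commutator estimate. -/
def commConst (d : ℕ) (s L : ℝ) : ℕ → ℝ
  | 0 => L * √d
  | n + 1 => (1 + d) * commConst d s L n + d * √(mulConst d s L n)

theorem commConst_nonneg {s : ℝ} (hL : 0 ≤ L) (n : ℕ) : 0 ≤ commConst d s L n := by
  induction n with
  | zero => exact mul_nonneg hL (Real.sqrt_nonneg _)
  | succ n ih => unfold commConst; positivity

/-- The commutator estimate. -/
theorem norm_Q_sub_mainForm_le {n : ℕ} {a : Space d → ℝ} (ha : Reg w L n a) (f g : 𝓢(Space d, ℂ)) :
    ‖Q w n f (mulS a g) - mainForm w n a f g‖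
      ≤ commConst d w.S L n * (√(lo w n g) * √(qn w n f)) := by
  have hL0 : 0 ≤ L := (abs_nonneg _).trans (ha.bound 0)
  induction n generalizing a f g with
  | zero =>
    rw [Reg] at ha
    obtain ⟨ht, hL, hd⟩ := ha
    -- Only the terms in which the difference falls on `a` remain. Cauchy–Schwarz over `(l, k)`
    -- separates `w.S * ‖J g‖ ^ 2` from the differences of `f`.
    have h1 : Q w 0 f (mulS a g) - mainForm w 0 a f g
        = ∑ p ∈ (Finset.univ : Finset (Fin d)) ×ˢ Finset.range w.K,
          (w.wt p.2 : ℂ) * inner ℂ (J (diff (dyadicStep p.1 p.2) f))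
            (J (mulS (fun x => a (x + dyadicStep p.1 p.2) - a x) g)) := by
      simp only [Q, mainForm]
      rw [Finset.sum_product, add_sub_add_left_eq_sub, ← Finset.sum_sub_distrib]
      refine Finset.sum_congr rfl fun l _ => ?_
      rw [← Finset.sum_sub_distrib]
      refine Finset.sum_congr rfl fun k _ => ?_
      rw [diff_mulS ht, map_add, inner_add_right]
      ring
    rw [h1]
    have h2 : ∀ p : Fin d × ℕ, ‖(w.wt p.2 : ℂ) * inner ℂ (J (diff (dyadicStep p.1 p.2) f))
            (J (mulS (fun x => a (x + dyadicStep p.1 p.2) - a x) g))‖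
        ≤ √(w.wt p.2 * (L * w.hb p.2 * ‖J g‖) ^ 2)
          * √(w.wt p.2 * ‖J (diff (dyadicStep p.1 p.2) f)‖ ^ 2) := by
      intro p
      have hw := w.wt_nonneg p.2
      have hh := w.hb_nonneg p.2
      have h4 := norm_J_mulS_le (a := fun x => a (x + dyadicStep p.1 p.2) - a x)
        ((hasTemperateGrowth_comp_add ht (dyadicStep p.1 p.2)).sub ht) (hd p.1 p.2) g
      rw [norm_mul, Complex.norm_real, Real.norm_of_nonneg hw, Real.sqrt_mul hw, Real.sqrt_mul hw,
        Real.sqrt_sq (by positivity), Real.sqrt_sq (norm_nonneg _)]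
      calc _ ≤ (√(w.wt p.2) * √(w.wt p.2)) * (‖J (diff (dyadicStep p.1 p.2) f)‖
            * (L * w.hb p.2 * ‖J g‖)) := by
            rw [Real.mul_self_sqrt hw]
            gcongr
            exact (norm_inner_le_norm _ _).trans (by gcongr)
        _ = _ := by ring
    have h3 := Real.sum_sqrt_mul_sqrt_le ((Finset.univ : Finset (Fin d)) ×ˢ Finset.range w.K)
      (f := fun p => w.wt p.2 * (L * w.hb p.2 * ‖J g‖) ^ 2)
      (g := fun p => w.wt p.2 * ‖J (diff (dyadicStep p.1 p.2) f)‖ ^ 2)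
      (fun p => mul_nonneg (w.wt_nonneg _) (sq_nonneg _))
      (fun p => mul_nonneg (w.wt_nonneg _) (sq_nonneg _))
    refine (norm_sum_le _ _).trans ((Finset.sum_le_sum fun p _ => h2 p).trans (h3.trans ?_))
    rw [← mul_assoc]
    refine mul_le_mul ?_ (Real.sqrt_le_sqrt ?_) (Real.sqrt_nonneg _)
      (mul_nonneg (commConst_nonneg hL0 0) (Real.sqrt_nonneg _))
    · have e : ∑ p ∈ (Finset.univ : Finset (Fin d)) ×ˢ Finset.range w.K,
          w.wt p.2 * (L * w.hb p.2 * ‖J g‖) ^ 2 = L ^ 2 * d * (w.S * ‖J g‖ ^ 2) := by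
        rw [Finset.sum_product]
        dsimp only
        rw [Finset.sum_const, Finset.card_univ, Fintype.card_fin, nsmul_eq_mul,
          Weights.S, Finset.sum_mul, Finset.mul_sum, Finset.mul_sum]
        refine Finset.sum_congr rfl fun k _ => ?_
        ring
      rw [e, lo, commConst, Real.sqrt_mul (by positivity), Real.sqrt_mul (by positivity),
        Real.sqrt_sq hL0]
    · rw [qn_zero, Finset.sum_product]
      exact le_add_of_nonneg_left (sq_nonneg _)
  | succ n ih =>
    rw [Reg] at ha
    obtain ⟨ht, hL, h0, hn, hd⟩ := ha
    set B := commConst d w.S L n with hB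
    have hB0 : 0 ≤ B := commConst_nonneg hL0 n
    set C := mulConst d w.S L n with hC
    have hlo : lo w n g ≤ lo w (n + 1) g := by
      have := Finset.sum_nonneg fun l (_ : l ∈ Finset.univ) => lo_nonneg (w := w) n (pd l g)
      rw [lo]
      linarith [qn_nonneg w n g]
    have hlod : ∀ l, lo w n (pd l g) ≤ lo w (n + 1) g := by
      intro l
      have := Finset.single_le_sum (f := fun l => lo w n (pd l g))
        (fun l _ => lo_nonneg n (pd l g)) (Finset.mem_univ l)
      rw [lo]
      linarith [qn_nonneg w n g, lo_nonneg (w := w) n g]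
    have hloq : qn w n g ≤ lo w (n + 1) g := by
      have := Finset.sum_nonneg fun l (_ : l ∈ Finset.univ) => lo_nonneg (w := w) n (pd l g)
      rw [lo]
      linarith [lo_nonneg (w := w) n g]
    set X := √(lo w (n + 1) g) * √(qn w (n + 1) f) with hX
    have e1 : ‖Q w n f (mulS a g) - mainForm w n a f g‖ ≤ B * X :=
      (ih hn f g).trans (by rw [hX]; gcongr; exact qn_le_succ n f)
    have e2 : ∀ l, ‖Q w n (pd l f) (mulS a (pd l g)) - mainForm w n a (pd l f) (pd l g)‖ ≤ B * X :=
      fun l => (ih hn _ _).trans (by rw [hX]; gcongr; exacts [hlod l, qn_pd_le n l f])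
    have e3 : ∀ l, ‖Q w n (pd l f) (mulS (pdf l a) g)‖ ≤ √C * X := by
      intro l
      refine (norm_Q_le w n _ _).trans ?_
      calc √(qn w n (pd l f)) * √(qn w n (mulS (pdf l a) g))
          ≤ √(qn w (n + 1) f) * √(C * lo w (n + 1) g) := by
            gcongr
            · exact qn_pd_le n l f
            · exact (qn_mulS_le (hd l) g).trans
                (mul_le_mul_of_nonneg_left hloq (mulConst_nonneg w.S_nonneg n))
        _ = _ := by rw [Real.sqrt_mul (mulConst_nonneg w.S_nonneg n)]; ring
    -- The Leibniz rule leaves commutators of level `n` and the terms with `∂_l` on `a`. In the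
    -- latter `g` has lost a derivative, which is why `lo` at level `n + 1` contains `qn w n g`.
    have e4 : Q w (n + 1) f (mulS a g) - mainForm w (n + 1) a f g
        = (Q w n f (mulS a g) - mainForm w n a f g)
          + ∑ l, ((Q w n (pd l f) (mulS a (pd l g)) - mainForm w n a (pd l f) (pd l g))
            + Q w n (pd l f) (mulS (pdf l a) g)) := by
      simp only [Q, mainForm, pd_mulS ht, Q_add_right, Finset.sum_add_distrib,
        Finset.sum_sub_distrib]
      ring
    rw [e4, commConst]
    refine (norm_add_le _ _).trans ((add_le_add e1 ((norm_sum_le _ _).trans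
      (Finset.sum_le_sum fun l _ => (norm_add_le _ _).trans (add_le_add (e2 l) (e3 l))))).trans ?_)
    simp only [Finset.sum_const, Finset.card_univ, Fintype.card_fin, nsmul_eq_mul]
    rw [← hB, ← hC]
    apply le_of_eq
    ring

end ParabolicSystem
end

/-! ### Coercivity of the leading part for smooth coefficients. -/

noncomputable section
namespace ParabolicSystem
set_option linter.unusedSectionVars false
open MeasureTheory Set Filter Topology
open scoped SchwartzMap ENNReal LineDeriv

variable {d d₁ : ℕ}

/-- The Legendre condition on the leading coefficients. -/
def Elliptic (δ : ℝ) (A : Fin d → Fin d → Fin d₁ → Fin d₁ → ℝ) : Prop :=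
  ∀ ξ : Fin d₁ → Fin d → ℝ,
    δ * ∑ k, ∑ i, ξ k i ^ 2 ≤ ∑ i, ∑ j, ∑ k, ∑ r, ξ k i * A i j k r * ξ r j

/-- The real inequality is applied to the real and to the imaginary part of `z`. Their sum is the
real part of the sesquilinear form, with no symmetry of `A` required. -/
theorem Elliptic.complex {δ : ℝ} {A : Fin d → Fin d → Fin d₁ → Fin d₁ → ℝ} (h : Elliptic δ A)
    (z : Fin d₁ → Fin d → ℂ) : δ * ∑ k, ∑ i, (starRingEnd ℂ (z k i) * z k i).re
      ≤ ∑ i, ∑ j, ∑ k, ∑ r, A i j k r * (starRingEnd ℂ (z k i) * z r j).re := by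
  have h1 := add_le_add (h fun k i => (z k i).re) (h fun k i => (z k i).im)
  simp only [← mul_add, ← Finset.sum_add_distrib] at h1
  refine (le_of_eq ?_).trans (h1.trans_eq ?_)
  · congr 1
    refine Finset.sum_congr rfl fun k _ => Finset.sum_congr rfl fun i _ => ?_
    simp only [Complex.mul_re, Complex.conj_re, Complex.conj_im]
    ring
  · refine Finset.sum_congr rfl fun i _ => Finset.sum_congr rfl fun j _ =>
      Finset.sum_congr rfl fun k _ => Finset.sum_congr rfl fun r _ => ?_
    simp only [Complex.mul_re, Complex.conj_re, Complex.conj_im]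
    ring

theorem integrable_coeff_mul {a : Space d → ℝ} (ha : a.HasTemperateGrowth) (f g : 𝓢(Space d, ℂ)) :
    Integrable (fun x => a x * (starRingEnd ℂ (f x) * g x).re) := by
  refine (integrable_conj_mul_schwartz f (mulS a g)).re.congr (Eventually.of_forall fun x => ?_)
  simp only [mulS_apply ha]
  rw [mul_left_comm]
  exact Complex.re_ofReal_mul _ _

theorem re_inner_mulS {a : Space d → ℝ} (ha : a.HasTemperateGrowth) (f g : 𝓢(Space d, ℂ)) :
    (inner ℂ (J f) (J (mulS a g))).re = ∫ x, a x * (starRingEnd ℂ (f x) * g x).re := by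
  rw [inner_J, ← RCLike.re_eq_complex_re, ← integral_re (integrable_conj_mul_schwartz f (mulS a g))]
  congr 1
  funext x
  rw [mulS_apply ha, mul_left_comm]
  exact Complex.re_ofReal_mul _ _

theorem norm_J_sq (f : 𝓢(Space d, ℂ)) : ‖J f‖ ^ 2 = ∫ x, (starRingEnd ℂ (f x) * f x).re := by
  rw [← inner_self_eq_norm_sq (𝕜 := ℂ), inner_J, ← integral_re (integrable_conj_mul_schwartz f f)]
  rfl

theorem Elliptic.integral {δ : ℝ} {α : Fin d → Fin d → Fin d₁ → Fin d₁ → Space d → ℝ}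
    (hα : ∀ i j k r, (α i j k r).HasTemperateGrowth) (h : ∀ x, Elliptic δ fun i j k r => α i j k r x)
    (v : Fin d₁ → Fin d → 𝓢(Space d, ℂ)) : δ * ∑ k, ∑ i, ‖J (v k i)‖ ^ 2
      ≤ ∑ i, ∑ j, ∑ k, ∑ r, (inner ℂ (J (v k i)) (J (mulS (α i j k r) (v r j)))).re := by
  simp only [re_inner_mulS (hα _ _ _ _), norm_J_sq]
  have i1 : ∀ k i, Integrable fun x => (starRingEnd ℂ (v k i x) * v k i x).re :=
    fun k i => (integrable_conj_mul_schwartz _ _).re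
  have i2 : ∀ i j k r, Integrable fun x => α i j k r x * (starRingEnd ℂ (v k i x) * v r j x).re :=
    fun i j k r => integrable_coeff_mul (hα i j k r) _ _
  have e1 : ∑ k, ∑ i, ∫ x, (starRingEnd ℂ (v k i x) * v k i x).re
      = ∫ x, ∑ k, ∑ i, (starRingEnd ℂ (v k i x) * v k i x).re := by
    rw [integral_finsetSum _ fun k _ => integrable_finsetSum _ fun i _ => i1 k i]
    exact Finset.sum_congr rfl fun k _ => (integral_finsetSum _ fun i _ => i1 k i).symm
  have e2 : ∑ i, ∑ j, ∑ k, ∑ r, ∫ x, α i j k r x * (starRingEnd ℂ (v k i x) * v r j x).re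
      = ∫ x, ∑ i, ∑ j, ∑ k, ∑ r, α i j k r x * (starRingEnd ℂ (v k i x) * v r j x).re := by
    rw [integral_finsetSum _ fun i _ => integrable_finsetSum _ fun j _ =>
      integrable_finsetSum _ fun k _ => integrable_finsetSum _ fun r _ => i2 i j k r]
    refine Finset.sum_congr rfl fun i _ => ?_
    rw [integral_finsetSum _ fun j _ =>
      integrable_finsetSum _ fun k _ => integrable_finsetSum _ fun r _ => i2 i j k r]
    refine Finset.sum_congr rfl fun j _ => ?_
    rw [integral_finsetSum _ fun k _ => integrable_finsetSum _ fun r _ => i2 i j k r]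
    refine Finset.sum_congr rfl fun k _ => ?_
    rw [integral_finsetSum _ fun r _ => i2 i j k r]
  rw [e1, e2, ← integral_const_mul]
  refine integral_mono ?_ ?_ fun x => (h x).complex fun k i => v k i x
  · exact (integrable_finsetSum _ fun k _ => integrable_finsetSum _ fun i _ => i1 k i).const_mul _
  · exact integrable_finsetSum _ fun i _ => integrable_finsetSum _ fun j _ =>
      integrable_finsetSum _ fun k _ => integrable_finsetSum _ fun r _ => i2 i j k r

/-- Integration by parts that exchanges `∂_i` and `∂_l`. -/
theorem inner_pd_pd_mulS {a : Space d → ℝ} (ha : a.HasTemperateGrowth) (i j l : Fin d)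
    (f g : 𝓢(Space d, ℂ)) :
    inner ℂ (J (pd l (pd l f))) (J (mulS a (pd i (pd j g))))
      = inner ℂ (J (pd i (pd l f))) (J (mulS a (pd j (pd l g))))
        + (inner ℂ (J (pd l f)) (J (mulS (pdf i a) (pd j (pd l g))))
          - inner ℂ (J (pd l f)) (J (mulS (pdf l a) (pd i (pd j g))))) := by
  rw [inner_pd_left l, inner_pd_left i, pd_mulS ha, pd_mulS ha, map_add, map_add, inner_add_right,
    inner_add_right, pd_comm l i, pd_comm l j]
  ring

theorem le_sum_univ {ι : Type*} [Fintype ι] (f : ι → ℝ) (hf : ∀ i, 0 ≤ f i) (i : ι) :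
    f i ≤ ∑ j, f j :=
  Finset.single_le_sum (fun j _ => hf j) (Finset.mem_univ i)

/-- The sum over all the indices of the leading coefficients. -/
abbrev Idx (d d₁ : ℕ) := Fin d × Fin d × Fin d × Fin d₁ × Fin d₁

/-- A smooth coefficient `α` close to `a`. -/
structure SmoothApprox (δ η C : ℝ) (a α : Fin d → Fin d → Fin d₁ → Fin d₁ → Space d → ℝ) : Prop where
  temperate : ∀ i j k r, (α i j k r).HasTemperateGrowth
  elliptic : ∀ x, Elliptic δ fun i j k r => α i j k r x
  close : ∀ i j k r x, |a i j k r x - α i j k r x| ≤ η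
  deriv : ∀ i j k r l x, |pdf l (α i j k r) x| ≤ C

/-- The differences in `mainForm` carry translated coefficients, so the `L2` estimate must hold for
all translates with the same constants. -/
theorem SmoothApprox.translate {δ η C : ℝ} {a α : Fin d → Fin d → Fin d₁ → Fin d₁ → Space d → ℝ}
    (h : SmoothApprox δ η C a α) (y : Space d) :
    SmoothApprox δ η C (fun i j k r x => a i j k r (x + y)) (fun i j k r x => α i j k r (x + y)) where
  temperate i j k r := hasTemperateGrowth_comp_add (h.temperate i j k r) y
  elliptic x := h.elliptic (x + y)
  close i j k r x := h.close i j k r (x + y)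
  deriv i j k r l x := by
    rw [pdf_comp_add]
    exact h.deriv i j k r l (x + y)

variable (w : Weights)

/-- The sum of the squares of the second derivatives. -/
def secondQ (n : ℕ) (u : Fin d₁ → 𝓢(Space d, ℂ)) : ℝ :=
  ∑ q : Fin d × Fin d₁ × Fin d, qn w n (pd q.2.2 (pd q.1 (u q.2.1)))

/-- The sum of the squares of the first derivatives. -/
def firstQ (n : ℕ) (u : Fin d₁ → 𝓢(Space d, ℂ)) : ℝ := ∑ q : Fin d × Fin d₁, qn w n (pd q.1 (u q.2))

/-- The sum of the main forms. -/
def mainSum (n : ℕ) (a : Fin d → Fin d → Fin d₁ → Fin d₁ → Space d → ℝ)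
    (u : Fin d₁ → 𝓢(Space d, ℂ)) : ℝ :=
  ∑ p : Idx d d₁, (mainForm w n (a p.2.1 p.2.2.1 p.2.2.2.1 p.2.2.2.2)
    (pd p.1 (pd p.1 (u p.2.2.2.1))) (pd p.2.1 (pd p.2.2.1 (u p.2.2.2.2)))).re

-- Replacing `a` by `α` costs `η ‖u_{xx}‖²` for each index. For `α`, integration by parts moves one
-- derivative `∂_l` across in exchange for `∂_i`, at the price of products of first and second
-- derivatives with `∂α`. Then the Legendre condition applies, for each `l`, to the matrix with
-- entries `∂_i ∂_l u^k`. Of the resulting `δ`, one quarter pays for `η` and one quarter for Young's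
-- inequality.
set_option maxHeartbeats 1000000 in
theorem coercive_L2 {δ η C : ℝ} (hδ : 0 < δ) (hC : 0 ≤ C)
    {a α : Fin d → Fin d → Fin d₁ → Fin d₁ → Space d → ℝ}
    (ha : ∀ i j k r, (a i j k r).HasTemperateGrowth) (h : SmoothApprox δ η C a α)
    (hη : Fintype.card (Idx d d₁) * η ≤ δ / 4) (u : Fin d₁ → 𝓢(Space d, ℂ)) :
    δ / 2 * ∑ q : Fin d × Fin d₁ × Fin d, ‖J (pd q.2.2 (pd q.1 (u q.2.1)))‖ ^ 2
        - 4 * (Fintype.card (Idx d d₁) * C) ^ 2 / δ * ∑ q : Fin d × Fin d₁, ‖J (pd q.1 (u q.2))‖ ^ 2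
      ≤ ∑ p : Idx d d₁, (inner ℂ (J (pd p.1 (pd p.1 (u p.2.2.2.1))))
          (J (mulS (a p.2.1 p.2.2.1 p.2.2.2.1 p.2.2.2.2) (pd p.2.1 (pd p.2.2.1 (u p.2.2.2.2)))))).re := by
  set H := ∑ q : Fin d × Fin d₁ × Fin d, ‖J (pd q.2.2 (pd q.1 (u q.2.1)))‖ ^ 2 with hH
  set G := ∑ q : Fin d × Fin d₁, ‖J (pd q.1 (u q.2))‖ ^ 2 with hG
  set M : ℝ := (Fintype.card (Idx d d₁) : ℝ)
  have hH0 : 0 ≤ H := by positivity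
  have hG0 : 0 ≤ G := by positivity
  have hM : 0 ≤ M := by positivity
  have hle : ∀ k i l, ‖J (pd i (pd l (u k)))‖ ≤ √H := fun k i l => Real.le_sqrt_of_sq_le
    (le_sum_univ (fun q : Fin d × Fin d₁ × Fin d => ‖J (pd q.2.2 (pd q.1 (u q.2.1)))‖ ^ 2)
      (fun _ => by positivity) (l, k, i))
  have hle1 : ∀ k l, ‖J (pd l (u k))‖ ≤ √G := fun k l => Real.le_sqrt_of_sq_le
    (le_sum_univ (fun q : Fin d × Fin d₁ => ‖J (pd q.1 (u q.2))‖ ^ 2)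
      (fun _ => by positivity) (l, k))
  have hell : δ * H ≤ ∑ p : Idx d d₁, (inner ℂ (J (pd p.2.1 (pd p.1 (u p.2.2.2.1))))
      (J (mulS (α p.2.1 p.2.2.1 p.2.2.2.1 p.2.2.2.2) (pd p.2.2.1 (pd p.1 (u p.2.2.2.2)))))).re := by
    have h1 : ∀ l, δ * ∑ k, ∑ i, ‖J (pd i (pd l (u k)))‖ ^ 2 ≤ _ := fun l =>
      Elliptic.integral h.temperate h.elliptic fun k i => pd i (pd l (u k))
    have h2 := Finset.sum_le_sum fun l (_ : l ∈ Finset.univ) => h1 l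
    rw [← Finset.mul_sum] at h2
    simpa only [hH, Fintype.sum_prod_type] using h2
  have hterm : ∀ i j k r l, (inner ℂ (J (pd i (pd l (u k)))) (J (mulS (α i j k r) (pd j (pd l (u r)))))).re
      - (η * H + 2 * C * (√G * √H))
      ≤ (inner ℂ (J (pd l (pd l (u k)))) (J (mulS (a i j k r) (pd i (pd j (u r)))))).re := by
    intro i j k r l
    have hα := h.temperate i j k r
    have e1 : mulS (a i j k r) (pd i (pd j (u r))) = mulS (α i j k r) (pd i (pd j (u r)))
        + mulS (fun x => a i j k r x - α i j k r x) (pd i (pd j (u r))) := by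
      ext x
      rw [add_apply, mulS_apply (ha i j k r), mulS_apply hα, mulS_apply (a := fun x => a i j k r x - α i j k r x) ((ha i j k r).sub hα)]
      push_cast
      ring
    rw [e1, map_add, inner_add_right, inner_pd_pd_mulS hα, Complex.add_re, Complex.add_re, Complex.sub_re]
    have hη0 : 0 ≤ η := (abs_nonneg _).trans (h.close i j k r 0)
    have b0 : ∀ (v v' : L2 d) {A B : ℝ}, ‖v‖ ≤ A → ‖v'‖ ≤ B → |(inner ℂ v v').re| ≤ A * B :=
      fun v v' A B h1 h2 => (Complex.abs_re_le_norm _).trans ((norm_inner_le_norm _ _).trans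
        (mul_le_mul h1 h2 (norm_nonneg _) ((norm_nonneg _).trans h1)))
    have b1 := b0 _ _ (hle k l l) ((norm_J_mulS_le (a := fun x => a i j k r x - α i j k r x) ((ha i j k r).sub hα) (h.close i j k r)
      (pd i (pd j (u r)))).trans (mul_le_mul_of_nonneg_left (hle r i j) hη0))
    have b2 := b0 _ _ (hle1 k l) ((norm_J_mulS_le (hasTemperateGrowth_pdf hα i) (h.deriv i j k r i)
      (pd j (pd l (u r)))).trans (mul_le_mul_of_nonneg_left (hle r j l) hC))
    have b3 := b0 _ _ (hle1 k l) ((norm_J_mulS_le (hasTemperateGrowth_pdf hα l) (h.deriv i j k r l)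
      (pd i (pd j (u r)))).trans (mul_le_mul_of_nonneg_left (hle r i j) hC))
    have b4 : √H * (η * √H) = η * H := by
      rw [mul_left_comm, Real.mul_self_sqrt hH0]
    rw [b4] at b1
    have c1 := abs_le.1 b1
    have c2 := abs_le.1 b2
    have c3 := abs_le.1 b3
    have c4 : √G * (C * √H) = C * (√G * √H) := by ring
    rw [c4] at c2 c3
    linarith [c1.1, c2.1, c3.2]
  have hsum := Finset.sum_le_sum fun (p : Idx d d₁) (_ : p ∈ Finset.univ) =>
    hterm p.2.1 p.2.2.1 p.2.2.2.1 p.2.2.2.2 p.1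
  rw [Finset.sum_sub_distrib, Finset.sum_const, Finset.card_univ, nsmul_eq_mul] at hsum
  refine le_trans ?_ hsum
  have y1 : M * (η * H) ≤ δ / 4 * H := by
    rw [← mul_assoc]; exact mul_le_mul_of_nonneg_right hη hH0
  -- Young's inequality, from the square of `δ / 2 * √H - 2 * (M * C) * √G` divided by `δ`.
  have y2 : M * (2 * C * (√G * √H)) ≤ δ / 4 * H + 4 * (M * C) ^ 2 / δ * G := by
    have e1 : √H ^ 2 = H := Real.sq_sqrt hH0
    have e2 : √G ^ 2 = G := Real.sq_sqrt hG0
    have := sq_nonneg (δ / 2 * √H - 2 * (M * C) * √G)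
    have e3 : δ / 4 * H + 4 * (M * C) ^ 2 / δ * G - M * (2 * C * (√G * √H))
        = (δ / 2 * √H - 2 * (M * C) * √G) ^ 2 / δ := by
      rw [← e1, ← e2, Real.sqrt_sq (Real.sqrt_nonneg _), Real.sqrt_sq (Real.sqrt_nonneg _)]
      field_simp
      ring
    have : 0 ≤ (δ / 2 * √H - 2 * (M * C) * √G) ^ 2 / δ := by positivity
    linarith
  linarith

theorem secondQ_zero (u : Fin d₁ → 𝓢(Space d, ℂ)) : secondQ w 0 u
    = ∑ q : Fin d × Fin d₁ × Fin d, ‖J (pd q.2.2 (pd q.1 (u q.2.1)))‖ ^ 2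
      + ∑ m, ∑ c ∈ Finset.range w.K, w.wt c *
        ∑ q : Fin d × Fin d₁ × Fin d,
          ‖J (pd q.2.2 (pd q.1 (diff (dyadicStep m c) (u q.2.1))))‖ ^ 2 := by
  simp only [secondQ, qn_zero, Finset.sum_add_distrib, pd_diff, Finset.mul_sum]
  congr 1
  rw [Finset.sum_comm]
  exact Finset.sum_congr rfl fun m _ => Finset.sum_comm

theorem firstQ_zero (u : Fin d₁ → 𝓢(Space d, ℂ)) : firstQ w 0 u
    = ∑ q : Fin d × Fin d₁, ‖J (pd q.1 (u q.2))‖ ^ 2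
      + ∑ m, ∑ c ∈ Finset.range w.K, w.wt c *
        ∑ q : Fin d × Fin d₁, ‖J (pd q.1 (diff (dyadicStep m c) (u q.2)))‖ ^ 2 := by
  simp only [firstQ, qn_zero, Finset.sum_add_distrib, pd_diff, Finset.mul_sum]
  congr 1
  rw [Finset.sum_comm]
  exact Finset.sum_congr rfl fun m _ => Finset.sum_comm

theorem mainSum_zero (a : Fin d → Fin d → Fin d₁ → Fin d₁ → Space d → ℝ)
    (u : Fin d₁ → 𝓢(Space d, ℂ)) : mainSum w 0 a u
    = ∑ p : Idx d d₁, (inner ℂ (J (pd p.1 (pd p.1 (u p.2.2.2.1))))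
          (J (mulS (a p.2.1 p.2.2.1 p.2.2.2.1 p.2.2.2.2) (pd p.2.1 (pd p.2.2.1 (u p.2.2.2.2)))))).re
      + ∑ m, ∑ c ∈ Finset.range w.K, w.wt c * ∑ p : Idx d d₁,
        (inner ℂ (J (pd p.1 (pd p.1 (diff (dyadicStep m c) (u p.2.2.2.1)))))
          (J (mulS (fun x => a p.2.1 p.2.2.1 p.2.2.2.1 p.2.2.2.2 (x + dyadicStep m c))
            (pd p.2.1 (pd p.2.2.1 (diff (dyadicStep m c) (u p.2.2.2.2))))))).re := by
  simp only [mainSum, mainForm, Finset.sum_add_distrib, pd_diff, Finset.mul_sum, Complex.add_re,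
    Complex.re_sum, Complex.re_ofReal_mul]
  congr 1
  rw [Finset.sum_comm]
  exact Finset.sum_congr rfl fun m _ => Finset.sum_comm

theorem secondQ_succ (n : ℕ) (u : Fin d₁ → 𝓢(Space d, ℂ)) :
    secondQ w (n + 1) u = secondQ w n u + ∑ m, secondQ w n fun k => pd m (u k) := by
  simp only [secondQ, qn_succ, Finset.sum_add_distrib]
  congr 1
  rw [Finset.sum_comm]
  refine Finset.sum_congr rfl fun m _ => Finset.sum_congr rfl fun q _ => ?_
  rw [pd_comm m, pd_comm m]

theorem firstQ_succ (n : ℕ) (u : Fin d₁ → 𝓢(Space d, ℂ)) :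
    firstQ w (n + 1) u = firstQ w n u + ∑ m, firstQ w n fun k => pd m (u k) := by
  simp only [firstQ, qn_succ, Finset.sum_add_distrib]
  congr 1
  rw [Finset.sum_comm]
  refine Finset.sum_congr rfl fun m _ => Finset.sum_congr rfl fun q _ => ?_
  rw [pd_comm m]

theorem mainSum_succ (n : ℕ) (a : Fin d → Fin d → Fin d₁ → Fin d₁ → Space d → ℝ)
    (u : Fin d₁ → 𝓢(Space d, ℂ)) :
    mainSum w (n + 1) a u = mainSum w n a u + ∑ m, mainSum w n a fun k => pd m (u k) := by
  simp only [mainSum, mainForm, Finset.sum_add_distrib, Complex.add_re, Complex.re_sum]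
  congr 1
  rw [Finset.sum_comm]
  refine Finset.sum_congr rfl fun m _ => Finset.sum_congr rfl fun p _ => ?_
  rw [pd_comm m, pd_comm m, pd_comm m, pd_comm m]

/-- In the main form all derivatives and differences fall on `u`, and they commute with each other.
It is therefore a nonnegative combination of `L2` forms of derived fields with translated
coefficients, and the constants depend neither on `n` nor on the weights. -/
theorem coercive_mainSum {δ η C : ℝ} (hδ : 0 < δ) (hC : 0 ≤ C)
    {a α : Fin d → Fin d → Fin d₁ → Fin d₁ → Space d → ℝ}
    (ha : ∀ i j k r, (a i j k r).HasTemperateGrowth) (h : SmoothApprox δ η C a α)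
    (hη : Fintype.card (Idx d d₁) * η ≤ δ / 4) (n : ℕ) (u : Fin d₁ → 𝓢(Space d, ℂ)) :
    δ / 2 * secondQ w n u - 4 * (Fintype.card (Idx d d₁) * C) ^ 2 / δ * firstQ w n u
      ≤ mainSum w n a u := by
  induction n generalizing u with
  | zero =>
    have h1 := coercive_L2 hδ hC ha h hη u
    have h2 : ∀ m, ∀ c ∈ Finset.range w.K, _ := fun m c _ => mul_le_mul_of_nonneg_left
      (coercive_L2 hδ hC (fun i j k r => hasTemperateGrowth_comp_add (ha i j k r) (dyadicStep m c))
        (h.translate (dyadicStep m c)) hη fun k => diff (dyadicStep m c) (u k)) (w.wt_nonneg c)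
    have h3 := Finset.sum_le_sum fun m (_ : m ∈ Finset.univ) => Finset.sum_le_sum (h2 m)
    rw [secondQ_zero, firstQ_zero, mainSum_zero]
    simp only [mul_sub, Finset.sum_sub_distrib, mul_left_comm (w.wt _), ← Finset.mul_sum] at h3
    linarith
  | succ n ih =>
    rw [secondQ_succ, firstQ_succ, mainSum_succ]
    have h3 := Finset.sum_le_sum fun m (_ : m ∈ Finset.univ) => ih fun k => pd m (u k)
    simp only [Finset.sum_sub_distrib, ← Finset.mul_sum] at h3
    linarith [ih u]

/-- The lower order terms. -/
def lowerQ (n : ℕ) (u : Fin d₁ → 𝓢(Space d, ℂ)) : ℝ :=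
  ∑ q : Fin d × Fin d₁ × Fin d, lo w n (pd q.2.2 (pd q.1 (u q.2.1)))

variable {w} in
theorem commutator_young {n : ℕ} {L ε : ℝ} (hε : 0 < ε) {a : Space d → ℝ} (ha : Reg w L n a)
    (f g : 𝓢(Space d, ℂ)) :
    |(Q w n f (mulS a g)).re - (mainForm w n a f g).re|
      ≤ ε * qn w n f + commConst d w.S L n ^ 2 / (4 * ε) * lo w n g := by
  rw [← Complex.sub_re]
  refine (Complex.abs_re_le_norm _).trans ((norm_Q_sub_mainForm_le ha f g).trans ?_)
  have h1 := Real.sq_sqrt (qn_nonneg w n f)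
  have h2 := Real.sq_sqrt (lo_nonneg (w := w) n g)
  set x := √(qn w n f)
  set y := √(lo w n g)
  set B := commConst d w.S L n
  rw [← h1, ← h2]
  have : 0 ≤ (2 * ε * x - B * y) ^ 2 / (4 * ε) := by positivity
  have e : ε * x ^ 2 + B ^ 2 / (4 * ε) * y ^ 2 - B * (y * x) = (2 * ε * x - B * y) ^ 2 / (4 * ε) := by
    field_simp
    ring
  linarith

theorem le_secondQ (n : ℕ) (u : Fin d₁ → 𝓢(Space d, ℂ)) (i l : Fin d) (k : Fin d₁) :
    qn w n (pd i (pd l (u k))) ≤ secondQ w n u := by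
  rw [secondQ]
  exact le_sum_univ (fun q : Fin d × Fin d₁ × Fin d =>
    qn w n (pd q.2.2 (pd q.1 (u q.2.1))))
    (fun _ => qn_nonneg w n _) (l, k, i)

theorem le_lowerQ (n : ℕ) (u : Fin d₁ → 𝓢(Space d, ℂ)) (i l : Fin d) (k : Fin d₁) :
    lo w n (pd i (pd l (u k))) ≤ lowerQ w n u := by
  rw [lowerQ]
  exact le_sum_univ (fun q : Fin d × Fin d₁ × Fin d =>
    lo w n (pd q.2.2 (pd q.1 (u q.2.1))))
    (fun _ => lo_nonneg n _) (l, k, i)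

variable {w} in
theorem sum_idx_le {n : ℕ} {ε B : ℝ} (hε : 0 ≤ ε) (hB : 0 ≤ B) (u : Fin d₁ → 𝓢(Space d, ℂ)) :
    (∑ p : Idx d d₁, (ε * qn w n (pd p.1 (pd p.1 (u p.2.2.2.1)))
      + B * lo w n (pd p.2.1 (pd p.2.2.1 (u p.2.2.2.2)))))
      ≤ Fintype.card (Idx d d₁) * (ε * secondQ w n u + B * lowerQ w n u) := by
  rw [← nsmul_eq_mul, ← Finset.card_univ, ← Finset.sum_const]
  exact Finset.sum_le_sum fun p _ => add_le_add (mul_le_mul_of_nonneg_left (le_secondQ w n u _ _ _) hε)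
    (mul_le_mul_of_nonneg_left (le_lowerQ w n u _ _ _) hB)

variable {w} in
theorem sum_idx_le' {n : ℕ} {ε B : ℝ} (hε : 0 ≤ ε) (hB : 0 ≤ B) (u : Fin d₁ → 𝓢(Space d, ℂ)) :
    (∑ p : Idx d d₁, (ε * qn w n (pd p.2.1 (pd p.2.2.1 (u p.2.2.2.2)))
      + B * lo w n (pd p.1 (pd p.1 (u p.2.2.2.1)))))
      ≤ Fintype.card (Idx d d₁) * (ε * secondQ w n u + B * lowerQ w n u) := by
  rw [← nsmul_eq_mul, ← Finset.card_univ, ← Finset.sum_const]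
  exact Finset.sum_le_sum fun p _ => add_le_add (mul_le_mul_of_nonneg_left (le_secondQ w n u _ _ _) hε)
    (mul_le_mul_of_nonneg_left (le_lowerQ w n u _ _ _) hB)

/-- The constant of the lower order terms. -/
def lowerConst (d d₁ : ℕ) (s L δ : ℝ) (n : ℕ) : ℝ :=
  Fintype.card (Idx d d₁) * (commConst d s L n ^ 2 * (Fintype.card (Idx d d₁) + 1) / δ)

theorem Q_coercive_of_main {δ Λ M X Y F m ε : ℝ} (hM : 0 ≤ M) (hX : 0 ≤ X) (hε : ε = δ / (4 * (M + 1)))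
    (hδ : 0 < δ) (h1 : δ / 2 * X - F ≤ m) (h2 : |Y - m| ≤ M * (ε * X + Λ)) :
    δ / 4 * X - F - M * Λ ≤ Y := by
  have h3 := (abs_le.1 h2).1
  -- The commutators over all `M` indices may use half of the available `δ / 2`.
  have h4 : M * ε ≤ δ / 4 := by
    rw [hε, mul_div_assoc', div_le_div_iff₀ (by positivity) (by positivity)]
    nlinarith
  nlinarith [mul_le_mul_of_nonneg_right h4 hX]

variable {w}

theorem secondQ_nonneg (n : ℕ) (u : Fin d₁ → 𝓢(Space d, ℂ)) : 0 ≤ secondQ w n u :=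
  Finset.sum_nonneg fun _ _ => qn_nonneg w n _

/-- Coercivity of the elliptic operator. -/
theorem coercive_Q {δ η C L : ℝ} (hδ : 0 < δ) (hC : 0 ≤ C) {n : ℕ}
    {a α : Fin d → Fin d → Fin d₁ → Fin d₁ → Space d → ℝ}
    (ha : ∀ i j k r, Reg w L n (a i j k r)) (h : SmoothApprox δ η C a α)
    (hη : Fintype.card (Idx d d₁) * η ≤ δ / 4) (u : Fin d₁ → 𝓢(Space d, ℂ)) :
    δ / 4 * secondQ w n u - 4 * (Fintype.card (Idx d d₁) * C) ^ 2 / δ * firstQ w n u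
        - lowerConst d d₁ w.S L δ n * lowerQ w n u
      ≤ ∑ p : Idx d d₁, (Q w n (pd p.1 (pd p.1 (u p.2.2.2.1)))
        (mulS (a p.2.1 p.2.2.1 p.2.2.2.1 p.2.2.2.2) (pd p.2.1 (pd p.2.2.1 (u p.2.2.2.2))))).re := by
  have hε : 0 < δ / (4 * ((Fintype.card (Idx d d₁) : ℝ) + 1)) := by positivity
  have h1 := coercive_mainSum w hδ hC (fun i j k r => (ha i j k r).temperate) h hη n u
  have h2 := Q_coercive_of_main (Nat.cast_nonneg _) (secondQ_nonneg n u) rfl hδ h1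
    (Y := ∑ p : Idx d d₁, (Q w n (pd p.1 (pd p.1 (u p.2.2.2.1)))
        (mulS (a p.2.1 p.2.2.1 p.2.2.2.1 p.2.2.2.2) (pd p.2.1 (pd p.2.2.1 (u p.2.2.2.2))))).re)
    (M := Fintype.card (Idx d d₁)) (Λ := commConst d w.S L n ^ 2 / (4 * (δ / (4 * ((Fintype.card (Idx d d₁) : ℝ) + 1)))) * lowerQ w n u) ?_
  · convert h2 using 2
    rw [lowerConst]
    field_simp
  · rw [mainSum, ← Finset.sum_sub_distrib]
    exact (Finset.abs_sum_le_sum_abs _ _).trans ((Finset.sum_le_sum fun p _ =>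
      commutator_young hε (ha _ _ _ _) _ _).trans (sum_idx_le hε.le (by positivity) u))

/-- Coercivity of the adjoint of the elliptic operator. -/
theorem coercive_Q_adjoint {δ η C L : ℝ} (hδ : 0 < δ) (hC : 0 ≤ C) {n : ℕ}
    {a α : Fin d → Fin d → Fin d₁ → Fin d₁ → Space d → ℝ}
    (ha : ∀ i j k r, Reg w L n (a i j k r)) (h : SmoothApprox δ η C a α)
    (hη : Fintype.card (Idx d d₁) * η ≤ δ / 4) (u : Fin d₁ → 𝓢(Space d, ℂ)) :
    δ / 4 * secondQ w n u - 4 * (Fintype.card (Idx d d₁) * C) ^ 2 / δ * firstQ w n u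
        - lowerConst d d₁ w.S L δ n * lowerQ w n u
      ≤ ∑ p : Idx d d₁, (Q w n (pd p.2.1 (pd p.2.2.1 (u p.2.2.2.2)))
        (mulS (a p.2.1 p.2.2.1 p.2.2.2.1 p.2.2.2.2) (pd p.1 (pd p.1 (u p.2.2.2.1))))).re := by
  have hε : 0 < δ / (4 * ((Fintype.card (Idx d d₁) : ℝ) + 1)) := by positivity
  have h1 := coercive_mainSum w hδ hC (fun i j k r => (ha i j k r).temperate) h hη n u
  have h2 := Q_coercive_of_main (Nat.cast_nonneg _) (secondQ_nonneg n u) rfl hδ h1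
    (Y := ∑ p : Idx d d₁, (Q w n (pd p.2.1 (pd p.2.2.1 (u p.2.2.2.2)))
        (mulS (a p.2.1 p.2.2.1 p.2.2.2.1 p.2.2.2.2) (pd p.1 (pd p.1 (u p.2.2.2.1))))).re)
    (M := Fintype.card (Idx d d₁)) (Λ := commConst d w.S L n ^ 2 / (4 * (δ / (4 * ((Fintype.card (Idx d d₁) : ℝ) + 1)))) * lowerQ w n u) ?_
  · convert h2 using 2
    rw [lowerConst]
    field_simp
  · rw [mainSum, ← Finset.sum_sub_distrib]
    refine (Finset.abs_sum_le_sum_abs _ _).trans ((Finset.sum_le_sum fun p _ => ?_).trans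
      (sum_idx_le' hε.le (by positivity) u))
    -- For real coefficients the main form is Hermitian, so exchanging its arguments does not change
    -- the real part. Only the commutator distinguishes the transposed form from the original one.
    -- The transposed estimate serves negative `γ`.
    have e : (mainForm w n (a p.2.1 p.2.2.1 p.2.2.2.1 p.2.2.2.2) (pd p.1 (pd p.1 (u p.2.2.2.1)))
        (pd p.2.1 (pd p.2.2.1 (u p.2.2.2.2)))).re = (mainForm w n (a p.2.1 p.2.2.1 p.2.2.2.1 p.2.2.2.2)
        (pd p.2.1 (pd p.2.2.1 (u p.2.2.2.2))) (pd p.1 (pd p.1 (u p.2.2.2.1)))).re := by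
      rw [← mainForm_conj w n (ha _ _ _ _).temperate, Complex.conj_re]
    rw [e]
    exact commutator_young hε (ha _ _ _ _) _ _

end ParabolicSystem
end

/-! ### Mollification and Hölder regularity of coefficients. -/

noncomputable section
namespace ParabolicSystem
set_option linter.unusedSectionVars false
open MeasureTheory Set Filter Topology
open scoped SchwartzMap ENNReal LineDeriv Convolution

variable {d d₁ : ℕ}

section Convolution

variable {F : Type} [NormedAddCommGroup F] [NormedSpace ℝ F]

/-- The convolution of a bounded function with a smooth function of compact support. -/
def smear (h : Space d → ℝ) (φ : Space d → F) (x : Space d) : F := ∫ y, h y • φ (x - y)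

theorem norm_smear_le {h : Space d → ℝ} {L : ℝ} (hL : ∀ x, |h x| ≤ L)
    {φ : Space d → F} (hφ : Continuous φ) (hc : HasCompactSupport φ) (x : Space d) :
    ‖smear h φ x‖ ≤ L * ∫ y, ‖φ y‖ := by
  rw [← integral_sub_left_eq_self (fun y => ‖φ y‖) volume x, ← integral_const_mul]
  have hi : Integrable fun y => ‖φ (x - y)‖ :=
    ((hφ.integrable_of_hasCompactSupport hc).comp_sub_left x).norm
  refine norm_integral_le_of_norm_le (hi.const_mul L) (Eventually.of_forall fun y => ?_)
  rw [norm_smul, Real.norm_eq_abs]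
  exact mul_le_mul_of_nonneg_right (hL y) (norm_nonneg _)

theorem hasFDerivAt_smear {h : Space d → ℝ} (hh : Continuous h) {φ : Space d → F}
    (hφ : ContDiff ℝ 1 φ) (hc : HasCompactSupport φ) (x : Space d) :
    HasFDerivAt (smear h φ) (smear h (fderiv ℝ φ) x) x :=
  hc.hasFDerivAt_convolution_right (ContinuousLinearMap.lsmul ℝ ℝ) hh.locallyIntegrable hφ x

end Convolution

/-- All derivatives fall on `φ`. The codomain varies in the induction because the derivative of `φ`
takes values in another space. -/
theorem smear_bounded (n : ℕ) {F : Type} [NormedAddCommGroup F] [NormedSpace ℝ F] {h : Space d → ℝ}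
    (hh : Continuous h) {L : ℝ} (hL : ∀ x, |h x| ≤ L) {φ : Space d → F}
    (hφ : ContDiff ℝ (⊤ : ℕ∞) φ) (hc : HasCompactSupport φ) :
    ContDiff ℝ n (smear h φ) ∧ ∃ C, ∀ x, ‖iteratedFDeriv ℝ n (smear h φ) x‖ ≤ C := by
  induction n generalizing F with
  | zero =>
    refine ⟨?_, L * ∫ y, ‖φ y‖, fun x => ?_⟩
    · exact contDiff_zero.2 (continuous_iff_continuousAt.2 fun x =>
        (hasFDerivAt_smear hh (hφ.of_le (by exact_mod_cast le_top)) hc x).continuousAt)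
    · rw [norm_iteratedFDeriv_zero]
      exact norm_smear_le hL hφ.continuous hc x
  | succ n ih =>
    have hd : fderiv ℝ (smear h φ) = smear h (fderiv ℝ φ) :=
      funext fun x => (hasFDerivAt_smear hh (hφ.of_le (by exact_mod_cast le_top)) hc x).fderiv
    obtain ⟨h1, C, h2⟩ := ih (φ := fderiv ℝ φ) (contDiff_infty_iff_fderiv.1 hφ).2 (hc.fderiv ℝ)
    refine ⟨?_, C, fun x => ?_⟩
    · rw [Nat.cast_add, Nat.cast_one, contDiff_succ_iff_fderiv, hd]
      exact ⟨fun x => (hasFDerivAt_smear hh (hφ.of_le (by exact_mod_cast le_top)) hc x).differentiableAt,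
        by simp, h1⟩
    · rw [← norm_iteratedFDeriv_fderiv, hd]
      exact h2 x

/-- A smooth mollifier supported in the ball of radius `ε`. -/
def bump (d : ℕ) (ε : ℝ) (hε : 0 < ε) : Space d → ℝ :=
  (⟨ε / 2, ε, half_pos hε, half_lt_self hε⟩ : ContDiffBump (0 : Space d)).normed volume

section Bump
variable {ε : ℝ} (hε : 0 < ε)

theorem contDiff_bump : ContDiff ℝ (⊤ : ℕ∞) (bump d ε hε) := ContDiffBump.contDiff_normed _

theorem hasCompactSupport_bump : HasCompactSupport (bump d ε hε) :=
  ContDiffBump.hasCompactSupport_normed _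

theorem bump_nonneg (x : Space d) : 0 ≤ bump d ε hε x := ContDiffBump.nonneg_normed _ x

theorem integral_bump : ∫ x, bump d ε hε x = 1 := ContDiffBump.integral_normed _

theorem bump_eq_zero {x : Space d} (hx : ε ≤ ‖x‖) : bump d ε hε x = 0 := by
  by_contra h
  have h1 : x ∈ Function.support (bump d ε hε) := h
  rw [bump, ContDiffBump.support_normed_eq] at h1
  simp at h1
  linarith

/-- The mollification of a function. -/
def mollify (h : Space d → ℝ) : Space d → ℝ := smear h (bump d ε hε)

theorem mollify_apply (h : Space d → ℝ) (x : Space d) :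
    mollify hε h x = ∫ y, bump d ε hε y * h (x - y) := by
  rw [mollify, smear, ← integral_sub_left_eq_self _ volume x]
  simp [mul_comm]

theorem integrable_bump_mul {h : Space d → ℝ} (hh : Continuous h) :
    Integrable fun y => bump d ε hε y * h y :=
  (((contDiff_bump hε).continuous.mul hh).integrable_of_hasCompactSupport
    (hasCompactSupport_bump hε).mul_right)

theorem integrable_bump_mul_sub {h : Space d → ℝ} (hh : Continuous h) (x : Space d) :
    Integrable fun y => bump d ε hε y * h (x - y) :=
  integrable_bump_mul hε (hh.comp (by fun_prop))

/-- Mollification is averaging with a probability density on the ball of radius `ε`. Bounds,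
oscillation and approximation estimates for `mollify` all come from this. -/
theorem bump_average_le {F : Space d → ℝ} (hF : Continuous F) {M : ℝ}
    (hM : ∀ y, ‖y‖ < ε → F y ≤ M) : ∫ y, bump d ε hε y * F y ≤ M := by
  have h1 : ∫ y, bump d ε hε y * F y ≤ ∫ y, bump d ε hε y * M := by
    refine integral_mono (integrable_bump_mul hε hF) (integrable_bump_mul hε continuous_const)
      fun y => ?_
    by_cases hy : ‖y‖ < ε
    · exact mul_le_mul_of_nonneg_left (hM y hy) (bump_nonneg hε y)
    · simp [bump_eq_zero hε (not_lt.1 hy)]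
  rwa [integral_mul_const, integral_bump, one_mul] at h1

theorem abs_bump_average_le {F : Space d → ℝ} (hF : Continuous F) {M : ℝ}
    (hM : ∀ y, ‖y‖ < ε → |F y| ≤ M) : |∫ y, bump d ε hε y * F y| ≤ M := by
  refine abs_le.2 ⟨?_, bump_average_le hε hF fun y hy => (abs_le.1 (hM y hy)).2⟩
  have := bump_average_le hε hF.neg fun y hy => (neg_le.1 (abs_le.1 (hM y hy)).1)
  simp only [Pi.neg_apply, mul_neg, integral_neg] at this
  linarith

theorem le_bump_average {F : Space d → ℝ} (hF : Continuous F) {M : ℝ}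
    (hM : ∀ y, ‖y‖ < ε → M ≤ F y) : M ≤ ∫ y, bump d ε hε y * F y := by
  have := bump_average_le hε hF.neg fun y hy => neg_le_neg (hM y hy)
  simp only [Pi.neg_apply, mul_neg, integral_neg] at this
  linarith

theorem abs_mollify_le {h : Space d → ℝ} (hh : Continuous h) {L : ℝ} (hL : ∀ x, |h x| ≤ L)
    (x : Space d) : |mollify hε h x| ≤ L := by
  rw [mollify_apply]
  exact abs_bump_average_le hε (hh.comp (by fun_prop)) fun y _ => hL _

theorem abs_mollify_sub_mollify_le {h : Space d → ℝ} (hh : Continuous h) {M : ℝ} {x y : Space d}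
    (hM : ∀ z, |h (x - z) - h (y - z)| ≤ M) : |mollify hε h x - mollify hε h y| ≤ M := by
  rw [mollify_apply, mollify_apply, ← integral_sub (integrable_bump_mul_sub hε hh x)
    (integrable_bump_mul_sub hε hh y)]
  simp only [← mul_sub]
  exact abs_bump_average_le hε (F := fun z => h (x - z) - h (y - z))
    ((hh.comp (by fun_prop)).sub (hh.comp (by fun_prop))) fun z _ => hM z

theorem abs_mollify_sub_le {h : Space d → ℝ} (hh : Continuous h) {M : ℝ} {x : Space d}
    (hM : ∀ z, ‖z‖ < ε → |h (x - z) - h x| ≤ M) : |mollify hε h x - h x| ≤ M := by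
  have e : h x = ∫ y, bump d ε hε y * h x := by rw [integral_mul_const, integral_bump, one_mul]
  rw [mollify_apply, show (∫ y, bump d ε hε y * h (x - y)) - h x
    = (∫ y, bump d ε hε y * h (x - y)) - ∫ y, bump d ε hε y * h x by rw [← e], ← integral_sub (integrable_bump_mul_sub hε hh x) (integrable_bump_mul hε continuous_const)]
  simp only [← mul_sub]
  exact abs_bump_average_le hε (F := fun z => h (x - z) - h x)
    ((hh.comp (by fun_prop)).sub continuous_const) fun z hz => hM z hz

theorem hasTemperateGrowth_mollify {h : Space d → ℝ} (hh : Continuous h) {L : ℝ}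
    (hL : ∀ x, |h x| ≤ L) : (mollify hε h).HasTemperateGrowth := by
  refine ⟨contDiff_infty.2 fun n => (smear_bounded n hh hL (contDiff_bump hε)
    (hasCompactSupport_bump hε)).1, fun n => ?_⟩
  obtain ⟨C, hC⟩ := (smear_bounded n hh hL (contDiff_bump hε) (hasCompactSupport_bump hε)).2
  exact ⟨0, C, fun x => by simpa [mollify] using hC x⟩

/-- For fixed `ξ` the Legendre condition is a linear inequality in the coefficients, so it survives
averaging with the same `δ`. -/
theorem Elliptic.mollify {δ : ℝ} {a : Fin d → Fin d → Fin d₁ → Fin d₁ → Space d → ℝ}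
    (ha : ∀ i j k r, Continuous (a i j k r)) (h : ∀ x, Elliptic δ fun i j k r => a i j k r x)
    (x : Space d) : Elliptic δ fun i j k r => mollify hε (a i j k r) x := by
  intro ξ
  have hc : ∀ i j k r, Continuous fun y => a i j k r (x - y) :=
    fun i j k r => (ha i j k r).comp (by fun_prop)
  have h1 := le_bump_average hε (F := fun y => ∑ i, ∑ j, ∑ k, ∑ r, ξ k i * a i j k r (x - y) * ξ r j)
    (by fun_prop) (fun y _ => h (x - y) ξ)
  refine h1.trans_eq ?_
  simp only [mollify_apply, Finset.mul_sum]
  have hi : ∀ i j k r, Integrable fun y => bump d ε hε y * (ξ k i * a i j k r (x - y) * ξ r j) :=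
    fun i j k r => integrable_bump_mul hε (by have := hc i j k r; fun_prop)
  rw [integral_finsetSum _ fun i _ => integrable_finsetSum _ fun j _ =>
      integrable_finsetSum _ fun k _ => integrable_finsetSum _ fun r _ => hi i j k r]
  refine Finset.sum_congr rfl fun i _ => ?_
  rw [integral_finsetSum _ fun j _ =>
    integrable_finsetSum _ fun k _ => integrable_finsetSum _ fun r _ => hi i j k r]
  refine Finset.sum_congr rfl fun j _ => ?_
  rw [integral_finsetSum _ fun k _ => integrable_finsetSum _ fun r _ => hi i j k r]
  refine Finset.sum_congr rfl fun k _ => ?_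
  rw [integral_finsetSum _ fun r _ => hi i j k r]
  refine Finset.sum_congr rfl fun r _ => ?_
  rw [← integral_const_mul, ← integral_mul_const]
  congr 1
  funext y
  ring

/-- A bound for the derivative of the mollifier. -/
def bumpConst : ℝ := ∫ y, ‖fderiv ℝ (bump d ε hε) y‖

/-- The derivative falls on the mollifier: a bound for `h` suffices, but the constant depends on
`ε`. This is enough for `SmoothApprox`, where the radius is fixed. -/
theorem abs_pdf_mollify_le {h : Space d → ℝ} (hh : Continuous h) {L : ℝ} (hL : ∀ x, |h x| ≤ L)
    (l : Fin d) (x : Space d) : |pdf l (mollify hε h) x| ≤ L * bumpConst (d := d) hε := by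
  have h1 : ContDiff ℝ 1 (bump d ε hε) := (contDiff_bump hε).of_le (by exact_mod_cast le_top)
  rw [pdf, mollify, (hasFDerivAt_smear hh h1 (hasCompactSupport_bump hε) x).fderiv]
  refine (ContinuousLinearMap.le_opNorm (smear h (fderiv ℝ (bump d ε hε)) x) _).trans ?_
  rw [PiLp.norm_single, norm_one, mul_one]
  exact norm_smear_le hL (h1.continuous_fderiv one_ne_zero) ((hasCompactSupport_bump hε).fderiv ℝ) x

/-- Here the derivative falls on `h`, so that regularity bounds for mollifications are uniform in
`ε`. -/
theorem pdf_mollify {h : Space d → ℝ} (hh : ContDiff ℝ 1 h) {L : ℝ} (hL : ∀ x, ‖fderiv ℝ h x‖ ≤ L)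
    (l : Fin d) : pdf l (mollify hε h) = mollify hε (pdf l h) := by
  funext x
  have hc := hh.continuous_fderiv one_ne_zero
  have h1 : HasFDerivAt (mollify hε h) (∫ y, bump d ε hε y • fderiv ℝ h (x - y)) x := by
    have e : mollify hε h = fun x => ∫ y, bump d ε hε y * h (x - y) :=
      funext fun x => mollify_apply hε h x
    rw [e]
    refine hasFDerivAt_integral_of_dominated_of_fderiv_le (𝕜 := ℝ) (s := univ)
      (F' := fun x y => bump d ε hε y • fderiv ℝ h (x - y))
      (bound := fun y => bump d ε hε y * L) univ_mem
      (Eventually.of_forall fun x => (integrable_bump_mul_sub hε hh.continuous x).1)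
      (integrable_bump_mul_sub hε hh.continuous x) ?_ ?_ (integrable_bump_mul hε continuous_const) ?_
    · exact ((contDiff_bump hε).continuous.smul (hc.comp (by fun_prop))).aestronglyMeasurable
    · refine Eventually.of_forall fun y z _ => ?_
      rw [norm_smul, Real.norm_of_nonneg (bump_nonneg hε y)]
      exact mul_le_mul_of_nonneg_left (hL _) (bump_nonneg hε y)
    · refine Eventually.of_forall fun y z _ => ?_
      have h2 := ((hh.differentiable one_ne_zero) (z - y)).hasFDerivAt
      have h3 := h2.comp z ((hasFDerivAt_id z).sub_const y)
      exact h3.const_mul _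
  rw [pdf, h1.fderiv, mollify_apply, ContinuousLinearMap.integral_apply]
  · rfl
  · exact ((contDiff_bump hε).continuous.smul (hc.comp (by fun_prop))).integrable_of_hasCompactSupport
      (hasCompactSupport_bump hε).smul_right

end Bump

/-- Hölder regularity of order `n + β`. -/
def HolderReg (β L : ℝ) : ℕ → (Space d → ℝ) → Prop
  | 0, h => (∀ x, |h x| ≤ L) ∧ ∀ x y, |h x - h y| ≤ L * ‖x - y‖ ^ β
  | n + 1, h => ContDiff ℝ 1 h ∧ (∀ x, |h x| ≤ L) ∧ (∀ x, ‖fderiv ℝ h x‖ ≤ L) ∧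
      HolderReg β L n h ∧ ∀ l, HolderReg β L n (pdf l h)

theorem HolderReg.bound {β L : ℝ} {n : ℕ} {h : Space d → ℝ} (hh : HolderReg β L n h) (x : Space d) :
    |h x| ≤ L := by
  cases n with
  | zero => rw [HolderReg] at hh; exact hh.1 x
  | succ n => rw [HolderReg] at hh; exact hh.2.1 x

theorem HolderReg.holder {β L : ℝ} {n : ℕ} {h : Space d → ℝ} (hh : HolderReg β L n h) (x y : Space d) :
    |h x - h y| ≤ L * ‖x - y‖ ^ β := by
  induction n with
  | zero => rw [HolderReg] at hh; exact hh.2 x y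
  | succ n ih => rw [HolderReg] at hh; exact ih hh.2.2.2.1

theorem continuous_of_holder {β L : ℝ} (hβ : 0 < β) {h : Space d → ℝ}
    (hh : ∀ x y, |h x - h y| ≤ L * ‖x - y‖ ^ β) : Continuous h := by
  refine continuous_iff_continuousAt.2 fun x => ?_
  rw [ContinuousAt, tendsto_iff_norm_sub_tendsto_zero]
  have h1 : Tendsto (fun y => L * ‖y - x‖ ^ β) (𝓝 x) (𝓝 0) := by
    have : ContinuousAt (fun y : Space d => L * ‖y - x‖ ^ β) x :=
      continuousAt_const.mul ((by fun_prop : ContinuousAt (fun y : Space d => ‖y - x‖) x).rpow_const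
        (Or.inr hβ.le))
    simpa [ContinuousAt, Real.zero_rpow hβ.ne'] using this
  exact squeeze_zero (fun _ => norm_nonneg _) (fun y => hh y x) h1

theorem norm_dyadicStep (l : Fin d) (k : ℕ) : ‖dyadicStep l k‖ = ((2 : ℝ) ^ k)⁻¹ := by
  rw [dyadicStep, norm_smul, PiLp.norm_single, norm_one, mul_one,
    Real.norm_of_nonneg (by positivity)]

/-- A step of length `2^{-k}` changes a `β`-Hölder function by at most `L * (2^{-k})^β`, and
averaging does not increase this. The same `L` serves every radius. -/
theorem reg_mollify {w : Weights} {β L ε : ℝ} (hε : 0 < ε) (hβ : 0 < β)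
    (hw : ∀ k, w.hb k = (((2 : ℝ) ^ k)⁻¹) ^ β) {n : ℕ} {h : Space d → ℝ} (hh : HolderReg β L n h) :
    Reg w L n (mollify hε h) := by
  have h0 : ∀ {n : ℕ} {h : Space d → ℝ}, HolderReg β L n h → Reg w L 0 (mollify hε h) := by
    intro n h hh
    have hc := continuous_of_holder hβ hh.holder
    rw [Reg]
    refine ⟨hasTemperateGrowth_mollify hε hc hh.bound, abs_mollify_le hε hc hh.bound, fun l k x => ?_⟩
    refine abs_mollify_sub_mollify_le hε hc fun z => ?_
    refine (hh.holder _ _).trans_eq ?_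
    rw [hw, sub_sub_sub_cancel_right, add_sub_cancel_left, norm_dyadicStep]
  induction n generalizing h with
  | zero => exact h0 hh
  | succ n ih =>
    have hc := continuous_of_holder hβ hh.holder
    have hr := h0 hh
    rw [HolderReg] at hh
    obtain ⟨h1, h2, h3, h4, h5⟩ := hh
    rw [Reg]
    refine ⟨hasTemperateGrowth_mollify hε hc h2, abs_mollify_le hε hc h2, hr, ih h4, fun l => ?_⟩
    rw [pdf_mollify hε h1 h3]
    exact ih (h5 l)

/-- One order is gained because the gradient of the mollification of a Lipschitz function is bounded
by the Lipschitz constant. With `hb k = 2` the condition on differences is trivial. -/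
theorem reg_mollify_of_lipschitz {w : Weights} {L ε : ℝ} (hε : 0 < ε)
    (hw : ∀ k, w.hb k = 2) {n : ℕ} {h : Space d → ℝ} (hh : HolderReg 1 L n h) :
    Reg w L (n + 1) (mollify hε h) := by
  have hr : ∀ {g : Space d → ℝ}, g.HasTemperateGrowth → (∀ x, |g x| ≤ L) → Reg w L 0 g := by
    intro g hg hL
    rw [Reg]
    refine ⟨hg, hL, fun l k x => ?_⟩
    rw [hw, mul_two]
    exact (abs_sub _ _).trans (add_le_add (hL _) (hL _))
  induction n generalizing h with
  | zero =>
    have hc := continuous_of_holder one_pos hh.holder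
    have ht := hasTemperateGrowth_mollify hε hc hh.bound
    have hb := abs_mollify_le hε hc hh.bound
    have hL0 : 0 ≤ L := (abs_nonneg _).trans (hh.bound 0)
    rw [Reg]
    refine ⟨ht, hb, hr ht hb, hr ht hb, fun l => hr (hasTemperateGrowth_pdf ht l) fun x => ?_⟩
    have h1 : ‖fderiv ℝ (mollify hε h) x‖ ≤ L := by
      refine norm_fderiv_le_of_lip' ℝ hL0 (Eventually.of_forall fun y => ?_)
      refine abs_mollify_sub_mollify_le hε hc fun z => ?_
      simpa using hh.holder (y - z) (x - z)
    refine (ContinuousLinearMap.le_opNorm (fderiv ℝ (mollify hε h) x) _).trans ?_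
    rwa [PiLp.norm_single, norm_one, mul_one]
  | succ n ih =>
    have hc := continuous_of_holder one_pos hh.holder
    rw [HolderReg] at hh
    obtain ⟨h1, h2, h3, h4, h5⟩ := hh
    have ht := hasTemperateGrowth_mollify hε hc h2
    have hb := abs_mollify_le hε hc h2
    rw [Reg]
    refine ⟨ht, hb, hr ht hb, ih h4, fun l => ?_⟩
    rw [pdf_mollify hε h1 h3]
    exact ih (h5 l)

theorem norm_iteratedFDeriv_pdf_sub_le {n : ℕ} {h : Space d → ℝ} (hh : ContDiff ℝ (n + 1 : ℕ) h)
    (l : Fin d) {j : ℕ} (hj : j ≤ n) (x y : Space d) :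
    ‖iteratedFDeriv ℝ j (pdf l h) x‖ ≤ ‖iteratedFDeriv ℝ (j + 1) h x‖ ∧
    ‖iteratedFDeriv ℝ j (pdf l h) x - iteratedFDeriv ℝ j (pdf l h) y‖
      ≤ ‖iteratedFDeriv ℝ (j + 1) h x - iteratedFDeriv ℝ (j + 1) h y‖ := by
  have hd : ContDiff ℝ n (fderiv ℝ h) := by
    rw [Nat.cast_add, Nat.cast_one, contDiff_succ_iff_fderiv] at hh
    exact hh.2.2
  let E : (Space d →L[ℝ] ℝ) →L[ℝ] ℝ :=
    ContinuousLinearMap.apply ℝ ℝ (EuclideanSpace.single l (1 : ℝ) : Space d)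
  have hE : ‖E‖ ≤ 1 := by
    refine ContinuousLinearMap.opNorm_le_bound _ zero_le_one fun f => ?_
    refine (f.le_opNorm _).trans_eq ?_
    rw [PiLp.norm_single, norm_one, mul_one, one_mul]
  have e : ∀ x, iteratedFDeriv ℝ j (pdf l h) x
      = E.compContinuousMultilinearMap (iteratedFDeriv ℝ j (fderiv ℝ h) x) := fun x =>
    E.iteratedFDeriv_comp_left hd.contDiffAt (by exact_mod_cast hj)
  have hb : ∀ A : Space d [×j]→L[ℝ] (Space d →L[ℝ] ℝ),
      ‖E.compContinuousMultilinearMap A‖ ≤ ‖A‖ := fun A =>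
    (E.norm_compContinuousMultilinearMap_le A).trans (mul_le_of_le_one_left (norm_nonneg _) hE)
  constructor
  · rw [e, ← norm_iteratedFDeriv_fderiv]
    exact hb _
  · have h2 : E.compContinuousMultilinearMap (iteratedFDeriv ℝ j (fderiv ℝ h) x)
        - E.compContinuousMultilinearMap (iteratedFDeriv ℝ j (fderiv ℝ h) y)
        = E.compContinuousMultilinearMap
          (iteratedFDeriv ℝ j (fderiv ℝ h) x - iteratedFDeriv ℝ j (fderiv ℝ h) y) := by
      ext v
      simp
    rw [e, e, h2, iteratedFDeriv_succ_eq_comp_right, iteratedFDeriv_succ_eq_comp_right]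
    refine (hb _).trans_eq ?_
    simp only [Function.comp_apply]
    rw [← LinearIsometryEquiv.map_sub, LinearIsometryEquiv.norm_map]

/-- The Lipschitz bound is used for `r ≤ 1` and the uniform bound for `r ≥ 1`. -/
theorem rpow_interpolation {L r t β : ℝ} (hr : 0 ≤ r) (hβ : 0 < β) (hβ1 : β ≤ 1) (hL : 0 ≤ L)
    (h1 : t ≤ L * r) (h2 : t ≤ 2 * L) : t ≤ 2 * L * r ^ β := by
  rcases le_total r 1 with h | h
  · have : r ≤ r ^ β := by
      rcases hr.eq_or_lt with rfl | h0
      · exact Real.rpow_nonneg le_rfl _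
      · simpa using Real.rpow_le_rpow_of_exponent_ge h0 h hβ1
    nlinarith [mul_le_mul_of_nonneg_left this hL, mul_nonneg hL (Real.rpow_nonneg hr β)]
  · have : 1 ≤ r ^ β := Real.one_le_rpow h hβ.le
    nlinarith

/-- Derivatives below the top order are bounded and Lipschitz, hence `β`-Hölder by interpolation.
The condition `2 * L ≤ M` leaves room for the constant lost there. -/
theorem holderReg_of_iteratedFDeriv {β L M : ℝ} (hβ : 0 < β) (hβ1 : β ≤ 1) (hL : 0 ≤ L)
    (hM : 2 * L ≤ M) (n : ℕ) {h : Space d → ℝ} (hh : ContDiff ℝ n h)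
    (hb : ∀ j ≤ n, ∀ x, ‖iteratedFDeriv ℝ j h x‖ ≤ L)
    (hd : ∀ x y, ‖iteratedFDeriv ℝ n h x - iteratedFDeriv ℝ n h y‖ ≤ M * ‖x - y‖ ^ β) :
    HolderReg β M n h := by
  have hLM : L ≤ M := by linarith
  induction n generalizing h with
  | zero =>
    refine ⟨fun x => ?_, fun x y => ?_⟩
    · have := hb 0 le_rfl x
      rw [norm_iteratedFDeriv_zero] at this
      exact this.trans hLM
    · have := hd x y
      simp only [iteratedFDeriv_zero_eq_comp, Function.comp_apply] at this
      rwa [← LinearIsometryEquiv.map_sub, LinearIsometryEquiv.norm_map] at this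
  | succ n ih =>
    have h1 : ContDiff ℝ 1 h := hh.of_le (by exact_mod_cast Nat.le_add_left 1 n)
    have hn : ContDiff ℝ n h := hh.of_le (by exact_mod_cast Nat.le_succ n)
    refine ⟨h1, fun x => ?_, fun x => ?_, ?_, fun l => ?_⟩
    · have := hb 0 (Nat.zero_le _) x
      rw [norm_iteratedFDeriv_zero] at this
      exact this.trans hLM
    · have := hb 1 (Nat.le_add_left 1 n) x
      rw [← norm_iteratedFDeriv_fderiv, norm_iteratedFDeriv_zero] at this
      exact this.trans hLM
    · refine ih hn (fun j hj => hb j (hj.trans (Nat.le_succ n))) fun x y => ?_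
      refine (rpow_interpolation (norm_nonneg _) hβ hβ1 hL ?_ ?_).trans
        (mul_le_mul_of_nonneg_right hM (Real.rpow_nonneg (norm_nonneg _) _))
      · refine Convex.norm_image_sub_le_of_norm_fderiv_le (𝕜 := ℝ) (s := univ) (fun z _ => ?_)
          (fun z _ => ?_) convex_univ (mem_univ y) (mem_univ x)
        · exact (hh.differentiable_iteratedFDeriv (by exact_mod_cast Nat.lt_succ_self n)) z
        · rw [norm_fderiv_iteratedFDeriv]
          exact hb _ le_rfl z
      · rw [two_mul]
        exact (norm_sub_le _ _).trans (add_le_add (hb n (Nat.le_succ n) x) (hb n (Nat.le_succ n) y))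
    · have hp : ContDiff ℝ n (pdf l h) := by
        rw [Nat.cast_add, Nat.cast_one, contDiff_succ_iff_fderiv] at hh
        exact hh.2.2.clm_apply contDiff_const
      exact ih hp (fun j hj x => (norm_iteratedFDeriv_pdf_sub_le hh l hj x x).1.trans
          (hb (j + 1) (Nat.succ_le_succ hj) x))
        fun x y => (norm_iteratedFDeriv_pdf_sub_le hh l le_rfl x y).2.trans (hd x y)

end ParabolicSystem
end

/-! ### Fourier symbols of the Sobolev forms. -/

noncomputable section
namespace ParabolicSystem
set_option linter.unusedSectionVars false
open MeasureTheory Set Filter Topology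
open scoped SchwartzMap ENNReal LineDeriv FourierTransform

variable {d d₁ : ℕ}

/-- The symbol of `1 - Δ`. -/
def br (ξ : Space d) : ℝ := 1 + ‖(2 * Real.pi) • ξ‖ ^ 2

theorem one_le_br (ξ : Space d) : 1 ≤ br ξ := le_add_of_nonneg_right (sq_nonneg _)

theorem br_pos (ξ : Space d) : 0 < br ξ := one_pos.trans_le (one_le_br ξ)

theorem continuous_br : Continuous (br : Space d → ℝ) := by unfold br; fun_prop

theorem br_eq_sum (ξ : Space d) : br ξ = 1 + ∑ l, (2 * Real.pi * ξ l) ^ 2 := by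
  rw [br, EuclideanSpace.norm_sq_eq]
  simp [Real.norm_eq_abs, mul_pow]

theorem besselSymbol_eq (s : ℝ) (ξ : Space d) : besselSymbol d s ξ = br ξ ^ (s / 2) := rfl

theorem besselSymbol_pos (s : ℝ) (ξ : Space d) : 0 < besselSymbol d s ξ :=
  Real.rpow_pos_of_pos (br_pos ξ) _

theorem besselSymbol_add (s r : ℝ) (ξ : Space d) :
    besselSymbol d (s + r) ξ = besselSymbol d s ξ * besselSymbol d r ξ := by
  rw [besselSymbol_eq, besselSymbol_eq, besselSymbol_eq, ← Real.rpow_add (br_pos ξ), add_div]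

theorem besselSymbol_zero (ξ : Space d) : besselSymbol d 0 ξ = 1 := by
  rw [besselSymbol_eq, zero_div, Real.rpow_zero]

theorem besselSymbol_sq (s : ℝ) (ξ : Space d) : besselSymbol d s ξ ^ 2 = br ξ ^ s := by
  rw [besselSymbol_eq, ← Real.rpow_natCast, ← Real.rpow_mul (br_pos ξ).le]
  congr 1
  push_cast
  ring

/-- The operator `(1 - Δ)^{s/2}` on Schwartz functions. -/
def bs (s : ℝ) : 𝓢(Space d, ℂ) →L[ℂ] 𝓢(Space d, ℂ) :=
  SchwartzMap.fourierMultiplierCLM ℂ (fun ξ : Space d => (besselSymbol d s ξ : ℂ))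

theorem hat_multiplier {g : Space d → ℂ} (hg : g.HasTemperateGrowth) (f : 𝓢(Space d, ℂ))
    (ξ : Space d) : 𝓕 (SchwartzMap.fourierMultiplierCLM ℂ g f) ξ = g ξ * 𝓕 f ξ := by
  rw [SchwartzMap.fourierMultiplierCLM_apply, FourierTransform.fourier_fourierInv_eq,
    SchwartzMap.smulLeftCLM_apply_apply hg, smul_eq_mul]

theorem hat_bs (s : ℝ) (f : 𝓢(Space d, ℂ)) (ξ : Space d) :
    𝓕 (bs s f) ξ = besselSymbol d s ξ * 𝓕 f ξ :=
  hat_multiplier (besselSymbol_hasTemperateGrowth d s) f ξ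

theorem hat_pd (l : Fin d) (f : 𝓢(Space d, ℂ)) (ξ : Space d) :
    𝓕 (pd l f) ξ = 2 * Real.pi * Complex.I * ξ l * 𝓕 f ξ := by
  rw [pd_eq_fourierMultiplier, FourierTransform.fourier_smul, smul_apply,
    hat_multiplier (hasTemperateGrowth_coord l), smul_eq_mul]
  ring

theorem hat_ext {f g : 𝓢(Space d, ℂ)} (h : ∀ ξ, 𝓕 f ξ = 𝓕 g ξ) : f = g := by
  have h1 : (𝓕 f : 𝓢(Space d, ℂ)) = 𝓕 g := SchwartzMap.ext h
  have h2 := congrArg (fun u : 𝓢(Space d, ℂ) => (𝓕⁻ u : 𝓢(Space d, ℂ))) h1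
  simpa only [FourierTransform.fourierInv_fourier_eq] using h2

theorem bs_bs (s r : ℝ) (f : 𝓢(Space d, ℂ)) : bs s (bs r f) = bs (s + r) f :=
  hat_ext fun ξ => by
    rw [hat_bs, hat_bs, hat_bs, besselSymbol_add]
    push_cast
    ring

theorem bs_zero (f : 𝓢(Space d, ℂ)) : bs 0 f = f :=
  hat_ext fun ξ => by rw [hat_bs, besselSymbol_zero, Complex.ofReal_one, one_mul]

/-- The symbol of the difference operator. -/
def dsym (h ξ : Space d) : ℂ := Complex.exp (Complex.I * (2 * Real.pi * inner ℝ h ξ : ℝ)) - 1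

theorem hat_diff (h : Space d) (f : 𝓢(Space d, ℂ)) (ξ : Space d) :
    𝓕 (diff h f) ξ = dsym h ξ * 𝓕 f ξ := by
  have h1 : 𝓕 (SchwartzMap.compSubConstCLM ℂ (-h) f) ξ
      = Complex.exp (Complex.I * (2 * Real.pi * inner ℝ h ξ : ℝ)) * 𝓕 f ξ := by
    have h2 := congrFun (VectorFourier.fourierIntegral_comp_add_right Real.fourierChar
      (volume : Measure (Space d)) (innerₗ (Space d)) f h) ξ
    have e : ((SchwartzMap.compSubConstCLM ℂ (-h) f : 𝓢(Space d, ℂ)) : Space d → ℂ)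
        = (f : Space d → ℂ) ∘ fun v => v + h := by
      funext x
      simp
    rw [SchwartzMap.fourier_coe, SchwartzMap.fourier_coe, e]
    refine h2.trans ?_
    rw [Circle.smul_def, Real.fourierChar_apply, smul_eq_mul, mul_comm Complex.I]
    rfl
  rw [dsym, sub_mul, one_mul, ← h1, diff, sub_apply, sub_eq_add_neg,
    FourierTransform.fourier_add, sub_eq_add_neg]
  simp

theorem inner_J_hat (f g : 𝓢(Space d, ℂ)) :
    inner ℂ (J f) (J g) = ∫ ξ, starRingEnd ℂ (𝓕 f ξ) * 𝓕 g ξ := by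
  rw [← inner_J]
  rw [← Lp.inner_fourier_eq, J_apply, J_apply, J_apply, J_apply, SchwartzMap.toLp_fourier_eq,
    SchwartzMap.toLp_fourier_eq]

theorem integrable_hat (f g : 𝓢(Space d, ℂ)) :
    Integrable fun ξ => starRingEnd ℂ (𝓕 f ξ) * 𝓕 g ξ := integrable_conj_mul_schwartz _ _

variable (w : Weights)

/-- The symbol of `Q 0`. -/
def msym (ξ : Space d) : ℝ :=
  1 + ∑ l, ∑ k ∈ Finset.range w.K, w.wt k * ‖dsym (dyadicStep l k) ξ‖ ^ 2

theorem continuous_dsym (h : Space d) : Continuous (dsym h) := by unfold dsym; fun_prop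

theorem continuous_msym : Continuous (msym w : Space d → ℝ) := by
  unfold msym
  have := continuous_dsym (d := d)
  fun_prop

theorem one_le_msym (ξ : Space d) : 1 ≤ msym w ξ :=
  le_add_of_nonneg_right (Finset.sum_nonneg fun _ _ => Finset.sum_nonneg fun k _ =>
    mul_nonneg (w.wt_nonneg k) (sq_nonneg _))

theorem conj_hat_diff (h : Space d) (f g : 𝓢(Space d, ℂ)) (ξ : Space d) :
    starRingEnd ℂ (𝓕 (diff h f) ξ) * 𝓕 (diff h g) ξ
      = ((‖dsym h ξ‖ ^ 2 : ℝ) : ℂ) * (starRingEnd ℂ (𝓕 f ξ) * 𝓕 g ξ) := by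
  rw [hat_diff, hat_diff, map_mul, Complex.ofReal_pow, ← Complex.conj_mul']
  ring

theorem conj_hat_pd (l : Fin d) (f g : 𝓢(Space d, ℂ)) (ξ : Space d) :
    starRingEnd ℂ (𝓕 (pd l f) ξ) * 𝓕 (pd l g) ξ
      = (((2 * Real.pi * ξ l) ^ 2 : ℝ) : ℂ) * (starRingEnd ℂ (𝓕 f ξ) * 𝓕 g ξ) := by
  rw [hat_pd, hat_pd]
  simp only [map_mul, Complex.conj_ofReal, Complex.conj_I, map_ofNat]
  push_cast
  linear_combination (-(2 * Real.pi * ξ l) ^ 2 * (starRingEnd ℂ (𝓕 f ξ) * 𝓕 g ξ)) * Complex.I_sq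

/-- Plancherel: each recursion step multiplies the symbol by `1 + ∑ (2π ξ_l)²`, which is `br`. -/
theorem Q_eq_integral (n : ℕ) (f g : 𝓢(Space d, ℂ)) :
    Integrable (fun ξ => ((msym w ξ * br ξ ^ n : ℝ) : ℂ) * (starRingEnd ℂ (𝓕 f ξ) * 𝓕 g ξ)) ∧
    Q w n f g = ∫ ξ, ((msym w ξ * br ξ ^ n : ℝ) : ℂ) * (starRingEnd ℂ (𝓕 f ξ) * 𝓕 g ξ) := by
  induction n generalizing f g with
  | zero =>
    have e : ∀ ξ, ((msym w ξ * br ξ ^ 0 : ℝ) : ℂ) * (starRingEnd ℂ (𝓕 f ξ) * 𝓕 g ξ)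
        = starRingEnd ℂ (𝓕 f ξ) * 𝓕 g ξ + ∑ l, ∑ k ∈ Finset.range w.K, (w.wt k : ℂ)
          * (starRingEnd ℂ (𝓕 (diff (dyadicStep l k) f) ξ) * 𝓕 (diff (dyadicStep l k) g) ξ) := by
      intro ξ
      simp only [conj_hat_diff, msym, pow_zero, mul_one]
      push_cast
      rw [add_mul, one_mul, Finset.sum_mul]
      simp only [Finset.sum_mul, mul_assoc]
    have h2 : ∀ l, ∀ k, Integrable fun ξ => (w.wt k : ℂ)
        * (starRingEnd ℂ (𝓕 (diff (dyadicStep l k) f) ξ) * 𝓕 (diff (dyadicStep l k) g) ξ) :=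
      fun l k => (integrable_hat _ _).const_mul _
    have h3 : ∀ l, Integrable fun ξ => ∑ k ∈ Finset.range w.K, (w.wt k : ℂ)
        * (starRingEnd ℂ (𝓕 (diff (dyadicStep l k) f) ξ) * 𝓕 (diff (dyadicStep l k) g) ξ) :=
      fun l => integrable_finsetSum _ fun k _ => h2 l k
    simp only [e]
    refine ⟨(integrable_hat f g).add (integrable_finsetSum _ fun l _ => h3 l), ?_⟩
    rw [integral_add (integrable_hat f g) (integrable_finsetSum _ fun l _ => h3 l),
      integral_finsetSum _ fun l _ => h3 l]
    simp only [Q, inner_J_hat]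
    congr 1
    refine Finset.sum_congr rfl fun l _ => ?_
    rw [integral_finsetSum _ fun k _ => h2 l k]
    exact Finset.sum_congr rfl fun k _ => (integral_const_mul _ _).symm
  | succ n ih =>
    have e : ∀ ξ, ((msym w ξ * br ξ ^ (n + 1) : ℝ) : ℂ) * (starRingEnd ℂ (𝓕 f ξ) * 𝓕 g ξ)
        = ((msym w ξ * br ξ ^ n : ℝ) : ℂ) * (starRingEnd ℂ (𝓕 f ξ) * 𝓕 g ξ)
          + ∑ l, ((msym w ξ * br ξ ^ n : ℝ) : ℂ)
            * (starRingEnd ℂ (𝓕 (pd l f) ξ) * 𝓕 (pd l g) ξ) := by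
      intro ξ
      simp only [conj_hat_pd]
      rw [← Finset.mul_sum, ← Finset.sum_mul, pow_succ, br_eq_sum]
      push_cast
      ring
    have h3 := fun l => (ih (pd l f) (pd l g)).1
    simp only [e]
    refine ⟨(ih f g).1.add (integrable_finsetSum _ fun l _ => h3 l), ?_⟩
    rw [integral_add (ih f g).1 (integrable_finsetSum _ fun l _ => h3 l),
      integral_finsetSum _ fun l _ => h3 l, Q, (ih f g).2]
    congr 1
    exact Finset.sum_congr rfl fun l _ => (ih _ _).2

theorem conj_mul_self_re (z : ℂ) : starRingEnd ℂ z * z = ((‖z‖ ^ 2 : ℝ) : ℂ) := by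
  rw [Complex.conj_mul', Complex.ofReal_pow]

theorem qn_eq_integral (n : ℕ) (f : 𝓢(Space d, ℂ)) :
    Integrable (fun ξ => msym w ξ * br ξ ^ n * ‖𝓕 f ξ‖ ^ 2) ∧
    qn w n f = ∫ ξ, msym w ξ * br ξ ^ n * ‖𝓕 f ξ‖ ^ 2 := by
  have h := Q_eq_integral w n f f
  simp only [conj_mul_self_re, ← Complex.ofReal_mul] at h
  have h1 : Integrable (fun ξ => msym w ξ * br ξ ^ n * ‖𝓕 f ξ‖ ^ 2) := by
    refine h.1.re.congr (Eventually.of_forall fun ξ => ?_)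
    exact Complex.ofReal_re _
  refine ⟨h1, ?_⟩
  rw [qn, h.2, integral_complex_ofReal, Complex.ofReal_re]

/-- The symbol of the lower order form. -/
def lsym : ℕ → Space d → ℝ
  | 0, _ => w.S
  | n + 1, ξ => lsym n ξ * br ξ + msym w ξ * br ξ ^ n

theorem norm_hat_pd_sq (l : Fin d) (f : 𝓢(Space d, ℂ)) (ξ : Space d) :
    ‖𝓕 (pd l f) ξ‖ ^ 2 = (2 * Real.pi * ξ l) ^ 2 * ‖𝓕 f ξ‖ ^ 2 := by
  have := conj_hat_pd l f f ξ
  rw [conj_mul_self_re, conj_mul_self_re] at this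
  exact_mod_cast this

theorem norm_J_sq_hat (f : 𝓢(Space d, ℂ)) :
    Integrable (fun ξ => ‖𝓕 f ξ‖ ^ 2) ∧ ‖J f‖ ^ 2 = ∫ ξ, ‖𝓕 f ξ‖ ^ 2 := by
  have h := integrable_hat f f
  have h2 := inner_J_hat f f
  simp only [conj_mul_self_re] at h h2
  have h1 : Integrable (fun ξ => ‖𝓕 f ξ‖ ^ 2) := by
    refine h.re.congr (Eventually.of_forall fun ξ => ?_)
    exact Complex.ofReal_re _
  refine ⟨h1, ?_⟩
  rw [← inner_self_eq_norm_sq (𝕜 := ℂ), h2, integral_complex_ofReal]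
  exact Complex.ofReal_re _

theorem lo_eq_integral (n : ℕ) (f : 𝓢(Space d, ℂ)) :
    Integrable (fun ξ => lsym w n ξ * ‖𝓕 f ξ‖ ^ 2) ∧
    lo w n f = ∫ ξ, lsym w n ξ * ‖𝓕 f ξ‖ ^ 2 := by
  induction n generalizing f with
  | zero =>
    refine ⟨(norm_J_sq_hat f).1.const_mul _, ?_⟩
    rw [lo, (norm_J_sq_hat f).2, ← integral_const_mul]
    rfl
  | succ n ih =>
    have e : ∀ ξ, lsym w (n + 1) ξ * ‖𝓕 f ξ‖ ^ 2 = lsym w n ξ * ‖𝓕 f ξ‖ ^ 2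
        + ∑ l, lsym w n ξ * ‖𝓕 (pd l f) ξ‖ ^ 2 + msym w ξ * br ξ ^ n * ‖𝓕 f ξ‖ ^ 2 := by
      intro ξ
      simp only [norm_hat_pd_sq]
      rw [← Finset.mul_sum, ← Finset.sum_mul, lsym]
      nth_rw 1 [br_eq_sum]
      ring
    have h3 := fun l => (ih (pd l f)).1
    have h4 := (ih f).1.add (integrable_finsetSum Finset.univ fun l _ => h3 l)
    simp only [e]
    refine ⟨h4.add (qn_eq_integral w n f).1, ?_⟩
    refine Eq.trans ?_ (integral_add h4 (qn_eq_integral w n f).1).symm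
    rw [lo, (qn_eq_integral w n f).2, (ih f).2, Finset.sum_congr rfl fun l _ => (ih (pd l f)).2,
      ← integral_finsetSum _ fun l _ => h3 l,
      ← integral_add (ih f).1 (integrable_finsetSum Finset.univ fun l _ => h3 l)]
    rfl

/-- The recursion solved: `lsym` is `S br^n` plus `n` times `msym br^{n-1}`. The extra factor `br`
avoids the exponent `n - 1`. As `msym` has order `br^σ`, both terms are of lower order than
`br^{n+σ}`, except the first when `σ = 0`; for the weights used then, `S` is zero. -/
theorem lsym_mul_br (n : ℕ) (ξ : Space d) :
    lsym w n ξ * br ξ = w.S * br ξ ^ (n + 1) + n * (msym w ξ * br ξ ^ n) := by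
  induction n with
  | zero => simp [lsym]
  | succ n ih =>
    rw [lsym, add_mul, ih]
    push_cast
    ring

end ParabolicSystem
end

/-! ### Passage to the limit in the number of dyadic steps. -/

noncomputable section
namespace ParabolicSystem
set_option linter.unusedSectionVars false
open MeasureTheory Set Filter Topology
open scoped SchwartzMap ENNReal LineDeriv FourierTransform

variable {d d₁ : ℕ}

theorem norm_bs_sq (r : ℝ) (f : 𝓢(Space d, ℂ)) :
    Integrable (fun ξ => br ξ ^ r * ‖𝓕 f ξ‖ ^ 2) ∧ ‖J (bs r f)‖ ^ 2 = ∫ ξ, br ξ ^ r * ‖𝓕 f ξ‖ ^ 2 := by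
  have h := norm_J_sq_hat (bs r f)
  have e : ∀ ξ, ‖𝓕 (bs r f) ξ‖ ^ 2 = br ξ ^ r * ‖𝓕 f ξ‖ ^ 2 := fun ξ => by
    rw [hat_bs, norm_mul, mul_pow, Complex.norm_real, Real.norm_of_nonneg (besselSymbol_pos r ξ).le,
      besselSymbol_sq]
  simpa only [e] using h

theorem sum_norm_bs_pd_sq (r : ℝ) (f : 𝓢(Space d, ℂ)) :
    ∑ l, ‖J (bs r (pd l f))‖ ^ 2 = ‖J (bs (r + 1) f)‖ ^ 2 - ‖J (bs r f)‖ ^ 2 := by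
  have h1 := norm_bs_sq (r + 1) f
  have h2 := norm_bs_sq r f
  rw [h1.2, h2.2, ← integral_sub h1.1 h2.1,
    Finset.sum_congr rfl fun l _ => (norm_bs_sq r (pd l f)).2,
    ← integral_finsetSum _ fun l _ => (norm_bs_sq r (pd l f)).1]
  congr 1
  funext ξ
  simp only [norm_hat_pd_sq]
  rw [← Finset.mul_sum, ← Finset.sum_mul, Real.rpow_add (br_pos ξ), Real.rpow_one]
  have := br_eq_sum ξ
  linear_combination (br ξ ^ r * ‖𝓕 f ξ‖ ^ 2) * -this

variable (d) in
/-- Weights whose forms converge to a form equivalent to the square of the norm of order `σ`. -/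
structure WeightFamily (σ : ℝ) where
  w : ℕ → Weights
  m : Space d → ℝ
  c₀ : ℝ
  C₀ : ℝ
  S₀ : ℝ
  c₀_pos : 0 < c₀
  tendsto : ∀ ξ, Tendsto (fun K => msym (w K) ξ) atTop (𝓝 (m ξ))
  upper : ∀ K (ξ : Space d), msym (w K) ξ ≤ C₀ * br ξ ^ σ
  lower : ∀ ξ, c₀ * br ξ ^ σ ≤ m ξ
  S_le : ∀ K, (w K).S ≤ S₀
  S_zero : σ = 0 → S₀ = 0

namespace WeightFamily

variable {σ : ℝ} (W : WeightFamily d σ)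

theorem S₀_nonneg : 0 ≤ W.S₀ := (W.w 0).S_nonneg.trans (W.S_le 0)

theorem m_le (ξ : Space d) : W.m ξ ≤ W.C₀ * br ξ ^ σ :=
  le_of_tendsto (W.tendsto ξ) (Eventually.of_forall fun K => W.upper K ξ)

theorem c₀_le_C₀ : W.c₀ ≤ W.C₀ :=
  le_of_mul_le_mul_right ((W.lower 0).trans (W.m_le 0)) (Real.rpow_pos_of_pos (br_pos _) σ)

theorem C₀_pos : 0 < W.C₀ := W.c₀_pos.trans_le W.c₀_le_C₀

theorem measurable_m : Measurable W.m :=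
  measurable_of_tendsto_metrizable (fun K => (continuous_msym (W.w K)).measurable)
    (tendsto_pi_nhds.2 W.tendsto)

/-- The symbol of the equivalent inner product. -/
def ρ (ξ : Space d) : ℝ := W.m ξ * br ξ ^ (-σ)

theorem rpow_mul_rpow_neg (ξ : Space d) (σ : ℝ) : br ξ ^ σ * br ξ ^ (-σ) = 1 := by
  rw [← Real.rpow_add (br_pos ξ), add_neg_cancel, Real.rpow_zero]

theorem c₀_le_ρ (ξ : Space d) : W.c₀ ≤ W.ρ ξ := by
  have := mul_le_mul_of_nonneg_right (W.lower ξ) (Real.rpow_nonneg (br_pos ξ).le (-σ))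
  rwa [mul_assoc, rpow_mul_rpow_neg, mul_one] at this

theorem ρ_le_C₀ (ξ : Space d) : W.ρ ξ ≤ W.C₀ := by
  have := mul_le_mul_of_nonneg_right (W.m_le ξ) (Real.rpow_nonneg (br_pos ξ).le (-σ))
  rwa [mul_assoc, rpow_mul_rpow_neg, mul_one] at this

theorem ρ_pos (ξ : Space d) : 0 < W.ρ ξ := W.c₀_pos.trans_le (W.c₀_le_ρ ξ)

theorem measurable_ρ : Measurable W.ρ :=
  W.measurable_m.mul (continuous_br.measurable.pow_const _)

theorem memLp_ρ : MemLp (fun ξ => (W.ρ ξ : ℂ)) ⊤ (volume : Measure (Space d)) :=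
  memLp_top_of_bound' (Complex.measurable_ofReal.comp W.measurable_ρ).aestronglyMeasurable W.C₀
    fun ξ => by
      rw [Complex.norm_real, Real.norm_of_nonneg (W.ρ_pos ξ).le]
      exact W.ρ_le_C₀ ξ

theorem qn_le (n K : ℕ) (f : 𝓢(Space d, ℂ)) : qn (W.w K) n f ≤ W.C₀ * ‖J (bs (n + σ) f)‖ ^ 2 := by
  rw [(qn_eq_integral (W.w K) n f).2, (norm_bs_sq _ f).2, ← integral_const_mul]
  refine integral_mono (qn_eq_integral (W.w K) n f).1 ((norm_bs_sq _ f).1.const_mul _) fun ξ => ?_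
  have h := W.upper K ξ
  have h2 : br ξ ^ ((n : ℝ) + σ) = br ξ ^ σ * br ξ ^ n := by
    rw [add_comm, Real.rpow_add (br_pos ξ), Real.rpow_natCast]
  change _ ≤ W.C₀ * (br ξ ^ ((n : ℝ) + σ) * ‖𝓕 f ξ‖ ^ 2)
  rw [h2, ← mul_assoc, ← mul_assoc]
  have := (br_pos ξ).le
  gcongr

theorem inner_fm_ρ (f g : 𝓢(Space d, ℂ)) : inner ℂ (J f) (fm (fun ξ => (W.ρ ξ : ℂ)) (J g))
    = ∫ ξ, (W.ρ ξ : ℂ) * (starRingEnd ℂ (𝓕 f ξ) * 𝓕 g ξ) := by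
  rw [← Lp.inner_fourier_eq, fourier_fm, inner_mulOp W.memLp_ρ, J_apply, J_apply,
    SchwartzMap.toLp_fourier_eq, SchwartzMap.toLp_fourier_eq]
  refine integral_congr_ae ?_
  filter_upwards [SchwartzMap.coeFn_toLp (𝓕 f) 2 volume, SchwartzMap.coeFn_toLp (𝓕 g) 2 volume]
    with ξ h1 h2
  rw [h1, h2]

/-- Dominated convergence on the Fourier side, with the uniform bound `upper` as majorant. The limit
is the `H^{n+σ}` inner product modified by the bounded symbol `ρ = m br^{-σ}`. -/
theorem tendsto_Q (n : ℕ) (f g : 𝓢(Space d, ℂ)) :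
    Tendsto (fun K => Q (W.w K) n f g) atTop
      (𝓝 (inner ℂ (J (bs (n + σ) f)) (fm (fun ξ => (W.ρ ξ : ℂ)) (J (bs (n + σ) g))))) := by
  have hr : ∀ ξ : Space d, br ξ ^ ((n : ℝ) + σ) = br ξ ^ n * br ξ ^ σ := fun ξ => by
    rw [Real.rpow_add (br_pos ξ), Real.rpow_natCast]
  have hb : ∀ ξ, starRingEnd ℂ (𝓕 (bs (n + σ) f) ξ) * 𝓕 (bs (n + σ) g) ξ
      = ((br ξ ^ n * br ξ ^ σ : ℝ) : ℂ) * (starRingEnd ℂ (𝓕 f ξ) * 𝓕 g ξ) := fun ξ => by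
    rw [hat_bs, hat_bs, ← hr, ← besselSymbol_sq, map_mul, Complex.conj_ofReal]
    push_cast
    ring
  rw [inner_fm_ρ]
  simp only [(Q_eq_integral _ n f g).2]
  refine tendsto_integral_of_dominated_convergence
    (fun ξ => W.C₀ * ‖starRingEnd ℂ (𝓕 (bs (n + σ) f) ξ) * 𝓕 (bs (n + σ) g) ξ‖)
    (fun K => (Q_eq_integral (W.w K) n f g).1.1) ((integrable_hat _ _).norm.const_mul _)
    (fun K => Eventually.of_forall fun ξ => ?_) (Eventually.of_forall fun ξ => ?_)
  · have h0 := (br_pos ξ).le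
    have h1 := Real.rpow_nonneg h0 σ
    have h2 := W.upper K ξ
    have h3 := zero_le_one.trans (one_le_msym (W.w K) ξ)
    rw [hb, norm_mul, norm_mul ((br ξ ^ n * br ξ ^ σ : ℝ) : ℂ), Complex.norm_real, Complex.norm_real,
      Real.norm_of_nonneg (by positivity), Real.norm_of_nonneg (by positivity), ← mul_assoc]
    refine mul_le_mul_of_nonneg_right ?_ (norm_nonneg _)
    rw [mul_left_comm, mul_comm (msym _ _)]
    exact mul_le_mul_of_nonneg_left h2 (by positivity)
  · have e : (W.ρ ξ : ℂ) * (starRingEnd ℂ (𝓕 (bs (n + σ) f) ξ) * 𝓕 (bs (n + σ) g) ξ)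
        = ((W.m ξ * br ξ ^ n : ℝ) : ℂ) * (starRingEnd ℂ (𝓕 f ξ) * 𝓕 g ξ) := by
      rw [hb, ← mul_assoc, ← Complex.ofReal_mul]
      congr 2
      rw [ρ]
      have := rpow_mul_rpow_neg ξ σ
      linear_combination (W.m ξ * br ξ ^ n) * this
    rw [e]
    exact (((Complex.continuous_ofReal.tendsto _).comp
      ((W.tendsto ξ).mul_const (br ξ ^ n))).mul_const _)

theorem le_re_inner_ρ (f : 𝓢(Space d, ℂ)) :
    W.c₀ * ‖J f‖ ^ 2 ≤ (inner ℂ (J f) (fm (fun ξ => (W.ρ ξ : ℂ)) (J f))).re := by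
  have h := re_inner_fm_mono (g := fun _ => W.c₀) (h := W.ρ) (memLp_top_const _) W.memLp_ρ W.c₀_le_ρ (J f)
  rw [fm_const, inner_smul_right, inner_self_eq_norm_sq_to_K, Complex.re_ofReal_mul,
    ← RCLike.ofReal_pow] at h
  exact h

theorem tendsto_qn (n : ℕ) (f : 𝓢(Space d, ℂ)) :
    Tendsto (fun K => qn (W.w K) n f) atTop
      (𝓝 (inner ℂ (J (bs (n + σ) f)) (fm (fun ξ => (W.ρ ξ : ℂ)) (J (bs (n + σ) f)))).re) :=
  (Complex.continuous_re.tendsto _).comp (W.tendsto_Q n f f)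

theorem mulConst_mono {s s' L : ℝ} (hs : s ≤ s') (n : ℕ) : mulConst d s L n ≤ mulConst d s' L n := by
  unfold mulConst
  gcongr

/-- Multiplication by a smooth coefficient is bounded in the norm of order `n + σ`. -/
theorem norm_mulS_le {n : ℕ} {L : ℝ} {a : Space d → ℝ} (ha : ∀ K, Reg (W.w K) L n a)
    (f : 𝓢(Space d, ℂ)) :
    W.c₀ * ‖J (bs (n + σ) (mulS a f))‖ ^ 2
      ≤ mulConst d W.S₀ L n * W.C₀ * ‖J (bs (n + σ) f)‖ ^ 2 := by
  refine (W.le_re_inner_ρ _).trans (le_of_tendsto (W.tendsto_qn n _) (Eventually.of_forall fun K => ?_))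
  refine (qn_mulS_le (ha K) f).trans ?_
  rw [mul_assoc]
  exact mul_le_mul (mulConst_mono (W.S_le K) n) (W.qn_le n K f) (qn_nonneg _ _ _)
    (mulConst_nonneg W.S₀_nonneg n)

theorem firstQ_le (n K : ℕ) (u : Fin d₁ → 𝓢(Space d, ℂ)) :
    firstQ (W.w K) n u ≤ W.C₀ * ∑ k, ‖J (bs (n + σ + 1) (u k))‖ ^ 2 := by
  rw [firstQ, Fintype.sum_prod_type_right, Finset.mul_sum]
  refine Finset.sum_le_sum fun k _ => ?_
  have h1 := W.qn_le (n + 1) K (u k)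
  have e : ((n + 1 : ℕ) : ℝ) + σ = n + σ + 1 := by push_cast; ring
  rw [qn_succ, e] at h1
  linarith [qn_nonneg (W.w K) n (u k)]

theorem coord_sq_le_br (l : Fin d) (ξ : Space d) : (2 * Real.pi * ξ l) ^ 2 ≤ br ξ := by
  rw [br_eq_sum]
  have := le_sum_univ (fun l => (2 * Real.pi * ξ l) ^ 2) (fun _ => sq_nonneg _) l
  linarith

theorem lsym_nonneg (w : Weights) (n : ℕ) (ξ : Space d) : 0 ≤ lsym w n ξ := by
  induction n with
  | zero => exact w.S_nonneg
  | succ n ih =>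
    exact add_nonneg (mul_nonneg ih (br_pos ξ).le) (mul_nonneg (zero_le_one.trans (one_le_msym w ξ))
      (pow_nonneg (br_pos ξ).le n))

/-- Two derivatives cost at most `br²`; one factor `br` enters `lsym_mul_br` and the other raises
the orders to `n + 2` and `n + σ + 1`. -/
theorem lo_pd_pd_le (n K : ℕ) (i l : Fin d) (f : 𝓢(Space d, ℂ)) :
    lo (W.w K) n (pd i (pd l f))
      ≤ W.S₀ * ‖J (bs (n + 2) f)‖ ^ 2 + n * W.C₀ * ‖J (bs (n + σ + 1) f)‖ ^ 2 := by
  rw [(lo_eq_integral (W.w K) n _).2, (norm_bs_sq _ f).2, (norm_bs_sq _ f).2, ← integral_const_mul,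
    ← integral_const_mul, ← integral_add ((norm_bs_sq _ f).1.const_mul _)
    ((norm_bs_sq _ f).1.const_mul _)]
  refine integral_mono (lo_eq_integral (W.w K) n _).1 (((norm_bs_sq _ f).1.const_mul _).add
    ((norm_bs_sq _ f).1.const_mul _)) fun ξ => ?_
  simp only [norm_hat_pd_sq]
  have h0 := br_pos ξ
  have h1 : br ξ ^ ((n : ℝ) + 2) = br ξ ^ (n + 1) * br ξ := by
    rw [← pow_succ, ← Real.rpow_natCast]
    congr 1
    push_cast
    ring
  have h2 : br ξ ^ ((n : ℝ) + σ + 1) = br ξ ^ n * br ξ ^ σ * br ξ := by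
    rw [Real.rpow_add h0, Real.rpow_add h0, Real.rpow_natCast, Real.rpow_one]
  have h3 := lsym_mul_br (W.w K) n ξ
  have h4 := lsym_nonneg (W.w K) n ξ
  have h5 : lsym (W.w K) n ξ * ((2 * Real.pi * ξ i) ^ 2 * (2 * Real.pi * ξ l) ^ 2)
      ≤ lsym (W.w K) n ξ * (br ξ * br ξ) := by
    gcongr
    · exact coord_sq_le_br i ξ
    · exact coord_sq_le_br l ξ
  have h6 : lsym (W.w K) n ξ * br ξ ≤ W.S₀ * br ξ ^ (n + 1) + n * (W.C₀ * br ξ ^ σ * br ξ ^ n) := by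
    rw [h3]
    gcongr
    · exact W.S_le K
    · exact W.upper K ξ
  have h7 := mul_le_mul_of_nonneg_right h6 h0.le
  rw [mul_assoc] at h7
  have h8 := mul_le_mul_of_nonneg_right (h5.trans h7) (sq_nonneg ‖𝓕 f ξ‖)
  rw [h1, h2]
  refine le_trans (le_of_eq ?_) (h8.trans_eq ?_) <;> ring

theorem lowerQ_le (n K : ℕ) (u : Fin d₁ → 𝓢(Space d, ℂ)) :
    lowerQ (W.w K) n u ≤ (d * d : ℝ) * (W.S₀ * ∑ k, ‖J (bs (n + 2) (u k))‖ ^ 2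
      + n * W.C₀ * ∑ k, ‖J (bs (n + σ + 1) (u k))‖ ^ 2) := by
  have h : lowerQ (W.w K) n u ≤ ∑ q : Fin d × Fin d₁ × Fin d,
      (W.S₀ * ‖J (bs (n + 2) (u q.2.1))‖ ^ 2 + n * W.C₀ * ‖J (bs (n + σ + 1) (u q.2.1))‖ ^ 2) :=
    Finset.sum_le_sum fun q _ => W.lo_pd_pd_le n K q.2.2 q.1 (u q.2.1)
  refine h.trans_eq ?_
  simp only [Fintype.sum_prod_type, Finset.sum_const, Finset.card_univ, Fintype.card_fin,
    nsmul_eq_mul, ← Finset.mul_sum, Finset.sum_add_distrib]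
  ring

/-- The symbol of the sum over all second derivatives is `(br - 1)² = br² - 2 br + 1`, and the last
term is dropped. The lower bound for `msym` is available only in the limit. -/
theorem tendsto_secondQ (n : ℕ) (u : Fin d₁ → 𝓢(Space d, ℂ)) :
    ∃ G, Tendsto (fun K => secondQ (W.w K) n u) atTop (𝓝 G) ∧
      W.c₀ * (∑ k, ‖J (bs (n + σ + 2) (u k))‖ ^ 2 - 2 * ∑ k, ‖J (bs (n + σ + 1) (u k))‖ ^ 2) ≤ G := by
  refine ⟨_, tendsto_finsetSum _ fun q _ => W.tendsto_qn n _, ?_⟩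
  refine le_trans ?_ (Finset.sum_le_sum fun q _ => W.le_re_inner_ρ _)
  rw [← Finset.mul_sum]
  refine mul_le_mul_of_nonneg_left ?_ W.c₀_pos.le
  rw [Fintype.sum_prod_type_right, Fintype.sum_prod_type, Finset.mul_sum, ← Finset.sum_sub_distrib]
  refine Finset.sum_le_sum fun k _ => ?_
  dsimp only
  have h1 : ∀ l, ∑ i, ‖J (bs (n + σ) (pd i (pd l (u k))))‖ ^ 2
      = ‖J (bs (n + σ + 1) (pd l (u k)))‖ ^ 2 - ‖J (bs (n + σ) (pd l (u k)))‖ ^ 2 :=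
    fun l => sum_norm_bs_pd_sq _ _
  rw [Finset.sum_comm, Finset.sum_congr rfl fun l _ => h1 l, Finset.sum_sub_distrib, sum_norm_bs_pd_sq,
    sum_norm_bs_pd_sq, show (n : ℝ) + σ + 2 = n + σ + 1 + 1 by ring]
  linarith [sq_nonneg ‖J (bs (n + σ) (u k))‖]

theorem commConst_mono {s s' L : ℝ} (hs : s ≤ s') (n : ℕ) :
    commConst d s L n ≤ commConst d s' L n := by
  induction n with
  | zero => exact le_rfl
  | succ n ih =>
    unfold commConst
    have := mulConst_mono (d := d) (L := L) hs n
    gcongr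

theorem lowerConst_mono {s s' L δ : ℝ} (hL : 0 ≤ L) (hδ : 0 < δ) (hs : s ≤ s') (n : ℕ) :
    lowerConst d d₁ s L δ n ≤ lowerConst d d₁ s' L δ n := by
  unfold lowerConst
  have h1 := commConst_mono (d := d) (L := L) hs n
  have h2 := commConst_nonneg (d := d) (s := s) hL n
  gcongr

/-- For `σ > 0` the term `ε x^σ` exceeds `A` beyond some `R`; below `R` a multiple of `x^{σ-1}`
does. For `σ = 0` nothing of this order can be absorbed, so `A` must vanish. -/
theorem interpolation {A ε : ℝ} (hA : 0 ≤ A) (hε : 0 < ε) (hσ : 0 ≤ σ) (h : σ = 0 → A = 0) :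
    ∃ lam, 0 ≤ lam ∧ ∀ x : ℝ, 1 ≤ x → A ≤ ε * x ^ σ + lam * x ^ (σ - 1) := by
  rcases hσ.eq_or_lt with h0 | h0
  · refine ⟨0, le_rfl, fun x hx => ?_⟩
    rw [h h0.symm, zero_mul, add_zero]
    positivity
  · have h1 := (tendsto_rpow_atTop h0).eventually_ge_atTop (A / ε)
    obtain ⟨R, hR⟩ := eventually_atTop.1 h1
    refine ⟨A * max R 1, by positivity, fun x hx => ?_⟩
    have hx0 : 0 < x := by linarith
    rcases le_total R x with h2 | h2
    · have h3 := (div_le_iff₀ hε).1 (hR x h2)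
      have : 0 ≤ A * max R 1 * x ^ (σ - 1) := by positivity
      linarith
    · have h3 : A ≤ A * max R 1 * x ^ (σ - 1) := by
        rw [mul_assoc]
        refine le_mul_of_one_le_right hA ?_
        rw [Real.rpow_sub hx0, Real.rpow_one, mul_div_assoc', le_div_iff₀ hx0, one_mul]
        calc x ≤ max R 1 * 1 := by rw [mul_one]; exact h2.trans (le_max_left _ _)
          _ ≤ max R 1 * x ^ σ := by
            gcongr
            exact Real.one_le_rpow hx hσ
      have : 0 ≤ ε * x ^ σ := by positivity
      linarith

theorem norm_interpolation {A ε : ℝ} (hA : 0 ≤ A) (hε : 0 < ε) (hσ : 0 ≤ σ) (h : σ = 0 → A = 0) (n : ℕ) :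
    ∃ lam, 0 ≤ lam ∧ ∀ f : 𝓢(Space d, ℂ), A * ‖J (bs (n + 2) f)‖ ^ 2
      ≤ ε * ‖J (bs (n + σ + 2) f)‖ ^ 2 + lam * ‖J (bs (n + σ + 1) f)‖ ^ 2 := by
  obtain ⟨lam, h1, h2⟩ := interpolation hA hε hσ h
  refine ⟨lam, h1, fun f => ?_⟩
  have i1 := norm_bs_sq (n + 2 : ℝ) f
  have i2 := norm_bs_sq (n + σ + 2 : ℝ) f
  have i3 := norm_bs_sq (n + σ + 1 : ℝ) f
  rw [i1.2, i2.2, i3.2, ← integral_const_mul, ← integral_const_mul, ← integral_const_mul,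
    ← integral_add (i2.1.const_mul _) (i3.1.const_mul _)]
  refine integral_mono (i1.1.const_mul _) ((i2.1.const_mul _).add (i3.1.const_mul _)) fun ξ => ?_
  have h0 := br_pos ξ
  have h3 := h2 (br ξ) (one_le_br ξ)
  have h4 : 0 ≤ br ξ ^ ((n : ℝ) + 2) * ‖𝓕 f ξ‖ ^ 2 := by positivity
  have h5 := mul_le_mul_of_nonneg_right h3 h4
  refine h5.trans_eq ?_
  have e1 : br ξ ^ ((n : ℝ) + σ + 2) = br ξ ^ ((n : ℝ) + 2) * br ξ ^ σ := by
    rw [← Real.rpow_add h0]; congr 1; ring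
  have e2 : br ξ ^ ((n : ℝ) + σ + 1) = br ξ ^ ((n : ℝ) + 2) * br ξ ^ (σ - 1) := by
    rw [← Real.rpow_add h0]; congr 1; ring
  simp only [e1, e2]
  ring

/-- Coercivity of the leading part for smooth coefficients, with constants that depend only on the
bounds of the coefficients. -/
theorem exists_coercive {δ η C L : ℝ} (hδ : 0 < δ) (hC : 0 ≤ C) (hL : 0 ≤ L) (hσ : 0 ≤ σ)
    (hη : Fintype.card (Idx d d₁) * η ≤ δ / 4) (n : ℕ) :
    ∃ c lam, 0 < c ∧ 0 ≤ lam ∧ ∀ a α : Fin d → Fin d → Fin d₁ → Fin d₁ → Space d → ℝ,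
      (∀ i j k r K, Reg (W.w K) L n (a i j k r)) → SmoothApprox δ η C a α →
      ∀ u : Fin d₁ → 𝓢(Space d, ℂ),
        c * ∑ k, ‖J (bs (n + σ + 2) (u k))‖ ^ 2 - lam * ∑ k, ‖J (bs (n + σ + 1) (u k))‖ ^ 2
          ≤ ∑ p : Idx d d₁, (inner ℂ (J (bs (n + σ) (pd p.1 (pd p.1 (u p.2.2.2.1)))))
            (fm (fun ξ => (W.ρ ξ : ℂ)) (J (bs (n + σ) (mulS (a p.2.1 p.2.2.1 p.2.2.2.1 p.2.2.2.2)
              (pd p.2.1 (pd p.2.2.1 (u p.2.2.2.2)))))))).re ∧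
        c * ∑ k, ‖J (bs (n + σ + 2) (u k))‖ ^ 2 - lam * ∑ k, ‖J (bs (n + σ + 1) (u k))‖ ^ 2
          ≤ ∑ p : Idx d d₁, (inner ℂ (J (bs (n + σ) (pd p.2.1 (pd p.2.2.1 (u p.2.2.2.2)))))
            (fm (fun ξ => (W.ρ ξ : ℂ)) (J (bs (n + σ) (mulS (a p.2.1 p.2.2.1 p.2.2.2.1 p.2.2.2.2)
              (pd p.1 (pd p.1 (u p.2.2.2.1)))))))).re := by
  set C1 := 4 * (Fintype.card (Idx d d₁) * C) ^ 2 / δ with hC1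
  set C2 := lowerConst d d₁ W.S₀ L δ n with hC2
  have hC1' : 0 ≤ C1 := by positivity
  have hC2' : 0 ≤ C2 := by
    have := commConst_nonneg (d := d) (s := W.S₀) hL n
    rw [hC2, lowerConst]
    positivity
  have hc0 := W.c₀_pos
  have hS := W.S₀_nonneg
  have hC0 := W.C₀_pos
  -- The term with `S₀` has order `n + 2`. It is interpolated between the orders `n + σ + 2` and `n
  -- + σ + 1`, spending half of the coefficient `δ * c₀ / 4` of the top order.
  obtain ⟨lam, hlam, hint⟩ := norm_interpolation (d := d) (A := C2 * (d * d) * W.S₀)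
    (ε := δ * W.c₀ / 8) (by positivity) (by positivity) hσ
    (fun h => by rw [W.S_zero h, mul_zero]) n
  refine ⟨δ * W.c₀ / 8, δ * W.c₀ / 2 + C1 * W.C₀ + lam + C2 * (d * d) * (n * W.C₀), by positivity,
    by positivity, fun a α ha hα u => ?_⟩
  set X := ∑ k, ‖J (bs (n + σ + 2) (u k))‖ ^ 2 with hX
  set Y := ∑ k, ‖J (bs (n + σ + 1) (u k))‖ ^ 2 with hY
  set Z := ∑ k, ‖J (bs (n + 2) (u k))‖ ^ 2 with hZ
  have hZ' : C2 * (d * d) * W.S₀ * Z ≤ δ * W.c₀ / 8 * X + lam * Y := by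
    rw [hX, hY, hZ, Finset.mul_sum, Finset.mul_sum, Finset.mul_sum, ← Finset.sum_add_distrib]
    exact Finset.sum_le_sum fun k _ => hint (u k)
  obtain ⟨G, hG, hGle⟩ := W.tendsto_secondQ n u
  have hlow : ∀ K, C1 * firstQ (W.w K) n u + lowerConst d d₁ (W.w K).S L δ n * lowerQ (W.w K) n u
      ≤ C1 * (W.C₀ * Y) + C2 * ((d * d : ℝ) * (W.S₀ * Z + n * W.C₀ * Y)) := fun K =>
    add_le_add (mul_le_mul_of_nonneg_left (W.firstQ_le n K u) hC1')
      (mul_le_mul (lowerConst_mono hL hδ (W.S_le K) n) (W.lowerQ_le n K u)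
        (Finset.sum_nonneg fun _ _ => lo_nonneg n _) hC2')
  -- The lower order terms are bounded uniformly in `K`, and the leading one converges. The argument
  -- is common to both forms.
  have key : ∀ (q : ℕ → ℝ) (B : ℝ), Tendsto q atTop (𝓝 B) →
      (∀ K, δ / 4 * secondQ (W.w K) n u - C1 * firstQ (W.w K) n u
        - lowerConst d d₁ (W.w K).S L δ n * lowerQ (W.w K) n u ≤ q K) →
      δ * W.c₀ / 8 * X - (δ * W.c₀ / 2 + C1 * W.C₀ + lam + C2 * (d * d) * (n * W.C₀)) * Y ≤ B := by
    intro q B hq hle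
    have h1 : δ / 4 * G - (C1 * (W.C₀ * Y) + C2 * ((d * d : ℝ) * (W.S₀ * Z + n * W.C₀ * Y))) ≤ B :=
      le_of_tendsto_of_tendsto' ((hG.const_mul _).sub_const _) hq fun K => by
        linarith [hle K, hlow K]
    have h2 := mul_le_mul_of_nonneg_left hGle (by positivity : 0 ≤ δ / 4)
    refine le_trans ?_ h1
    linarith
  constructor
  · exact key _ _ (tendsto_finsetSum _ fun p _ => (Complex.continuous_re.tendsto _).comp
      (W.tendsto_Q n _ _)) fun K => coercive_Q hδ hC (fun i j k r => ha i j k r K) hα hη u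
  · exact key _ _ (tendsto_finsetSum _ fun p _ => (Complex.continuous_re.tendsto _).comp
      (W.tendsto_Q n _ _)) fun K => coercive_Q_adjoint hδ hC (fun i j k r => ha i j k r K) hα hη u

end WeightFamily

end ParabolicSystem
end

/-! ### Dyadic weights of fractional order. -/

noncomputable section
namespace ParabolicSystem
set_option linter.unusedSectionVars false
open MeasureTheory Set Filter Topology
open scoped SchwartzMap ENNReal LineDeriv FourierTransform

variable {d : ℕ}

theorem pow_rpow_comm {a : ℝ} (ha : 0 ≤ a) (j : ℕ) (s : ℝ) : (a ^ j) ^ s = (a ^ s) ^ j := by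
  rw [← Real.rpow_natCast, ← Real.rpow_mul ha, mul_comm, Real.rpow_mul ha, Real.rpow_natCast]

theorem sum_geom_le {q : ℝ} (h0 : 0 ≤ q) (h1 : q < 1) (K : ℕ) :
    ∑ k ∈ Finset.range K, q ^ k ≤ (1 - q)⁻¹ := by
  rw [← tsum_geometric_of_lt_one h0 h1]
  exact (summable_geometric_of_lt_one h0 h1).sum_le_tsum _ fun k _ => pow_nonneg h0 k

/-- The dyadic sum equivalent to `y^{2σ}`. -/
theorem dyadic_sum_le {σ : ℝ} (h0 : 0 < σ) (h1 : σ < 1) {y : ℝ} (hy : 1 ≤ y) (K : ℕ) {t : ℕ → ℝ}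
    (ht : ∀ k, 0 ≤ t k) (ht1 : ∀ k, t k ≤ 2) (ht2 : ∀ k, t k ≤ y / 2 ^ k) :
    ∑ k ∈ Finset.range K, ((2 : ℝ) ^ k) ^ (2 * σ) * t k ^ 2
      ≤ (4 * (1 - (2 : ℝ) ^ (-(2 * σ)))⁻¹ + (1 - (2 : ℝ) ^ (2 * σ - 2))⁻¹) * y ^ (2 * σ) := by
  -- The sum is split where `2^k` passes `y`. For `k ≤ N` the bound `t k ≤ 2` gives a geometric
  -- series, summed backwards from `N`. For `k > N` the bound `t k ≤ y / 2^k` gives one with ratio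
  -- `2^{2σ-2} < 1`.
  obtain ⟨N, hN1, hN2⟩ := exists_nat_pow_near hy one_lt_two
  have hy0 : 0 < y := by linarith
  have hq1 : (2 : ℝ) ^ (-(2 * σ)) < 1 := Real.rpow_lt_one_of_one_lt_of_neg one_lt_two (by linarith)
  have hq2 : (2 : ℝ) ^ (2 * σ - 2) < 1 := Real.rpow_lt_one_of_one_lt_of_neg one_lt_two (by linarith)
  have hpos : ∀ k, 0 ≤ ((2 : ℝ) ^ k) ^ (2 * σ) * t k ^ 2 := fun k => by positivity
  have hsub : ∑ k ∈ Finset.range K, ((2 : ℝ) ^ k) ^ (2 * σ) * t k ^ 2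
      ≤ ∑ k ∈ Finset.range (N + 1 + K), ((2 : ℝ) ^ k) ^ (2 * σ) * t k ^ 2 :=
    Finset.sum_le_sum_of_subset_of_nonneg (Finset.range_mono (Nat.le_add_left _ _))
      fun k _ _ => hpos k
  rw [Finset.sum_range_add, ← Finset.sum_range_reflect _ (N + 1)] at hsub
  refine hsub.trans ?_
  rw [add_mul]
  refine add_le_add ?_ ?_
  · calc _ ≤ ∑ j ∈ Finset.range (N + 1), 4 * y ^ (2 * σ) * ((2 : ℝ) ^ (-(2 * σ))) ^ j := by
          refine Finset.sum_le_sum fun j hj => ?_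
          have hj' : j ≤ N := Nat.lt_succ_iff.1 (Finset.mem_range.1 hj)
          have e : ((2 : ℝ) ^ (N + 1 - 1 - j)) ^ (2 * σ)
              = ((2 : ℝ) ^ N) ^ (2 * σ) * ((2 : ℝ) ^ (-(2 * σ))) ^ j := by
            rw [Nat.add_sub_cancel, pow_sub₀ _ two_ne_zero hj', Real.mul_rpow (by positivity)
              (by positivity), ← inv_pow, pow_rpow_comm (by positivity) j, Real.inv_rpow zero_le_two,
              Real.rpow_neg zero_le_two]
          rw [e]
          have h2 : t (N + 1 - 1 - j) ^ 2 ≤ 4 := by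
            have := pow_le_pow_left₀ (ht _) (ht1 (N + 1 - 1 - j)) 2
            linarith
          have h3 : ((2 : ℝ) ^ N) ^ (2 * σ) ≤ y ^ (2 * σ) :=
            Real.rpow_le_rpow (by positivity) hN1 (by positivity)
          calc _ ≤ y ^ (2 * σ) * ((2 : ℝ) ^ (-(2 * σ))) ^ j * 4 := by gcongr
            _ = _ := by ring
      _ ≤ _ := by
          rw [← Finset.mul_sum]
          have := sum_geom_le (by positivity) hq1 (N + 1)
          have hy2 : 0 ≤ 4 * y ^ (2 * σ) := by positivity
          refine (mul_le_mul_of_nonneg_left this hy2).trans_eq ?_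
          ring
  · calc _ ≤ ∑ j ∈ Finset.range K, y ^ (2 * σ) * ((2 : ℝ) ^ (2 * σ - 2)) ^ j := by
          refine Finset.sum_le_sum fun j _ => ?_
          set T := (2 : ℝ) ^ (N + 1 + j) with hT
          have hT0 : 0 < T := by positivity
          have h2 : t (N + 1 + j) ^ 2 ≤ y ^ 2 * T ^ (-2 : ℝ) := by
            have := pow_le_pow_left₀ (ht _) (ht2 (N + 1 + j)) 2
            rwa [div_pow, div_eq_mul_inv, ← Real.rpow_natCast (2 ^ (N + 1 + j)),
              ← Real.rpow_neg (by positivity)] at this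
          calc T ^ (2 * σ) * t (N + 1 + j) ^ 2 ≤ T ^ (2 * σ) * (y ^ 2 * T ^ (-2 : ℝ)) := by gcongr
            _ = y ^ 2 * T ^ (2 * σ - 2) := by
                rw [sub_eq_add_neg, Real.rpow_add hT0]; ring
            _ = y ^ 2 * ((2 : ℝ) ^ (N + 1)) ^ (2 * σ - 2) * ((2 : ℝ) ^ (2 * σ - 2)) ^ j := by
                rw [hT, pow_add, Real.mul_rpow (by positivity) (by positivity),
                  pow_rpow_comm zero_le_two j, mul_assoc]
            _ ≤ y ^ 2 * y ^ (2 * σ - 2) * ((2 : ℝ) ^ (2 * σ - 2)) ^ j := by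
                refine mul_le_mul_of_nonneg_right (mul_le_mul_of_nonneg_left ?_ (by positivity))
                  (by positivity)
                exact Real.rpow_le_rpow_of_nonpos hy0 hN2.le (by linarith)
            _ = _ := by
                rw [← Real.rpow_natCast y, ← Real.rpow_add hy0]
                congr 2
                push_cast
                ring
      _ ≤ _ := by
          rw [← Finset.mul_sum, mul_comm]
          exact mul_le_mul_of_nonneg_right (sum_geom_le (by positivity) hq2 K) (by positivity)

theorem inner_dyadicStep (l : Fin d) (k : ℕ) (ξ : Space d) :
    inner ℝ (dyadicStep l k) ξ = ξ l / 2 ^ k := by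
  rw [dyadicStep, real_inner_smul_left, EuclideanSpace.inner_single_left]
  simp
  ring

theorem norm_dsym (l : Fin d) (k : ℕ) (ξ : Space d) :
    ‖dsym (dyadicStep l k) ξ‖ = 2 * |Real.sin (Real.pi * (ξ l / 2 ^ k))| := by
  rw [dsym, inner_dyadicStep, Complex.norm_exp_I_mul_ofReal_sub_one, norm_mul, Real.norm_eq_abs,
    Real.norm_eq_abs, abs_two]
  congr 3
  ring

theorem norm_dsym_le_two (l : Fin d) (k : ℕ) (ξ : Space d) : ‖dsym (dyadicStep l k) ξ‖ ≤ 2 := by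
  rw [norm_dsym]
  linarith [Real.abs_sin_le_one (Real.pi * (ξ l / 2 ^ k))]

theorem norm_dsym_le (l : Fin d) (k : ℕ) (ξ : Space d) :
    ‖dsym (dyadicStep l k) ξ‖ ≤ √(br ξ) / 2 ^ k := by
  rw [dsym, inner_dyadicStep]
  refine (Real.norm_exp_I_mul_ofReal_sub_one_le).trans ?_
  have h1 : |2 * Real.pi * ξ l| ≤ √(br ξ) := Real.abs_le_sqrt (WeightFamily.coord_sq_le_br l ξ)
  rw [Real.norm_eq_abs, mul_div_assoc', abs_div, abs_of_pos (by positivity : (0 : ℝ) < 2 ^ k)]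
  gcongr

/-- The step `2^{-(N+2)}` resolves frequencies of size `2^N`: the argument of the sine lies between
`π/4` and `π/2`, and there `sin x ≥ 2x/π`. -/
theorem one_le_norm_dsym (l : Fin d) {N : ℕ} {ξ : Space d} (h1 : (2 : ℝ) ^ N ≤ |ξ l|)
    (h2 : |ξ l| < 2 ^ (N + 1)) : 1 ≤ ‖dsym (dyadicStep l (N + 2)) ξ‖ := by
  rw [norm_dsym]
  set θ := |ξ l| / 2 ^ (N + 2) with hθ
  have e : |Real.sin (Real.pi * (ξ l / 2 ^ (N + 2)))| = |Real.sin (Real.pi * θ)| := by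
    rcases abs_choice (ξ l) with h | h
    · rw [hθ, h]
    · rw [hθ, h, neg_div, mul_neg, Real.sin_neg, abs_neg]
  have t1 : 1 / 4 ≤ θ := by
    rw [hθ, le_div_iff₀ (by positivity)]
    rw [pow_add]
    linarith
  have t2 : θ ≤ 1 / 2 := by
    rw [hθ, div_le_iff₀ (by positivity)]
    have : (2 : ℝ) ^ (N + 2) = 2 ^ (N + 1) * 2 := pow_succ _ _
    linarith
  have hpi := Real.pi_pos
  have h3 := Real.mul_le_sin (x := Real.pi * θ) (by positivity) (by nlinarith)
  have h4 : 2 / Real.pi * (Real.pi * θ) = 2 * θ := by field_simp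
  rw [e]
  linarith [le_abs_self (Real.sin (Real.pi * θ))]

/-- Dyadic weights for a fractional order `σ`, for coefficients of Hölder exponent `β`. -/
def dyadicWeights (σ β : ℝ) (K : ℕ) : Weights where
  wt k := ((2 : ℝ) ^ k) ^ (2 * σ)
  hb k := (((2 : ℝ) ^ k)⁻¹) ^ β
  K := K
  wt_nonneg k := by positivity
  hb_nonneg k := by positivity

/-- A geometric series with ratio `2^{2σ-2β}`. Its convergence is the reason for requiring more
Hölder regularity than the fractional order `σ`. -/
theorem dyadicWeights_S_le {σ β : ℝ} (h : σ < β) (K : ℕ) :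
    (dyadicWeights σ β K).S ≤ (1 - (2 : ℝ) ^ (2 * σ - 2 * β))⁻¹ := by
  have e : ∀ k : ℕ, ((2 : ℝ) ^ k) ^ (2 * σ) * ((((2 : ℝ) ^ k)⁻¹) ^ β) ^ 2
      = ((2 : ℝ) ^ (2 * σ - 2 * β)) ^ k := fun k => by
    have h2 : (0 : ℝ) < 2 ^ k := by positivity
    rw [Real.inv_rpow h2.le, ← Real.rpow_neg h2.le, ← Real.rpow_natCast (_ ^ (-β)), ← Real.rpow_mul h2.le,
      ← Real.rpow_add h2, pow_rpow_comm zero_le_two]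
    congr 2
    push_cast
    ring
  simp only [Weights.S, dyadicWeights, e]
  exact sum_geom_le (by positivity) (Real.rpow_lt_one_of_one_lt_of_neg one_lt_two (by linarith)) K

theorem msym_dyadic_mono (σ β : ℝ) (ξ : Space d) : Monotone fun K => msym (dyadicWeights σ β K) ξ := by
  intro K K' h
  refine add_le_add_right (Finset.sum_le_sum fun l _ => ?_) _
  exact Finset.sum_le_sum_of_subset_of_nonneg (Finset.range_mono h) fun k _ _ =>
    mul_nonneg ((dyadicWeights σ β K').wt_nonneg k) (sq_nonneg _)

theorem msym_dyadic_le {σ : ℝ} (β : ℝ) (h0 : 0 < σ) (h1 : σ < 1) (K : ℕ) (ξ : Space d) :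
    msym (dyadicWeights σ β K) ξ
      ≤ (1 + d * (4 * (1 - (2 : ℝ) ^ (-(2 * σ)))⁻¹ + (1 - (2 : ℝ) ^ (2 * σ - 2))⁻¹)) * br ξ ^ σ := by
  have hb := one_le_br ξ
  have hs : √(br ξ) ^ (2 * σ) = br ξ ^ σ := by
    rw [Real.sqrt_eq_rpow, ← Real.rpow_mul (br_pos ξ).le]
    congr 1
    ring
  have h2 : ∀ l, ∑ k ∈ Finset.range K, ((2 : ℝ) ^ k) ^ (2 * σ) * ‖dsym (dyadicStep l k) ξ‖ ^ 2
      ≤ _ := fun l => dyadic_sum_le h0 h1 (Real.one_le_sqrt.2 hb) K (fun k => norm_nonneg _)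
    (fun k => norm_dsym_le_two l k ξ) (fun k => norm_dsym_le l k ξ)
  have h3 := Finset.sum_le_sum fun l (_ : l ∈ Finset.univ) => h2 l
  rw [Finset.sum_const, Finset.card_univ, Fintype.card_fin, nsmul_eq_mul, hs, ← mul_assoc] at h3
  rw [add_mul, one_mul]
  exact add_le_add (Real.one_le_rpow hb h0.le) h3

/-- One term of the sum suffices, the one whose step matches the size of `ξ l`; small frequencies
are covered by the summand `1` of `msym`. -/
theorem abs_coord_rpow_le {σ : ℝ} (β : ℝ) (h0 : 0 < σ) (l : Fin d) (ξ : Space d) :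
    ∃ K, |ξ l| ^ (2 * σ) ≤ msym (dyadicWeights σ β K) ξ := by
  rcases le_total |ξ l| 1 with h | h
  · exact ⟨0, (Real.rpow_le_one (abs_nonneg _) h (by linarith)).trans (one_le_msym _ ξ)⟩
  · obtain ⟨N, h1, h2⟩ := exists_nat_pow_near h one_lt_two
    refine ⟨N + 3, ?_⟩
    have h3 := one_le_norm_dsym l h1 h2
    have h4 : |ξ l| ^ (2 * σ) ≤ ((2 : ℝ) ^ (N + 2)) ^ (2 * σ) * ‖dsym (dyadicStep l (N + 2)) ξ‖ ^ 2 := by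
      have h5 : |ξ l| ^ (2 * σ) ≤ ((2 : ℝ) ^ (N + 2)) ^ (2 * σ) := by
        refine Real.rpow_le_rpow (abs_nonneg _) (h2.le.trans ?_) (by linarith)
        exact pow_le_pow_right₀ one_le_two (Nat.le_succ _)
      refine h5.trans (le_mul_of_one_le_right (by positivity) (one_le_pow₀ h3))
    have h6 := Finset.single_le_sum (s := Finset.range (N + 3))
      (f := fun k => ((2 : ℝ) ^ k) ^ (2 * σ) * ‖dsym (dyadicStep l k) ξ‖ ^ 2)
      (fun k _ => by positivity) (Finset.mem_range.2 (Nat.lt_succ_self (N + 2)))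
    have h7 := le_sum_univ (fun l => ∑ k ∈ Finset.range (N + 3),
      ((2 : ℝ) ^ k) ^ (2 * σ) * ‖dsym (dyadicStep l k) ξ‖ ^ 2)
      (fun l => Finset.sum_nonneg fun k _ => by positivity) l
    have h8 : msym (dyadicWeights σ β (N + 3)) ξ = 1 + ∑ l, ∑ k ∈ Finset.range (N + 3),
      ((2 : ℝ) ^ k) ^ (2 * σ) * ‖dsym (dyadicStep l k) ξ‖ ^ 2 := rfl
    rw [h8]
    linarith

theorem br_rpow_le {σ m : ℝ} (h0 : 0 < σ) (hm : 1 ≤ m) {ξ : Space d}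
    (h : ∀ l, |ξ l| ^ (2 * σ) ≤ m) : br ξ ^ σ ≤ (1 + d * (2 * Real.pi) ^ 2) ^ σ * m := by
  have hm0 : 0 ≤ m := by linarith
  have h1 : ∀ l, (2 * Real.pi * ξ l) ^ 2 ≤ (2 * Real.pi) ^ 2 * m ^ σ⁻¹ := by
    intro l
    rw [mul_pow]
    gcongr
    have h2 := Real.rpow_le_rpow (by positivity) (h l) (inv_nonneg.2 h0.le)
    rw [← Real.rpow_mul (abs_nonneg _), mul_assoc, mul_inv_cancel₀ h0.ne', mul_one,
      Real.rpow_two] at h2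
    rwa [sq_abs] at h2
  have h3 : br ξ ≤ (1 + d * (2 * Real.pi) ^ 2) * m ^ σ⁻¹ := by
    rw [br_eq_sum]
    have h4 := Finset.sum_le_sum fun l (_ : l ∈ Finset.univ) => h1 l
    rw [Finset.sum_const, Finset.card_univ, Fintype.card_fin, nsmul_eq_mul] at h4
    have h5 : 1 ≤ m ^ σ⁻¹ := Real.one_le_rpow hm (inv_nonneg.2 h0.le)
    linarith
  have h4 := Real.rpow_le_rpow (br_pos ξ).le h3 h0.le
  rwa [Real.mul_rpow (by positivity) (by positivity), ← Real.rpow_mul hm0, inv_mul_cancel₀ h0.ne',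
    Real.rpow_one] at h4

/-- The symbols increase with `K` and are bounded by the dyadic sum, so the limit is the supremum.
The lower bound comes from one matching step for each coordinate. -/
theorem exists_weightFamily (d : ℕ) {σ β : ℝ} (h0 : 0 < σ) (h1 : σ < 1) (hβ : σ < β) :
    ∃ W : WeightFamily d σ, ∀ K k, (W.w K).hb k = (((2 : ℝ) ^ k)⁻¹) ^ β := by
  have hbdd : ∀ ξ : Space d, BddAbove (range fun K => msym (dyadicWeights σ β K) ξ) := fun ξ =>
    ⟨_, by rintro _ ⟨K, rfl⟩; exact msym_dyadic_le β h0 h1 K ξ⟩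
  refine ⟨
    { w := dyadicWeights σ β
      m := fun ξ => ⨆ K, msym (dyadicWeights σ β K) ξ
      c₀ := ((1 + d * (2 * Real.pi) ^ 2) ^ σ)⁻¹
      C₀ := 1 + d * (4 * (1 - (2 : ℝ) ^ (-(2 * σ)))⁻¹ + (1 - (2 : ℝ) ^ (2 * σ - 2))⁻¹)
      S₀ := (1 - (2 : ℝ) ^ (2 * σ - 2 * β))⁻¹
      c₀_pos := by positivity
      tendsto := fun ξ => tendsto_atTop_ciSup (msym_dyadic_mono σ β ξ) (hbdd ξ)
      upper := msym_dyadic_le β h0 h1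
      lower := fun ξ => ?_
      S_le := dyadicWeights_S_le hβ
      S_zero := fun h => absurd h h0.ne' }, fun K k => rfl⟩
  rw [inv_mul_le_iff₀ (by positivity)]
  refine br_rpow_le h0 ((one_le_msym (dyadicWeights σ β 0) ξ).trans (le_ciSup (hbdd ξ) 0)) fun l => ?_
  obtain ⟨K, hK⟩ := abs_coord_rpow_le β h0 l ξ
  exact hK.trans (le_ciSup (hbdd ξ) K)

/-- The trivial weights, for integer orders. -/
def trivialWeights : Weights where
  wt _ := 0
  hb _ := 2
  K := 0
  wt_nonneg _ := le_rfl
  hb_nonneg _ := zero_le_two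

variable (d) in
/-- The weights for integer orders. -/
def trivialFamily : WeightFamily d 0 where
  w _ := trivialWeights
  m _ := 1
  c₀ := 1
  C₀ := 1
  S₀ := 0
  c₀_pos := one_pos
  tendsto ξ := by simp [msym, trivialWeights]
  upper K ξ := by simp [msym, trivialWeights]
  lower ξ := by simp
  S_le K := by simp [Weights.S, trivialWeights]
  S_zero _ := rfl

end ParabolicSystem
end

/-! ### Multiplication operators conjugated by Bessel potentials. -/

noncomputable section
namespace ParabolicSystem
set_option linter.unusedSectionVars false
open MeasureTheory Set Filter Topology
open scoped SchwartzMap ENNReal LineDeriv FourierTransform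

variable {d d₁ : ℕ}

section Hilbert

variable {H : Type*} [NormedAddCommGroup H] [InnerProductSpace ℂ H]

theorem injective_of_denseRange {K : H →L[ℂ] H} (hsymm : ∀ x y, inner ℂ (K x) y = inner ℂ x (K y))
    (hd : DenseRange K) : Function.Injective K := by
  refine (injective_iff_map_eq_zero K).2 fun x hx => ?_
  refine hd.eq_zero_of_inner_right (𝕜 := ℂ) fun y => ?_
  rw [hsymm, hx, inner_zero_right]

/-- A vector lies in the image of a ball under a symmetric operator if it does so weakly. -/
theorem exists_preimage_of_inner_le [CompleteSpace H] {K : H →L[ℂ] H}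
    (hsymm : ∀ x y, inner ℂ (K x) y = inner ℂ x (K y)) (hd : DenseRange K) {h : H} {R : ℝ}
    (hR : 0 ≤ R) (hh : ∀ θ, ‖inner ℂ h θ‖ ≤ R * ‖K θ‖) : ∃ χ, K χ = h ∧ ‖χ‖ ≤ R := by
  have hinj : Function.Injective K.toLinearMap := injective_of_denseRange hsymm hd
  let e : H ≃ₗ[ℂ] K.toLinearMap.range := LinearEquiv.ofInjective K.toLinearMap hinj
  have he : ∀ x, ((e x : K.toLinearMap.range) : H) = K x := fun x => rfl
  -- The functional sends `K θ` to `(h, θ)`. It is well defined by injectivity of `K` and bounded by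
  -- `R`; a norm-preserving extension is represented by the vector sought.
  let f : K.toLinearMap.range →ₗ[ℂ] ℂ := (innerSL ℂ h).toLinearMap ∘ₗ e.symm.toLinearMap
  have hf : ∀ x, ‖f x‖ ≤ R * ‖x‖ := fun x => by
    have h1 := hh (e.symm x)
    rw [← he, LinearEquiv.apply_symm_apply] at h1
    exact h1
  obtain ⟨g, hg1, hg2⟩ := exists_extension_norm_eq _ (f.mkContinuous R hf)
  refine ⟨(InnerProductSpace.toDual ℂ H).symm g, ?_, ?_⟩
  · refine ext_inner_right ℂ fun θ => ?_
    rw [hsymm, InnerProductSpace.toDual_symm_apply, ← he, hg1]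
    change inner ℂ h (e.symm (e θ)) = _
    rw [LinearEquiv.symm_apply_apply]
  · rw [LinearIsometryEquiv.norm_map, hg2]
    exact f.mkContinuous_norm_le hR hf

/-- Conjugation of an operator by an unbounded inverse. -/
theorem exists_conjugate [CompleteSpace H] {K A : H →L[ℂ] H}
    (hsymm : ∀ x y, inner ℂ (K x) y = inner ℂ x (K y)) (hd : DenseRange K) {C : ℝ} (hC : 0 ≤ C)
    (hA : ∀ ψ θ, ‖inner ℂ (A (K ψ)) θ‖ ≤ C * ‖ψ‖ * ‖K θ‖) :
    ∃ N : H →L[ℂ] H, (∀ ψ, K (N ψ) = A (K ψ)) ∧ ∀ ψ, ‖N ψ‖ ≤ C * ‖ψ‖ := by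
  have hinj := injective_of_denseRange hsymm hd
  choose N h1 h2 using fun ψ => exists_preimage_of_inner_le hsymm hd (by positivity) (hA ψ)
  let N' : H →ₗ[ℂ] H :=
    { toFun := N
      map_add' := fun x y => hinj (by rw [map_add, h1, h1, h1, map_add, map_add])
      map_smul' := fun c x => hinj (by
        rw [RingHom.id_apply, map_smul, h1, h1, map_smul, map_smul]) }
  exact ⟨N'.mkContinuous C h2, h1, h2⟩

end Hilbert

/-- The operator `(1 - Δ)^{-r/2}` on `L2`. -/
def pot (r : ℝ) : L2 d →L[ℂ] L2 d := fm (fun ξ => (besselSymbol d (-r) ξ : ℂ))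

theorem continuous_besselSymbol (r : ℝ) : Continuous (besselSymbol d r) := by
  have : besselSymbol d r = fun ξ => br ξ ^ (r / 2) := rfl
  rw [this]
  exact continuous_br.rpow_const fun ξ => Or.inl (br_pos ξ).ne'

theorem besselSymbol_neg_le_one {r : ℝ} (hr : 0 ≤ r) (ξ : Space d) : besselSymbol d (-r) ξ ≤ 1 :=
  Real.rpow_le_one_of_one_le_of_nonpos (one_le_br ξ) (by linarith)

theorem norm_besselSymbol_neg_le_one {r : ℝ} (hr : 0 ≤ r) (ξ : Space d) :
    ‖(besselSymbol d (-r) ξ : ℂ)‖ ≤ 1 := by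
  rw [Complex.norm_real, Real.norm_of_nonneg (besselSymbol_pos _ ξ).le]
  exact besselSymbol_neg_le_one hr ξ

theorem memLp_besselSymbol {r : ℝ} (hr : 0 ≤ r) :
    MemLp (fun ξ => (besselSymbol d (-r) ξ : ℂ)) ⊤ (volume : Measure (Space d)) :=
  memLp_top_of_bound' (Complex.continuous_ofReal.comp (continuous_besselSymbol _)).aestronglyMeasurable
    1 (norm_besselSymbol_neg_le_one hr)

theorem norm_pot_le {r : ℝ} (hr : 0 ≤ r) (v : L2 d) : ‖pot r v‖ ≤ ‖v‖ := by
  have := norm_fm_le zero_le_one (norm_besselSymbol_neg_le_one hr) v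
  rwa [one_mul] at this

theorem pot_symm {r : ℝ} (hr : 0 ≤ r) (v w : L2 d) : inner ℂ (pot r v) w = inner ℂ v (pot r w) :=
  inner_fm_real_left (memLp_besselSymbol hr) v w

theorem J_multiplier {g : Space d → ℂ} (hg : g.HasTemperateGrowth)
    (hb : MemLp g ⊤ (volume : Measure (Space d))) (f : 𝓢(Space d, ℂ)) :
    J (SchwartzMap.fourierMultiplierCLM ℂ g f) = fm g (J f) := toLp_fourierMultiplier hg hb f

theorem pot_J {r : ℝ} (hr : 0 ≤ r) (f : 𝓢(Space d, ℂ)) : pot r (J f) = J (bs (-r) f) :=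
  (J_multiplier (besselSymbol_hasTemperateGrowth d (-r)) (memLp_besselSymbol hr) f).symm

theorem pot_J_bs {r : ℝ} (hr : 0 ≤ r) (f : 𝓢(Space d, ℂ)) : pot r (J (bs r f)) = J f := by
  rw [pot_J hr, bs_bs, neg_add_cancel, bs_zero]

theorem pot_pot {r r' : ℝ} (hr : 0 ≤ r) (hr' : 0 ≤ r') (v : L2 d) :
    pot r (pot r' v) = pot (r + r') v := by
  rw [pot, pot, fm_mul (memLp_besselSymbol hr) (memLp_besselSymbol hr'), pot]
  congr 2
  funext ξ
  rw [neg_add, besselSymbol_add, Complex.ofReal_mul]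

theorem pot_zero (v : L2 d) : pot 0 v = v := by
  rw [pot]
  simp only [neg_zero, besselSymbol_zero, Complex.ofReal_one, fm_const, one_smul]

theorem denseRange_J_bs (r : ℝ) : DenseRange fun f : 𝓢(Space d, ℂ) => J (bs r f) := by
  have : Function.Surjective (bs (d := d) r) := fun f =>
    ⟨bs (-r) f, by rw [bs_bs, add_neg_cancel, bs_zero]⟩
  exact denseRange_J.comp this.denseRange J.continuous

theorem denseRange_pot {r : ℝ} (hr : 0 ≤ r) : DenseRange (pot r : L2 d → L2 d) := by
  refine denseRange_J.mono ?_
  rintro _ ⟨f, rfl⟩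
  exact ⟨J (bs r f), pot_J_bs hr f⟩

theorem pot_injective {r : ℝ} (hr : 0 ≤ r) : Function.Injective (pot r : L2 d → L2 d) :=
  injective_of_denseRange (pot_symm hr) (denseRange_pot hr)

/-- `N` is the operator `(1 - Δ)^{s/2} a (1 - Δ)^{-s/2}`. -/
structure IsMul (s C : ℝ) (a : Space d → ℝ) (N : L2 d →L[ℂ] L2 d) : Prop where
  memLp : MemLp (fun x => (a x : ℂ)) ⊤ (volume : Measure (Space d))
  pot_apply : ∀ ψ, pot s (N ψ) = mulOp (fun x => (a x : ℂ)) (pot s ψ)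
  norm_le : ∀ ψ, ‖N ψ‖ ≤ C * ‖ψ‖

/-- Multiplication by bounded measurable functions. -/
theorem isMul_zero {a : Space d → ℝ} (ha : AEStronglyMeasurable a volume) {L : ℝ}
    (hL : ∀ x, |a x| ≤ L) : IsMul 0 L a (mulOp fun x => (a x : ℂ)) where
  memLp := memLp_top_of_bound' (Complex.continuous_ofReal.comp_aestronglyMeasurable ha) L
    fun x => by rw [Complex.norm_real]; exact hL x
  pot_apply ψ := by rw [pot_zero, pot_zero]
  norm_le ψ := norm_mulOp_le ((abs_nonneg _).trans (hL 0))
    (fun x => by rw [Complex.norm_real]; exact hL x) ψ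

theorem mulOp_J {a : Space d → ℝ} (ha : a.HasTemperateGrowth) {L : ℝ} (hL : ∀ x, |a x| ≤ L)
    (f : 𝓢(Space d, ℂ)) : mulOp (fun x => (a x : ℂ)) (J f) = J (mulS a f) := by
  have hm : MemLp (fun x => (a x : ℂ)) ⊤ (volume : Measure (Space d)) :=
    memLp_top_of_bound' (Complex.continuous_ofReal.comp ha.1.continuous).aestronglyMeasurable L
      fun x => by rw [Complex.norm_real]; exact hL x
  refine Lp.ext ?_
  filter_upwards [coeFn_mulOp hm (J f), coeFn_J f, coeFn_J (mulS a f)] with x h1 h2 h3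
  rw [h1, h2, h3, mulS_apply ha]

namespace WeightFamily

variable {σ : ℝ} (W : WeightFamily d σ)

/-- Coefficients that are uniform limits of uniformly regular smooth functions. -/
structure Approximable (n : ℕ) (L : ℝ) (a : Space d → ℝ) : Prop where
  continuous : Continuous a
  exists_reg : ∀ ε, 0 < ε → ∃ a', (∀ K, Reg (W.w K) L n a') ∧ ∀ x, |a x - a' x| ≤ ε

variable {W}

theorem Approximable.bound {n : ℕ} {L : ℝ} {a : Space d → ℝ} (h : W.Approximable n L a) (x : Space d) :
    |a x| ≤ L := by
  refine le_of_forall_pos_le_add fun ε hε => ?_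
  obtain ⟨a', h1, h2⟩ := h.exists_reg ε hε
  have h3 := (h1 0).bound x
  have h4 := h2 x
  have := abs_sub_abs_le_abs_sub (a x) (a' x)
  linarith

theorem Approximable.memLp {n : ℕ} {L : ℝ} {a : Space d → ℝ} (h : W.Approximable n L a) :
    MemLp (fun x => (a x : ℂ)) ⊤ (volume : Measure (Space d)) :=
  memLp_top_of_bound' (Complex.continuous_ofReal.comp h.continuous).aestronglyMeasurable L
    fun x => by rw [Complex.norm_real]; exact h.bound x

theorem Approximable.norm_sub_le {n : ℕ} {L ε : ℝ} {a a' : Space d → ℝ} (h : W.Approximable n L a)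
    (h1 : ∀ K, Reg (W.w K) L n a') (h2 : ∀ x, |a x - a' x| ≤ ε) (f : 𝓢(Space d, ℂ)) :
    ‖mulOp (fun x => (a x : ℂ)) (J f) - J (mulS a' f)‖ ≤ ε * ‖J f‖ := by
  have hm : MemLp (fun x => (a' x : ℂ)) ⊤ (volume : Measure (Space d)) :=
    memLp_top_of_bound' (Complex.continuous_ofReal.comp (h1 0).temperate.1.continuous).aestronglyMeasurable L
      fun x => by rw [Complex.norm_real]; exact (h1 0).bound x
  rw [← mulOp_J (h1 0).temperate (h1 0).bound, ← mulOp_sub h.memLp hm]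
  refine norm_mulOp_le ((abs_nonneg _).trans (h2 0)) (fun x => ?_) _
  rw [← Complex.ofReal_sub, Complex.norm_real]
  exact h2 x

variable (W) in
/-- The bound of the multiplication operators. -/
def opConst (n : ℕ) (L : ℝ) : ℝ := √(mulConst d W.S₀ L n * W.C₀ / W.c₀)

theorem norm_bs_mulS_le {n : ℕ} {L : ℝ} {a : Space d → ℝ} (ha : ∀ K, Reg (W.w K) L n a)
    (f : 𝓢(Space d, ℂ)) : ‖J (bs (n + σ) (mulS a f))‖ ≤ W.opConst n L * ‖J (bs (n + σ) f)‖ := by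
  have h := W.norm_mulS_le ha f
  have h1 := mulConst_nonneg (d := d) (L := L) W.S₀_nonneg n
  have h2 := W.C₀_pos
  have h3 := W.c₀_pos
  refine (sq_le_sq₀ (norm_nonneg _) (mul_nonneg (Real.sqrt_nonneg _) (norm_nonneg _))).1 ?_
  rw [mul_pow, Real.sq_sqrt (by positivity), div_mul_eq_mul_div, le_div_iff₀ h3]
  linarith

/-- The conjugated operator is obtained from a weak bound, which has to be checked only for smooth
`ψ`. There `a` may be replaced by a regular `a'` with an arbitrarily small error in `L2`, and the
bound for `a'` does not depend on the approximation. -/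
theorem Approximable.exists_isMul {n : ℕ} {L : ℝ} (hσ : 0 ≤ σ) {a : Space d → ℝ}
    (h : W.Approximable n L a) : ∃ N, IsMul (n + σ) (W.opConst n L) a N := by
  have hs : 0 ≤ (n : ℝ) + σ := by positivity
  have hC : 0 ≤ W.opConst n L := Real.sqrt_nonneg _
  have key : ∀ ψ θ : L2 d, ‖inner ℂ (mulOp (fun x => (a x : ℂ)) (pot (n + σ) ψ)) θ‖
      ≤ W.opConst n L * ‖ψ‖ * ‖pot (n + σ) θ‖ := by
    intro ψ θ
    refine (denseRange_J_bs (d := d) (n + σ)).induction_on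
      (p := fun ψ => ‖inner ℂ (mulOp (fun x => (a x : ℂ)) (pot (n + σ) ψ)) θ‖
        ≤ W.opConst n L * ‖ψ‖ * ‖pot (n + σ) θ‖) ψ
      (isClosed_le (by fun_prop) (by fun_prop)) fun f => ?_
    rw [pot_J_bs hs]
    refine le_of_forall_pos_le_add fun ε hε => ?_
    obtain ⟨a', h1, h2⟩ := h.exists_reg (ε / (‖J f‖ * ‖θ‖ + 1)) (by positivity)
    have h3 := h.norm_sub_le h1 h2 f
    have e : inner ℂ (mulOp (fun x => (a x : ℂ)) (J f)) θ
        = inner ℂ (J (bs (n + σ) (mulS a' f))) (pot (n + σ) θ)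
          + inner ℂ (mulOp (fun x => (a x : ℂ)) (J f) - J (mulS a' f)) θ := by
      rw [← pot_symm hs, pot_J_bs hs, inner_sub_left]
      ring
    rw [e]
    refine (norm_add_le _ _).trans (add_le_add ?_ ?_)
    · exact (norm_inner_le_norm _ _).trans
        (mul_le_mul_of_nonneg_right (norm_bs_mulS_le h1 f) (norm_nonneg _))
    · refine (norm_inner_le_norm _ _).trans ((mul_le_mul_of_nonneg_right h3 (norm_nonneg _)).trans ?_)
      rw [div_mul_eq_mul_div, div_mul_eq_mul_div, div_le_iff₀ (by positivity)]
      nlinarith [mul_nonneg (norm_nonneg (J f)) (norm_nonneg θ)]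
  obtain ⟨N, h1, h2⟩ := exists_conjugate (pot_symm hs) (denseRange_pot hs) hC key
  exact ⟨N, h.memLp, h1, h2⟩

end WeightFamily

end ParabolicSystem
end

/-! ### Riesz operators and coercivity for nonsmooth coefficients. -/

noncomputable section
namespace ParabolicSystem
set_option linter.unusedSectionVars false
open MeasureTheory Set Filter Topology
open scoped SchwartzMap ENNReal LineDeriv FourierTransform

variable {d d₁ : ℕ}

theorem J_eq_fm {g : Space d → ℂ} (hg : MemLp g ⊤ (volume : Measure (Space d))) {f f' : 𝓢(Space d, ℂ)}
    (h : ∀ ξ, 𝓕 f ξ = g ξ * 𝓕 f' ξ) : J f = fm g (J f') := by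
  rw [fm_apply, J_apply, J_apply, SchwartzMap.toLp_fourier_eq]
  have h1 : mulOp g ((𝓕 f' : 𝓢(Space d, ℂ)).toLp 2) = (𝓕 f : 𝓢(Space d, ℂ)).toLp 2 := by
    refine Lp.ext ?_
    filter_upwards [coeFn_mulOp hg ((𝓕 f' : 𝓢(Space d, ℂ)).toLp 2),
      SchwartzMap.coeFn_toLp (𝓕 f) 2 volume, SchwartzMap.coeFn_toLp (𝓕 f') 2 volume] with x h1 h2 h3
    rw [h1, h2, h3, h x]
  rw [h1, ← SchwartzMap.toLp_fourier_eq, FourierTransform.fourierInv_fourier_eq]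

/-- The symbol of `∂_i`. -/
def dsy (i : Fin d) (ξ : Space d) : ℂ := 2 * Real.pi * Complex.I * ξ i

theorem continuous_dsy (i : Fin d) : Continuous (dsy i) := by unfold dsy; fun_prop

theorem norm_dsy_le (i : Fin d) (ξ : Space d) : ‖dsy i ξ‖ ≤ besselSymbol d 1 ξ := by
  have h1 : |2 * Real.pi * ξ i| ≤ √(br ξ) := Real.abs_le_sqrt (WeightFamily.coord_sq_le_br i ξ)
  rw [besselSymbol_eq, ← Real.sqrt_eq_rpow]
  refine (le_of_eq ?_).trans h1
  rw [dsy]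
  simp [abs_mul]

/-- The operator `∂_i (1 - Δ)^{-1/2}`. -/
def riesz (i : Fin d) : L2 d →L[ℂ] L2 d := fm fun ξ => dsy i ξ * besselSymbol d (-1) ξ

theorem norm_rieszSymbol_le (i : Fin d) (ξ : Space d) : ‖dsy i ξ * besselSymbol d (-1) ξ‖ ≤ 1 := by
  rw [norm_mul, Complex.norm_real, Real.norm_of_nonneg (besselSymbol_pos _ ξ).le]
  calc _ ≤ besselSymbol d 1 ξ * besselSymbol d (-1) ξ :=
        mul_le_mul_of_nonneg_right (norm_dsy_le i ξ) (besselSymbol_pos _ ξ).le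
    _ = 1 := by rw [← besselSymbol_add, add_neg_cancel, besselSymbol_zero]

theorem memLp_rieszSymbol (i : Fin d) :
    MemLp (fun ξ => dsy i ξ * besselSymbol d (-1) ξ) ⊤ (volume : Measure (Space d)) :=
  memLp_top_of_bound' ((continuous_dsy i).mul (Complex.continuous_ofReal.comp
    (continuous_besselSymbol _))).aestronglyMeasurable 1 (norm_rieszSymbol_le i)

theorem norm_riesz_le (i : Fin d) (v : L2 d) : ‖riesz i v‖ ≤ ‖v‖ := by
  have := norm_fm_le zero_le_one (norm_rieszSymbol_le i) v
  rwa [one_mul] at this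

theorem riesz_J (i : Fin d) (r : ℝ) (f : 𝓢(Space d, ℂ)) :
    riesz i (J (bs (r + 1) f)) = J (bs r (pd i f)) := by
  refine (J_eq_fm (memLp_rieszSymbol i) fun ξ => ?_).symm
  rw [hat_bs, hat_bs, hat_pd, show r = -1 + (r + 1) by ring, besselSymbol_add, dsy,
    show -1 + (r + 1) + 1 = r + 1 by ring]
  push_cast
  ring

theorem riesz_fm {g : Space d → ℂ} (hg : MemLp g ⊤ (volume : Measure (Space d))) (i : Fin d) (v : L2 d) :
    riesz i (fm g v) = fm g (riesz i v) := fm_comm (memLp_rieszSymbol i) hg v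

theorem riesz_riesz_J (i j : Fin d) (r : ℝ) (f : 𝓢(Space d, ℂ)) :
    riesz i (riesz j (J (bs (r + 2) f))) = J (bs r (pd i (pd j f))) := by
  rw [show r + 2 = r + 1 + 1 by ring, riesz_J, riesz_J]

namespace WeightFamily

variable {σ : ℝ} {W : WeightFamily d σ}

variable (W) in
/-- The operator of the equivalent inner product. -/
def rop : L2 d →L[ℂ] L2 d := fm (fun ξ => (W.ρ ξ : ℂ))

theorem rop_symm (v w : L2 d) : inner ℂ (W.rop v) w = inner ℂ v (W.rop w) :=
  inner_fm_real_left W.memLp_ρ v w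

/-- The products `a' m f` converge to `a f` only in `L2`, so the operator of order `n + σ` is moved
to the smooth function `g` before taking the limit. -/
theorem Approximable.tendsto_inner {n : ℕ} {L C : ℝ} (hσ : 0 ≤ σ) {a : Space d → ℝ}
    (h : W.Approximable n L a) {N : L2 d →L[ℂ] L2 d} (hN : IsMul (n + σ) C a N)
    {a' : ℕ → Space d → ℝ} (h1 : ∀ m K, Reg (W.w K) L n (a' m))
    (h2 : ∀ m x, |a x - a' m x| ≤ 1 / ((m : ℝ) + 1)) (f g : 𝓢(Space d, ℂ)) :
    Tendsto (fun m => inner ℂ (J (bs (n + σ) g)) (W.rop (J (bs (n + σ) (mulS (a' m) f))))) atTop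
      (𝓝 (inner ℂ (J (bs (n + σ) g)) (W.rop (N (J (bs (n + σ) f)))))) := by
  have hs : 0 ≤ (n : ℝ) + σ := by positivity
  have e : ∀ χ, inner ℂ (J (bs (n + σ) g)) (W.rop χ)
      = inner ℂ (W.rop (J (bs (n + σ + (n + σ)) g))) (pot (n + σ) χ) := fun χ => by
    rw [← pot_J_bs hs (bs (n + σ) g), pot_symm hs, rop_symm, bs_bs]
    congr 1
    exact fm_comm (memLp_besselSymbol hs) W.memLp_ρ _
  simp only [e, hN.pot_apply, pot_J_bs hs]
  refine Tendsto.inner tendsto_const_nhds ?_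
  rw [tendsto_iff_norm_sub_tendsto_zero]
  have hz : Tendsto (fun m : ℕ => 1 / ((m : ℝ) + 1) * ‖J f‖) atTop (𝓝 0) := by
    simpa only [zero_mul] using
      (tendsto_one_div_add_atTop_nhds_zero_nat (𝕜 := ℝ)).mul_const ‖J f‖
  refine squeeze_zero (fun _ => norm_nonneg _) (fun m => ?_) hz
  rw [norm_sub_rev]
  exact h.norm_sub_le (h1 m) (h2 m) f

variable (W) in
/-- Coercivity of the leading part. -/
theorem exists_coercive_operators {δ η C L : ℝ} (hδ : 0 < δ) (hC : 0 ≤ C) (hL : 0 ≤ L) (hσ : 0 ≤ σ)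
    (hη0 : 0 < η) (hη : Fintype.card (Idx d d₁) * η ≤ δ / 4) (n : ℕ) :
    ∃ c lam, 0 < c ∧ 0 ≤ lam ∧ ∀ (a α : Fin d → Fin d → Fin d₁ → Fin d₁ → Space d → ℝ)
      (N : Fin d → Fin d → Fin d₁ → Fin d₁ → L2 d →L[ℂ] L2 d) (C' : ℝ),
      (∀ i j k r, W.Approximable n L (a i j k r)) → SmoothApprox δ (η / 2) C a α →
      (∀ i j k r, IsMul (n + σ) C' (a i j k r) (N i j k r)) →
      ∀ v : Fin d₁ → L2 d,
        c * ∑ k, ‖v k‖ ^ 2 - lam * ∑ k, ‖pot 1 (v k)‖ ^ 2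
          ≤ ∑ p : Idx d d₁, (inner ℂ (riesz p.1 (riesz p.1 (v p.2.2.2.1)))
            (W.rop (N p.2.1 p.2.2.1 p.2.2.2.1 p.2.2.2.2
              (riesz p.2.1 (riesz p.2.2.1 (v p.2.2.2.2)))))).re ∧
        c * ∑ k, ‖v k‖ ^ 2 - lam * ∑ k, ‖pot 1 (v k)‖ ^ 2
          ≤ ∑ p : Idx d d₁, (inner ℂ (riesz p.2.1 (riesz p.2.2.1 (v p.2.2.2.2)))
            (W.rop (N p.2.1 p.2.2.1 p.2.2.2.1 p.2.2.2.2
              (riesz p.1 (riesz p.1 (v p.2.2.2.1)))))).re := by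
  obtain ⟨c, lam, hc, hlam, H⟩ := W.exists_coercive (d₁ := d₁) hδ hC hL hσ hη n
  refine ⟨c, lam, hc, hlam, fun a α N C' ha hα hN v => ?_⟩
  have hd : DenseRange (fun u : Fin d₁ → 𝓢(Space d, ℂ) => fun k => J (bs (n + σ + 2) (u k))) :=
    DenseRange.piMap fun _ => denseRange_J_bs (n + σ + 2)
  refine hd.induction_on (p := fun v : Fin d₁ → L2 d =>
        c * ∑ k, ‖v k‖ ^ 2 - lam * ∑ k, ‖pot 1 (v k)‖ ^ 2
          ≤ ∑ p : Idx d d₁, (inner ℂ (riesz p.1 (riesz p.1 (v p.2.2.2.1)))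
            (W.rop (N p.2.1 p.2.2.1 p.2.2.2.1 p.2.2.2.2
              (riesz p.2.1 (riesz p.2.2.1 (v p.2.2.2.2)))))).re ∧
        c * ∑ k, ‖v k‖ ^ 2 - lam * ∑ k, ‖pot 1 (v k)‖ ^ 2
          ≤ ∑ p : Idx d d₁, (inner ℂ (riesz p.2.1 (riesz p.2.2.1 (v p.2.2.2.2)))
            (W.rop (N p.2.1 p.2.2.1 p.2.2.2.1 p.2.2.2.2
              (riesz p.1 (riesz p.1 (v p.2.2.2.1)))))).re)
      v ?_ fun u => ?_
  · have h0 : Continuous fun v : Fin d₁ → L2 d =>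
        c * ∑ k, ‖v k‖ ^ 2 - lam * ∑ k, ‖pot 1 (v k)‖ ^ 2 := by fun_prop
    have h1 : Continuous fun v : Fin d₁ → L2 d =>
        ∑ p : Idx d d₁, (inner ℂ (riesz p.1 (riesz p.1 (v p.2.2.2.1)))
          (W.rop (N p.2.1 p.2.2.1 p.2.2.2.1 p.2.2.2.2
            (riesz p.2.1 (riesz p.2.2.1 (v p.2.2.2.2)))))).re := by fun_prop
    have h2 : Continuous fun v : Fin d₁ → L2 d =>
        ∑ p : Idx d d₁, (inner ℂ (riesz p.2.1 (riesz p.2.2.1 (v p.2.2.2.2)))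
          (W.rop (N p.2.1 p.2.2.1 p.2.2.2.1 p.2.2.2.2
            (riesz p.1 (riesz p.1 (v p.2.2.2.1)))))).re := by fun_prop
    exact (isClosed_le h0 h1).inter (isClosed_le h0 h2)
  have e1 : ∀ k, pot 1 (J (bs (n + σ + 2) (u k))) = J (bs (n + σ + 1) (u k)) := fun k => by
    rw [pot_J zero_le_one, bs_bs]
    rw [show -1 + ((n : ℝ) + σ + 2) = n + σ + 1 by ring]
  simp only [e1, riesz_riesz_J]
  -- The first bound keeps the approximations within `η / 2 + η / 2` of `α`; the second makes them
  -- converge to `a`.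
  have hm : ∀ m : ℕ, 0 < min (η / 2) (1 / ((m : ℝ) + 1)) := fun m => by positivity
  choose a' ha1 ha2 using fun i j k r m => (ha i j k r).exists_reg _ (hm m)
  have hα' : ∀ m, SmoothApprox δ η C (fun i j k r => a' i j k r m) α := fun m =>
    { temperate := hα.temperate
      elliptic := hα.elliptic
      close := fun i j k r x => by
        have h1 := (ha2 i j k r m x).trans (min_le_left _ _)
        have h2 := hα.close i j k r x
        rw [abs_sub_comm] at h1
        exact (abs_sub_le _ (a i j k r x) _).trans (by linarith)
      deriv := hα.deriv }
  have ht : ∀ i j k r f g, _ := fun i j k r f g => (ha i j k r).tendsto_inner hσ (hN i j k r)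
    (ha1 i j k r) (fun m x => (ha2 i j k r m x).trans (min_le_right _ _)) f g
  constructor
  · refine le_of_tendsto_of_tendsto' tendsto_const_nhds (tendsto_finsetSum _ fun p _ =>
      (Complex.continuous_re.tendsto _).comp (ht p.2.1 p.2.2.1 p.2.2.2.1 p.2.2.2.2
        (pd p.2.1 (pd p.2.2.1 (u p.2.2.2.2))) (pd p.1 (pd p.1 (u p.2.2.2.1))))) fun m => ?_
    exact (H _ _ (fun i j k r => ha1 i j k r m) (hα' m) u).1
  · refine le_of_tendsto_of_tendsto' tendsto_const_nhds (tendsto_finsetSum _ fun p _ =>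
      (Complex.continuous_re.tendsto _).comp (ht p.2.1 p.2.2.1 p.2.2.2.1 p.2.2.2.2
        (pd p.1 (pd p.1 (u p.2.2.2.1))) (pd p.2.1 (pd p.2.2.1 (u p.2.2.2.2))))) fun m => ?_
    exact (H _ _ (fun i j k r => ha1 i j k r m) (hα' m) u).2

end WeightFamily

end ParabolicSystem
end

/-! ### Vector-valued operators and the Gårding inequality. -/

noncomputable section
namespace ParabolicSystem
set_option linter.unusedSectionVars false
open MeasureTheory Set Filter Topology
open scoped SchwartzMap ENNReal LineDeriv FourierTransform

variable {d d₁ : ℕ}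

/-- Enters the separability of `L2`, on which the passage from weak to strong measurability rests.
-/
instance : Fact ((2 : ℝ≥0∞) ≠ ⊤) := ⟨ENNReal.ofNat_ne_top⟩

instance : SecondCountableTopology (L2 d) := inferInstance

/-- Square integrable vector-valued functions. -/
abbrev Vec (d d₁ : ℕ) := PiLp 2 fun _ : Fin d₁ => L2 d

instance : SecondCountableTopology (Vec d d₁) := inferInstance

/-- The operator with a given matrix of operators. -/
def mat (A : Fin d₁ → Fin d₁ → L2 d →L[ℂ] L2 d) : Vec d d₁ →L[ℂ] Vec d d₁ :=
  (PiLp.continuousLinearEquiv 2 ℂ fun _ : Fin d₁ => L2 d).symm.toContinuousLinearMap ∘L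
    ContinuousLinearMap.pi fun k => ∑ r, A k r ∘L PiLp.proj 2 (fun _ : Fin d₁ => L2 d) r

theorem mat_apply (A : Fin d₁ → Fin d₁ → L2 d →L[ℂ] L2 d) (v : Vec d d₁) (k : Fin d₁) :
    mat A v k = ∑ r, A k r (v r) := by
  simp [mat]

/-- An operator acting on each component. -/
def diag (A : L2 d →L[ℂ] L2 d) : Vec d d₁ →L[ℂ] Vec d d₁ :=
  (PiLp.continuousLinearEquiv 2 ℂ fun _ : Fin d₁ => L2 d).symm.toContinuousLinearMap ∘L
    ContinuousLinearMap.pi fun k => A ∘L PiLp.proj 2 (fun _ : Fin d₁ => L2 d) k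

@[simp]
theorem diag_apply (A : L2 d →L[ℂ] L2 d) (v : Vec d d₁) (k : Fin d₁) : diag A v k = A (v k) := rfl

theorem norm_diag_le {A : L2 d →L[ℂ] L2 d} {C : ℝ} (hC : 0 ≤ C) (h : ∀ v, ‖A v‖ ≤ C * ‖v‖)
    (v : Vec d d₁) : ‖diag A v‖ ≤ C * ‖v‖ := by
  refine (sq_le_sq₀ (norm_nonneg _) (by positivity)).1 ?_
  rw [mul_pow, PiLp.norm_sq_eq_of_L2, PiLp.norm_sq_eq_of_L2, Finset.mul_sum]
  refine Finset.sum_le_sum fun k _ => ?_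
  rw [← mul_pow]
  exact pow_le_pow_left₀ (norm_nonneg _) (h _) 2

theorem diag_symm {A : L2 d →L[ℂ] L2 d} (h : ∀ v w, inner ℂ (A v) w = inner ℂ v (A w))
    (v w : Vec d d₁) : inner ℂ (diag A v) w = inner ℂ v (diag A w) := by
  rw [PiLp.inner_apply, PiLp.inner_apply]
  exact Finset.sum_congr rfl fun k _ => h _ _

theorem diag_comm {A B : L2 d →L[ℂ] L2 d} (h : ∀ v, A (B v) = B (A v)) (v : Vec d d₁) :
    diag A (diag B v) = diag B (diag A v) := by
  refine PiLp.ext fun k => ?_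
  exact h _

theorem tendsto_diag {A : ℕ → L2 d →L[ℂ] L2 d} {v w : Vec d d₁}
    (h : ∀ k, Tendsto (fun n => A n (v k)) atTop (𝓝 (w k))) :
    Tendsto (fun n => diag (A n) v) atTop (𝓝 w) := by
  have e := (PiLp.continuousLinearEquiv 2 ℂ fun _ : Fin d₁ => L2 d)
  have h1 : Tendsto (fun n k => A n (v k)) atTop (𝓝 (fun k => w k)) := tendsto_pi_nhds.2 h
  exact ((PiLp.continuousLinearEquiv 2 ℂ fun _ : Fin d₁ => L2 d).symm.continuous.tendsto _).comp h1

theorem denseRange_diag {A : L2 d →L[ℂ] L2 d} (h : DenseRange A) :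
    DenseRange (diag A : Vec d d₁ → Vec d d₁) := by
  let e := PiLp.continuousLinearEquiv 2 ℂ fun _ : Fin d₁ => L2 d
  have h1 : DenseRange (Pi.map fun _ : Fin d₁ => (A : L2 d → L2 d)) := DenseRange.piMap fun _ => h
  have h2 := (e.symm.surjective.denseRange.comp h1 e.symm.continuous).comp
    e.surjective.denseRange (e.symm.continuous.comp (by
      exact continuous_pi fun k => A.continuous.comp (continuous_apply k)))
  exact h2

theorem tendsto_fm_of_le_one {g : ℕ → Space d → ℂ} (hg : ∀ n, MemLp (g n) ⊤ (volume : Measure (Space d)))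
    (hb : ∀ n ξ, ‖g n ξ‖ ≤ 1) (hl : ∀ ξ, Tendsto (fun n => g n ξ) atTop (𝓝 1)) (v : L2 d) :
    Tendsto (fun n => fm (g n) v) atTop (𝓝 v) := by
  have h : Tendsto (fun n => mulOp (g n) (𝓕 v)) atTop (𝓝 (𝓕 v)) := by
    refine Lp.tendsto_of_dominated (fun n => ?_) ?_
    · filter_upwards [coeFn_mulOp (hg n) (𝓕 v)] with x hx
      rw [hx, norm_mul]
      exact mul_le_of_le_one_left (norm_nonneg _) (hb n x)
    · filter_upwards [ae_all_iff.2 fun n => coeFn_mulOp (hg n) (𝓕 v)] with x hx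
      simp only [hx]
      simpa using (hl x).mul_const ((𝓕 v : L2 d) x)
  have h2 := ((Lp.fourierTransformₗᵢ (Space d) ℂ).symm.continuous.tendsto (𝓕 v)).comp h
  have e : (Lp.fourierTransformₗᵢ (Space d) ℂ).symm (𝓕 v) = v :=
    (Lp.fourierTransformₗᵢ (Space d) ℂ).symm_apply_apply v
  rw [e] at h2
  exact h2

/-- Approximations of `(1 - Δ)^{1/2}`. -/
def qsym (n : ℕ) (ξ : Space d) : ℝ := besselSymbol d 1 ξ / (1 + br ξ / (n + 1))

theorem qsym_nonneg (n : ℕ) (ξ : Space d) : 0 ≤ qsym n ξ :=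
  div_nonneg (besselSymbol_pos _ ξ).le (by have := br_pos ξ; positivity)

theorem besselSymbol_one_le_br (ξ : Space d) : besselSymbol d 1 ξ ≤ br ξ := by
  rw [besselSymbol_eq]
  exact (Real.rpow_le_rpow_of_exponent_le (one_le_br ξ) (by norm_num)).trans_eq (Real.rpow_one _)

theorem norm_qsym_le (n : ℕ) (ξ : Space d) : ‖(qsym n ξ : ℂ)‖ ≤ n + 1 := by
  have h := br_pos ξ
  rw [Complex.norm_real, Real.norm_of_nonneg (qsym_nonneg n ξ), qsym, div_le_iff₀ (by positivity)]
  have : ((n : ℝ) + 1) * (1 + br ξ / (n + 1)) = n + 1 + br ξ := by field_simp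
  rw [this]
  have h2 := besselSymbol_one_le_br ξ
  have : (0 : ℝ) ≤ n := Nat.cast_nonneg n
  linarith

theorem continuous_qsym (n : ℕ) : Continuous (qsym (d := d) n) := by
  refine (continuous_besselSymbol 1).div (by have := continuous_br (d := d); fun_prop) fun ξ => ?_
  have h := br_pos ξ
  positivity

theorem memLp_qsym (n : ℕ) : MemLp (fun ξ => (qsym n ξ : ℂ)) ⊤ (volume : Measure (Space d)) :=
  memLp_top_of_bound' (Complex.continuous_ofReal.comp (continuous_qsym n)).aestronglyMeasurable _
    (norm_qsym_le n)

/-- The resolvent-type cutoff of `(1 - Δ)^{1/2}` is bounded for each `n`, while its product with `(1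
- Δ)^{-1/2}` is a contraction tending strongly to the identity. -/
theorem qsym_mul (n : ℕ) (ξ : Space d) :
    (qsym n ξ : ℂ) * (besselSymbol d (-1) ξ : ℂ) = ((1 + br ξ / (n + 1))⁻¹ : ℝ) := by
  have : besselSymbol d 1 ξ * besselSymbol d (-1) ξ = 1 := by
    rw [← besselSymbol_add, add_neg_cancel, besselSymbol_zero]
  rw [← Complex.ofReal_mul, qsym, div_mul_eq_mul_div, this, one_div]

theorem norm_qsym_mul_le (n : ℕ) (ξ : Space d) :
    ‖(qsym n ξ : ℂ) * (besselSymbol d (-1) ξ : ℂ)‖ ≤ 1 := by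
  have h := br_pos ξ
  rw [qsym_mul, Complex.norm_real, Real.norm_of_nonneg (by positivity)]
  refine inv_le_one_of_one_le₀ ?_
  have : 0 ≤ br ξ / ((n : ℝ) + 1) := by positivity
  linarith

theorem tendsto_qsym_mul (ξ : Space d) :
    Tendsto (fun n : ℕ => (qsym n ξ : ℂ) * (besselSymbol d (-1) ξ : ℂ)) atTop (𝓝 1) := by
  simp only [qsym_mul]
  have h : Tendsto (fun n : ℕ => br ξ * (1 / ((n : ℝ) + 1))) atTop (𝓝 (br ξ * 0)) :=
    (tendsto_one_div_add_atTop_nhds_zero_nat (𝕜 := ℝ)).const_mul _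
  have h1 : Tendsto (fun n : ℕ => (1 + br ξ / ((n : ℝ) + 1))⁻¹) atTop (𝓝 1) := by
    simp only [mul_one_div, mul_zero] at h
    simpa using (h.const_add 1).inv₀ (by norm_num)
  exact_mod_cast (Complex.continuous_ofReal.tendsto _).comp h1

/-- The spatial operators attached to an equivalent norm given by a symbol. -/
def spatialOps (p : Space d → ℝ) {m M : ℝ} (hm : 0 < m) (hp : Measurable p) (h1 : ∀ ξ, m ≤ p ξ)
    (h2 : ∀ ξ, p ξ ≤ M) : SpatialOps (Vec d d₁) :=
  have hM : 0 ≤ M := hm.le.trans ((h1 0).trans (h2 0))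
  have hb : ∀ ξ, ‖(p ξ : ℂ)‖ ≤ M := fun ξ => by
    rw [Complex.norm_real, Real.norm_of_nonneg (hm.le.trans (h1 ξ))]; exact h2 ξ
  have hL : MemLp (fun ξ => (p ξ : ℂ)) ⊤ (volume : Measure (Space d)) :=
    memLp_top_of_bound' (Complex.measurable_ofReal.comp hp).aestronglyMeasurable M hb
  have hL' : MemLp (fun ξ => (((p ξ)⁻¹ : ℝ) : ℂ)) ⊤ (volume : Measure (Space d)) :=
    memLp_top_of_bound' (Complex.measurable_ofReal.comp hp.inv).aestronglyMeasurable m⁻¹ fun ξ => by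
      rw [Complex.norm_real, Real.norm_of_nonneg (inv_nonneg.2 (hm.le.trans (h1 ξ)))]
      exact inv_anti₀ hm (h1 ξ)
  { j := diag (pot 1)
    ρ := diag (fm fun ξ => (p ξ : ℂ))
    ρ' := diag (fm fun ξ => (((p ξ)⁻¹ : ℝ) : ℂ))
    Q := fun n => diag (fm fun ξ => (qsym n ξ : ℂ))
    bound := M
    lower := m
    lower_pos := hm
    j_symm := diag_symm (pot_symm zero_le_one)
    ρ_symm := diag_symm (inner_fm_real_left hL)
    Q_symm := fun n => diag_symm (inner_fm_real_left (memLp_qsym n))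
    Q_j := fun n => diag_comm (fm_comm (memLp_qsym n) (memLp_besselSymbol zero_le_one))
    ρ_j := diag_comm (fm_comm hL (memLp_besselSymbol zero_le_one))
    ρ_Q := fun n => diag_comm (fm_comm hL (memLp_qsym n))
    ρ_ρ' := fun x => by
      refine PiLp.ext fun k => ?_
      rw [diag_apply, diag_apply, fm_mul hL hL']
      have : (fun ξ => (p ξ : ℂ) * (((p ξ)⁻¹ : ℝ) : ℂ)) = fun _ => 1 := funext fun ξ => by
        rw [← Complex.ofReal_mul, mul_inv_cancel₀ (hm.trans_le (h1 ξ)).ne', Complex.ofReal_one]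
      rw [this, fm_const, one_smul]
    tendsto_Q := fun x => by
      have e : ∀ n : ℕ, diag (fm fun ξ => (qsym n ξ : ℂ)) (diag (pot 1) x)
          = diag (fm fun ξ => (qsym n ξ : ℂ) * (besselSymbol d (-1) ξ : ℂ)) x := fun n =>
        PiLp.ext fun k => fm_mul (memLp_qsym n) (memLp_besselSymbol zero_le_one) _
      simp only [e]
      refine tendsto_diag fun k => tendsto_fm_of_le_one (fun n => ?_) norm_qsym_mul_le
        tendsto_qsym_mul _
      exact (memLp_besselSymbol zero_le_one).mul (memLp_qsym n)
    norm_Q := fun n x => by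
      have e : diag (fm fun ξ => (qsym n ξ : ℂ)) (diag (pot 1) x)
          = diag (fm fun ξ => (qsym n ξ : ℂ) * (besselSymbol d (-1) ξ : ℂ)) x :=
        PiLp.ext fun k => fm_mul (memLp_qsym n) (memLp_besselSymbol zero_le_one) _
      rw [e]
      have := norm_diag_le zero_le_one (norm_fm_le zero_le_one (norm_qsym_mul_le n)) x
      rwa [one_mul] at this
    dense_j := denseRange_diag (denseRange_pot zero_le_one)
    coercive_ρ := fun x => by
      rw [PiLp.norm_sq_eq_of_L2, PiLp.inner_apply, Finset.mul_sum, Complex.re_sum]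
      refine Finset.sum_le_sum fun k _ => ?_
      have hc : MemLp (fun _ : Space d => ((m : ℝ) : ℂ)) ⊤ (volume : Measure (Space d)) :=
        memLp_top_of_bound' aestronglyMeasurable_const _ fun _ => le_rfl
      have h := re_inner_fm_mono hc hL h1 (x k)
      rw [fm_const, inner_smul_right, Complex.re_ofReal_mul, ← inner_fm_real_left hL,
        inner_self_eq_norm_sq_to_K] at h
      exact_mod_cast h
    bound_nonneg := hM
    norm_ρ := norm_diag_le hM (norm_fm_le hM hb) }

/-- The spatial part of the system, as an operator on `L2`. -/
def systemOp (Ma : Fin d → Fin d → Fin d₁ → Fin d₁ → L2 d →L[ℂ] L2 d)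
    (Mb : Fin d → Fin d₁ → Fin d₁ → L2 d →L[ℂ] L2 d) (Mc : Fin d₁ → Fin d₁ → L2 d →L[ℂ] L2 d) :
    Vec d d₁ →L[ℂ] Vec d d₁ :=
  mat fun k r => -(∑ i, ∑ j, Ma i j k r ∘L riesz i ∘L riesz j + ∑ i, Mb i k r ∘L riesz i ∘L pot 1
    + Mc k r ∘L pot 2)

theorem systemOp_apply (Ma : Fin d → Fin d → Fin d₁ → Fin d₁ → L2 d →L[ℂ] L2 d)
    (Mb : Fin d → Fin d₁ → Fin d₁ → L2 d →L[ℂ] L2 d) (Mc : Fin d₁ → Fin d₁ → L2 d →L[ℂ] L2 d)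
    (v : Vec d d₁) (k : Fin d₁) :
    systemOp Ma Mb Mc v k = -(∑ r, ∑ i, ∑ j, Ma i j k r (riesz i (riesz j (v r))))
      - ∑ r, (∑ i, Mb i k r (riesz i (pot 1 (v r))) + Mc k r (pot 2 (v r))) := by
  rw [systemOp, mat_apply, ← Finset.sum_neg_distrib, ← Finset.sum_sub_distrib]
  refine Finset.sum_congr rfl fun r _ => ?_
  simp only [neg_apply, add_apply, sum_apply, ContinuousLinearMap.comp_apply]
  abel

/-- The identity `1 = (1 - Δ)^{-1} - Δ (1 - Δ)^{-1}`. It turns a pairing with `v` into pairings with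
second derivatives, the form in which coercivity is known. -/
theorem pot_two_sub (v : L2 d) : v = pot 2 v - ∑ l, riesz l (riesz l v) := by
  have h : ∀ l, riesz l (riesz l v)
      = fm (fun ξ : Space d => (dsy l ξ * besselSymbol d (-1) ξ) * (dsy l ξ * besselSymbol d (-1) ξ)) v :=
    fun l => fm_mul (memLp_rieszSymbol l) (memLp_rieszSymbol l) v
  have hm : ∀ l : Fin d, MemLp (fun ξ : Space d =>
      (dsy l ξ * besselSymbol d (-1) ξ) * (dsy l ξ * besselSymbol d (-1) ξ)) ⊤ volume := fun l =>
    (memLp_rieszSymbol l).mul (memLp_rieszSymbol l)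
  simp only [h]
  rw [← fm_sum _ _ (fun l _ => hm l), pot, ← fm_sub (memLp_besselSymbol zero_le_two) (memLp_finsetSum _ fun l _ => hm l)]
  have : (fun ξ : Space d => (besselSymbol d (-2) ξ : ℂ) - ∑ l, (dsy l ξ * besselSymbol d (-1) ξ) *
      (dsy l ξ * besselSymbol d (-1) ξ)) = fun _ => 1 := by
    funext ξ
    have e1 : besselSymbol d (-2) ξ = besselSymbol d (-1) ξ * besselSymbol d (-1) ξ := by
      rw [← besselSymbol_add]; norm_num
    have e2 : besselSymbol d (-1) ξ * besselSymbol d (-1) ξ * br ξ = 1 := by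
      rw [← besselSymbol_add, besselSymbol_eq]
      rw [show ((-1 : ℝ) + -1) / 2 = -1 by norm_num, Real.rpow_neg_one, inv_mul_cancel₀ (br_pos ξ).ne']
    have e3 : ∀ l, dsy l ξ * besselSymbol d (-1) ξ * (dsy l ξ * besselSymbol d (-1) ξ)
        = ((-(2 * Real.pi * ξ l) ^ 2 * (besselSymbol d (-1) ξ * besselSymbol d (-1) ξ) : ℝ) : ℂ) := fun l => by
      rw [dsy]
      push_cast
      linear_combination (2 * Real.pi * ξ l : ℂ) ^ 2 * (besselSymbol d (-1) ξ : ℂ) ^ 2 * Complex.I_sq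
    simp only [e3, e1]
    rw [← Complex.ofReal_sum, ← Complex.ofReal_sub, ← Finset.sum_mul]
    refine (congrArg ((↑) : ℝ → ℂ) ?_).trans Complex.ofReal_one
    rw [br_eq_sum] at e2
    rw [Finset.sum_neg_distrib]
    linarith
  rw [this, fm_const, one_smul]

/-- A bound for the components of `systemOp`. -/
def compConst (d d₁ : ℕ) (C : ℝ) : ℝ := d₁ * ((d * d + d + 1) * C)

theorem norm_lower_le {Mb : Fin d → Fin d₁ → Fin d₁ → L2 d →L[ℂ] L2 d}
    {Mc : Fin d₁ → Fin d₁ → L2 d →L[ℂ] L2 d} {C : ℝ} (hC : 0 ≤ C)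
    (hb : ∀ i k r v, ‖Mb i k r v‖ ≤ C * ‖v‖) (hc : ∀ k r v, ‖Mc k r v‖ ≤ C * ‖v‖)
    (v : Vec d d₁) (k : Fin d₁) :
    ‖∑ r, (∑ i, Mb i k r (riesz i (pot 1 (v r))) + Mc k r (pot 2 (v r)))‖
      ≤ d₁ * ((d + 1) * C) * ‖diag (pot 1) v‖ := by
  have h : ∀ r, ‖∑ i, Mb i k r (riesz i (pot 1 (v r))) + Mc k r (pot 2 (v r))‖
      ≤ (d + 1) * C * ‖diag (pot 1) v‖ := fun r => by
    have hr : ‖pot 1 (v r)‖ ≤ ‖diag (pot 1) v‖ := PiLp.norm_apply_le (diag (pot 1) v) r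
    have h2 : ‖pot 2 (v r)‖ ≤ ‖diag (pot 1) v‖ := by
      have : pot 2 (v r) = pot 1 (pot 1 (v r)) := by
        rw [pot_pot zero_le_one zero_le_one]; norm_num
      rw [this]
      exact (norm_pot_le zero_le_one _).trans hr
    have h1 : ‖∑ i, Mb i k r (riesz i (pot 1 (v r)))‖ ≤ ∑ _i : Fin d, C * ‖diag (pot 1) v‖ :=
      (norm_sum_le _ _).trans (Finset.sum_le_sum fun i _ => (hb i k r _).trans
        (mul_le_mul_of_nonneg_left ((norm_riesz_le i _).trans hr) hC))
    rw [Finset.sum_const, Finset.card_univ, Fintype.card_fin, nsmul_eq_mul] at h1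
    refine (norm_add_le _ _).trans ((add_le_add h1 ((hc k r _).trans
      (mul_le_mul_of_nonneg_left h2 hC))).trans_eq ?_)
    ring
  refine (norm_sum_le _ _).trans ((Finset.sum_le_sum fun r _ => h r).trans_eq ?_)
  rw [Finset.sum_const, Finset.card_univ, Fintype.card_fin, nsmul_eq_mul]
  ring

theorem norm_systemOp_apply_le {Ma : Fin d → Fin d → Fin d₁ → Fin d₁ → L2 d →L[ℂ] L2 d}
    {Mb : Fin d → Fin d₁ → Fin d₁ → L2 d →L[ℂ] L2 d}
    {Mc : Fin d₁ → Fin d₁ → L2 d →L[ℂ] L2 d} {C : ℝ} (hC : 0 ≤ C)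
    (ha : ∀ i j k r v, ‖Ma i j k r v‖ ≤ C * ‖v‖)
    (hb : ∀ i k r v, ‖Mb i k r v‖ ≤ C * ‖v‖) (hc : ∀ k r v, ‖Mc k r v‖ ≤ C * ‖v‖)
    (v : Vec d d₁) (k : Fin d₁) : ‖systemOp Ma Mb Mc v k‖ ≤ compConst d d₁ C * ‖v‖ := by
  have hj : ‖diag (pot 1) v‖ ≤ ‖v‖ := by
    have := norm_diag_le (d₁ := d₁) zero_le_one (fun v : L2 d => by
      rw [one_mul]; exact norm_pot_le zero_le_one v) v
    rwa [one_mul] at this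
  have h1 : ‖∑ r, ∑ i, ∑ j, Ma i j k r (riesz i (riesz j (v r)))‖
      ≤ ∑ _r : Fin d₁, ∑ _i : Fin d, ∑ _j : Fin d, C * ‖v‖ :=
    (norm_sum_le _ _).trans <| Finset.sum_le_sum fun r _ =>
    (norm_sum_le _ _).trans <| Finset.sum_le_sum fun i _ =>
    (norm_sum_le _ _).trans <| Finset.sum_le_sum fun j _ => (ha i j k r _).trans
      (mul_le_mul_of_nonneg_left ((norm_riesz_le i _).trans
        ((norm_riesz_le j _).trans (PiLp.norm_apply_le v r))) hC)
  simp only [Finset.sum_const, Finset.card_univ, Fintype.card_fin, nsmul_eq_mul] at h1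
  have h2 := (norm_lower_le hC hb hc v k).trans
    (mul_le_mul_of_nonneg_left hj (by positivity))
  rw [systemOp_apply, sub_eq_add_neg]
  refine (norm_add_le _ _).trans ?_
  rw [norm_neg, norm_neg]
  refine (add_le_add h1 h2).trans_eq ?_
  rw [compConst]
  ring

theorem compConst_nonneg {C : ℝ} (hC : 0 ≤ C) : 0 ≤ compConst d d₁ C := by
  unfold compConst; positivity

theorem norm_systemOp_le {Ma : Fin d → Fin d → Fin d₁ → Fin d₁ → L2 d →L[ℂ] L2 d}
    {Mb : Fin d → Fin d₁ → Fin d₁ → L2 d →L[ℂ] L2 d}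
    {Mc : Fin d₁ → Fin d₁ → L2 d →L[ℂ] L2 d} {C : ℝ} (hC : 0 ≤ C)
    (ha : ∀ i j k r v, ‖Ma i j k r v‖ ≤ C * ‖v‖)
    (hb : ∀ i k r v, ‖Mb i k r v‖ ≤ C * ‖v‖) (hc : ∀ k r v, ‖Mc k r v‖ ≤ C * ‖v‖)
    (v : Vec d d₁) : ‖systemOp Ma Mb Mc v‖ ≤ √d₁ * compConst d d₁ C * ‖v‖ := by
  have h0 := compConst_nonneg (d := d) (d₁ := d₁) hC
  refine (sq_le_sq₀ (norm_nonneg _) (by positivity)).1 ?_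
  rw [PiLp.norm_sq_eq_of_L2]
  refine (Finset.sum_le_sum fun k _ => pow_le_pow_left₀ (norm_nonneg _)
    (norm_systemOp_apply_le hC ha hb hc v k) 2).trans_eq ?_
  rw [Finset.sum_const, Finset.card_univ, Fintype.card_fin, nsmul_eq_mul, mul_assoc √_, mul_pow √_,
    Real.sq_sqrt (Nat.cast_nonneg _)]

/-- The constant of the lower order terms in the Gårding inequality. -/
def gardingConst (d d₁ : ℕ) (CP C c lam : ℝ) : ℝ :=
  lam + (d₁ * (CP * (compConst d d₁ C * (1 + d)))) ^ 2 / (2 * c)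

theorem sum_idx (f : Fin d → Fin d → Fin d → Fin d₁ → Fin d₁ → ℝ) :
    ∑ p : Idx d d₁, f p.1 p.2.1 p.2.2.1 p.2.2.2.1 p.2.2.2.2 = ∑ k, ∑ l, ∑ r, ∑ i, ∑ j, f l i j k r := by
  simp only [Idx, Fintype.sum_prod_type]
  rw [Finset.sum_comm (s := (Finset.univ : Finset (Fin d₁)))]
  refine Finset.sum_congr rfl fun l _ => ?_
  have h1 : ∀ k, ∑ r, ∑ i, ∑ j, f l i j k r = ∑ i, ∑ j, ∑ r, f l i j k r := fun k => by
    rw [Finset.sum_comm]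
    exact Finset.sum_congr rfl fun i _ => Finset.sum_comm
  simp only [h1]
  rw [Finset.sum_comm (s := (Finset.univ : Finset (Fin d₁)))]
  refine Finset.sum_congr rfl fun i _ => ?_
  rw [Finset.sum_comm (s := (Finset.univ : Finset (Fin d₁)))]

/-- Used with `A` the leading and `B` the lower order part of the system. The first and the last
term on the right each contain a factor controlled by `pot 1`. -/
theorem inner_split (P : L2 d →L[ℂ] L2 d) {T A B : L2 d} (h : T = -A - B) (v : L2 d) :
    inner ℂ (P T) v = inner ℂ (P T) (pot 2 v) + ∑ l, inner ℂ (P A) (riesz l (riesz l v))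
      + ∑ l, inner ℂ (P B) (riesz l (riesz l v)) := by
  have hPT : P T = -P A - P B := by rw [h, map_sub, map_neg]
  have h1 : inner ℂ (P T) v
      = inner ℂ (P T) (pot 2 v) - ∑ l, inner ℂ (P T) (riesz l (riesz l v)) := by
    rw [← inner_sum, ← inner_sub_right, ← pot_two_sub]
  have h2 : ∀ z, inner ℂ (P T) z = -inner ℂ (P A) z - inner ℂ (P B) z := fun z => by
    rw [hPT, inner_sub_left, inner_neg_left]
  rw [h1]
  simp only [h2, Finset.sum_sub_distrib, Finset.sum_neg_distrib]
  ring

theorem abs_re_inner_le {P : L2 d →L[ℂ] L2 d} {CP X Y : ℝ} (hCP : 0 ≤ CP) (hP : ∀ v, ‖P v‖ ≤ CP * ‖v‖)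
    {x y : L2 d} (hx : ‖x‖ ≤ X) (hy : ‖y‖ ≤ Y) : |(inner ℂ (P x) y).re| ≤ CP * X * Y :=
  (Complex.abs_re_le_norm _).trans ((norm_inner_le_norm _ _).trans
    (mul_le_mul ((hP _).trans (mul_le_mul_of_nonneg_left hx hCP)) hy (norm_nonneg _)
      (mul_nonneg hCP ((norm_nonneg _).trans hx))))

-- After `inner_split` the middle term is the leading form of `hmain`. The other terms are at most a
-- constant times `‖v‖ ‖diag (pot 1) v‖`.
set_option maxHeartbeats 1000000 in
theorem garding {P : L2 d →L[ℂ] L2 d} {Ma : Fin d → Fin d → Fin d₁ → Fin d₁ → L2 d →L[ℂ] L2 d}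
    {Mb : Fin d → Fin d₁ → Fin d₁ → L2 d →L[ℂ] L2 d}
    {Mc : Fin d₁ → Fin d₁ → L2 d →L[ℂ] L2 d} {C CP c lam : ℝ} (hC : 0 ≤ C) (hCP : 0 ≤ CP)
    (hc0 : 0 < c) (hP : ∀ v, ‖P v‖ ≤ CP * ‖v‖)
    (ha : ∀ i j k r v, ‖Ma i j k r v‖ ≤ C * ‖v‖)
    (hb : ∀ i k r v, ‖Mb i k r v‖ ≤ C * ‖v‖) (hc : ∀ k r v, ‖Mc k r v‖ ≤ C * ‖v‖)
    (hmain : ∀ v : Fin d₁ → L2 d, c * ∑ k, ‖v k‖ ^ 2 - lam * ∑ k, ‖pot 1 (v k)‖ ^ 2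
      ≤ ∑ p : Idx d d₁, (inner ℂ (P (Ma p.2.1 p.2.2.1 p.2.2.2.1 p.2.2.2.2
          (riesz p.2.1 (riesz p.2.2.1 (v p.2.2.2.2))))) (riesz p.1 (riesz p.1 (v p.2.2.2.1)))).re)
    (v : Vec d d₁) :
    c / 2 * ‖v‖ ^ 2 ≤ (inner ℂ (diag P (systemOp Ma Mb Mc v)) v).re
      + gardingConst d d₁ CP C c lam * ‖diag (pot 1) v‖ ^ 2 := by
  set C1 := compConst d d₁ C with hC1
  have hC1n : 0 ≤ C1 := compConst_nonneg hC
  set y := ‖diag (pot 1) v‖ with hy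
  have hy0 : 0 ≤ y := norm_nonneg _
  have hm := hmain v
  rw [sum_idx fun l i j k r => (inner ℂ (P (Ma i j k r (riesz i (riesz j (v r)))))
    (riesz l (riesz l (v k)))).re] at hm
  rw [← PiLp.norm_sq_eq_of_L2, show ∑ k, ‖pot 1 (v k)‖ ^ 2 = y ^ 2 from
    (PiLp.norm_sq_eq_of_L2 _ (diag (pot 1) v)).symm] at hm
  have hk : ∀ k, ∑ l, ∑ r, ∑ i, ∑ j, (inner ℂ (P (Ma i j k r (riesz i (riesz j (v r)))))
      (riesz l (riesz l (v k)))).re - CP * (C1 * (1 + d)) * ‖v‖ * y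
      ≤ (inner ℂ (P (systemOp Ma Mb Mc v k)) (v k)).re := fun k => by
    obtain ⟨A, hA⟩ : ∃ A, A = ∑ r, ∑ i, ∑ j, Ma i j k r (riesz i (riesz j (v r))) := ⟨_, rfl⟩
    obtain ⟨B, hB⟩ : ∃ B, B = ∑ r, (∑ i, Mb i k r (riesz i (pot 1 (v r))) + Mc k r (pot 2 (v r))) :=
      ⟨_, rfl⟩
    have hBn : ‖B‖ ≤ C1 * y := by
      rw [hB]
      refine (norm_lower_le hC hb hc v k).trans (mul_le_mul_of_nonneg_right ?_ hy0)
      rw [hC1, compConst]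
      have : (0 : ℝ) ≤ d₁ * ((d * d) * C) := by positivity
      nlinarith
    have hT := norm_systemOp_apply_le hC ha hb hc v k
    have hS : systemOp Ma Mb Mc v k = -A - B := by
      rw [hA, hB]
      exact systemOp_apply _ _ _ v k
    have hp2 : ‖pot 2 (v k)‖ ≤ y := by
      have : pot 2 (v k) = pot 1 (pot 1 (v k)) := by
        rw [pot_pot zero_le_one zero_le_one]; norm_num
      rw [this]
      exact (norm_pot_le zero_le_one _).trans (PiLp.norm_apply_le (diag (pot 1) v) k)
    have e := inner_split P hS (v k)
    have e1 : ∀ l, (inner ℂ (P A) (riesz l (riesz l (v k)))).re = ∑ r, ∑ i, ∑ j,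
        (inner ℂ (P (Ma i j k r (riesz i (riesz j (v r))))) (riesz l (riesz l (v k)))).re := fun l => by
      rw [hA]
      simp only [map_sum, sum_inner, Complex.re_sum]
    have h1 := abs_re_inner_le hCP hP hT hp2
    have h2 : ∀ l, -(CP * (C1 * y) * ‖v‖) ≤ (inner ℂ (P B) (riesz l (riesz l (v k)))).re := fun l =>
      (abs_le.1 (abs_re_inner_le hCP hP hBn ((norm_riesz_le l _).trans
        ((norm_riesz_le l _).trans (PiLp.norm_apply_le v k))))).1
    have h3 : ∑ _l : Fin d, -(CP * (C1 * y) * ‖v‖)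
        ≤ ∑ l, (inner ℂ (P B) (riesz l (riesz l (v k)))).re := Finset.sum_le_sum fun l _ => h2 l
    rw [Finset.sum_const, Finset.card_univ, Fintype.card_fin, nsmul_eq_mul] at h3
    rw [e, Complex.add_re, Complex.add_re, Complex.re_sum, Complex.re_sum]
    simp only [e1]
    have h4 := (abs_le.1 h1).1
    have h5 : CP * (C1 * (1 + d)) * ‖v‖ * y = CP * (C1 * ‖v‖) * y + d * (CP * (C1 * y) * ‖v‖) := by
      ring
    rw [h5]
    linarith
  have hs := Finset.sum_le_sum (s := Finset.univ) fun k _ => hk k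
  rw [Finset.sum_sub_distrib, Finset.sum_const, Finset.card_univ, Fintype.card_fin, nsmul_eq_mul] at hs
  rw [PiLp.inner_apply, Complex.re_sum]
  simp only [diag_apply]
  set D : ℝ := d₁ * (CP * (C1 * (1 + d))) with hD
  -- Young's inequality spends half of the coercivity constant; the other coefficient is the second
  -- term of `gardingConst`.
  have h5 : D * ‖v‖ * y ≤ c / 2 * ‖v‖ ^ 2 + D ^ 2 / (2 * c) * y ^ 2 := by
    have h6 : 0 ≤ (c * ‖v‖ - D * y) ^ 2 / (2 * c) := by positivity
    have h7 : (c * ‖v‖ - D * y) ^ 2 / (2 * c)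
        = c / 2 * ‖v‖ ^ 2 + D ^ 2 / (2 * c) * y ^ 2 - D * ‖v‖ * y := by field_simp; ring
    linarith
  rw [gardingConst, ← hC1, ← hD]
  have h8 : (d₁ : ℝ) * (CP * (C1 * (1 + d)) * ‖v‖ * y) = D * ‖v‖ * y := by rw [hD]; ring
  rw [h8] at hs
  linarith

end ParabolicSystem
end

/-! ### Conjugation, the bilinear pairing and multiplication of distributions. -/

noncomputable section
namespace ParabolicSystem
set_option linter.unusedSectionVars false
open MeasureTheory Set Filter Topology
open scoped SchwartzMap ENNReal LineDeriv FourierTransform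

variable {d d₁ : ℕ}

/-- Complex conjugation on `L2`. -/
def cj : L2 d →L[ℝ] L2 d := (Complex.conjCLE : ℂ →L[ℝ] ℂ).compLpL 2 volume

theorem coeFn_cj (v : L2 d) : cj v =ᵐ[volume] fun x => starRingEnd ℂ (v x) :=
  ContinuousLinearMap.coeFn_compLpL _ v

/-- Complex conjugation on Schwartz functions. -/
def cjS : 𝓢(Space d, ℂ) →L[ℝ] 𝓢(Space d, ℂ) :=
  SchwartzMap.postcompCLM (Complex.conjCLE : ℂ →L[ℝ] ℂ)

@[simp]
theorem cjS_apply (f : 𝓢(Space d, ℂ)) (x : Space d) : cjS f x = starRingEnd ℂ (f x) := rfl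

theorem cj_J (f : 𝓢(Space d, ℂ)) : cj (J f) = J (cjS f) := by
  refine Lp.ext ?_
  filter_upwards [coeFn_cj (J f), coeFn_J f, coeFn_J (cjS f)] with x h1 h2 h3
  rw [h1, h2, h3, cjS_apply]

theorem cj_cj (v : L2 d) : cj (cj v) = v := by
  refine Lp.ext ?_
  filter_upwards [coeFn_cj (cj v), coeFn_cj v] with x h1 h2
  rw [h1, h2, Complex.conj_conj]

theorem inner_cj_cj (v w : L2 d) : inner ℂ (cj v) (cj w) = inner ℂ w v := by
  rw [L2.inner_def, L2.inner_def]
  refine integral_congr_ae ?_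
  filter_upwards [coeFn_cj v, coeFn_cj w] with x h1 h2
  rw [h1, h2]
  simp only [RCLike.inner_apply, Complex.conj_conj]
  ring

/-- The bilinear pairing `∫ v w`. -/
def pr (v w : L2 d) : ℂ := inner ℂ (cj v) w

theorem pr_eq_integral (v w : L2 d) : pr v w = ∫ x, v x * w x := by
  rw [pr, L2.inner_def]
  refine integral_congr_ae ?_
  filter_upwards [coeFn_cj v] with x h1
  rw [h1]
  simp only [RCLike.inner_apply, Complex.conj_conj]
  ring

theorem pr_comm (v w : L2 d) : pr v w = pr w v := by
  rw [pr_eq_integral, pr_eq_integral]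
  simp only [mul_comm]

theorem pr_cj_cj (v w : L2 d) : pr (cj v) (cj w) = starRingEnd ℂ (pr v w) := by
  rw [pr, pr, inner_cj_cj, inner_conj_symm]

theorem pr_add_left (u v w : L2 d) : pr (u + v) w = pr u w + pr v w := by
  rw [pr, map_add, inner_add_left, pr, pr]

theorem eq_of_pr_J {v w : L2 d} (h : ∀ φ : 𝓢(Space d, ℂ), pr v (J φ) = pr w (J φ)) : v = w := by
  have h1 : cj v = cj w := by
    rw [← sub_eq_zero]
    refine denseRange_J.eq_zero_of_inner_left (𝕜 := ℂ) fun φ => ?_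
    rw [inner_sub_left, sub_eq_zero]
    exact h φ
  rw [← cj_cj v, h1, cj_cj]

theorem fourier_cjS (f : 𝓢(Space d, ℂ)) (ξ : Space d) :
    𝓕 (cjS f) ξ = starRingEnd ℂ (𝓕 f (-ξ)) := by
  rw [SchwartzMap.fourier_coe, SchwartzMap.fourier_coe, Real.fourier_eq', Real.fourier_eq',
    ← integral_conj]
  congr 1
  funext x
  rw [cjS_apply, smul_eq_mul, smul_eq_mul, map_mul, ← Complex.exp_conj]
  congr 2
  simp [Complex.conj_ofNat]

theorem br_neg (ξ : Space d) : br (-ξ) = br ξ := by rw [br, br, smul_neg, norm_neg]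

theorem besselSymbol_neg_arg (s : ℝ) (ξ : Space d) : besselSymbol d s (-ξ) = besselSymbol d s ξ := by
  rw [besselSymbol_eq, besselSymbol_eq, br_neg]

theorem bs_cjS (s : ℝ) (f : 𝓢(Space d, ℂ)) : bs s (cjS f) = cjS (bs s f) :=
  hat_ext fun ξ => by
    rw [hat_bs, fourier_cjS, fourier_cjS, hat_bs, map_mul, Complex.conj_ofReal, besselSymbol_neg_arg]

theorem pd_cjS (i : Fin d) (f : 𝓢(Space d, ℂ)) : pd i (cjS f) = cjS (pd i f) :=
  hat_ext fun ξ => by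
    rw [hat_pd, fourier_cjS, fourier_cjS, hat_pd]
    simp [Complex.conj_ofReal, Complex.conj_ofNat]

theorem pot_cj {r : ℝ} (hr : 0 ≤ r) (v : L2 d) : pot r (cj v) = cj (pot r v) := by
  refine denseRange_J.induction_on (p := fun v => pot r (cj v) = cj (pot r v)) v
    (isClosed_eq (by fun_prop) (by fun_prop)) fun f => ?_
  rw [cj_J, pot_J hr, pot_J hr, cj_J, bs_cjS]

theorem riesz_cj (i : Fin d) (v : L2 d) : riesz i (cj v) = cj (riesz i v) := by
  refine (denseRange_J_bs (0 + 1)).induction_on (p := fun v => riesz i (cj v) = cj (riesz i v)) v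
    (isClosed_eq (by fun_prop) (by fun_prop)) fun f => ?_
  rw [cj_J, ← bs_cjS, riesz_J, riesz_J, cj_J, pd_cjS, bs_cjS]

theorem mulOp_cj {a : Space d → ℝ} (ha : MemLp (fun x => (a x : ℂ)) ⊤ (volume : Measure (Space d)))
    (v : L2 d) : mulOp (fun x => (a x : ℂ)) (cj v) = cj (mulOp (fun x => (a x : ℂ)) v) := by
  refine Lp.ext ?_
  filter_upwards [coeFn_mulOp ha (cj v), coeFn_cj v, coeFn_cj (mulOp (fun x => (a x : ℂ)) v),
    coeFn_mulOp ha v] with x h1 h2 h3 h4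
  rw [h1, h2, h3, h4, map_mul, Complex.conj_ofReal]

theorem pr_pot {r : ℝ} (hr : 0 ≤ r) (v w : L2 d) : pr (pot r v) w = pr v (pot r w) := by
  rw [pr, ← pot_cj hr, pot_symm hr, pr]

theorem pr_mulOp {a : Space d → ℝ} (ha : MemLp (fun x => (a x : ℂ)) ⊤ (volume : Measure (Space d)))
    (v w : L2 d) : pr (mulOp (fun x => (a x : ℂ)) v) w = pr v (mulOp (fun x => (a x : ℂ)) w) := by
  rw [pr, ← mulOp_cj ha, inner_mulOp_left ha, pr]
  simp only [Complex.conj_ofReal]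

theorem pr_riesz (i : Fin d) (v w : L2 d) : pr (riesz i v) w = -pr v (riesz i w) := by
  rw [pr, ← riesz_cj, riesz, inner_fm_left (memLp_rieszSymbol i), pr]
  have : (fun ξ : Space d => starRingEnd ℂ (dsy i ξ * besselSymbol d (-1) ξ))
      = fun ξ => (-1) * (dsy i ξ * besselSymbol d (-1) ξ) := by
    funext ξ
    simp [dsy, Complex.conj_ofNat]
  rw [this, fm_const_mul (memLp_rieszSymbol i), inner_smul_right]
  ring

theorem coe_apply_eq_pr (v : L2 d) (φ : 𝓢(Space d, ℂ)) : (v : Dist d) φ = pr v (J φ) := by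
  rw [Lp.toTemperedDistribution_apply, pr_eq_integral]
  refine integral_congr_ae ?_
  filter_upwards [coeFn_J φ] with x h1
  rw [h1, smul_eq_mul, mul_comm]

theorem fourierInv_apply_eq (f : 𝓢(Space d, ℂ)) (ξ : Space d) : 𝓕⁻ f ξ = 𝓕 f (-ξ) := by
  rw [SchwartzMap.fourierInv_coe, SchwartzMap.fourier_coe, Real.fourierInv_eq_fourier_neg]

/-- Transposing a Fourier multiplier reflects its symbol, and the Bessel symbol is even. -/
theorem besselOp_apply (s : ℝ) (u : Dist d) (φ : 𝓢(Space d, ℂ)) : besselOp s u φ = u (bs s φ) := by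
  rw [besselOp, TemperedDistribution.fourierMultiplierCLM_apply_apply]
  congr 1
  refine hat_ext fun ξ => ?_
  rw [hat_bs]
  set h := SchwartzMap.smulLeftCLM ℂ (fun ξ : Space d => (besselSymbol d s ξ : ℂ)) (𝓕⁻ φ) with hh
  have e : 𝓕 (𝓕 h) ξ = h (-ξ) := by
    have := fourierInv_apply_eq (𝓕 h) (-ξ)
    rw [neg_neg, FourierTransform.fourierInv_fourier_eq] at this
    exact this.symm
  rw [e, hh, SchwartzMap.smulLeftCLM_apply_apply (besselSymbol_hasTemperateGrowth d s),
    fourierInv_apply_eq, neg_neg, besselSymbol_neg_arg, smul_eq_mul]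

theorem dist_ext {u v : Dist d} (h : ∀ φ, u φ = v φ) : u = v := by
  ext φ
  exact h φ

theorem besselOp_besselOp (s r : ℝ) (u : Dist d) : besselOp s (besselOp r u) = besselOp (s + r) u :=
  dist_ext fun φ => by rw [besselOp_apply, besselOp_apply, besselOp_apply, bs_bs, add_comm]

theorem besselOp_zero (u : Dist d) : besselOp 0 u = u :=
  dist_ext fun φ => by rw [besselOp_apply, bs_zero]

theorem besselOp_coe {r : ℝ} (hr : 0 ≤ r) (v : L2 d) : besselOp (-r) (v : Dist d) = (pot r v : Dist d) :=
  fourierMultiplier_coe (besselSymbol_hasTemperateGrowth d (-r)) (memLp_besselSymbol hr) v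

theorem besselRep_eq {s : ℝ} {u : Dist d} {v : L2 d} (h : besselOp s u = (v : Dist d)) :
    besselRep s u = v := (besselRep_eq_iff ⟨v, h⟩ v).2 h

theorem besselOp_eq_rep {s : ℝ} {u : Dist d} (h : BesselInL2 s u) :
    besselOp s u = (besselRep s u : Dist d) := (besselRep_eq_iff h _).1 rfl

theorem eq_besselOp_rep {s : ℝ} {u : Dist d} (h : BesselInL2 s u) :
    u = besselOp (-s) (besselRep s u : Dist d) := by
  rw [← besselOp_eq_rep h, besselOp_besselOp, neg_add_cancel, besselOp_zero]

theorem besselOp_neg_coe (s : ℝ) (v : L2 d) : besselOp s (besselOp (-s) (v : Dist d)) = (v : Dist d) := by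
  rw [besselOp_besselOp, add_neg_cancel, besselOp_zero]

theorem besselInL2_potential (s : ℝ) (v : L2 d) : BesselInL2 s (besselOp (-s) (v : Dist d)) :=
  ⟨v, besselOp_neg_coe s v⟩

theorem besselRep_potential (s : ℝ) (v : L2 d) : besselRep s (besselOp (-s) (v : Dist d)) = v :=
  besselRep_eq (besselOp_neg_coe s v)

theorem besselOp_of_le {s r : ℝ} (hr : 0 ≤ r) {u : Dist d} (h : BesselInL2 (s + r) u) :
    besselOp s u = (pot r (besselRep (s + r) u) : Dist d) := by
  rw [← besselOp_coe hr, ← besselOp_eq_rep h, besselOp_besselOp]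
  congr 1
  ring

theorem besselInL2_of_le {s r : ℝ} (hr : 0 ≤ r) {u : Dist d} (h : BesselInL2 (s + r) u) :
    BesselInL2 s u := ⟨_, besselOp_of_le hr h⟩

theorem besselRep_of_le {s r : ℝ} (hr : 0 ≤ r) {u : Dist d} (h : BesselInL2 (s + r) u) :
    besselRep s u = pot r (besselRep (s + r) u) := besselRep_eq (besselOp_of_le hr h)

theorem apply_eq_pr {s : ℝ} {u : Dist d} (h : BesselInL2 s u) (φ : 𝓢(Space d, ℂ)) :
    u φ = pr (besselRep s u) (J (bs (-s) φ)) := by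
  conv_lhs => rw [eq_besselOp_rep h, besselOp_apply, coe_apply_eq_pr]

theorem besselOp_pderiv {s : ℝ} (i : Fin d) {u : Dist d} (h : BesselInL2 (s + 1) u) :
    besselOp s (pderiv i u) = (riesz i (besselRep (s + 1) u) : Dist d) := by
  refine dist_ext fun φ => ?_
  rw [besselOp_apply, pderiv, TemperedDistribution.lineDerivOp_apply_apply, coe_apply_eq_pr, pr_riesz,
    map_neg, ← pd_apply, apply_eq_pr h]
  congr 2
  refine (J_eq_fm (memLp_rieszSymbol i) fun ξ => ?_)
  rw [hat_bs, hat_pd, hat_bs, show -1 = -(s + 1) + s by ring, besselSymbol_add, dsy]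
  push_cast
  ring

theorem besselInL2_pderiv {s : ℝ} (i : Fin d) {u : Dist d} (h : BesselInL2 (s + 1) u) :
    BesselInL2 s (pderiv i u) := ⟨_, besselOp_pderiv i h⟩

theorem besselRep_pderiv {s : ℝ} (i : Fin d) {u : Dist d} (h : BesselInL2 (s + 1) u) :
    besselRep s (pderiv i u) = riesz i (besselRep (s + 1) u) := besselRep_eq (besselOp_pderiv i h)

theorem cjS_eq_self {φ : 𝓢(Space d, ℂ)} (h : ∀ x, (φ x).im = 0) : cjS φ = φ :=
  SchwartzMap.ext fun x => Complex.conj_eq_iff_im.2 (h x)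

theorem im_eq_zero_of_cjS {φ : 𝓢(Space d, ℂ)} (h : cjS φ = φ) (x : Space d) : (φ x).im = 0 :=
  Complex.conj_eq_iff_im.1 (by rw [← cjS_apply, h])

/-- Bessel potentials commute with conjugation, so reality can be tested on the representing
function. -/
theorem isReal_iff {s : ℝ} {u : Dist d} (h : BesselInL2 s u) :
    IsReal u ↔ cj (besselRep s u) = besselRep s u := by
  set v := besselRep s u with hv
  have key : ∀ φ, u φ = pr v (J (bs (-s) φ)) := apply_eq_pr h
  constructor
  · intro hr
    have h1 : ∀ ψ : 𝓢(Space d, ℂ), cjS ψ = ψ → pr (cj v) (J ψ) = pr v (J ψ) := fun ψ hψ => by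
      have e : bs (-s) (bs s ψ) = ψ := by rw [bs_bs, neg_add_cancel, bs_zero]
      have h2 := hr (bs s ψ) (im_eq_zero_of_cjS (by rw [← bs_cjS, hψ]))
      rw [key, e, ← Complex.conj_eq_iff_im, ← pr_cj_cj, cj_J, hψ] at h2
      exact h2
    refine eq_of_pr_J fun φ => ?_
    -- A complex test function is a combination of two functions fixed by conjugation.
    have e : φ = (1 / 2 : ℂ) • (φ + cjS φ) + (-Complex.I / 2) • (Complex.I • (φ - cjS φ)) := by
      refine SchwartzMap.ext fun x => ?_
      simp only [add_apply, sub_apply, smul_apply, smul_eq_mul]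
      linear_combination (1 / 2 : ℂ) * (φ x - cjS φ x) * Complex.I_sq
    have hs : ∀ (c : ℂ) (f : 𝓢(Space d, ℂ)), cjS (c • f) = starRingEnd ℂ c • cjS f := fun c f =>
      SchwartzMap.ext fun x => by simp
    have hcc : cjS (cjS φ) = φ := SchwartzMap.ext fun x => by simp
    rw [e]
    simp only [map_add (J (d := d)), map_smul (J (d := d)), pr, inner_add_right, inner_smul_right]
    have h2 := h1 (φ + cjS φ) (by rw [map_add, hcc, add_comm])
    have h3 := h1 (Complex.I • (φ - cjS φ)) (by
      rw [hs, map_sub, hcc, Complex.conj_I, neg_smul, ← smul_neg, neg_sub])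
    simp only [pr, map_add (J (d := d)), map_smul (J (d := d)), inner_add_right, inner_smul_right] at h2 h3
    rw [h2, h3]
  · intro hc φ hφ
    rw [key, ← Complex.conj_eq_iff_im, ← pr_cj_cj, hc, cj_J, ← bs_cjS, cjS_eq_self hφ]

theorem ofFun_mul {a : Space d → ℝ} (ha : MemLp (fun x => (a x : ℂ)) ⊤ (volume : Measure (Space d)))
    (φ : 𝓢(Space d, ℂ)) : ofFun (fun y => (a y : ℂ) * φ y)
      = (mulOp (fun x => (a x : ℂ)) (J φ) : Dist d) := by
  have h1 : (fun y => (a y : ℂ) * φ y) =ᵐ[volume] mulOp (fun x => (a x : ℂ)) (J φ) := by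
    filter_upwards [coeFn_mulOp ha (J φ), coeFn_J φ] with x h1 h2
    rw [h1, h2]
  have h2 : MemLp (fun y => (a y : ℂ) * φ y) 2 (volume : Measure (Space d)) :=
    (Lp.memLp _).ae_eq h1.symm
  rw [ofFun, dif_pos h2]
  congr 1
  refine Lp.ext ?_
  filter_upwards [h1, h2.coeFn_toLp] with x h3 h4
  rw [h4, h3]

/-- `M` is multiplication by `a` in `H^γ`, conjugated by `(1 - Δ)^{γ/2}`. -/
structure IsMulH (γ C : ℝ) (a : Space d → ℝ) (M : L2 d →L[ℂ] L2 d) : Prop where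
  norm_le : ∀ v, ‖M v‖ ≤ C * ‖v‖
  map_cj : ∀ v, M (cj v) = cj (M v)
  mulPair_eq : ∀ v φ, mulPair γ a v φ = pr (M (besselRep γ v)) (J (bs (-γ) φ))

open Classical in
/-- The operator of multiplication in `H^γ`, defined by duality for negative `γ`. -/
def dualOp (γ : ℝ) (N : L2 d →L[ℂ] L2 d) : L2 d →L[ℂ] L2 d :=
  if 0 ≤ γ then N else ContinuousLinearMap.adjoint N

theorem IsMul.map_cj {s C : ℝ} (hs : 0 ≤ s) {a : Space d → ℝ} {N : L2 d →L[ℂ] L2 d} (h : IsMul s C a N)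
    (v : L2 d) : N (cj v) = cj (N v) :=
  pot_injective hs (by rw [h.pot_apply, pot_cj hs, mulOp_cj h.memLp, pot_cj hs, h.pot_apply])

theorem adjoint_map_cj {N : L2 d →L[ℂ] L2 d} (h : ∀ v, N (cj v) = cj (N v)) (v : L2 d) :
    ContinuousLinearMap.adjoint N (cj v) = cj (ContinuousLinearMap.adjoint N v) := by
  refine ext_inner_right ℂ fun w => ?_
  rw [ContinuousLinearMap.adjoint_inner_left, ← cj_cj w, h, inner_cj_cj, inner_cj_cj,
    ContinuousLinearMap.adjoint_inner_right]

/-- For `γ < 0` the pairing involves `(1 - Δ)^{-γ/2} (a φ)`, which is `N` applied to `(1 - Δ)^{-γ/2}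
φ`. The product is thus given by the transpose of `N`, which agrees with the adjoint because `N`
commutes with conjugation. -/
theorem IsMul.isMulH {γ C : ℝ} (hC : 0 ≤ C) {a : Space d → ℝ} {N : L2 d →L[ℂ] L2 d}
    (h : IsMul |γ| C a N) : IsMulH γ C a (dualOp γ N) := by
  have hs := abs_nonneg γ
  have hcj := h.map_cj hs
  have hn : ‖N‖ ≤ C := N.opNorm_le_bound hC h.norm_le
  unfold dualOp
  split_ifs with h0
  · rw [abs_of_nonneg h0] at h
    refine ⟨h.norm_le, hcj, fun v φ => ?_⟩
    rw [mulPair, ofFun_mul h.memLp, besselRep_eq (besselOp_coe h0 _), ← pr_eq_integral, ← pr_pot h0,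
      ← pr_mulOp h.memLp, ← h.pot_apply, pr_pot h0, pot_J h0]
  · push Not at h0
    rw [abs_of_neg h0] at h
    have h1 : 0 ≤ -γ := by linarith
    refine ⟨fun v => ?_, adjoint_map_cj hcj, fun v φ => ?_⟩
    · refine (ContinuousLinearMap.le_opNorm _ v).trans ?_
      rw [LinearIsometryEquiv.norm_map]
      exact mul_le_mul_of_nonneg_right hn (norm_nonneg _)
    · have e : ofFun (fun y => (a y : ℂ) * φ y) = besselOp (- -γ) ((N (J (bs (-γ) φ)) : L2 d) : Dist d) := by
        rw [besselOp_coe h1, h.pot_apply, pot_J_bs h1, ofFun_mul h.memLp]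
      rw [mulPair, e, besselRep_potential, ← pr_eq_integral, pr, pr, ← adjoint_map_cj hcj,
        ContinuousLinearMap.adjoint_inner_left]

end ParabolicSystem
end

/-! ### Density of compactly supported test functions. -/

noncomputable section
namespace ParabolicSystem
set_option linter.unusedSectionVars false
open MeasureTheory Set Filter Topology
open scoped SchwartzMap ENNReal LineDeriv FourierTransform

variable {d d₁ : ℕ}

/-- A smooth function equal to one on the unit ball, with compact support. -/
def cutoff (d : ℕ) : ContDiffBump (0 : Space d) := ⟨1, 2, one_pos, one_lt_two⟩

theorem hasTemperateGrowth_cutoff (c : ℝ) :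
    (fun x : Space d => cutoff d (c • x)).HasTemperateGrowth := by
  have h1 : (fun x : Space d => cutoff d x).HasTemperateGrowth :=
    ((cutoff d).hasCompactSupport.toSchwartzMap (cutoff d).contDiff).hasTemperateGrowth
  have h2 : (fun x : Space d => c • x).HasTemperateGrowth := by fun_prop
  exact h1.comp h2

theorem exists_bound_iteratedFDeriv_cutoff (i : ℕ) :
    ∃ B, 0 ≤ B ∧ ∀ x : Space d, ‖iteratedFDeriv ℝ i (fun x => 1 - cutoff d x) x‖ ≤ B := by
  obtain ⟨B, hB⟩ := ((cutoff d).hasCompactSupport.iteratedFDeriv (𝕜 := ℝ) i).exists_bound_of_continuous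
    ((cutoff d).contDiff.continuous_iteratedFDeriv (m := i) (by exact_mod_cast le_top))
  refine ⟨1 + B, add_nonneg zero_le_one ((norm_nonneg _).trans (hB 0)), fun x => ?_⟩
  have e : (fun x : Space d => 1 - cutoff d x) = (fun _ => (1 : ℝ)) - (cutoff d : Space d → ℝ) := rfl
  rw [e, iteratedFDeriv_sub_apply contDiffAt_const (cutoff d).contDiffAt]
  refine (norm_sub_le _ _).trans (add_le_add ?_ (hB x))
  rcases Nat.eq_zero_or_pos i with rfl | hi
  · rw [norm_iteratedFDeriv_zero, norm_one]
  · rw [iteratedFDeriv_const_of_ne hi.ne']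
    simp

theorem iteratedFDeriv_cutoff_eq_zero (i : ℕ) {x : Space d} (hx : ‖x‖ < 1) :
    iteratedFDeriv ℝ i (fun x => 1 - cutoff d x) x = 0 := by
  have h : (fun x => 1 - cutoff d x) =ᶠ[𝓝 x] fun _ => (0 : ℝ) := by
    have h1 : Metric.ball (0 : Space d) 1 ∈ 𝓝 x := Metric.isOpen_ball.mem_nhds (by simpa using hx)
    filter_upwards [h1] with y hy
    rw [(cutoff d).one_of_mem_closedBall (Metric.ball_subset_closedBall hy), sub_self]
  rw [(h.iteratedFDeriv ℝ i).eq_of_nhds]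
  simp

/-- Compactly supported functions are dense in the Schwartz space. -/
theorem tendsto_mulS_cutoff (φ : 𝓢(Space d, ℂ)) :
    Tendsto (fun n : ℕ => mulS (fun x => cutoff d ((1 / ((n : ℝ) + 1)) • x)) φ) atTop (𝓝 φ) := by
  choose B hB0 hB using exists_bound_iteratedFDeriv_cutoff (d := d)
  rw [(schwartz_withSeminorms ℝ (Space d) ℂ).tendsto_nhds]
  rintro ⟨k, m⟩ ε hε
  set M : ℝ := ∑ i ∈ Finset.range (m + 1), (m.choose i : ℝ) * B i * SchwartzMap.seminorm ℝ (k + 1) (m - i) φ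
    with hM
  have hM0 : 0 ≤ M := Finset.sum_nonneg fun i _ =>
    mul_nonneg (mul_nonneg (Nat.cast_nonneg _) (hB0 i)) (apply_nonneg _ _)
  have hz : Tendsto (fun n : ℕ => 1 / ((n : ℝ) + 1) * M) atTop (𝓝 0) := by
    simpa only [zero_mul] using (tendsto_one_div_add_atTop_nhds_zero_nat (𝕜 := ℝ)).mul_const M
  filter_upwards [hz.eventually (gt_mem_nhds hε)] with n hn
  set c : ℝ := 1 / ((n : ℝ) + 1) with hc
  have hc0 : 0 < c := by positivity
  have hc1 : c ≤ 1 := by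
    rw [hc, div_le_one (by positivity)]
    linarith [(Nat.cast_nonneg n : (0 : ℝ) ≤ n)]
  refine lt_of_le_of_lt ?_ hn
  rw [map_sub_rev]
  refine SchwartzMap.seminorm_le_bound ℝ k m _ (by positivity) fun x => ?_
  have hsm : ContDiff ℝ (⊤ : ℕ∞) (fun x : Space d => 1 - cutoff d x) := contDiff_const.sub (cutoff d).contDiff
  have e : ((φ - mulS (fun x => cutoff d (c • x)) φ : 𝓢(Space d, ℂ)) : Space d → ℂ)
      = fun x => (fun y : Space d => 1 - cutoff d (c • y)) x • φ x := by
    funext y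
    rw [sub_apply, mulS_apply (hasTemperateGrowth_cutoff c), Complex.real_smul]
    push_cast
    ring
  rw [e]
  -- The function vanishes for `‖c • x‖ < 1`, and elsewhere `1 ≤ c * ‖x‖`. The factor `‖x‖` raises
  -- the weight of the seminorm by one, and `c` tends to zero.
  have hi : ∀ i, ‖iteratedFDeriv ℝ i (fun y : Space d => 1 - cutoff d (c • y)) x‖ ≤ B i * (c * ‖x‖) := by
    intro i
    have h1 := congrFun (iteratedFDeriv_comp_const_smul (i := i) c (hsm.of_le (by exact_mod_cast le_top))) x
    rw [h1, norm_smul, norm_pow, Real.norm_of_nonneg hc0.le]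
    by_cases hx : ‖c • x‖ < 1
    · rw [iteratedFDeriv_cutoff_eq_zero i hx, norm_zero, mul_zero]
      exact mul_nonneg (hB0 i) (by positivity)
    · rw [norm_smul, Real.norm_of_nonneg hc0.le, not_lt] at hx
      calc _ ≤ 1 * B i := mul_le_mul (pow_le_one₀ hc0.le hc1) (hB i _) (norm_nonneg _) zero_le_one
        _ ≤ B i * (c * ‖x‖) := by nlinarith [hB0 i]
  have h2 := norm_iteratedFDeriv_smul_le (n := m) (N := m) (𝕜 := ℝ)
    (f := fun y : Space d => 1 - cutoff d (c • y)) (g := φ)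
    ((hsm.comp (contDiff_const_smul c)).of_le (by exact_mod_cast le_top)) (φ.smooth _) x le_rfl
  refine (mul_le_mul_of_nonneg_left h2 (by positivity)).trans ?_
  rw [hM, Finset.mul_sum, Finset.mul_sum]
  refine Finset.sum_le_sum fun i _ => ?_
  have h3 := SchwartzMap.le_seminorm ℝ (k + 1) (m - i) φ x
  calc _ ≤ ‖x‖ ^ k * ((m.choose i : ℝ) * (B i * (c * ‖x‖)) * ‖iteratedFDeriv ℝ (m - i) φ x‖) := by
        gcongr
        exact hi i
    _ = c * ((m.choose i : ℝ) * B i * (‖x‖ ^ (k + 1) * ‖iteratedFDeriv ℝ (m - i) φ x‖)) := by ring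
    _ ≤ _ := by
        have := hB0 i
        gcongr

/-- Tempered distributions are determined by their values on compactly supported functions. -/
theorem dist_ext_compact {u v : Dist d} (h : ∀ φ : 𝓢(Space d, ℂ), HasCompactSupport φ → u φ = v φ) :
    u = v := by
  refine dist_ext fun φ => ?_
  refine tendsto_nhds_unique ((u.continuous.tendsto _).comp (tendsto_mulS_cutoff φ))
    (((v.continuous.tendsto _).comp (tendsto_mulS_cutoff φ)).congr fun n => (h _ ?_).symm)
  set c : ℝ := 1 / ((n : ℝ) + 1) with hc
  have hc0 : c ≠ 0 := by positivity
  have h1 : HasCompactSupport fun x : Space d => cutoff d (c • x) :=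
    (cutoff d).hasCompactSupport.comp_smul hc0
  refine h1.mono fun x hx => ?_
  rw [Function.mem_support] at hx ⊢
  rw [mulS_apply (hasTemperateGrowth_cutoff c)] at hx
  intro h0
  rw [h0] at hx
  simp at hx

end ParabolicSystem
end

/-! ### Measurability in time of the operator families. -/

noncomputable section
namespace ParabolicSystem
set_option linter.unusedSectionVars false
open MeasureTheory Set Filter Topology
open scoped SchwartzMap ENNReal LineDeriv FourierTransform

variable {d d₁ : ℕ}

theorem restrict_Ioi_prod (d : ℕ) : (volume : Measure (ℝ × Space d)).restrict (Ioi 0 ×ˢ univ)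
    = (volume.restrict (Ioi (0 : ℝ))).prod (volume : Measure (Space d)) := by
  rw [Measure.volume_eq_prod, ← Measure.prod_restrict, Measure.restrict_univ]

section

variable {a : ℝ → Space d → ℝ} {T s C : ℝ}

theorem aemeasurable_time (ha : AEMeasurable (fun p : ℝ × Space d => a p.1 p.2)
    (volume.restrict (Ioi 0 ×ˢ univ))) :
    AEMeasurable (fun p : ℝ × Space d => a p.1 p.2) ((timeMeasure T).prod volume) := by
  rw [restrict_Ioi_prod] at ha
  exact ha.mono_ac ((Measure.restrict_mono Ioc_subset_Ioi_self le_rfl).absolutelyContinuous.prod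
    Measure.AbsolutelyContinuous.rfl)

theorem ae_aestronglyMeasurable (ha : AEMeasurable (fun p : ℝ × Space d => a p.1 p.2)
    (volume.restrict (Ioi 0 ×ˢ univ))) :
    ∀ᵐ t ∂(timeMeasure T), AEStronglyMeasurable (a t) volume := by
  have h := aemeasurable_time (T := T) ha
  filter_upwards [h.aestronglyMeasurable.prodMk_left] with t ht
  exact ht

/-- The operators `N t` are chosen separately for each `t`, but their pairings with `pot s θ` are
integrals of a jointly measurable function. Density of the range of `pot s` and weak measurability
give the rest. -/
theorem aestronglyMeasurable_isMul (hs : 0 ≤ s) (ha : AEMeasurable (fun p : ℝ × Space d => a p.1 p.2)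
    (volume.restrict (Ioi 0 ×ˢ univ))) {N : ℝ → L2 d →L[ℂ] L2 d}
    (hN : ∀ᵐ t ∂(timeMeasure T), IsMul s C (a t) (N t)) (ψ : L2 d) :
    AEStronglyMeasurable (fun t => N t ψ) (timeMeasure T) := by
  refine aestronglyMeasurable_of_inner fun y => ?_
  have h1 : ∀ θ : L2 d, AEStronglyMeasurable (fun t => inner ℂ (pot s θ) (N t ψ)) (timeMeasure T) := by
    intro θ
    have h2 : AEStronglyMeasurable (fun p : ℝ × Space d => starRingEnd ℂ (θ p.2) * ((a p.1 p.2 : ℂ) *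
        pot s ψ p.2)) ((timeMeasure T).prod volume) := by
      have h3 : AEStronglyMeasurable (fun p : ℝ × Space d => ((a p.1 p.2 : ℝ) : ℂ))
          ((timeMeasure T).prod volume) :=
        Complex.continuous_ofReal.comp_aestronglyMeasurable (aemeasurable_time ha).aestronglyMeasurable
      have h4 : AEStronglyMeasurable (fun p : ℝ × Space d => starRingEnd ℂ (θ p.2))
          ((timeMeasure T).prod volume) :=
        Complex.continuous_conj.comp_aestronglyMeasurable (Lp.aestronglyMeasurable θ).comp_snd
      exact h4.mul (h3.mul (Lp.aestronglyMeasurable (pot s ψ)).comp_snd)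
    refine h2.integral_prod_right'.congr ?_
    filter_upwards [hN] with t ht
    rw [pot_symm hs, ht.pot_apply, inner_mulOp ht.memLp]
    congr 1
    funext x
    ring
  obtain ⟨θ, hθ⟩ := mem_closure_iff_seq_limit.1 (denseRange_pot hs y)
  choose θ' hθ' using hθ.1
  refine aestronglyMeasurable_of_tendsto_ae atTop (fun n => h1 (θ' n)) (Eventually.of_forall fun t => ?_)
  simp only [hθ']
  exact hθ.2.inner tendsto_const_nhds

theorem aestronglyMeasurable_adjoint {N : ℝ → L2 d →L[ℂ] L2 d}
    (hN : ∀ ψ, AEStronglyMeasurable (fun t => N t ψ) (timeMeasure T)) (ψ : L2 d) :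
    AEStronglyMeasurable (fun t => ContinuousLinearMap.adjoint (N t) ψ) (timeMeasure T) := by
  refine aestronglyMeasurable_of_inner fun y => ?_
  simp only [ContinuousLinearMap.adjoint_inner_right]
  exact (hN y).inner aestronglyMeasurable_const

theorem aestronglyMeasurable_dualOp {N : ℝ → L2 d →L[ℂ] L2 d} (γ : ℝ)
    (hN : ∀ ψ, AEStronglyMeasurable (fun t => N t ψ) (timeMeasure T)) (ψ : L2 d) :
    AEStronglyMeasurable (fun t => dualOp γ (N t) ψ) (timeMeasure T) := by
  unfold dualOp
  split_ifs
  · exact hN ψ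
  · exact aestronglyMeasurable_adjoint hN ψ

open Classical in
/-- The operator of multiplication by `a`, or zero if it is not bounded. -/
def mulFamily (s C : ℝ) (a : Space d → ℝ) : L2 d →L[ℂ] L2 d :=
  if h : ∃ N, IsMul s C a N then h.choose else 0

theorem isMul_mulFamily {a : Space d → ℝ} (h : ∃ N, IsMul s C a N) : IsMul s C a (mulFamily s C a) := by
  rw [mulFamily, dif_pos h]
  exact h.choose_spec

theorem norm_mulFamily_le (hC : 0 ≤ C) (a : Space d → ℝ) (v : L2 d) : ‖mulFamily s C a v‖ ≤ C * ‖v‖ := by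
  by_cases h : ∃ N, IsMul s C a N
  · exact (isMul_mulFamily h).norm_le v
  · rw [mulFamily, dif_neg h, zero_apply, norm_zero]
    positivity

theorem norm_dualOp_le (hC : 0 ≤ C) (γ : ℝ) {N : L2 d →L[ℂ] L2 d} (h : ∀ v, ‖N v‖ ≤ C * ‖v‖) (v : L2 d) :
    ‖dualOp γ N v‖ ≤ C * ‖v‖ := by
  unfold dualOp
  split_ifs
  · exact h v
  · refine (ContinuousLinearMap.le_opNorm _ v).trans ?_
    rw [LinearIsometryEquiv.norm_map]
    exact mul_le_mul_of_nonneg_right (N.opNorm_le_bound hC h) (norm_nonneg _)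

end

theorem aestronglyMeasurable_vec {α : Type*} [MeasurableSpace α] {μ : Measure α} {f : α → Vec d d₁}
    (h : ∀ k, AEStronglyMeasurable (fun t => f t k) μ) : AEStronglyMeasurable f μ := by
  refine aestronglyMeasurable_of_inner fun y => ?_
  simp only [PiLp.inner_apply]
  exact Finset.aestronglyMeasurable_fun_sum _ fun k _ => aestronglyMeasurable_const.inner (h k)

theorem aestronglyMeasurable_systemOp {T : ℝ} {Ma : Fin d → Fin d → Fin d₁ → Fin d₁ → ℝ → L2 d →L[ℂ] L2 d}
    {Mb : Fin d → Fin d₁ → Fin d₁ → ℝ → L2 d →L[ℂ] L2 d} {Mc : Fin d₁ → Fin d₁ → ℝ → L2 d →L[ℂ] L2 d}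
    (ha : ∀ i j k r v, AEStronglyMeasurable (fun t => Ma i j k r t v) (timeMeasure T))
    (hb : ∀ i k r v, AEStronglyMeasurable (fun t => Mb i k r t v) (timeMeasure T))
    (hc : ∀ k r v, AEStronglyMeasurable (fun t => Mc k r t v) (timeMeasure T)) (v : Vec d d₁) :
    AEStronglyMeasurable (fun t => systemOp (fun i j k r => Ma i j k r t) (fun i k r => Mb i k r t)
      (fun k r => Mc k r t) v) (timeMeasure T) := by
  refine aestronglyMeasurable_vec fun k => ?_
  simp only [systemOp_apply]
  refine AEStronglyMeasurable.sub (AEStronglyMeasurable.neg ?_) ?_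
  · exact Finset.aestronglyMeasurable_fun_sum _ fun r _ => Finset.aestronglyMeasurable_fun_sum _ fun i _ =>
      Finset.aestronglyMeasurable_fun_sum _ fun j _ => ha i j k r _
  · exact Finset.aestronglyMeasurable_fun_sum _ fun r _ => AEStronglyMeasurable.add
      (Finset.aestronglyMeasurable_fun_sum _ fun i _ => hb i k r _) (hc k r _)

end ParabolicSystem
end

/-! ### Translation between distributions and the Cauchy problem. -/

noncomputable section
namespace ParabolicSystem
set_option linter.unusedSectionVars false
open MeasureTheory Set Filter Topology
open scoped SchwartzMap ENNReal LineDeriv FourierTransform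

variable {d d₁ : ℕ}

/-- The pairing as a linear functional. -/
def prL (χ : L2 d) : L2 d →L[ℂ] ℂ := innerSL ℂ (cj χ)

theorem prL_apply (χ v : L2 d) : prL χ v = pr v χ := by
  rw [pr_comm]; rfl

theorem besselRep_pderiv_pderiv {γ : ℝ} (i j : Fin d) {u : Dist d} (h : BesselInL2 (γ + 2) u) :
    besselRep γ (pderiv i (pderiv j u)) = riesz i (riesz j (besselRep (γ + 2) u)) := by
  have e : γ + 2 = γ + 1 + 1 := by ring
  rw [e] at h ⊢
  rw [besselRep_pderiv i (besselInL2_pderiv j h), besselRep_pderiv j h]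

theorem besselRep_pderiv_pot {γ : ℝ} (i : Fin d) {u : Dist d} (h : BesselInL2 (γ + 2) u) :
    besselRep γ (pderiv i u) = riesz i (pot 1 (besselRep (γ + 2) u)) := by
  have e : γ + 2 = γ + 1 + 1 := by ring
  rw [e] at h ⊢
  rw [besselRep_pderiv i (besselInL2_of_le zero_le_one h), besselRep_of_le zero_le_one h]

section

variable {Ma : Fin d → Fin d → Fin d₁ → Fin d₁ → L2 d →L[ℂ] L2 d}
  {Mb : Fin d → Fin d₁ → Fin d₁ → L2 d →L[ℂ] L2 d} {Mc : Fin d₁ → Fin d₁ → L2 d →L[ℂ] L2 d}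
  {a : Fin d → Fin d → Fin d₁ → Fin d₁ → Space d → ℝ} {b : Fin d → Fin d₁ → Fin d₁ → Space d → ℝ}
  {c : Fin d₁ → Fin d₁ → Space d → ℝ} {γ C : ℝ}

/-- In terms of `w = (1 - Δ)^{(γ+2)/2} u`, second derivatives become products of Riesz operators in
`H^γ`, first derivatives gain one factor `pot 1`, and `u` itself gains `pot 2`. -/
theorem sum_mulPair_eq (ha : ∀ i j k r, IsMulH γ C (a i j k r) (Ma i j k r))
    (hb : ∀ i k r, IsMulH γ C (b i k r) (Mb i k r)) (hc : ∀ k r, IsMulH γ C (c k r) (Mc k r))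
    {u : Fin d₁ → Dist d} (hu : ∀ r, BesselInL2 (γ + 2) (u r)) {w : Vec d d₁}
    (hw : ∀ r, w r = besselRep (γ + 2) (u r)) (k : Fin d₁) (φ : 𝓢(Space d, ℂ)) :
    (∑ i, ∑ j, ∑ r, mulPair γ (a i j k r) (pderiv i (pderiv j (u r))) φ)
        + (∑ i, ∑ r, mulPair γ (b i k r) (pderiv i (u r)) φ) + (∑ r, mulPair γ (c k r) (u r) φ)
      = -pr (systemOp Ma Mb Mc w k) (J (bs (-γ) φ)) := by
  simp only [(ha _ _ _ _).mulPair_eq, (hb _ _ _).mulPair_eq, (hc _ _).mulPair_eq,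
    besselRep_pderiv_pderiv _ _ (hu _), besselRep_pderiv_pot _ (hu _),
    besselRep_of_le zero_le_two (hu _), ← hw]
  rw [systemOp_apply]
  simp only [← prL_apply, map_sub, map_neg, map_sum, map_add, Finset.sum_add_distrib]
  have h1 : ∀ f : Fin d → Fin d → Fin d₁ → ℂ, ∑ i, ∑ j, ∑ r, f i j r = ∑ r, ∑ i, ∑ j, f i j r := fun f => by
    rw [Finset.sum_comm (s := (Finset.univ : Finset (Fin d₁)))]
    exact Finset.sum_congr rfl fun i _ => Finset.sum_comm
  rw [h1, Finset.sum_comm (s := (Finset.univ : Finset (Fin d))) (t := (Finset.univ : Finset (Fin d₁)))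
    (f := fun i r => prL _ (Mb i k r _))]
  ring

/-- Conjugation on vector-valued functions. -/
def cjV : Vec d d₁ →L[ℝ] Vec d d₁ :=
  (PiLp.continuousLinearEquiv 2 ℝ fun _ : Fin d₁ => L2 d).symm.toContinuousLinearMap ∘L
    ContinuousLinearMap.pi fun k => cj ∘L PiLp.proj 2 (fun _ : Fin d₁ => L2 d) k

@[simp]
theorem cjV_apply (v : Vec d d₁) (k : Fin d₁) : cjV v k = cj (v k) := rfl

theorem systemOp_cjV (ha : ∀ i j k r, IsMulH γ C (a i j k r) (Ma i j k r))
    (hb : ∀ i k r, IsMulH γ C (b i k r) (Mb i k r)) (hc : ∀ k r, IsMulH γ C (c k r) (Mc k r))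
    (v : Vec d d₁) : systemOp Ma Mb Mc (cjV v) = cjV (systemOp Ma Mb Mc v) := by
  refine PiLp.ext fun k => ?_
  rw [cjV_apply, systemOp_apply, systemOp_apply]
  simp only [cjV_apply, riesz_cj, pot_cj zero_le_one, pot_cj zero_le_two, (ha _ _ _ _).map_cj,
    (hb _ _ _).map_cj, (hc _ _).map_cj, map_sub, map_neg, map_sum, map_add]

end

theorem SolvesCauchy.congr {X : Type*} [NormedAddCommGroup X] [InnerProductSpace ℂ X] [CompleteSpace X]
    {j : X →L[ℂ] X} {T : ℝ} {A : ℝ → X →L[ℂ] X} {F F' W W' : ℝ → X} {w : X}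
    (h : SolvesCauchy j T A F W w) (hF : F =ᵐ[timeMeasure T] F') (hW : W =ᵐ[timeMeasure T] W') :
    SolvesCauchy j T A F' W' w := by
  have e : (fun s => F s - A s (W s)) =ᵐ[timeMeasure T] fun s => F' s - A s (W' s) := by
    filter_upwards [hF, hW] with s h1 h2
    rw [h1, h2]
  filter_upwards [h, hW] with t h1 h2
  rw [← h2, h1, primitive_congr e]

/-- Solutions with real data are real. -/
theorem cj_eq_of_unique {T M : ℝ} {A : ℝ → Vec d d₁ →L[ℂ] Vec d d₁}
    (hA : ∀ x, AEStronglyMeasurable (fun t => A t x) (timeMeasure T)) (hM : ∀ t x, ‖A t x‖ ≤ M * ‖x‖)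
    (hcj : ∀ᵐ t ∂(timeMeasure T), ∀ v, A t (cjV v) = cjV (A t v))
    {F W : Lp (Vec d d₁) 2 (timeMeasure T)} {w : Vec d d₁}
    (hW : SolvesCauchy (diag (pot 1)) T A F W w)
    (huniq : ∀ W' : Lp (Vec d d₁) 2 (timeMeasure T), SolvesCauchy (diag (pot 1)) T A F W' w → W' = W)
    (hF : ∀ᵐ t ∂(timeMeasure T), cjV (F t) = F t) (hw : cjV w = w) :
    ∀ᵐ t ∂(timeMeasure T), cjV (W t) = W t := by
  have hG : Integrable (fun s => F s - A s (W s)) (timeMeasure T) :=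
    ((Lp.memLp F).sub (memLp_family_apply hA hM W)).integrable one_le_two
  have hj : ∀ v : Vec d d₁, diag (pot 1) (cjV v) = cjV (diag (pot 1) v) := fun v =>
    PiLp.ext fun k => pot_cj zero_le_one _
  have h1 : SolvesCauchy (diag (pot 1)) T A F (fun t => cjV (W t)) w := by
    have e : (fun s => cjV (F s - A s (W s))) =ᵐ[timeMeasure T] fun s => F s - A s (cjV (W s)) := by
      filter_upwards [hcj, hF] with s h1 h2
      rw [map_sub, h1, h2]
    filter_upwards [hW] with t ht
    rw [hj, hj, ht, map_add, ← hj, hw]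
    exact congrArg _ ((map_primitive hG cjV t).trans (primitive_congr e t))
  have h2 := huniq (cjV.compLp W) (h1.congr EventuallyEq.rfl (EventuallyEq.symm (cjV.coeFn_compLp W)))
  filter_upwards [cjV.coeFn_compLp W] with t ht
  rw [← ht, h2]

/-- The distributions with given Bessel potentials. -/
def potential (γ : ℝ) (y : Vec d d₁) (k : Fin d₁) : Dist d := besselOp (-γ) ((y k : L2 d) : Dist d)

theorem potential_apply (γ : ℝ) (y : Vec d d₁) (k : Fin d₁) (φ : 𝓢(Space d, ℂ)) :
    potential γ y k φ = pr (y k) (J (bs (-γ) φ)) := by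
  rw [potential, besselOp_apply, coe_apply_eq_pr]

/-- The trajectory of a solution of the Cauchy problem. -/
def trajectory (T : ℝ) (G : ℝ → Vec d d₁) (w : Vec d d₁) (t : ℝ) : Vec d d₁ :=
  diag (pot 1) w + primitive T G t

theorem potential_trajectory_apply {γ T : ℝ} {G : ℝ → Vec d d₁} (hG : Integrable G (timeMeasure T))
    (w : Vec d d₁) {t : ℝ} (ht : t ∈ Icc 0 T) (k : Fin d₁) (φ : 𝓢(Space d, ℂ)) :
    potential γ (trajectory T G w t) k φ
      = potential γ (diag (pot 1) w) k φ + ∫ s in (0 : ℝ)..t, potential γ (G s) k φ := by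
  simp only [potential_apply]
  rw [← primitive_eq_intervalIntegral ht]
  have h := map_primitive hG (((prL (J (bs (-γ) φ))) ∘L
    (PiLp.proj 2 (fun _ : Fin d₁ => L2 d) k : Vec d d₁ →L[ℂ] L2 d)).restrictScalars ℝ) t
  have h1 : pr (primitive T G t k) (J (bs (-γ) φ)) = primitive T (fun s => pr (G s k) (J (bs (-γ) φ))) t := by
    simp only [← prL_apply]
    exact h
  rw [← h1, ← pr_add_left]
  rfl

theorem potential_injective {γ : ℝ} {y z : Vec d d₁} (h : ∀ k, potential γ y k = potential γ z k) : y = z := by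
  refine PiLp.ext fun k => ?_
  have := congrArg (besselRep γ) (h k)
  rwa [potential, potential, besselRep_potential, besselRep_potential] at this

theorem trajectory_zero {T : ℝ} (G : ℝ → Vec d d₁) (w : Vec d d₁) : trajectory T G w 0 = diag (pot 1) w := by
  have : primitive T G 0 = 0 := by
    rw [primitive, Measure.restrict_restrict measurableSet_Iic]
    have : Iic (0 : ℝ) ∩ Ioc 0 T = ∅ := by
      ext x
      simp only [mem_inter_iff, mem_Iic, mem_Ioc, mem_empty_iff_false, iff_false]
      rintro ⟨h1, h2, _⟩
      linarith
    rw [this, Measure.restrict_empty, integral_zero_measure]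
  rw [trajectory, this, add_zero]

theorem memBH_potential_of_real {γ T : ℝ} {G : ℝ → Vec d d₁} (hG : MemLp G 2 (timeMeasure T))
    (hr : ∀ᵐ t ∂(timeMeasure T), cjV (G t) = G t) : MemBH γ T (fun t => potential γ (G t)) := by
  refine ⟨?_, fun k => ?_⟩
  · filter_upwards [hr] with t ht k
    have hb : BesselInL2 γ (potential γ (G t) k) := besselInL2_potential _ _
    refine ⟨(isReal_iff hb).2 ?_, hb⟩
    rw [potential, besselRep_potential, ← cjV_apply, ht]
  · simp only [potential, besselRep_potential]
    exact (PiLp.proj 2 (fun _ : Fin d₁ => L2 d) k : Vec d d₁ →L[ℂ] L2 d).comp_memLp' hG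

end ParabolicSystem
end

/-! ### Equivalence of the system with the abstract Cauchy problem. -/

noncomputable section
namespace ParabolicSystem
set_option linter.unusedSectionVars false
open MeasureTheory Set Filter Topology
open scoped SchwartzMap ENNReal LineDeriv FourierTransform

variable {d d₁ : ℕ}

theorem pr_neg_left (v w : L2 d) : pr (-v) w = -pr v w := by
  rw [pr, map_neg, inner_neg_left, pr]

theorem norm_le_sum_norm (v : Vec d d₁) : ‖v‖ ≤ ∑ k, ‖v k‖ := by
  refine (sq_le_sq₀ (norm_nonneg _) (Finset.sum_nonneg fun k _ => norm_nonneg _)).1 ?_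
  rw [PiLp.norm_sq_eq_of_L2]
  exact Finset.sum_sq_le_sq_sum_of_nonneg fun k _ => norm_nonneg _

/-- Operator families representing the coefficients of the system. -/
structure Families (γ T C : ℝ) (a : Fin d → Fin d → Fin d₁ → Fin d₁ → ℝ → Space d → ℝ)
    (b : Fin d → Fin d₁ → Fin d₁ → ℝ → Space d → ℝ) (c : Fin d₁ → Fin d₁ → ℝ → Space d → ℝ)
    (Ma : Fin d → Fin d → Fin d₁ → Fin d₁ → ℝ → L2 d →L[ℂ] L2 d)
    (Mb : Fin d → Fin d₁ → Fin d₁ → ℝ → L2 d →L[ℂ] L2 d)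
    (Mc : Fin d₁ → Fin d₁ → ℝ → L2 d →L[ℂ] L2 d) : Prop where
  nonneg : 0 ≤ C
  mulA : ∀ᵐ t ∂(timeMeasure T), ∀ i j k r, IsMulH γ C (a i j k r t) (Ma i j k r t)
  mulB : ∀ᵐ t ∂(timeMeasure T), ∀ i k r, IsMulH γ C (b i k r t) (Mb i k r t)
  mulC : ∀ᵐ t ∂(timeMeasure T), ∀ k r, IsMulH γ C (c k r t) (Mc k r t)
  normA : ∀ i j k r t v, ‖Ma i j k r t v‖ ≤ C * ‖v‖
  normB : ∀ i k r t v, ‖Mb i k r t v‖ ≤ C * ‖v‖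
  normC : ∀ k r t v, ‖Mc k r t v‖ ≤ C * ‖v‖
  measA : ∀ i j k r v, AEStronglyMeasurable (fun t => Ma i j k r t v) (timeMeasure T)
  measB : ∀ i k r v, AEStronglyMeasurable (fun t => Mb i k r t v) (timeMeasure T)
  measC : ∀ k r v, AEStronglyMeasurable (fun t => Mc k r t v) (timeMeasure T)

/-- The operator of the system at a given time. -/
def sysOp (Ma : Fin d → Fin d → Fin d₁ → Fin d₁ → ℝ → L2 d →L[ℂ] L2 d)
    (Mb : Fin d → Fin d₁ → Fin d₁ → ℝ → L2 d →L[ℂ] L2 d)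
    (Mc : Fin d₁ → Fin d₁ → ℝ → L2 d →L[ℂ] L2 d) (t : ℝ) : Vec d d₁ →L[ℂ] Vec d d₁ :=
  systemOp (fun i j k r => Ma i j k r t) (fun i k r => Mb i k r t) (fun k r => Mc k r t)

namespace Families

variable {γ T C : ℝ} {a : Fin d → Fin d → Fin d₁ → Fin d₁ → ℝ → Space d → ℝ}
  {b : Fin d → Fin d₁ → Fin d₁ → ℝ → Space d → ℝ} {c : Fin d₁ → Fin d₁ → ℝ → Space d → ℝ}
  {Ma : Fin d → Fin d → Fin d₁ → Fin d₁ → ℝ → L2 d →L[ℂ] L2 d}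
  {Mb : Fin d → Fin d₁ → Fin d₁ → ℝ → L2 d →L[ℂ] L2 d}
  {Mc : Fin d₁ → Fin d₁ → ℝ → L2 d →L[ℂ] L2 d}


theorem meas (H : Families γ T C a b c Ma Mb Mc)
    (v : Vec d d₁) : AEStronglyMeasurable (fun t => sysOp Ma Mb Mc t v) (timeMeasure T) :=
  aestronglyMeasurable_systemOp H.measA H.measB H.measC v

theorem norm_le (H : Families γ T C a b c Ma Mb Mc)
    (t : ℝ) (v : Vec d d₁) : ‖sysOp Ma Mb Mc t v‖ ≤ √d₁ * compConst d d₁ C * ‖v‖ :=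
  norm_systemOp_le H.nonneg (fun i j k r => H.normA i j k r t) (fun i k r => H.normB i k r t)
    (fun k r => H.normC k r t) v

theorem memLp_rhs (H : Families γ T C a b c Ma Mb Mc)
    (F W : Lp (Vec d d₁) 2 (timeMeasure T)) :
    MemLp (fun s => F s - sysOp Ma Mb Mc s (W s)) 2 (timeMeasure T) :=
  (Lp.memLp F).sub (memLp_family_apply H.meas H.norm_le W)

theorem map_cjV (H : Families γ T C a b c Ma Mb Mc) :
    ∀ᵐ t ∂(timeMeasure T), ∀ v,
    sysOp Ma Mb Mc t (cjV v) = cjV (sysOp Ma Mb Mc t v) := by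
  filter_upwards [H.mulA, H.mulB, H.mulC] with t h1 h2 h3 v
  exact systemOp_cjV h1 h2 h3 v

variable {f : ℝ → Fin d₁ → Dist d} {u₀ : Fin d₁ → Dist d}

/-- The solution is defined through `trajectory` and not through `W`, which is known only almost
everywhere, because the integral identity must hold for every `t`. The two agree for almost every
`t`, which suffices for the norms and for the equation. -/
theorem isSolution (H : Families γ T C a b c Ma Mb Mc)
    (hf : MemBH γ T f) (hu₀ : MemH (γ + 1) u₀)
    {F W : Lp (Vec d d₁) 2 (timeMeasure T)} {w : Vec d d₁}
    (hF : ∀ᵐ t ∂(timeMeasure T), ∀ k, F t k = besselRep γ (f t k))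
    (hw : ∀ k, w k = besselRep (γ + 1) (u₀ k))
    (hW : SolvesCauchy (diag (pot 1)) T (sysOp Ma Mb Mc) F W w)
    (hreal : ∀ᵐ t ∂(timeMeasure T), cjV (W t) = W t) :
    IsSolution γ T a b c f u₀
      (fun t => potential γ (trajectory T (fun s => F s - sysOp Ma Mb Mc s (W s)) w t)) := by
  set G : ℝ → Vec d d₁ := fun s => F s - sysOp Ma Mb Mc s (W s) with hG
  have hGm : MemLp G 2 (timeMeasure T) := H.memLp_rhs F W
  have hGi : Integrable G (timeMeasure T) := hGm.integrable one_le_two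
  have hFr : ∀ᵐ t ∂(timeMeasure T), cjV (F t) = F t := by
    filter_upwards [hF, hf.1] with t h1 h2
    refine PiLp.ext fun k => ?_
    rw [cjV_apply, h1, ← isReal_iff (h2 k).2]
    exact (h2 k).1
  have h0 : (fun k => potential γ (trajectory T G w 0) k) = u₀ := by
    funext k
    rw [trajectory_zero, eq_besselOp_rep (hu₀ k).2, ← hw, potential, diag_apply,
      ← besselOp_coe zero_le_one, besselOp_besselOp]
    congr 1
    ring
  have hrep : ∀ᵐ t ∂(timeMeasure T), ∀ k,
      potential γ (trajectory T G w t) k = potential (γ + 2) (W t) k := by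
    filter_upwards [hW] with t ht k
    have h1 : trajectory T G w t = diag (pot 1) (diag (pot 1) (W t)) := ht.symm
    rw [h1, potential, potential, diag_apply, diag_apply, pot_pot zero_le_one zero_le_one,
      ← besselOp_coe (by norm_num), besselOp_besselOp]
    congr 1
    ring
  have hGr : ∀ᵐ t ∂(timeMeasure T), cjV (G t) = G t := by
    filter_upwards [H.map_cjV, hreal, hFr] with t h1 h2 h3
    rw [hG]
    simp only [map_sub, ← h1, h2, h3]
  have hWB := memBH_potential_of_real (γ := γ + 2) (Lp.memLp W) hreal
  refine ⟨h0, fun t => potential γ (G t), ⟨⟨?_, fun k => ?_⟩, ?_, memBH_potential_of_real hGm hGr, ?_⟩, ?_⟩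
  · filter_upwards [hWB.1, hrep] with t h1 h2 k
    rw [h2]
    exact h1 k
  · refine (hWB.2 k).ae_eq ?_
    filter_upwards [hrep] with t h2
    rw [h2]
  · intro k
    rw [congrFun h0 k]
    exact hu₀ k
  · intro k φ _ t ht
    change potential γ (trajectory T G w t) k φ = potential γ (trajectory T G w 0) k φ
      + ∫ s in (0 : ℝ)..t, potential γ (G s) k φ
    rw [potential_trajectory_apply hGi w ht, trajectory_zero]
  · filter_upwards [H.mulA, H.mulB, H.mulC, hrep, hF, hf.1] with t h1 h2 h3 h4 h5 h6 k φ _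
    have hu : ∀ r, BesselInL2 (γ + 2) (potential γ (trajectory T G w t) r) := fun r => by
      rw [h4]
      exact besselInL2_potential _ _
    have hw' : ∀ r, W t r = besselRep (γ + 2) (potential γ (trajectory T G w t) r) := fun r => by
      rw [h4, potential, besselRep_potential]
    rw [sum_mulPair_eq h1 h2 h3 hu hw' k φ, apply_eq_pr (h6 k).2, ← h5, potential_apply, ← pr_neg_left,
      ← pr_add_left]
    congr 1
    change F t k - systemOp _ _ _ (W t) k = _
    abel

/-- The converse. Every solution is the trajectory of its own Bessel potential at all times, so
uniqueness of `W` gives uniqueness for every `t`. -/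
theorem exists_cauchy (H : Families γ T C a b c Ma Mb Mc)
    (hf : MemBH γ T f) (hu₀ : MemH (γ + 1) u₀)
    {F : Lp (Vec d d₁) 2 (timeMeasure T)} {w : Vec d d₁}
    (hF : ∀ᵐ t ∂(timeMeasure T), ∀ k, F t k = besselRep γ (f t k))
    (hw : ∀ k, w k = besselRep (γ + 1) (u₀ k)) {v : ℝ → Fin d₁ → Dist d}
    (hv : IsSolution γ T a b c f u₀ v) :
    ∃ W : Lp (Vec d d₁) 2 (timeMeasure T), SolvesCauchy (diag (pot 1)) T (sysOp Ma Mb Mc) F W w ∧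
      ∀ t ∈ Icc 0 T,
        v t = potential γ (trajectory T (fun s => F s - sysOp Ma Mb Mc s (W s)) w t) := by
  obtain ⟨hv0, g, hmem, heq⟩ := hv
  set V : ℝ → Vec d d₁ := fun t => WithLp.toLp 2 fun k => besselRep (γ + 2) (v t k) with hV
  have hVm : MemLp V 2 (timeMeasure T) := by
    have h1 : AEStronglyMeasurable V (timeMeasure T) :=
      aestronglyMeasurable_vec fun k => (hmem.mem.2 k).aestronglyMeasurable
    refine (memLp_finsetSum (s := Finset.univ)
      (f := fun k t => ‖besselRep (γ + 2) (v t k)‖) fun k _ => (hmem.mem.2 k).norm).mono h1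
      (Eventually.of_forall fun t => ?_)
    rw [Real.norm_of_nonneg (Finset.sum_nonneg fun k _ => norm_nonneg _)]
    exact norm_le_sum_norm _
  set W : Lp (Vec d d₁) 2 (timeMeasure T) := hVm.toLp V with hWdef
  have hWV : W =ᵐ[timeMeasure T] V := hVm.coeFn_toLp
  set G : ℝ → Vec d d₁ := fun s => F s - sysOp Ma Mb Mc s (W s) with hG
  have hGi : Integrable G (timeMeasure T) := (H.memLp_rhs F W).integrable one_le_two
  have hg : ∀ᵐ t ∂(timeMeasure T), ∀ k, g t k = potential γ (G t) k := by
    filter_upwards [H.mulA, H.mulB, H.mulC, hmem.mem.1, hF, hf.1, heq, hWV] with t h1 h2 h3 h4 h5 h6 h7 h8 k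
    -- The equation is tested only with compactly supported functions, while the Bessel potential of
    -- a test function is not of this kind; equality of tempered distributions is therefore
    -- established first.
    refine dist_ext_compact fun φ hφ => ?_
    have hw' : ∀ r, W t r = besselRep (γ + 2) (v t r) := fun r => by rw [h8]
    rw [h7 k φ hφ, sum_mulPair_eq h1 h2 h3 (fun r => (h4 r).2) hw' k φ, apply_eq_pr (h6 k).2, ← h5,
      potential_apply, ← pr_neg_left, ← pr_add_left]
    congr 1
    change _ = F t k - systemOp _ _ _ (W t) k
    abel
  have hu0 : ∀ k, u₀ k = potential γ (diag (pot 1) w) k := fun k => by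
    rw [eq_besselOp_rep (hu₀ k).2, ← hw, potential, diag_apply, ← besselOp_coe zero_le_one,
      besselOp_besselOp]
    congr 1
    ring
  have htraj : ∀ t ∈ Icc 0 T, v t = potential γ (trajectory T G w t) := by
    intro t ht
    funext k
    refine dist_ext_compact fun φ hφ => ?_
    rw [hmem.deriv k φ hφ t ht, hv0, potential_trajectory_apply hGi w ht, hu0]
    congr 1
    rw [← primitive_eq_intervalIntegral ht, ← primitive_eq_intervalIntegral ht]
    refine primitive_congr ?_ t
    filter_upwards [hg] with s hs
    rw [hs]
  refine ⟨W, ?_, htraj⟩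
  filter_upwards [hmem.mem.1, hWV, ae_restrict_mem measurableSet_Ioc] with t h1 h2 h3
  change _ = trajectory T G w t
  refine potential_injective (γ := γ) fun k => ?_
  rw [← htraj t (Ioc_subset_Icc_self h3), eq_besselOp_rep (h1 k).2, potential, diag_apply, diag_apply,
    pot_pot zero_le_one zero_le_one, ← besselOp_coe (by norm_num), besselOp_besselOp, h2]
  congr 1
  ring

end Families

end ParabolicSystem
end

/-! ### From Hölder norms to bounded multiplication operators. -/

noncomputable section
namespace ParabolicSystem
set_option linter.unusedSectionVars false
open MeasureTheory Set Filter Topology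
open scoped SchwartzMap ENNReal LineDeriv FourierTransform

variable {d d₁ : ℕ}

theorem abs_le_of_holderNorm_zero {L : ℝ} (hL : 0 ≤ L) {h : Space d → ℝ}
    (H : holderNorm 0 h < ENNReal.ofReal L) (x : Space d) : |h x| ≤ L := by
  rw [holderNorm, if_pos rfl] at H
  have h1 : ‖h x‖ₑ ≤ ENNReal.ofReal L := (le_iSup (fun x => ‖h x‖ₑ) x).trans H.le
  rwa [← ofReal_norm, ENNReal.ofReal_le_ofReal_iff hL] at h1

theorem bounds_of_holderNorm {s L : ℝ} (hs : 0 < s) (hL : 0 ≤ L) {h : Space d → ℝ}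
    (H : holderNorm s h < ENNReal.ofReal L) :
    ContDiff ℝ ((⌈s⌉₊ - 1 : ℕ) : ℕ∞) h ∧
      (∀ j ≤ ⌈s⌉₊ - 1, ∀ x, ‖iteratedFDeriv ℝ j h x‖ ≤ L) ∧
      ∀ x y, ‖iteratedFDeriv ℝ (⌈s⌉₊ - 1) h x - iteratedFDeriv ℝ (⌈s⌉₊ - 1) h y‖
        ≤ L * ‖x - y‖ ^ (s - ((⌈s⌉₊ - 1 : ℕ) : ℝ)) := by
  rw [holderNorm, if_neg hs.ne'] at H
  split_ifs at H with hc
  · refine ⟨hc, fun j hj x => ?_, fun x y => ?_⟩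
    · have h1 : ‖iteratedFDeriv ℝ j h x‖ₑ ≤ ENNReal.ofReal L := by
        refine (le_iSup (fun x => ‖iteratedFDeriv ℝ j h x‖ₑ) x).trans ?_
        refine (Finset.single_le_sum (f := fun j => ⨆ x, ‖iteratedFDeriv ℝ j h x‖ₑ)
          (fun _ _ => bot_le) (Finset.mem_range.2 (Nat.lt_succ_of_le hj))).trans ?_
        exact (le_add_right le_rfl).trans H.le
      rwa [← ofReal_norm, ENNReal.ofReal_le_ofReal_iff hL] at h1
    · rcases eq_or_ne x y with rfl | hxy
      · rw [sub_self, norm_zero]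
        positivity
      · have hp : 0 < ‖x - y‖ := norm_pos_iff.2 (sub_ne_zero.2 hxy)
        have h1 := ((le_iSup₂_of_le (f := fun x y => ⨆ _ : x ≠ y,
          ‖iteratedFDeriv ℝ (⌈s⌉₊ - 1) h x - iteratedFDeriv ℝ (⌈s⌉₊ - 1) h y‖ₑ
            / edist x y ^ (s - ((⌈s⌉₊ - 1 : ℕ) : ℝ))) x y (le_iSup_of_le hxy le_rfl)).trans
          (le_add_left le_rfl)).trans H.le
        rw [edist_dist, dist_eq_norm, ENNReal.ofReal_rpow_of_pos hp, ← ofReal_norm,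
          ← ENNReal.ofReal_div_of_pos (by positivity), ENNReal.ofReal_le_ofReal_iff hL,
          div_le_iff₀ (by positivity)] at h1
        exact h1
  · exact absurd H (by simp)

/-- Functions in Hölder spaces. -/
theorem holderReg_of_holderNorm {s L : ℝ} (hL : 0 ≤ L) {h : Space d → ℝ}
    {n : ℕ} (hn : (n : ℝ) < s) (H : holderNorm s h < ENNReal.ofReal L) :
    HolderReg (min 1 (s - n)) (2 * L) n h := by
  have hs : 0 < s := (Nat.cast_nonneg n).trans_lt hn
  obtain ⟨h1, h2, h3⟩ := bounds_of_holderNorm hs hL H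
  have hm : n + 1 ≤ ⌈s⌉₊ := Nat.lt_ceil.2 hn
  have hle : n ≤ ⌈s⌉₊ - 1 := by omega
  have hcd : ContDiff ℝ n h := h1.of_le (by exact_mod_cast hle)
  refine holderReg_of_iteratedFDeriv (lt_min one_pos (by linarith)) (min_le_left _ _) hL le_rfl n hcd
    (fun j hj x => h2 j (hj.trans hle) x) fun x y => ?_
  -- Either `n` is the top order of differentiability, with Hölder exponent `s - n ≤ 1`, or a
  -- further bounded derivative exists and the exponent is `1`.
  rcases eq_or_lt_of_le hle with he | hlt
  · have h4 := h3 x y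
    rw [← he] at h4
    have : s - n ≤ 1 := by
      have h5 := Nat.le_ceil s
      have h6 : ((⌈s⌉₊ : ℕ) : ℝ) = n + 1 := by
        have : ⌈s⌉₊ = n + 1 := by omega
        rw [this]; push_cast; ring
      linarith
    rw [min_eq_right this]
    refine h4.trans ?_
    have := Real.rpow_nonneg (norm_nonneg (x - y)) (s - n)
    nlinarith
  · have : 1 ≤ s - n := by
      have h5 := Nat.ceil_lt_add_one hs.le
      have h6 : ((n + 2 : ℕ) : ℝ) ≤ ⌈s⌉₊ := by exact_mod_cast (by omega : n + 2 ≤ ⌈s⌉₊)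
      push_cast at h6
      linarith
    rw [min_eq_left this, Real.rpow_one]
    have hcd' : ContDiff ℝ (n + 1 : ℕ) h := h1.of_le (by exact_mod_cast hlt)
    have h7 : ‖iteratedFDeriv ℝ n h x - iteratedFDeriv ℝ n h y‖ ≤ L * ‖x - y‖ := by
      refine Convex.norm_image_sub_le_of_norm_fderiv_le (𝕜 := ℝ) (s := Set.univ) (fun z _ => ?_)
        (fun z _ => ?_) convex_univ (mem_univ y) (mem_univ x)
      · exact (hcd'.differentiable_iteratedFDeriv (by exact_mod_cast Nat.lt_succ_self n)) z
      · rw [norm_fderiv_iteratedFDeriv]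
        exact h2 (n + 1) hlt z
    have := norm_nonneg (x - y)
    nlinarith

theorem exists_radius_of_holder {β L ε : ℝ} (hβ : 0 < β) (hε : 0 < ε) :
    ∃ r, 0 < r ∧ ∀ h : Space d → ℝ, (∀ x y, |h x - h y| ≤ L * ‖x - y‖ ^ β) →
      ∀ x z : Space d, ‖z‖ < r → |h (x - z) - h x| ≤ ε := by
  refine ⟨(ε / (|L| + 1)) ^ (1 / β), by positivity, fun h hh x z hz => ?_⟩
  refine (hh _ _).trans ?_
  rw [sub_sub_cancel_left, norm_neg]
  have h1 : ‖z‖ ^ β ≤ ε / (|L| + 1) := by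
    have := Real.rpow_le_rpow (norm_nonneg z) hz.le hβ.le
    rwa [← Real.rpow_mul (by positivity), one_div_mul_cancel hβ.ne', Real.rpow_one] at this
  have h2 : 0 ≤ ‖z‖ ^ β := Real.rpow_nonneg (norm_nonneg z) β
  rw [le_div_iff₀ (by positivity)] at h1
  nlinarith [le_abs_self L]

/-- The classes of coefficients give bounded operators. -/
structure CoeffClass {σ : ℝ} (W : WeightFamily d σ) (γ μ L : ℝ) (n : ℕ) (L' C : ℝ) : Prop where
  σ_nonneg : 0 ≤ σ
  order : |γ| = n + σ
  L_nonneg : 0 ≤ L'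
  C_nonneg : 0 ≤ C
  exists_isMul : ∀ h : Space d → ℝ, holderNorm (absPlus μ γ) h < ENNReal.ofReal L →
    AEStronglyMeasurable h volume → ∃ N, IsMul |γ| C h N
  approximable : ∀ h : Space d → ℝ, holderNorm (absPlus μ γ) h < ENNReal.ofReal L →
    UniformContinuous h → W.Approximable n L' h
  bound : ∀ h : Space d → ℝ, holderNorm (absPlus μ γ) h < ENNReal.ofReal L → ∀ x, |h x| ≤ L'

theorem coeffClass_of_reg {σ β L' : ℝ} {W : WeightFamily d σ} {γ μ L : ℝ} {n k : ℕ} (hσ : 0 ≤ σ)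
    (hβ : 0 < β) (hL' : 0 ≤ L') (ho : |γ| = n + σ)
    (h1 : ∀ h : Space d → ℝ, holderNorm (absPlus μ γ) h < ENNReal.ofReal L → HolderReg β L' k h)
    (h2 : ∀ (h : Space d → ℝ) (ε : ℝ) (hε : 0 < ε), HolderReg β L' k h →
      ∀ K, Reg (W.w K) L' n (mollify hε h)) :
    CoeffClass W γ μ L n L' (W.opConst n L') := by
  have key : ∀ h : Space d → ℝ, holderNorm (absPlus μ γ) h < ENNReal.ofReal L →
      W.Approximable n L' h := fun h hh => by
    have h3 := h1 h hh
    have hc := continuous_of_holder hβ h3.holder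
    refine ⟨hc, fun ε hε => ?_⟩
    obtain ⟨r, hr, H⟩ := exists_radius_of_holder (d := d) (L := L') hβ hε
    refine ⟨mollify hr h, h2 h r hr h3, fun x => ?_⟩
    rw [abs_sub_comm]
    exact abs_mollify_sub_le hr hc fun z hz => H h h3.holder x z hz
  refine ⟨hσ, ho, hL', Real.sqrt_nonneg _, fun h hh _ => ?_, fun h hh _ => key h hh,
    fun h hh => (h1 h hh).bound⟩
  rw [ho]
  exact (key h hh).exists_isMul hσ

theorem reg_zero_trivial {L : ℝ} {h : Space d → ℝ} (ht : h.HasTemperateGrowth) (hb : ∀ x, |h x| ≤ L) :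
    Reg trivialWeights L 0 h := by
  rw [Reg]
  refine ⟨ht, hb, fun l k x => (abs_sub _ _).trans ?_⟩
  change _ ≤ L * 2
  linarith [hb (x + dyadicStep l k), hb x]

/-- For `γ = 0` bounded measurable functions act on `L2`, and uniform continuity gives the
approximation. For integer `|γ| = n + 1` the class is `C^{n,1}` and the trivial weights are used.
Otherwise `σ` is the fractional part of `|γ|`, and `μ > 0` leaves room for an exponent `β > σ`. -/
theorem exists_coeffClass (d : ℕ) {γ μ L : ℝ} (hμ : 0 < μ) (hL : 0 < L) :
    ∃ (σ : ℝ) (W : WeightFamily d σ) (n : ℕ) (L' C : ℝ), CoeffClass W γ μ L n L' C := by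
  by_cases hint : ∃ n : ℕ, |γ| = n
  · obtain ⟨N, hN⟩ := hint
    have hp : absPlus μ γ = N := by rw [absPlus, if_pos ⟨N, hN⟩, hN]
    rcases N with _ | n
    · refine ⟨0, trivialFamily d, 0, L, L, le_rfl, by rw [hN, add_zero], hL.le, hL.le, ?_, ?_, ?_⟩
      · intro h hh hm
        rw [hp, Nat.cast_zero] at hh
        rw [hN, Nat.cast_zero]
        exact ⟨_, isMul_zero hm (abs_le_of_holderNorm_zero hL.le hh)⟩
      · intro h hh hu
        rw [hp, Nat.cast_zero] at hh
        have hb := abs_le_of_holderNorm_zero hL.le hh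
        refine ⟨hu.continuous, fun ε hε => ?_⟩
        obtain ⟨r, hr, H⟩ := Metric.uniformContinuous_iff.1 hu ε hε
        refine ⟨mollify hr h, fun K => reg_zero_trivial
          (hasTemperateGrowth_mollify hr hu.continuous hb) (abs_mollify_le hr hu.continuous hb), fun x => ?_⟩
        rw [abs_sub_comm]
        refine abs_mollify_sub_le hr hu.continuous fun z hz => ?_
        have := H (a := x - z) (b := x) (by rwa [dist_eq_norm, sub_sub_cancel_left, norm_neg])
        rw [Real.dist_eq] at this
        exact this.le
      · intro h hh
        rw [hp, Nat.cast_zero] at hh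
        exact abs_le_of_holderNorm_zero hL.le hh
    · refine ⟨0, trivialFamily d, n + 1, 2 * L, _, coeffClass_of_reg (β := 1) (k := n) le_rfl one_pos
        (by positivity) (by rw [hN, add_zero]) (fun h hh => ?_)
        fun h ε hε hr K => reg_mollify_of_lipschitz hε (fun _ => rfl) hr⟩
      rw [hp] at hh
      have := holderReg_of_holderNorm hL.le (n := n) (by push_cast; linarith) hh
      rwa [Nat.cast_add, Nat.cast_one, add_sub_cancel_left, min_self] at this
  · have hp : absPlus μ γ = |γ| + μ := by rw [absPlus, if_neg hint]
    set n := ⌊|γ|⌋₊ with hn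
    set σ := |γ| - n with hσ
    have h0 : 0 ≤ σ := sub_nonneg.2 (Nat.floor_le (abs_nonneg γ))
    have h1 : σ < 1 := by have := Nat.lt_floor_add_one |γ|; linarith
    have h0' : 0 < σ := lt_of_le_of_ne h0 fun h => hint ⟨n, by linarith⟩
    -- The Hölder exponent is cut at `1` because `|γ| + μ` may exceed the next integer.
    have hβ : σ < min 1 (σ + μ) := lt_min h1 (by linarith)
    obtain ⟨W, hW⟩ := exists_weightFamily d h0' h1 hβ
    refine ⟨σ, W, n, 2 * L, _, coeffClass_of_reg (β := min 1 (σ + μ)) (k := n) h0 (h0'.trans hβ)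
      (by positivity) (by rw [hσ]; ring) (fun h hh => ?_)
      fun h ε hε hr K => reg_mollify hε (h0'.trans hβ) (hW K) hr⟩
    rw [hp] at hh
    have := holderReg_of_holderNorm hL.le (n := n) (by linarith) hh
    rwa [show |γ| + μ - n = σ + μ by rw [hσ]; ring] at this

end ParabolicSystem
end

/-! ### The main estimate for either sign of `γ`, and well-posedness. -/

noncomputable section
namespace ParabolicSystem
set_option linter.unusedSectionVars false
open MeasureTheory Set Filter Topology
open scoped SchwartzMap ENNReal LineDeriv FourierTransform

variable {d d₁ : ℕ}

namespace WeightFamily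

variable {σ : ℝ} (W : WeightFamily d σ)

/-- The inverse of `rop`. -/
def rinv : L2 d →L[ℂ] L2 d := fm (fun ξ => (((W.ρ ξ)⁻¹ : ℝ) : ℂ))

theorem norm_inv_ρ_le (ξ : Space d) : ‖(((W.ρ ξ)⁻¹ : ℝ) : ℂ)‖ ≤ W.c₀⁻¹ := by
  rw [Complex.norm_real, Real.norm_of_nonneg (inv_nonneg.2 (W.ρ_pos ξ).le)]
  exact inv_anti₀ W.c₀_pos (W.c₀_le_ρ ξ)

theorem memLp_inv_ρ : MemLp (fun ξ => (((W.ρ ξ)⁻¹ : ℝ) : ℂ)) ⊤ (volume : Measure (Space d)) :=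
  memLp_top_of_bound' (Complex.measurable_ofReal.comp W.measurable_ρ.inv).aestronglyMeasurable _
    W.norm_inv_ρ_le

theorem rop_rinv (v : L2 d) : W.rop (W.rinv v) = v := by
  rw [rop, rinv, fm_mul W.memLp_ρ W.memLp_inv_ρ]
  have : (fun ξ => (W.ρ ξ : ℂ) * (((W.ρ ξ)⁻¹ : ℝ) : ℂ)) = fun _ => 1 := funext fun ξ => by
    rw [← Complex.ofReal_mul, mul_inv_cancel₀ (W.ρ_pos ξ).ne', Complex.ofReal_one]
  rw [this, fm_const, one_smul]

theorem norm_rop_le (v : L2 d) : ‖W.rop v‖ ≤ W.C₀ * ‖v‖ :=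
  norm_fm_le W.C₀_pos.le (fun ξ => by
    rw [Complex.norm_real, Real.norm_of_nonneg (W.ρ_pos ξ).le]
    exact W.ρ_le_C₀ ξ) v

theorem norm_rinv_le (v : L2 d) : ‖W.rinv v‖ ≤ W.c₀⁻¹ * ‖v‖ :=
  norm_fm_le (inv_nonneg.2 W.c₀_pos.le) W.norm_inv_ρ_le v

theorem pot_rinv {r : ℝ} (hr : 0 ≤ r) (v : L2 d) : pot r (W.rinv v) = W.rinv (pot r v) :=
  fm_comm (memLp_besselSymbol hr) W.memLp_inv_ρ v

theorem riesz_rinv (i : Fin d) (v : L2 d) : riesz i (W.rinv v) = W.rinv (riesz i v) :=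
  riesz_fm W.memLp_inv_ρ i v

/-- In the inner product given by `ρ⁻¹`, the form of the adjoint of `N` at `v, w` is the `ρ`-form of
`N` at `ρ⁻¹ v, ρ⁻¹ w` with the roles of the arguments exchanged. This reduces negative `γ` to the
transposed estimate of order `|γ|`. -/
theorem inner_rinv_adjoint (N : L2 d →L[ℂ] L2 d) (v w : L2 d) :
    inner ℂ (W.rinv (ContinuousLinearMap.adjoint N v)) w = inner ℂ (W.rinv v) (W.rop (N (W.rinv w))) := by
  rw [← W.rop_symm, W.rop_rinv, rinv, inner_fm_real_left W.memLp_inv_ρ,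
    ContinuousLinearMap.adjoint_inner_left]

end WeightFamily

/-- The Gårding inequality for the leading part, in an equivalent inner product. -/
theorem WeightFamily.exists_main_estimate {σ : ℝ} (W : WeightFamily d σ) (γ : ℝ) {δ η C L : ℝ}
    (hδ : 0 < δ) (hC : 0 ≤ C) (hL : 0 ≤ L) (hσ : 0 ≤ σ)
    (hη0 : 0 < η) (hη : Fintype.card (Idx d d₁) * η ≤ δ / 4) (n : ℕ) :
    ∃ (p : Space d → ℝ) (m M c lam : ℝ), 0 < m ∧ 0 < c ∧ 0 ≤ lam ∧ Measurable p ∧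
      (∀ ξ, m ≤ p ξ) ∧ (∀ ξ, p ξ ≤ M) ∧
      ∀ (a α : Fin d → Fin d → Fin d₁ → Fin d₁ → Space d → ℝ)
        (N : Fin d → Fin d → Fin d₁ → Fin d₁ → L2 d →L[ℂ] L2 d) (C' : ℝ),
        (∀ i j k r, W.Approximable n L (a i j k r)) → SmoothApprox δ (η / 2) C a α →
        (∀ i j k r, IsMul (n + σ) C' (a i j k r) (N i j k r)) →
        ∀ v : Fin d₁ → L2 d,
          c * ∑ k, ‖v k‖ ^ 2 - lam * ∑ k, ‖pot 1 (v k)‖ ^ 2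
            ≤ ∑ q : Idx d d₁, (inner ℂ (fm (fun ξ => (p ξ : ℂ))
              (dualOp γ (N q.2.1 q.2.2.1 q.2.2.2.1 q.2.2.2.2)
                (riesz q.2.1 (riesz q.2.2.1 (v q.2.2.2.2)))))
              (riesz q.1 (riesz q.1 (v q.2.2.2.1)))).re := by
  obtain ⟨c, lam, hc, hlam, H⟩ := W.exists_coercive_operators (d₁ := d₁) hδ hC hL hσ hη0 hη n
  have hc₀ := W.c₀_pos
  have hC₀ := W.C₀_pos
  by_cases h0 : 0 ≤ γ
  · refine ⟨W.ρ, W.c₀, W.C₀, c, lam, hc₀, hc, hlam, W.measurable_ρ, W.c₀_le_ρ, W.ρ_le_C₀,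
      fun a α N C' h1 h2 h3 v => ((H a α N C' h1 h2 h3 v).1).trans_eq ?_⟩
    refine Finset.sum_congr rfl fun q _ => ?_
    rw [dualOp, if_pos h0, ← inner_conj_symm, Complex.conj_re]
    rfl
  · refine ⟨fun ξ => (W.ρ ξ)⁻¹, W.C₀⁻¹, W.c₀⁻¹, c / W.C₀ ^ 2, lam * W.c₀⁻¹ ^ 2, by positivity, by positivity,
      by positivity, W.measurable_ρ.inv, fun ξ => inv_anti₀ (W.ρ_pos ξ) (W.ρ_le_C₀ ξ),
      fun ξ => inv_anti₀ hc₀ (W.c₀_le_ρ ξ), fun a α N C' h1 h2 h3 v => ?_⟩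
    -- The transposed estimate is applied to `ρ⁻¹ v`. The constants `c / C₀²` and `lam * c₀⁻²` come
    -- from comparing the norms of `v` and `ρ⁻¹ v`.
    have key := (H a α N C' h1 h2 h3 fun k => W.rinv (v k)).2
    have e1 : ∀ k, 1 / W.C₀ ^ 2 * ‖v k‖ ^ 2 ≤ ‖W.rinv (v k)‖ ^ 2 := fun k => by
      have h4 := W.norm_rop_le (W.rinv (v k))
      rw [W.rop_rinv] at h4
      rw [one_div_mul_eq_div, div_le_iff₀ (by positivity)]
      calc _ ≤ (W.C₀ * ‖W.rinv (v k)‖) ^ 2 := pow_le_pow_left₀ (norm_nonneg _) h4 2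
        _ = _ := by ring
    have e2 : ∀ k, ‖pot 1 (W.rinv (v k))‖ ^ 2 ≤ W.c₀⁻¹ ^ 2 * ‖pot 1 (v k)‖ ^ 2 := fun k => by
      rw [← mul_pow, W.pot_rinv zero_le_one]
      exact pow_le_pow_left₀ (norm_nonneg _) (W.norm_rinv_le _) 2
    have s1 := Finset.sum_le_sum (s := Finset.univ) fun k _ => e1 k
    have s2 := Finset.sum_le_sum (s := Finset.univ) fun k _ => e2 k
    rw [← Finset.mul_sum] at s1 s2
    refine le_trans ?_ (key.trans_eq ?_)
    · have t1 := mul_le_mul_of_nonneg_left s1 hc.le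
      have t2 := mul_le_mul_of_nonneg_left s2 hlam
      have t3 : c / W.C₀ ^ 2 * ∑ k, ‖v k‖ ^ 2 = c * (1 / W.C₀ ^ 2 * ∑ k, ‖v k‖ ^ 2) := by ring
      rw [t3, mul_assoc]
      linarith
    · refine Finset.sum_congr rfl fun q _ => ?_
      rw [dualOp, if_neg h0, W.riesz_rinv, W.riesz_rinv, W.riesz_rinv, W.riesz_rinv]
      exact congrArg Complex.re (W.inner_rinv_adjoint _ _ _).symm

theorem bhNorm_eq {γ T : ℝ} {f : ℝ → Fin d₁ → Dist d} {F : Lp (Vec d d₁) 2 (timeMeasure T)}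
    (hF : ∀ᵐ t ∂(timeMeasure T), ∀ k, F t k = besselRep γ (f t k)) : bhNorm γ T f = ‖F‖ := by
  rw [bhNorm, ← Real.sqrt_sq (norm_nonneg F), Lp.norm_sq_eq_integral]
  congr 1
  refine integral_congr_ae ?_
  filter_upwards [hF] with t ht
  rw [hNorm, Real.sq_sqrt (Finset.sum_nonneg fun k _ => sq_nonneg _), PiLp.norm_sq_eq_of_L2]
  simp only [ht]

theorem exists_lp {γ T : ℝ} {f : ℝ → Fin d₁ → Dist d}
    (hf : ∀ k, MemLp (fun t => besselRep γ (f t k)) 2 (volume.restrict (Ioc 0 T))) :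
    ∃ F : Lp (Vec d d₁) 2 (timeMeasure T), ∀ᵐ t ∂(timeMeasure T), ∀ k, F t k = besselRep γ (f t k) := by
  set V : ℝ → Vec d d₁ := fun t => WithLp.toLp 2 fun k => besselRep γ (f t k) with hV
  have hVm : MemLp V 2 (timeMeasure T) := by
    have h1 : AEStronglyMeasurable V (timeMeasure T) :=
      aestronglyMeasurable_vec fun k => (hf k).aestronglyMeasurable
    refine (memLp_finsetSum (s := Finset.univ)
      (f := fun k t => ‖besselRep γ (f t k)‖) fun k _ => (hf k).norm).mono h1
      (Eventually.of_forall fun t => ?_)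
    rw [Real.norm_of_nonneg (Finset.sum_nonneg fun k _ => norm_nonneg _)]
    exact norm_le_sum_norm _
  refine ⟨hVm.toLp V, ?_⟩
  filter_upwards [hVm.coeFn_toLp] with t ht k
  rw [ht]

/-- Well-posedness of the system, for coefficients represented by operator families that satisfy a
Gårding inequality. -/
theorem Families.wellPosed {γ T C : ℝ} {a : Fin d → Fin d → Fin d₁ → Fin d₁ → ℝ → Space d → ℝ}
    {b : Fin d → Fin d₁ → Fin d₁ → ℝ → Space d → ℝ} {c : Fin d₁ → Fin d₁ → ℝ → Space d → ℝ}
    {Ma : Fin d → Fin d → Fin d₁ → Fin d₁ → ℝ → L2 d →L[ℂ] L2 d}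
    {Mb : Fin d → Fin d₁ → Fin d₁ → ℝ → L2 d →L[ℂ] L2 d}
    {Mc : Fin d₁ → Fin d₁ → ℝ → L2 d →L[ℂ] L2 d} (H : Families γ T C a b c Ma Mb Mc)
    {S : SpatialOps (Vec d d₁)} (hS : S.j = diag (pot 1)) {κ lam : ℝ} (hκ : 0 < κ) (hlam : 0 ≤ lam)
    (hg : ∀ᵐ t ∂(timeMeasure T), ∀ x, κ * ‖x‖ ^ 2
      ≤ (inner ℂ (S.ρ (sysOp Ma Mb Mc t x)) x).re + lam * ‖S.j x‖ ^ 2)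
    {f : ℝ → Fin d₁ → Dist d} {u₀ : Fin d₁ → Dist d} (hf : MemBH γ T f) (hu₀ : MemH (γ + 1) u₀) :
    ∃ u : ℝ → Fin d₁ → Dist d, IsSolution γ T a b c f u₀ u ∧
      (∀ v : ℝ → Fin d₁ → Dist d, IsSolution γ T a b c f u₀ v → ∀ t ∈ Icc 0 T, v t = u t) ∧
      bhNorm (γ + 2) T u ≤ (S.bound / κ + 1) * Real.exp (lam / S.lower * T)
        * (bhNorm γ T f + hNorm (γ + 1) u₀) := by
  obtain ⟨F, hF⟩ := exists_lp hf.2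
  set w : Vec d d₁ := WithLp.toLp 2 fun k => besselRep (γ + 1) (u₀ k) with hwdef
  have hw : ∀ k, w k = besselRep (γ + 1) (u₀ k) := fun k => rfl
  obtain ⟨W, hW, huniq, hbound⟩ := wellPosed_of_garding S hκ hlam H.meas H.norm_le hg F w
  rw [hS] at hW huniq
  have hFr : ∀ᵐ t ∂(timeMeasure T), cjV (F t) = F t := by
    filter_upwards [hF, hf.1] with t h1 h2
    refine PiLp.ext fun k => ?_
    rw [cjV_apply, h1, ← isReal_iff (h2 k).2]
    exact (h2 k).1
  have hwr : cjV w = w := PiLp.ext fun k => (isReal_iff (hu₀ k).2).1 (hu₀ k).1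
  have hreal := cj_eq_of_unique H.meas H.norm_le H.map_cjV hW huniq hFr hwr
  have hsol := H.isSolution hf hu₀ hF hw hW hreal
  refine ⟨_, hsol, fun v hv t ht => ?_, ?_⟩
  · obtain ⟨W', hW', hv'⟩ := H.exists_cauchy hf hu₀ hF hw hv
    rw [hv' t ht, huniq W' hW']
  · have hrep : ∀ᵐ t ∂(timeMeasure T), ∀ k, W t k = besselRep (γ + 2)
        (potential γ (trajectory T (fun s => F s - sysOp Ma Mb Mc s (W s)) w t) k) := by
      filter_upwards [hW] with t ht k
      have h1 : trajectory T (fun s => F s - sysOp Ma Mb Mc s (W s)) w t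
        = diag (pot 1) (diag (pot 1) (W t)) := ht.symm
      rw [h1, potential, diag_apply, diag_apply, pot_pot zero_le_one zero_le_one,
        ← besselOp_coe (by norm_num), besselOp_besselOp, show -γ + -(1 + 1) = -(γ + 2) by ring,
        besselRep_potential]
    have hwn : hNorm (γ + 1) u₀ = ‖w‖ := by
      rw [hNorm, PiLp.norm_eq_of_L2]
    rw [bhNorm_eq hrep, bhNorm_eq hF, hwn]
    exact hbound

end ParabolicSystem
end

/-! ### Assembly: smooth approximation, operator families and constants. -/

noncomputable section
namespace ParabolicSystem
set_option linter.unusedSectionVars false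
open MeasureTheory Set Filter Topology
open scoped SchwartzMap ENNReal LineDeriv FourierTransform

variable {d d₁ : ℕ}

theorem uniformContinuous_of_modulus {ω : ℝ → ℝ} (hω : ∀ ε, 0 < ε → 0 < ω ε) {h : Space d → ℝ}
    (hh : ∀ ε, 0 < ε → ∀ x y : Space d, ‖x - y‖ < ω ε → |h x - h y| < ε) : UniformContinuous h :=
  Metric.uniformContinuous_iff.2 fun ε hε => ⟨ω ε, hω ε hε, fun {x y} hxy => by
    rw [dist_eq_norm] at hxy
    exact hh ε hε x y hxy⟩

/-- The radius is taken from the modulus of continuity, so the bound for the derivatives depends on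
the coefficients only through `L` and `r`. The absolute value makes the nonnegativity of this bound
evident. -/
theorem smoothApprox_mollify {δ η L : ℝ} {r : ℝ} (hr : 0 < r)
    {a : Fin d → Fin d → Fin d₁ → Fin d₁ → Space d → ℝ} (hc : ∀ i j k r, Continuous (a i j k r))
    (hb : ∀ i j k r x, |a i j k r x| ≤ L) (he : ∀ x, Elliptic δ fun i j k r => a i j k r x)
    (ho : ∀ i j k l, ∀ x y : Space d, ‖x - y‖ < r → |a i j k l x - a i j k l y| ≤ η) :
    SmoothApprox δ η |L * bumpConst (d := d) hr| a (fun i j k l => mollify hr (a i j k l)) where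
  temperate i j k l := hasTemperateGrowth_mollify hr (hc i j k l) (hb i j k l)
  elliptic := Elliptic.mollify hr hc he
  close i j k l x := by
    rw [abs_sub_comm]
    refine abs_mollify_sub_le hr (hc i j k l) fun z hz => ho i j k l _ _ ?_
    rwa [sub_sub_cancel_left, norm_neg]
  deriv i j k l m x := (abs_pdf_mollify_le hr (hc i j k l) (hb i j k l) m x).trans (le_abs_self _)

section

variable {σ γ μ L L' C T : ℝ} {W : WeightFamily d σ} {n : ℕ}

theorem CoeffClass.ae_isMul (hW : CoeffClass W γ μ L n L' C) {a : ℝ → Space d → ℝ}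
    (ha : AEMeasurable (fun p : ℝ × Space d => a p.1 p.2) (volume.restrict (Ioi 0 ×ˢ univ)))
    (hL : ∀ t, 0 < t → holderNorm (absPlus μ γ) (a t) < ENNReal.ofReal L) :
    ∀ᵐ t ∂(timeMeasure T), IsMul |γ| C (a t) (mulFamily |γ| C (a t)) := by
  filter_upwards [ae_aestronglyMeasurable (T := T) ha, ae_restrict_mem measurableSet_Ioc] with t h1 h2
  exact isMul_mulFamily (hW.exists_isMul _ (hL t h2.1) h1)

theorem CoeffClass.families (hW : CoeffClass W γ μ L n L' C)
    {a : Fin d → Fin d → Fin d₁ → Fin d₁ → ℝ → Space d → ℝ}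
    {b : Fin d → Fin d₁ → Fin d₁ → ℝ → Space d → ℝ} {c : Fin d₁ → Fin d₁ → ℝ → Space d → ℝ}
    (ha : ∀ i j k r, AEMeasurable (fun p : ℝ × Space d => a i j k r p.1 p.2)
      (volume.restrict (Ioi 0 ×ˢ univ)))
    (hb : ∀ i k r, AEMeasurable (fun p : ℝ × Space d => b i k r p.1 p.2)
      (volume.restrict (Ioi 0 ×ˢ univ)))
    (hc : ∀ k r, AEMeasurable (fun p : ℝ × Space d => c k r p.1 p.2)
      (volume.restrict (Ioi 0 ×ˢ univ)))
    (hLa : ∀ i j k r t, 0 < t → holderNorm (absPlus μ γ) (a i j k r t) < ENNReal.ofReal L)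
    (hLb : ∀ i k r t, 0 < t → holderNorm (absPlus μ γ) (b i k r t) < ENNReal.ofReal L)
    (hLc : ∀ k r t, 0 < t → holderNorm (absPlus μ γ) (c k r t) < ENNReal.ofReal L) :
    Families γ T C a b c (fun i j k r t => dualOp γ (mulFamily |γ| C (a i j k r t)))
      (fun i k r t => dualOp γ (mulFamily |γ| C (b i k r t)))
      (fun k r t => dualOp γ (mulFamily |γ| C (c k r t))) where
  nonneg := hW.C_nonneg
  mulA := by
    simp only [ae_all_iff]
    intro i j k r
    filter_upwards [hW.ae_isMul (ha i j k r) (hLa i j k r)] with t ht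
    exact ht.isMulH hW.C_nonneg
  mulB := by
    simp only [ae_all_iff]
    intro i k r
    filter_upwards [hW.ae_isMul (hb i k r) (hLb i k r)] with t ht
    exact ht.isMulH hW.C_nonneg
  mulC := by
    simp only [ae_all_iff]
    intro k r
    filter_upwards [hW.ae_isMul (hc k r) (hLc k r)] with t ht
    exact ht.isMulH hW.C_nonneg
  normA i j k r t := norm_dualOp_le hW.C_nonneg γ (norm_mulFamily_le hW.C_nonneg _)
  normB i k r t := norm_dualOp_le hW.C_nonneg γ (norm_mulFamily_le hW.C_nonneg _)
  normC k r t := norm_dualOp_le hW.C_nonneg γ (norm_mulFamily_le hW.C_nonneg _)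
  measA i j k r := aestronglyMeasurable_dualOp γ
    (aestronglyMeasurable_isMul (abs_nonneg γ) (ha i j k r) (hW.ae_isMul (ha i j k r) (hLa i j k r)))
  measB i k r := aestronglyMeasurable_dualOp γ
    (aestronglyMeasurable_isMul (abs_nonneg γ) (hb i k r) (hW.ae_isMul (hb i k r) (hLb i k r)))
  measC k r := aestronglyMeasurable_dualOp γ
    (aestronglyMeasurable_isMul (abs_nonneg γ) (hc k r) (hW.ae_isMul (hc k r) (hLc k r)))

end

end ParabolicSystem
end

open ParabolicSystem MeasureTheory in
theorem mainTheorem6 (d d₁ : ℕ) [NeZero d] (γ μ : ℝ) (hμ : 0 < μ)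
    (δ L : ℝ) (hδ : 0 < δ) (hL : 0 < L) (K : Fin d → ℝ) (hK : ∀ j, 0 < K j)
    (ω : ℝ → ℝ) (hω : ∀ ε, 0 < ε → 0 < ω ε) :
    ∃ N : ℝ, 0 < N ∧
      ∀ (a : Fin d → Fin d → Fin d₁ → Fin d₁ → ℝ → ParabolicSystem.Space d → ℝ)
        (b : Fin d → Fin d₁ → Fin d₁ → ℝ → ParabolicSystem.Space d → ℝ)
        (c : Fin d₁ → Fin d₁ → ℝ → ParabolicSystem.Space d → ℝ),
        -- the coefficients are (Lebesgue) measurable on `(0,∞) × ℝ^d`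
        (∀ i j k r, AEMeasurable (fun p : ℝ × ParabolicSystem.Space d => a i j k r p.1 p.2)
          (MeasureTheory.volume.restrict (Set.Ioi 0 ×ˢ Set.univ))) →
        (∀ i k r, AEMeasurable (fun p : ℝ × ParabolicSystem.Space d => b i k r p.1 p.2)
          (MeasureTheory.volume.restrict (Set.Ioi 0 ×ˢ Set.univ))) →
        (∀ k r, AEMeasurable (fun p : ℝ × ParabolicSystem.Space d => c k r p.1 p.2)
          (MeasureTheory.volume.restrict (Set.Ioi 0 ×ˢ Set.univ))) →
        -- `δ |ξ|² ≤ ξ_i^* A^{ij} ξ_j` for all real `d₁ × d` matrices `ξ`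
        (∀ t, 0 < t → ∀ x, ∀ ξ : Matrix (Fin d₁) (Fin d) ℝ,
          δ * ∑ k, ∑ i, ξ k i ^ 2
            ≤ ∑ i, ∑ j, ∑ k, ∑ r, ξ k i * a i j k r t x * ξ r j) →
        -- `|A^{1j}| ≤ K^j`
        (∀ t, 0 < t → ∀ x, ∀ j, Real.sqrt (∑ k, ∑ r, a 0 j k r t x ^ 2) ≤ K j) →
        -- uniform continuity of the leading coefficients in `x`
        (∀ ε, 0 < ε → ∀ t, 0 < t → ∀ i j k r, ∀ x y : ParabolicSystem.Space d,
          ‖x - y‖ < ω ε → |a i j k r t x - a i j k r t y| < ε) →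
        -- bounds in `B^{|γ|_+}`
        (∀ t, 0 < t → ∀ i j k r,
          ParabolicSystem.holderNorm (ParabolicSystem.absPlus μ γ) (a i j k r t)
            + ParabolicSystem.holderNorm (ParabolicSystem.absPlus μ γ) (b i k r t)
            + ParabolicSystem.holderNorm (ParabolicSystem.absPlus μ γ) (c k r t)
            < ENNReal.ofReal L) →
        ∀ (T : ℝ), 0 < T → ∀ (f : ℝ → Fin d₁ → ParabolicSystem.Dist d)
          (u₀ : Fin d₁ → ParabolicSystem.Dist d),
          ParabolicSystem.MemBH γ T f → ParabolicSystem.MemH (γ + 1) u₀ →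
          ∃ u : ℝ → Fin d₁ → ParabolicSystem.Dist d,
            ParabolicSystem.IsSolution γ T a b c f u₀ u ∧
            (∀ v : ℝ → Fin d₁ → ParabolicSystem.Dist d,
              ParabolicSystem.IsSolution γ T a b c f u₀ v → ∀ t ∈ Set.Icc 0 T, v t = u t) ∧
            ParabolicSystem.bhNorm (γ + 2) T u
              ≤ N * Real.exp (N * T)
                * (ParabolicSystem.bhNorm γ T f + ParabolicSystem.hNorm (γ + 1) u₀) := by
  obtain ⟨σ, W, n, L', C, hW⟩ := exists_coeffClass d (γ := γ) hμ hL
  -- Small enough that the errors of all index tuples together use at most `δ / 4`.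
  set η : ℝ := δ / (4 * (Fintype.card (Idx d d₁) + 1)) with hη
  have hη0 : 0 < η := by positivity
  have hη1 : Fintype.card (Idx d d₁) * η ≤ δ / 4 := by
    rw [hη, mul_div_assoc', div_le_div_iff₀ (by positivity) (by positivity)]
    nlinarith
  -- The mollification radius. Half of `η` is reserved for the later approximation of `a` by regular
  -- coefficients.
  have hr : 0 < ω (η / 2) := hω _ (by positivity)
  obtain ⟨p, m, M, κ, lam, hm, hκ, hlam, hp, hp1, hp2, hmain⟩ :=
    W.exists_main_estimate (d₁ := d₁) γ hδ (abs_nonneg (L' * bumpConst (d := d) hr)) hW.L_nonneg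
      hW.σ_nonneg hη0 hη1 n
  have hM : 0 < M := hm.trans_le ((hp1 0).trans (hp2 0))
  have hpn : ∀ ξ, ‖(p ξ : ℂ)‖ ≤ M := fun ξ => by
    rw [Complex.norm_real, Real.norm_of_nonneg (hm.le.trans (hp1 ξ))]
    exact hp2 ξ
  set lam' := gardingConst d d₁ M C κ lam with hlam'
  have hlam0 : 0 ≤ lam' := by
    rw [hlam', gardingConst]
    positivity
  -- The sum dominates both the prefactor `M / (κ / 2) + 1` and the growth rate `lam' / m`, and was
  -- fixed before the coefficients and `T`.
  refine ⟨M / (κ / 2) + 1 + lam' / m, by positivity, ?_⟩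
  intro a b c ha hb hc hell _ hmod hbd T hT f u₀ hf hu₀
  have hLa : ∀ i j k r t, 0 < t → holderNorm (absPlus μ γ) (a i j k r t) < ENNReal.ofReal L :=
    fun i j k r t ht => lt_of_le_of_lt (le_add_right (le_add_right le_rfl)) (hbd t ht i j k r)
  have hLb : ∀ i k r t, 0 < t → holderNorm (absPlus μ γ) (b i k r t) < ENNReal.ofReal L :=
    fun i k r t ht => lt_of_le_of_lt (le_add_right (le_add_left le_rfl)) (hbd t ht i i k r)
  -- The joint bound carries spatial indices even for `c`; `d ≥ 1` supplies the index `0`.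
  have hLc : ∀ k r t, 0 < t → holderNorm (absPlus μ γ) (c k r t) < ENNReal.ofReal L :=
    fun k r t ht => lt_of_le_of_lt (le_add_left le_rfl) (hbd t ht 0 0 k r)
  have H := hW.families (T := T) ha hb hc hLa hLb hLc
  have huc : ∀ t, 0 < t → ∀ i j k r, UniformContinuous (a i j k r t) := fun t ht i j k r =>
    uniformContinuous_of_modulus hω fun ε hε x y h => hmod ε hε t ht i j k r x y h
  have hg : ∀ᵐ t ∂(timeMeasure T), ∀ x : Vec d d₁, κ / 2 * ‖x‖ ^ 2
      ≤ (inner ℂ ((spatialOps p hm hp hp1 hp2).ρ (sysOp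
          (fun i j k r t => dualOp γ (mulFamily |γ| C (a i j k r t)))
          (fun i k r t => dualOp γ (mulFamily |γ| C (b i k r t)))
          (fun k r t => dualOp γ (mulFamily |γ| C (c k r t))) t x)) x).re
        + lam' * ‖(spatialOps (d₁ := d₁) p hm hp hp1 hp2).j x‖ ^ 2 := by
    have hmul : ∀ᵐ t ∂(timeMeasure T), ∀ i j k r,
        IsMul |γ| C (a i j k r t) (mulFamily |γ| C (a i j k r t)) := by
      simp only [ae_all_iff]
      exact fun i j k r => hW.ae_isMul (ha i j k r) (hLa i j k r)
    filter_upwards [hmul, ae_restrict_mem measurableSet_Ioc] with t h1 h2 x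
    refine garding hW.C_nonneg hM.le hκ (norm_fm_le hM.le hpn) (fun i j k r => H.normA i j k r t)
      (fun i k r => H.normB i k r t) (fun k r => H.normC k r t) ?_ x
    refine hmain (fun i j k r => a i j k r t) _ (fun i j k r => mulFamily |γ| C (a i j k r t)) C
      (fun i j k r => hW.approximable _ (hLa i j k r t h2.1) (huc t h2.1 i j k r))
      (smoothApprox_mollify hr (fun i j k r => (huc t h2.1 i j k r).continuous)
        (fun i j k r => hW.bound _ (hLa i j k r t h2.1)) (fun x ξ => hell t h2.1 x ξ)
        fun i j k l x y h => (hmod _ (by positivity) t h2.1 i j k l x y h).le)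
      fun i j k r => ?_
    rw [← hW.order]
    exact h1 i j k r
  obtain ⟨u, hu1, hu2, hu3⟩ := H.wellPosed rfl (half_pos hκ) hlam0 hg hf hu₀
  refine ⟨u, hu1, hu2, hu3.trans ?_⟩
  have h1 : 0 ≤ lam' / m := by positivity
  have h2 : 0 ≤ M / (κ / 2) := by positivity
  have h3 : (M / (κ / 2) + 1) * Real.exp (lam' / m * T)
      ≤ (M / (κ / 2) + 1 + lam' / m) * Real.exp ((M / (κ / 2) + 1 + lam' / m) * T) :=
    mul_le_mul (le_add_of_nonneg_right h1) (Real.exp_le_exp.2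
      (mul_le_mul_of_nonneg_right (by linarith) hT.le)) (Real.exp_pos _).le (by positivity)
  exact mul_le_mul_of_nonneg_right h3 (add_nonneg (Real.sqrt_nonneg _) (Real.sqrt_nonneg _))
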